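/- Let $d\in\{2,3\}$, let $\Omega\subset\mathbb R^d$ be a bounded connected open set with $\operatorname{int}\overline\Omega=\Omega$, and let $T,\nu,\sigma,\varepsilon>0$, $\gamma\ge 0$. Let $\mathcal T_h$ be a finite partition of $\overline\Omega$ without hanging nodes into closed simplices (simplicial mesh), or into boxes or, more generally, parallelotopes (tensor-product mesh), with facets $\mathcal F_h$ and interior facets $\mathcal F_h^i$ (those not contained in $\partial\Omega$). For $F\in\mathcal F_h^i$ call the two adjacent elements $K^+,K^-$ in an arbitrary but fixed order, let $n_F$ be the unit normal of $F$ pointing out of $K^+$, and put $[\![\phi]\!]=\phi^+-\phi^-$, $\{\!\{\phi\}\!\}=\tfrac12(\phi^++\phi^-)$; on boundary facets $n_F$ is the outer unit normal and $[\![\phi]\!]=\{\!\{\phi\}\!\}=\phi$. Let $h_F>0$ be given length scales, let $H^s(\mathcal T_h)$ be the space of $L^2(\Omega)$-fields that are in $H^s(K)$ for all $K\in\mathcal T_h$, and let $\nabla_h$ be the elementwise gradient. Let $V=H^1_0(\Omega)^d$, $Q=L^2_0(\Omega)$. For each $K\in\mathcal T_h$ let $V_k(K)$ be a finite-dimensional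 space of polynomial vector fields, let $\ell\ge 0$, and let $\mathbb P_\ell(K)$ denote the polynomials of degree at most $\ell$ (in total on simplices, in each variable on tensor-product elements). Put $$V_h=\{v\in H(\mathrm{div};\Omega): v|_K\in V_k(K)\ \forall K\in\mathcal T_h,\ v\cdot n|_{\partial\Omega}=0\},\qquad Q_h=\{q\in Q: q|_K\in\mathbb P_\ell(K)\ \forall K\in\mathcal T_h\},$$ and assume $\nabla\cdot V_h\subset Q_h$. Let $(\cdot,\cdot)$ be the $L^2(\Omega)$ inner product, and $$a(w,v)=\int_\Omega\nabla w:\nabla v,\qquad c(\beta;w,v)=\int_\Omega(\beta\cdot\nabla)w\cdot v,\qquad b(w,q)=-\int_\Omega q\,\nabla\cdot w,$$ $$a_h(w,v)=\int_\Omega\nabla_hw:\nabla_hv-\sum_{F\in\mathcal F_h}\int_F\{\!\{\nabla w\}\!\}n_F\cdot[\![v]\!]-\sum_{F\in\mathcal F_h}\int_F[\![w]\!]\cdot\{\!\{\nabla v\}\!\}n_F+\sum_{F\in\mathcal F_h}\int_F\frac{\sigma}{h_F}[\![w]\!]\cdot[\![v]\!],$$ $$c_h(\beta;w,v)=\int_\Omega(\beta\cdot\nabla_h)w\cdot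 v-\sum_{F\in\mathcal F_h^i}\int_F(\beta\cdot n_F)[\![w]\!]\cdot\{\!\{v\}\!\}+\sum_{F\in\mathcal F_h^i}\int_F\frac\gamma2|\beta\cdot n_F|[\![w]\!]\cdot[\![v]\!].$$ Let $V_h^{\mathrm{div}}=\{v\in V_h: b(v,q)=0\ \forall q\in Q_h\}$ be the space of discretely divergence-free velocities. Let $\beta\in L^\infty(0,T;L^\infty(\Omega)^d)$ satisfy $\nabla\cdot\beta=0$ in $\Omega$ and $\beta\cdot n=0$ on $\partial\Omega$ for a.e. $t$ (on interior facets $\beta\cdot n_F$ is the normal trace), and let $f(t)\in L^2(\Omega)^d$ for $t\in(0,T)$. Let $u\in L^2(0,T;V)$ with $\partial_tu\in L^2(0,T;L^2(\Omega)^d)$ and $p\in L^2(0,T;Q)$ solve the Oseen problem: $u(0)=u_0$ and, for all $(v,q)\in V\times Q$ and a.e. $t\in(0,T)$, $$(\partial_tu,v)+\nu a(u,v)+c(\beta;u,v)+b(v,p)-b(u,q)=(f,v).$$ Let $u_h\in L^2(0,T;V_h)$ with $\partial_tu_h\in L^2(0,T;V_h)$ and $p_h\in L^2(0,T;Q_h)$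 solve the semidiscrete problem: $u_h(0)=u_{0h}\in V_h$ and, for all $(v_h,q_h)\in V_h\times Q_h$ and a.e. $t\in(0,T)$, $$(\partial_tu_h,v_h)+\nu a_h(u_h,v_h)+c_h(\beta;u_h,v_h)+b(v_h,p_h)-b(u_h,q_h)=(f,v_h).$$ Suppose that $u\in L^2(0,T;H^{3/2+\varepsilon}(\mathcal T_h))$. Then, for every $v_h\in V_h^{\mathrm{div}}$, $$(\partial_t[u-u_h],v_h)+\nu a_h(u-u_h,v_h)+c_h(\beta;u-u_h,v_h)=0\qquad\text{for a.e. }t\in(0,T).$$ -/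

import Mathlib

open MeasureTheory Set Filter Topology
open scoped ENNReal ContDiff

noncomputable section

namespace OseenHdiv

/-! ## Sobolev spaces, weak derivatives, traces -/

/-- Euclidean space `ℝ^d`. -/
abbrev Vec (d : ℕ) : Type := EuclideanSpace ℝ (Fin d)

/-- The standard basis vector `e_j`. -/
def unitVec {d : ℕ} (j : Fin d) : Vec d := EuclideanSpace.single j 1

/-- The space `L²(Ω)^d`. -/
abbrev L2Vec {d : ℕ} (Ω : Set (Vec d)) : Type := Lp (Vec d) 2 (volume.restrict Ω)

/-- The space `L²(Ω)`. -/
abbrev L2Scal {d : ℕ} (Ω : Set (Vec d)) : Type := Lp ℝ 2 (volume.restrict Ω)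

/-- `φ` belongs to `C_c^∞(U)`. -/
def IsTest {E G : Type*} [NormedAddCommGroup E] [NormedSpace ℝ E]
    [NormedAddCommGroup G] [NormedSpace ℝ G] (U : Set E) (φ : E → G) : Prop :=
  ContDiff ℝ ∞ φ ∧ HasCompactSupport φ ∧ tsupport φ ⊆ U

section Sobolev

variable {d : ℕ} {G : Type*} [NormedAddCommGroup G] [NormedSpace ℝ G]

/-- `g ∈ L²(U)` is the weak partial derivative `∂_j w` on the open set `U`. -/
def HasWeakPartial (U : Set (Vec d)) (j : Fin d) (w g : Vec d → G) : Prop :=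
  MemLp g 2 (volume.restrict U) ∧
    ∀ φ : Vec d → ℝ, IsTest U φ →
      ∫ x in U, (fderiv ℝ φ x (unitVec j)) • w x = - ∫ x in U, φ x • g x

open Classical in
/-- The weak partial derivative `∂_j w` on `U`, as a function (unique almost everywhere on `U`
for `w ∈ L²(U)`); zero if it does not exist in `L²(U)`. -/
def weakPartial (U : Set (Vec d)) (j : Fin d) (w : Vec d → G) : Vec d → G :=
  if h : ∃ g, HasWeakPartial U j w g then h.choose else 0

/-- The squared Slobodeckij seminorm of order `θ ∈ (0,1)` on `U`; nothing for `θ = 0`. -/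
def slobodeckijSq (U : Set (Vec d)) (θ : ℝ) (w : Vec d → G) : ℝ≥0∞ :=
  if θ = 0 then 0 else
    ∫⁻ x in U, ∫⁻ y in U, ENNReal.ofReal (‖w x - w y‖ ^ 2 / ‖x - y‖ ^ ((d : ℝ) + 2 * θ))

open Classical in
/-- The squared norm of `H^{m+θ}(U)` for `m ∈ ℕ`, `θ ∈ [0,1)`: the `L²` norms of all weak
derivatives of order at most `m` and the Slobodeckij seminorms of those of order `m`
(up to repetitions of mixed derivatives); it is `∞` if `w ∉ H^{m+θ}(U)`. -/
def sobolevAuxSq (U : Set (Vec d)) (θ : ℝ) : ℕ → (Vec d → G) → ℝ≥0∞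
  | 0, w => eLpNorm w 2 (volume.restrict U) ^ 2 + slobodeckijSq U θ w
  | m + 1, w =>
      if ∀ j : Fin d, ∃ g, HasWeakPartial U j w g then
        eLpNorm w 2 (volume.restrict U) ^ 2 + ∑ j : Fin d, sobolevAuxSq U θ m (weakPartial U j w)
      else ⊤

/-- The squared norm of the Sobolev(-Slobodeckij) space `H^s(U)`, `s ≥ 0` real. -/
def sobolevSq (U : Set (Vec d)) (s : ℝ) (w : Vec d → G) : ℝ≥0∞ :=
  sobolevAuxSq U (Int.fract s) ⌊s⌋₊ w

/-- The trace of `w` from within `K` at a boundary point `x` of `K`, as the limit of the averages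
over `B_r(x) ∩ K` as `r → 0`. For a polytope `K` and `w ∈ H^s(K)`, `s > 1/2`, the limit exists at
almost every point of `∂K` and is the usual trace; for `w` continuous on `K` it is the value. -/
def trace (K : Set (Vec d)) (w : Vec d → G) (x : Vec d) : G :=
  limUnder (𝓝[>] (0 : ℝ)) fun r => ⨍ y in Metric.ball x r ∩ K, w y

end Sobolev

section Domain

variable {d : ℕ}

/-- `V = H¹₀(Ω)^d`: the closure of `C_c^∞(Ω)^d` in `H¹(Ω)^d`. -/
def spaceV (Ω : Set (Vec d)) : Set (L2Vec Ω) :=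
  {w | sobolevSq Ω 1 w < ⊤ ∧
    ∀ δ : ℝ≥0∞, 0 < δ → ∃ φ : Vec d → Vec d, IsTest Ω φ ∧ sobolevSq Ω 1 (fun x => w x - φ x) < δ}

/-- `Q = L²₀(Ω)`. -/
def spaceQ (Ω : Set (Vec d)) : Set (L2Scal Ω) := {q | ∫ x in Ω, q x = 0}

/-- `g ∈ L²(Ω)` is the weak divergence of `w` on `Ω`. -/
def HasWeakDiv (Ω : Set (Vec d)) (w : Vec d → Vec d) (g : Vec d → ℝ) : Prop :=
  MemLp g 2 (volume.restrict Ω) ∧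
    ∀ φ : Vec d → ℝ, IsTest Ω φ → ∫ x in Ω, fderiv ℝ φ x (w x) = - ∫ x in Ω, φ x * g x

open Classical in
/-- The weak divergence `∇ · w` on `Ω`, as a function (unique almost everywhere on `Ω`); zero if it
does not exist in `L²(Ω)`. -/
def weakDiv (Ω : Set (Vec d)) (w : Vec d → Vec d) : Vec d → ℝ :=
  if h : ∃ g, HasWeakDiv Ω w g then h.choose else 0

/-- `H(div; Ω)`. -/
def spaceHdiv (Ω : Set (Vec d)) : Set (L2Vec Ω) := {w | ∃ g, HasWeakDiv Ω w g}

/-- `w · n = 0` on `∂Ω`, in the weak sense of `H(div; Ω)`: Green's formula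
`∫ w · ∇φ + ∫ (∇ · w) φ = 0` holds for all `φ ∈ C_c^∞(ℝ^d)`. -/
def NormalTraceZero (Ω : Set (Vec d)) (w : Vec d → Vec d) : Prop :=
  ∀ φ : Vec d → ℝ, IsTest univ φ →
    (∫ x in Ω, fderiv ℝ φ x (w x)) + ∫ x in Ω, weakDiv Ω w x * φ x = 0

/-- `a(w, v) = ∫_Ω ∇w : ∇v`. -/
def formA (Ω : Set (Vec d)) (w v : Vec d → Vec d) : ℝ :=
  ∫ x in Ω, ∑ j, inner ℝ (weakPartial Ω j w x) (weakPartial Ω j v x)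

/-- `c(b; w, v) = ∫_Ω (b · ∇)w · v`. -/
def formC (Ω : Set (Vec d)) (b w v : Vec d → Vec d) : ℝ :=
  ∫ x in Ω, inner ℝ (∑ j, b x j • weakPartial Ω j w x) (v x)

/-- `b(w, q) = -∫_Ω q (∇ · w)`. -/
def formB (Ω : Set (Vec d)) (w : Vec d → Vec d) (q : Vec d → ℝ) : ℝ :=
  - ∫ x in Ω, q x * weakDiv Ω w x

/-- `β ∈ L^∞(0,T; L^∞(Ω))` with `∇ · β(t) = 0` in `Ω` and `β(t) · n = 0` on `∂Ω` for a.e. `t`. -/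
def IsConvectiveField (Ω : Set (Vec d)) (T : ℝ) (β : ℝ → Vec d → Vec d) : Prop :=
  MemLp (fun z : ℝ × Vec d => β z.1 z.2) ⊤
      ((volume.restrict (Ioo 0 T)).prod (volume.restrict Ω)) ∧
    ∀ᵐ t ∂volume.restrict (Ioo 0 T), HasWeakDiv Ω (β t) 0 ∧ NormalTraceZero Ω (β t)

end Domain

/-! ## Time-dependent functions -/

section Time

variable {X : Type*} [NormedAddCommGroup X] [NormedSpace ℝ X]

/-- `u' ∈ L²(0,T; X)` is the weak time derivative of `u` on `(0,T)`. -/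
def HasWeakTimeDeriv (T : ℝ) (u u' : ℝ → X) : Prop :=
  MemLp u' 2 (volume.restrict (Ioo 0 T)) ∧
    ∀ φ : ℝ → ℝ, IsTest (Ioo 0 T) φ →
      ∫ t in Ioo 0 T, deriv φ t • u t = - ∫ t in Ioo 0 T, φ t • u' t

open Classical in
/-- The weak time derivative `∂_t u` (unique almost everywhere on `(0,T)`); zero if it does not
exist in `L²(0,T; X)`. -/
def timeDeriv (T : ℝ) (u : ℝ → X) : ℝ → X :=
  if h : ∃ u', HasWeakTimeDeriv T u u' then h.choose else 0

/-- `u(0) = u₀`: the representative of `u` that is continuous on `[0,T]` with values in `X` has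
the value `u₀` at `0`. -/
def HasInitialValue (T : ℝ) (u : ℝ → X) (u₀ : X) : Prop :=
  ∃ v : ℝ → X, ContinuousOn v (Icc 0 T) ∧ u =ᵐ[volume.restrict (Ioo 0 T)] v ∧ v 0 = u₀

/-- `u ∈ L²(0,T; Y)`, where `Y ⊆ X` is the space with squared norm `N` (`N = ∞` outside `Y`). For
the separable Hilbert spaces `Y`, continuously embedded in `X`, for which this is used, strong
measurability of `u` into `X` and into `Y` agree. -/
def MemBochnerL2 (T : ℝ) (N : X → ℝ≥0∞) (u : ℝ → X) : Prop :=
  AEStronglyMeasurable u (volume.restrict (Ioo 0 T)) ∧ ∫⁻ t in Ioo 0 T, N (u t) < ⊤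

/-- `V^T = {v ∈ L²(0,T; V) : ∂_t v ∈ L²(0,T; L²)}`. -/
def spaceVT {d : ℕ} (Ω : Set (Vec d)) (T : ℝ) : Set (ℝ → L2Vec Ω) :=
  {u | MemBochnerL2 T (fun w : L2Vec Ω => sobolevSq Ω 1 w) u ∧
    (∀ᵐ t ∂volume.restrict (Ioo 0 T), u t ∈ spaceV Ω) ∧ ∃ u', HasWeakTimeDeriv T u u'}

/-- `Q^T = L²(0,T; Q)`. -/
def spaceQT {d : ℕ} (Ω : Set (Vec d)) (T : ℝ) : Set (ℝ → L2Scal Ω) :=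
  {p | MemLp p 2 (volume.restrict (Ioo 0 T)) ∧
    ∀ᵐ t ∂volume.restrict (Ioo 0 T), p t ∈ spaceQ Ω}

/-- `(u, p)` solves the variational formulation of the time-dependent Oseen problem. -/
def IsOseenSolution {d : ℕ} (Ω : Set (Vec d)) (T ν : ℝ) (β : ℝ → Vec d → Vec d)
    (f : ℝ → L2Vec Ω) (u₀ : L2Vec Ω) (u : ℝ → L2Vec Ω) (p : ℝ → L2Scal Ω) : Prop :=
  u ∈ spaceVT Ω T ∧ p ∈ spaceQT Ω T ∧ HasInitialValue T u u₀ ∧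
    ∀ v ∈ spaceV Ω, ∀ q ∈ spaceQ Ω, ∀ᵐ t ∂volume.restrict (Ioo 0 T),
      inner ℝ (timeDeriv T u t) v + ν * formA Ω (u t) v + formC Ω (β t) (u t) v
        + formB Ω v (p t) - formB Ω (u t) q = inner ℝ (f t) v

end Time

/-! ## Meshes -/

section Mesh

/-- The two types of meshes. -/
inductive MeshKind
  | simplicial
  | tensorProduct

/-- The reference element: the unit simplex or the unit cube. -/
def MeshKind.ref (d : ℕ) : MeshKind → Set (Vec d)
  | .simplicial => {x | (∀ i, 0 ≤ x i) ∧ ∑ i, x i ≤ 1}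
  | .tensorProduct => {x | ∀ i, 0 ≤ x i ∧ x i ≤ 1}

/-- Polynomials of total degree at most `ℓ` (simplices), or of degree at most `ℓ` in each variable
(tensor-product elements). -/
def MeshKind.DegreeLE {d : ℕ} (ℓ : ℕ) : MeshKind → MvPolynomial (Fin d) ℝ → Prop
  | .simplicial, P => P.totalDegree ≤ ℓ
  | .tensorProduct, P => ∀ i, P.degreeOf i ≤ ℓ

variable {d : ℕ}

/-- The polynomial space `ℙ_ℓ(K)` on an element `K` (an affine image of the reference element):
for simplices, all polynomials of total degree at most `ℓ`; for axis-parallel boxes, all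
polynomials of degree at most `ℓ` in each variable; for parallelotopes, the same in the affine
coordinates given by the edges. -/
def localPoly (kind : MeshKind) (ℓ : ℕ) (K : Set (Vec d)) : Set (Vec d → ℝ) :=
  {q | ∃ A : Vec d ≃ᵃ[ℝ] Vec d, A '' kind.ref d = K ∧
    ∃ P : MvPolynomial (Fin d) ℝ, kind.DegreeLE ℓ P ∧
      ∀ x, q x = MvPolynomial.eval (fun i => A.symm x i) P}

/-- `F` is a facet (a face of dimension `d - 1`) of the polytope `K`, with outer unit normal `n`. -/
def IsFacet (K : Set (Vec d)) (n : Vec d) (F : Set (Vec d)) : Prop :=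
  ‖n‖ = 1 ∧ F = {x ∈ K | ∀ y ∈ K, inner ℝ n y ≤ inner ℝ n x} ∧
    Module.finrank ℝ (vectorSpan ℝ F) + 1 = d

/-- A finite element partition of `Ω` without hanging nodes into (closed) simplices, or into
(closed) boxes or more generally parallelotopes, together with its facets and a numbering
`K⁺`, `K⁻` of the elements adjacent to each facet; the normal `n_F` points out of `K⁺`. -/
structure Mesh (kind : MeshKind) (Ω : Set (Vec d)) where
  elements : Finset (Set (Vec d))
  isElement : ∀ K ∈ elements, ∃ A : Vec d ≃ᵃ[ℝ] Vec d, A '' kind.ref d = K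
  cover : closure Ω = ⋃ K ∈ elements, K
  /-- two different elements intersect in a (possibly empty) common face -/
  conforming : ∀ K ∈ elements, ∀ K' ∈ elements, K ≠ K' →
    IsExposed ℝ K (K ∩ K') ∧ IsExposed ℝ K' (K ∩ K')
  /-- the skeleton `𝓕_h` -/
  facets : Finset (Set (Vec d))
  mem_facets : ∀ F, F ∈ facets ↔ ∃ K ∈ elements, ∃ n, IsFacet K n F
  plus : Set (Vec d) → Set (Vec d)
  minus : Set (Vec d) → Set (Vec d)
  normal : Set (Vec d) → Vec d
  plus_mem : ∀ F ∈ facets, plus F ∈ elements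
  isFacet_plus : ∀ F ∈ facets, IsFacet (plus F) (normal F) F
  minus_mem : ∀ F ∈ facets, ¬ F ⊆ frontier Ω → minus F ∈ elements
  minus_ne : ∀ F ∈ facets, ¬ F ⊆ frontier Ω → minus F ≠ plus F
  isFacet_minus : ∀ F ∈ facets, ¬ F ⊆ frontier Ω → ∃ n, IsFacet (minus F) n F

namespace Mesh

variable {kind : MeshKind} {Ω : Set (Vec d)} (M : Mesh kind Ω)
variable {G : Type*} [NormedAddCommGroup G] [NormedSpace ℝ G]

open Classical in
/-- The interior facets. -/
def interiorFacets : Finset (Set (Vec d)) := M.facets.filter fun F => ¬ F ⊆ frontier Ω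

open Classical in
/-- The jump across `F`: `w⁺ - w⁻` on interior facets, `w` on boundary facets. -/
def jump (F : Set (Vec d)) (w : Vec d → G) (x : Vec d) : G :=
  if F ⊆ frontier Ω then trace (M.plus F) w x
  else trace (M.plus F) w x - trace (M.minus F) w x

open Classical in
/-- The average on `F`: `(w⁺ + w⁻)/2` on interior facets, `w` on boundary facets. -/
def avg (F : Set (Vec d)) (w : Vec d → G) (x : Vec d) : G :=
  if F ⊆ frontier Ω then trace (M.plus F) w x
  else (1 / 2 : ℝ) • (trace (M.plus F) w x + trace (M.minus F) w x)

/-- The `j`-th column `∂_j w` of the broken gradient `∇_h w`. -/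
def brokenPartial (j : Fin d) (w : Vec d → G) (x : Vec d) : G :=
  ∑ K ∈ M.elements, (interior K).indicator (weakPartial (interior K) j w) x

/-- The squared norm of the broken Sobolev space `H^s(𝓣_h)`. -/
def brokenSobolevSq (s : ℝ) (w : Vec d → G) : ℝ≥0∞ :=
  ∑ K ∈ M.elements, sobolevSq (interior K) s w

/-- The integral of a scalar function over a facet with respect to the surface measure. -/
def facetInt (F : Set (Vec d)) (g : Vec d → ℝ) : ℝ :=
  ∫ x in F, g x ∂(Measure.euclideanHausdorffMeasure (d - 1))

/-- `{∇w} n_F` on the facet `F`. -/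
def avgNormalDeriv (F : Set (Vec d)) (w : Vec d → Vec d) (x : Vec d) : Vec d :=
  ∑ j, M.normal F j • M.avg F (M.brokenPartial j w) x

/-- `g ∈ L^∞(F)` is the normal trace `b · n_F` on an interior facet `F` of a bounded
divergence-free field `b`, in the sense of Green's formula on `K⁺`. -/
def IsNormalTrace (b : Vec d → Vec d) (F : Set (Vec d)) (g : Vec d → ℝ) : Prop :=
  MemLp g ⊤ ((Measure.euclideanHausdorffMeasure (d - 1)).restrict F) ∧
    ∀ φ : Vec d → ℝ, IsTest (interior (M.plus F ∪ M.minus F)) φ →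
      ∫ x in M.plus F, fderiv ℝ φ x (b x) = facetInt F fun x => φ x * g x

open Classical in
/-- The normal trace `b · n_F` on an interior facet (unique almost everywhere on `F`). -/
def normalTrace (b : Vec d → Vec d) (F : Set (Vec d)) : Vec d → ℝ :=
  if h : ∃ g, M.IsNormalTrace b F g then h.choose else 0

/-- The symmetric interior penalty form `a_h` with parameter `σ` and facet length scales `hF`. -/
def formAh (σ : ℝ) (hF : Set (Vec d) → ℝ) (w v : Vec d → Vec d) : ℝ :=
  (∫ x in Ω, ∑ j, inner ℝ (M.brokenPartial j w x) (M.brokenPartial j v x))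
    - (∑ F ∈ M.facets, facetInt F fun x => inner ℝ (M.avgNormalDeriv F w x) (M.jump F v x))
    - (∑ F ∈ M.facets, facetInt F fun x => inner ℝ (M.jump F w x) (M.avgNormalDeriv F v x))
    + ∑ F ∈ M.facets, facetInt F fun x => σ / hF F * inner ℝ (M.jump F w x) (M.jump F v x)

/-- The convective form `c_h(b; ·, ·)` with upwind parameter `γ`. -/
def formCh (γ : ℝ) (b w v : Vec d → Vec d) : ℝ :=
  (∫ x in Ω, inner ℝ (∑ j, b x j • M.brokenPartial j w x) (v x))
    - (∑ F ∈ M.interiorFacets,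
        facetInt F fun x => M.normalTrace b F x * inner ℝ (M.jump F w x) (M.avg F v x))
    + ∑ F ∈ M.interiorFacets,
        facetInt F fun x => γ / 2 * |M.normalTrace b F x| * inner ℝ (M.jump F w x) (M.jump F v x)

/-! ## Finite element spaces and the discrete problem -/

/-- `Vk` assigns to every element a space of polynomial vector fields of bounded degree. -/
def IsLocalVelocity (Vk : Set (Vec d) → Submodule ℝ (Vec d → Vec d)) : Prop :=
  ∀ K ∈ M.elements, ∃ N : ℕ, ∀ v ∈ Vk K, ∃ P : Fin d → MvPolynomial (Fin d) ℝ,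
    (∀ i, (P i).totalDegree ≤ N) ∧ ∀ x i, v x i = MvPolynomial.eval (fun j => x j) (P i)

/-- `V_h = {v ∈ H(div; Ω) : v|_K ∈ V_k(K) for all K, v · n = 0 on ∂Ω}`. -/
def spaceVh (Vk : Set (Vec d) → Submodule ℝ (Vec d → Vec d)) : Set (L2Vec Ω) :=
  {v | v ∈ spaceHdiv Ω ∧
    (∀ K ∈ M.elements, ∃ q ∈ Vk K, ∀ᵐ x ∂volume.restrict (interior K), v x = q x) ∧
    NormalTraceZero Ω v}

/-- `Q_h = {q ∈ L²₀(Ω) : q|_K ∈ ℙ_ℓ(K) for all K}`. -/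
def spaceQh (ℓ : ℕ) : Set (L2Scal Ω) :=
  {q | q ∈ spaceQ Ω ∧
    ∀ K ∈ M.elements, ∃ r ∈ localPoly kind ℓ K, ∀ᵐ x ∂volume.restrict (interior K), q x = r x}

/-- The divergence-conformity `∇ · V_h ⊆ Q_h`. -/
def DivergenceConforming (Vk : Set (Vec d) → Submodule ℝ (Vec d → Vec d)) (ℓ : ℕ) : Prop :=
  ∀ v ∈ M.spaceVh Vk, ∃ q ∈ M.spaceQh ℓ, HasWeakDiv Ω v q

/-- The discretely divergence-free velocities `V_h^div`. -/
def spaceVhDiv (Vk : Set (Vec d) → Submodule ℝ (Vec d → Vec d)) (ℓ : ℕ) : Set (L2Vec Ω) :=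
  {v | v ∈ M.spaceVh Vk ∧ ∀ q ∈ M.spaceQh ℓ, formB Ω v q = 0}

/-- `V_h^T = {v ∈ L²(0,T; V_h) : ∂_t v ∈ L²(0,T; V_h)}`. -/
def spaceVhT (Vk : Set (Vec d) → Submodule ℝ (Vec d → Vec d)) (T : ℝ) : Set (ℝ → L2Vec Ω) :=
  {u | MemLp u 2 (volume.restrict (Ioo 0 T)) ∧
    (∀ᵐ t ∂volume.restrict (Ioo 0 T), u t ∈ M.spaceVh Vk) ∧
    ∃ u', HasWeakTimeDeriv T u u' ∧ ∀ᵐ t ∂volume.restrict (Ioo 0 T), u' t ∈ M.spaceVh Vk}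

/-- `Q_h^T = L²(0,T; Q_h)`. -/
def spaceQhT (ℓ : ℕ) (T : ℝ) : Set (ℝ → L2Scal Ω) :=
  {p | MemLp p 2 (volume.restrict (Ioo 0 T)) ∧
    ∀ᵐ t ∂volume.restrict (Ioo 0 T), p t ∈ M.spaceQh ℓ}

/-- `(u_h, p_h)` solves the space-semidiscrete problem with initial value `u_{0h} ∈ V_h`. -/
def IsDiscreteSolution (Vk : Set (Vec d) → Submodule ℝ (Vec d → Vec d)) (ℓ : ℕ)
    (σ γ : ℝ) (hF : Set (Vec d) → ℝ) (T ν : ℝ) (β : ℝ → Vec d → Vec d) (f : ℝ → L2Vec Ω)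
    (u₀ : L2Vec Ω) (u : ℝ → L2Vec Ω) (p : ℝ → L2Scal Ω) : Prop :=
  u ∈ M.spaceVhT Vk T ∧ p ∈ M.spaceQhT ℓ T ∧ u₀ ∈ M.spaceVh Vk ∧ HasInitialValue T u u₀ ∧
    ∀ v ∈ M.spaceVh Vk, ∀ q ∈ M.spaceQh ℓ, ∀ᵐ t ∂volume.restrict (Ioo 0 T),
      inner ℝ (timeDeriv T u t) v + ν * M.formAh σ hF (u t) v + M.formCh γ (β t) (u t) v
        + formB Ω v (p t) - formB Ω (u t) q = inner ℝ (f t) v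

end Mesh

end Mesh

end OseenHdiv

end

open OseenHdiv

noncomputable section

namespace OseenHdiv

/-! ### Surface measure on hyperplanes; volumes of strips and tubes -/

section Hyperplane

open Measure

variable {V : Type*} [NormedAddCommGroup V] [InnerProductSpace ℝ V] [FiniteDimensional ℝ V]
  [MeasurableSpace V] [BorelSpace V]

/-! The divergence of `v_h` lies in `Q_h` and is orthogonal to `Q_h`, hence vanishes; so the
pressure drops out of the discrete equation tested with `(v_h, 0)`. The claim follows by subtraction
once `u` satisfies the same pressure-free equation with the discrete forms (`Mesh.forms_consistent`)
and these forms are linear on `u` and `u_h` (`Mesh.formAh_sub`, `Mesh.formCh_sub`).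

Consistency. As `u(t)` lies in `H¹₀`, its jumps vanish (`Mesh.jump_ae_eq_zero`), and of all facet
terms only `{∇u} n_F · [v_h]` survives. It remains to show that the weak momentum balance may be
tested with the discontinuous field `v_h` at the price of this one term (`Mesh.consistency`).
Elementwise integration by parts is not available: neither `Δu` nor `∇p` need be square integrable
on an element, and `p` in `L²` has no traces; only the combination `ν∇u - pI` has a weak divergence
in `L²`. Instead `v_h` is made admissible by smoothing. Near a facet, `v_h` is a smooth field plus a
smooth jump field `J` times the indicator of one side. The indicator is replaced by `Φ((⟪n, x⟫ - c)
/ r)` with a smooth profile `Φ`. As `r → 0`, the derivative of the profile concentrates on the facet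
and produces the two one-sided traces of `∇u`, with equal weights if `Φ(0) = 1/2`. At a boundary
facet, a profile that vanishes before the facet is reached keeps the support inside `Ω` and leaves
the inner trace. The pressure contributes `1/r` times the integral of `p n · J` over a strip of
width `r`. Since `v_h` is solenoidal, `n · J` vanishes on the facet and is `O(r)` in the strip, so
the contribution tends to zero without any trace of `p` (`FacetNhd.inner_jump_eq_zero`,
`FacetNhd.integral_eq`).

Globalisation. These local identities say that a functional `ψ ↦ ∫ Dψ(A) + ∫ ψ B + Σ_F ∫_F ψ c_F`
vanishes on test functions supported near any point off the ridges, the intersections of nonparallel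
facet hyperplanes. The ridges have codimension two and `A` is in `L²`, so they are removable
(`Mesh.firstOrder_eq_zero`), and `ψ = 1` on the closure of `Ω` gives the result
(`Mesh.Balance.integral_source_eq`).

Traces. A trace is a limit of averages over shrinking balls, so its existence has to be proved. The
sufficient condition `OscDecay` follows from a Slobodeckij seminorm of order above `1/2`, or from
`H¹` regularity on a convex set. It makes the averages along dyadic radii summably close for almost
every point of a facet, with a limit that is the same for all subsets without cusp
(`TraceSetting.exists_tendsto_ave_of_tsum`); and it makes the function close in the mean to its
trace on thin slabs (`TraceSetting.tendsto_slab`), which is what the strip limits use.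

Time. The exceptional null set of times depends on the test field, so the continuous equation is
used for countably many fields that determine all others (`exists_countable_tests`). Piecewise
regularity at almost every time follows from its integrated form because the Sobolev norms are Borel
functions on `L²` (`measurable_sobolevSq`). -/

theorem measurePreserving_orthogonal_add_smul {n : V} (hn : ‖n‖ = 1) :
    MeasurePreserving (fun p : (ℝ ∙ n)ᗮ × ℝ => (p.1 : V) + p.2 • n)
      ((volume : Measure (ℝ ∙ n)ᗮ).prod (volume : Measure ℝ)) (volume : Measure V) := by
  have h1 := ((ℝ ∙ n).measurePreserving_measurableEquivProd (0 : V)).symm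
  rw [InnerProductSpace.euclideanHausdorffMeasure_eq_volume] at h1
  have h2 : MeasurePreserving (LinearIsometryEquiv.toSpanUnitSingleton (𝕜 := ℝ) n hn) volume volume :=
    LinearIsometryEquiv.measurePreserving _
  have h3 := h2.prod (MeasurePreserving.id (volume : Measure (ℝ ∙ n)ᗮ))
  have h4 : MeasurePreserving (Prod.swap : (ℝ ∙ n)ᗮ × ℝ → ℝ × (ℝ ∙ n)ᗮ)
    (volume.prod volume) (volume.prod volume) := measurePreserving_swap
  have h5 := h1.comp (h3.comp h4)
  have h6 : (fun p : (ℝ ∙ n)ᗮ × ℝ => (p.1 : V) + p.2 • n) =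
      (⇑((ℝ ∙ n).measurableEquivProd (0 : V)).symm ∘
        Prod.map (⇑(LinearIsometryEquiv.toSpanUnitSingleton (𝕜 := ℝ) n hn)) id ∘ Prod.swap) := by
    funext p
    simp [add_comm]
  rw [h6]
  exact h5

/-- The surface measure on the hyperplane `⟪n, x⟫ = c`. -/
def surf (n : V) (c : ℝ) : Measure V :=
  (volume : Measure (ℝ ∙ n)ᗮ).map fun x : (ℝ ∙ n)ᗮ => (x : V) + c • n

instance (n : V) (c : ℝ) : SFinite (surf n c) := by unfold surf; infer_instance

/-- Fubini's theorem along the normal `n`, with the hyperplane at height `c` as base; moving the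
base from height `0` to `c` is absorbed by translation invariance on the line. -/
theorem measurePreserving_surf {n : V} (hn : ‖n‖ = 1) (c : ℝ) :
    MeasurePreserving (fun p : V × ℝ => p.1 + p.2 • n)
      ((surf n c).prod (volume : Measure ℝ)) (volume : Measure V) := by
  refine ⟨by fun_prop, ?_⟩
  have h1 : (surf n c).prod (volume : Measure ℝ) =
      ((volume : Measure (ℝ ∙ n)ᗮ).prod (volume : Measure ℝ)).map
        (Prod.map (fun x : (ℝ ∙ n)ᗮ => (x : V) + c • n) id) := by
    rw [← Measure.map_prod_map _ _ (by fun_prop) measurable_id, Measure.map_id]; rfl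
  rw [h1, Measure.map_map (by fun_prop) (by fun_prop)]
  have h2 : MeasurePreserving (fun p : (ℝ ∙ n)ᗮ × ℝ => (p.1, c + p.2))
      ((volume : Measure (ℝ ∙ n)ᗮ).prod (volume : Measure ℝ)) (volume.prod volume) :=
    (MeasurePreserving.id _).prod (measurePreserving_add_left volume c)
  rw [← ((measurePreserving_orthogonal_add_smul hn).comp h2).map_eq]
  congr 1
  funext p
  simp [add_smul, add_assoc]

theorem orthogonal_add_range {n : V} (hn : ‖n‖ = 1) (c : ℝ) :
    range (fun x : (ℝ ∙ n)ᗮ => (x : V) + c • n) = {x | inner ℝ n x = c} := by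
  have hnn : inner ℝ n n = (1 : ℝ) := by rw [real_inner_self_eq_norm_sq, hn]; norm_num
  ext y
  constructor
  · rintro ⟨x, rfl⟩
    have := Submodule.mem_orthogonal_singleton_iff_inner_right.1 x.2
    simp [inner_add_right, inner_smul_right, this, hn]
  · intro hy
    refine ⟨⟨y - c • n, ?_⟩, by simp⟩
    rw [Submodule.mem_orthogonal_singleton_iff_inner_right]
    simp only [mem_ofPred_eq] at hy
    simp [inner_sub_right, inner_smul_right, hn, hy]

theorem measurableSet_hyperplane (n : V) (c : ℝ) : MeasurableSet {x : V | inner ℝ n x = c} :=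
  (isClosed_eq (by fun_prop) continuous_const).measurableSet

theorem surf_ae {n : V} (hn : ‖n‖ = 1) (c : ℝ) : ∀ᵐ x ∂(surf n c), inner ℝ n x = c := by
  unfold surf
  rw [ae_map_iff (by fun_prop) (measurableSet_hyperplane n c)]
  refine Eventually.of_forall fun x : (ℝ ∙ n)ᗮ => ?_
  have : (x : V) + c • n ∈ range (fun x : (ℝ ∙ n)ᗮ => (x : V) + c • n) := ⟨x, rfl⟩
  rwa [orthogonal_add_range hn] at this

/-- The parametrisation of the hyperplane by the orthogonal complement of `n` is an isometry, and on
an inner product space the normalised Hausdorff measure of full dimension is Lebesgue measure. This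
replaces the facet measure of the statement by `surf`. -/
theorem euclideanHausdorffMeasure_restrict_hyperplane {n : V} (hn : ‖n‖ = 1) (c : ℝ) :
    (μHE[Module.finrank ℝ V - 1] : Measure V).restrict {x | inner ℝ n x = c} = surf n c := by
  have hdim : Module.finrank ℝ (ℝ ∙ n)ᗮ = Module.finrank ℝ V - 1 := by
    have h1 : Module.finrank ℝ (ℝ ∙ n) = 1 :=
      finrank_span_singleton (by rintro rfl; simp at hn)
    have := (ℝ ∙ n).finrank_add_finrank_orthogonal
    omega
  have hiso : Isometry (fun x : (ℝ ∙ n)ᗮ => (x : V) + c • n) :=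
    (IsometryEquiv.addRight (c • n)).isometry.comp isometry_subtype_coe
  have := hiso.map_euclideanHausdorffMeasure (d := Module.finrank ℝ V - 1)
  rw [orthogonal_add_range hn, ← hdim, InnerProductSpace.euclideanHausdorffMeasure_eq_volume] at this
  rw [← hdim, ← this]; rfl

theorem restrict_eq_surf_restrict {n : V} (hn : ‖n‖ = 1) {c : ℝ} {F : Set V} (hF : MeasurableSet F)
    (hFn : ∀ x ∈ F, inner ℝ n x = c) :
    (μHE[Module.finrank ℝ V - 1] : Measure V).restrict F = (surf n c).restrict F := by
  rw [← euclideanHausdorffMeasure_restrict_hyperplane hn, Measure.restrict_restrict hF,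
    inter_eq_left.2 (show F ⊆ {x | inner ℝ n x = c} from hFn)]

/-- In orthogonal coordinates the set lies in the product of a ball and an interval of length `2δ`.
The constant does not depend on the height `c`, and `δ = 0` is allowed, which shows that hyperplanes
are null sets. -/
theorem volume_strip_inter_ball_le {n : V} (hn : ‖n‖ = 1) (R : ℝ) :
    ∃ C : ℝ, 0 ≤ C ∧ ∀ c δ : ℝ, 0 ≤ δ → volume ({x : V | |inner ℝ n x - c| ≤ δ} ∩ Metric.ball 0 R)
      ≤ ENNReal.ofReal (C * δ) := by
  refine ⟨(volume (Metric.ball (0 : (ℝ ∙ n)ᗮ) R)).toReal * 2, by positivity, fun c δ hδ => ?_⟩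
  have hnn : inner ℝ n n = (1 : ℝ) := by rw [real_inner_self_eq_norm_sq, hn]; norm_num
  have hm : MeasurableSet ({x : V | |inner ℝ n x - c| ≤ δ} ∩ Metric.ball 0 R) := by
    refine MeasurableSet.inter ?_ measurableSet_ball
    exact (isClosed_le (by fun_prop) continuous_const).measurableSet
  rw [← (measurePreserving_orthogonal_add_smul hn).measure_preimage hm.nullMeasurableSet]
  calc _ ≤ ((volume : Measure (ℝ ∙ n)ᗮ).prod (volume : Measure ℝ))
        (Metric.ball 0 R ×ˢ Icc (c - δ) (c + δ)) := by
        refine measure_mono ?_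
        rintro ⟨x, s⟩ ⟨h1, h2⟩
        have hx := Submodule.mem_orthogonal_singleton_iff_inner_right.1 x.2
        have hx' : inner ℝ (x : V) n = (0 : ℝ) := by rw [real_inner_comm]; exact hx
        simp only [mem_ofPred_eq, inner_add_right, inner_smul_right, hx, hnn] at h1
        simp only [mem_ball_zero_iff] at h2
        refine ⟨?_, ?_⟩
        · rw [mem_ball_zero_iff]
          have h3 : ‖(x : V)‖ ^ 2 ≤ ‖(x : V) + s • n‖ ^ 2 := by
            rw [norm_add_sq_real, inner_smul_right, hx']
            nlinarith [sq_nonneg ‖s • n‖]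
          exact lt_of_le_of_lt (abs_le_of_sq_le_sq' h3 (norm_nonneg _)).2 h2
        · rw [abs_le] at h1
          constructor <;> linarith
    _ = _ := by
        rw [Measure.prod_prod, Real.volume_Icc, ENNReal.ofReal_mul' hδ,
          ENNReal.ofReal_mul ENNReal.toReal_nonneg, ENNReal.ofReal_toReal measure_ball_lt_top.ne]
        rw [mul_assoc, ← ENNReal.ofReal_mul (by norm_num)]
        ring_nf

theorem volume_strip_inter_ball_le' {a : V} (ha : a ≠ 0) (R : ℝ) :
    ∃ C : ℝ, 0 ≤ C ∧ ∀ c δ : ℝ, 0 ≤ δ → volume ({x : V | |inner ℝ a x - c| ≤ δ} ∩ Metric.ball 0 R)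
      ≤ ENNReal.ofReal (C * δ) := by
  have ha' : 0 < ‖a‖ := norm_pos_iff.2 ha
  obtain ⟨C, hC, h⟩ := volume_strip_inter_ball_le (n := (‖a‖⁻¹ : ℝ) • a)
    (by rw [norm_smul, norm_inv, norm_norm, inv_mul_cancel₀ ha'.ne']) R
  refine ⟨C * ‖a‖⁻¹, by positivity, fun c δ hδ => ?_⟩
  refine le_trans (measure_mono ?_) (le_trans (h (‖a‖⁻¹ * c) (‖a‖⁻¹ * δ) (by positivity)) ?_)
  · rintro x ⟨h1, h2⟩
    refine ⟨?_, h2⟩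
    simp only [mem_ofPred_eq] at h1 ⊢
    rw [inner_smul_left, RCLike.conj_to_real, ← mul_sub, abs_mul, abs_of_pos (inv_pos.2 ha')]
    gcongr
  · rw [mul_assoc]

/-- The component of `a` orthogonal to `n` does not vanish. -/
theorem orthogonalProjection_ne_zero {n a : V} (ha : a ∉ ℝ ∙ n) :
    (ℝ ∙ n)ᗮ.orthogonalProjectionOnto a ≠ 0 := by
  intro h
  apply ha
  have := Submodule.orthogonalProjectionOnto_eq_zero_iff.1 h
  rwa [Submodule.orthogonal_orthogonal] at this

theorem inner_orthogonalProjection {n : V} (a : V) (x : (ℝ ∙ n)ᗮ) :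
    inner ℝ a (x : V) = inner ℝ ((ℝ ∙ n)ᗮ.orthogonalProjectionOnto a) x := by
  exact (Submodule.inner_orthogonalProjectionOnto_eq_of_mem_right x a).symm

/-- On the complement of `n`, the functional `⟪a, ·⟫` is represented by the projection of `a`, which
is nonzero since `a` is not parallel to `n`; the strip bound then applies inside the hyperplane. -/
theorem surf_strip_inter_ball_le {n a : V} (ha : a ∉ ℝ ∙ n) (c R : ℝ) :
    ∃ C : ℝ, 0 ≤ C ∧ ∀ b δ : ℝ, 0 ≤ δ →
      volume {x : (ℝ ∙ n)ᗮ | |inner ℝ a (x : V) - b| ≤ δ ∧ ‖x‖ < R} ≤ ENNReal.ofReal (C * δ) := by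
  obtain ⟨C, hC, h⟩ := volume_strip_inter_ball_le' (orthogonalProjection_ne_zero ha) R
  refine ⟨C, hC, fun b δ hδ => le_trans (measure_mono ?_) (h b δ hδ)⟩
  rintro x ⟨h1, h2⟩
  refine ⟨?_, by simpa using h2⟩
  rw [inner_orthogonalProjection] at h1
  exact h1

/-- Slicing along `n`: an interval of heights of length `2δ`, and for each height a strip of measure
`O(δ)` inside the hyperplane. The square is what makes the codimension-two ridges removable later.
-/
theorem volume_tube_inter_ball_le {n a : V} (hn : ‖n‖ = 1) (ha : a ∉ ℝ ∙ n) (R : ℝ) :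
    ∃ C : ℝ, 0 ≤ C ∧ ∀ c b δ : ℝ, 0 ≤ δ →
      volume ({x : V | |inner ℝ n x - c| ≤ δ ∧ |inner ℝ a x - b| ≤ δ} ∩ Metric.ball 0 R)
        ≤ ENNReal.ofReal (C * δ ^ 2) := by
  obtain ⟨C, hC, h⟩ := surf_strip_inter_ball_le ha 0 R
  refine ⟨C * 2, by positivity, fun c b δ hδ => ?_⟩
  have hnn : inner ℝ n n = (1 : ℝ) := by rw [real_inner_self_eq_norm_sq, hn]; norm_num
  set S := ({x : V | |inner ℝ n x - c| ≤ δ ∧ |inner ℝ a x - b| ≤ δ} ∩ Metric.ball 0 R) with hS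
  have hm : MeasurableSet S := by
    refine MeasurableSet.inter ?_ measurableSet_ball
    exact ((isClosed_le (f := fun x : V => |inner ℝ n x - c|) (by fun_prop) continuous_const).inter
      (isClosed_le (f := fun x : V => |inner ℝ a x - b|) (by fun_prop)
        continuous_const)).measurableSet
  rw [← (measurePreserving_orthogonal_add_smul hn).measure_preimage hm.nullMeasurableSet]
  rw [Measure.prod_apply_symm ((measurePreserving_orthogonal_add_smul hn).measurable hm)]
  calc _ ≤ ∫⁻ s : ℝ, (Icc (c - δ) (c + δ)).indicator (fun _ => ENNReal.ofReal (C * δ)) s := by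
        refine lintegral_mono fun s => ?_
        by_cases hs : s ∈ Icc (c - δ) (c + δ)
        · rw [indicator_of_mem hs]
          -- At height `s` the second strip is shifted by `s⟪a, n⟫`; here the uniformity of the
          -- constant in the offset is needed.
          refine le_trans (measure_mono ?_) (h (b - s * inner ℝ a n) δ hδ)
          rintro x ⟨⟨h1, h2⟩, h3⟩
          have hx := Submodule.mem_orthogonal_singleton_iff_inner_right.1 x.2
          have hx' : inner ℝ (x : V) n = (0 : ℝ) := by rw [real_inner_comm]; exact hx
          refine ⟨?_, ?_⟩
          · rw [inner_add_right, inner_smul_right] at h2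
            convert h2 using 2; ring
          · simp only [mem_ball_zero_iff] at h3
            have h3' : ‖(x : V)‖ ^ 2 ≤ ‖(x : V) + s • n‖ ^ 2 := by
              rw [norm_add_sq_real, inner_smul_right, hx']
              nlinarith [sq_nonneg ‖s • n‖]
            exact lt_of_le_of_lt (abs_le_of_sq_le_sq' h3' (norm_nonneg _)).2 h3
        · rw [indicator_of_notMem hs]
          refine le_of_eq (measure_mono_null ?_ measure_empty)
          rintro x ⟨⟨h1, h2⟩, h3⟩
          have hx := Submodule.mem_orthogonal_singleton_iff_inner_right.1 x.2
          simp only [inner_add_right, inner_smul_right, hx, hnn] at h1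
          rw [abs_le] at h1
          exact hs ⟨by linarith, by linarith⟩
    _ = _ := by
        rw [lintegral_indicator measurableSet_Icc, lintegral_const, Measure.restrict_apply_univ,
          Real.volume_Icc, ← ENNReal.ofReal_mul (by positivity)]
        ring_nf

/-- The strip bound with `δ = 0`, on an exhaustion by balls. -/
theorem surf_hyperplane_eq_zero {n a : V} (ha : a ∉ ℝ ∙ n) (c b : ℝ) :
    surf n c {x | inner ℝ a x = b} = 0 := by
  unfold surf
  rw [Measure.map_apply (by fun_prop) (measurableSet_hyperplane a b)]
  have h : ∀ N : ℕ, volume {x : (ℝ ∙ n)ᗮ | |inner ℝ a (x : V) - (b - c * inner ℝ a n)| ≤ 0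
      ∧ ‖x‖ < N} = 0 := by
    intro N
    obtain ⟨C, hC, h⟩ := surf_strip_inter_ball_le ha 0 N
    simpa using h (b - c * inner ℝ a n) 0 le_rfl
  refine measure_mono_null (fun x hx => ?_) (measure_iUnion_null h)
  obtain ⟨N, hN⟩ := exists_nat_gt ‖x‖
  refine mem_iUnion.2 ⟨N, ?_, hN⟩
  simp only [mem_preimage, mem_ofPred_eq, inner_add_right, inner_smul_right] at hx
  rw [abs_nonpos_iff]; linarith

/-- The orthogonal projection does not increase distances, so the trace of the ball on the
hyperplane lies in a ball of the same radius around the projected centre. -/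
theorem surf_ball_le {n : V} (hn : ‖n‖ = 1) (c : ℝ) :
    ∃ C : ℝ, 0 ≤ C ∧ ∀ (y : V) (r : ℝ), 0 ≤ r →
      surf n c (Metric.ball y r) ≤ ENNReal.ofReal (C * r ^ (Module.finrank ℝ V - 1)) := by
  have hdim : Module.finrank ℝ (ℝ ∙ n)ᗮ = Module.finrank ℝ V - 1 := by
    have h1 : Module.finrank ℝ (ℝ ∙ n) = 1 :=
      finrank_span_singleton (by rintro rfl; simp at hn)
    have := (ℝ ∙ n).finrank_add_finrank_orthogonal
    omega
  refine ⟨(volume (Metric.ball (0 : (ℝ ∙ n)ᗮ) 1)).toReal, by positivity, fun y r hr => ?_⟩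
  unfold surf
  rw [Measure.map_apply (by fun_prop) measurableSet_ball]
  set y' : (ℝ ∙ n)ᗮ := (ℝ ∙ n)ᗮ.orthogonalProjectionOnto (y - c • n) with hy'
  calc _ ≤ volume (Metric.closedBall y' r) := by
        refine measure_mono fun x hx => ?_
        simp only [mem_preimage, Metric.mem_ball, dist_eq_norm] at hx
        rw [Metric.mem_closedBall, dist_eq_norm]
        have h1 : x - y' = (ℝ ∙ n)ᗮ.orthogonalProjectionOnto ((x : V) + c • n - y) := by
          have : (x : V) + c • n - y = x - (y - c • n) := by abel
          rw [this, map_sub, Submodule.orthogonalProjectionOnto_mem_subspace_eq_self]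
        rw [h1]
        exact (Submodule.norm_orthogonalProjectionOnto_apply_le _ _).trans hx.le
    _ = _ := by
        rw [Measure.addHaar_closedBall _ _ hr, hdim,
          ENNReal.ofReal_mul ENNReal.toReal_nonneg, ENNReal.ofReal_toReal measure_ball_lt_top.ne,
          mul_comm]

end Hyperplane

/-! ### Weak derivatives and extension by zero -/

section WeakDeriv
variable {d : ℕ} {G : Type*} [NormedAddCommGroup G] [NormedSpace ℝ G]

theorem IsTest.mono {E F : Type*} [NormedAddCommGroup E] [NormedSpace ℝ E]
    [NormedAddCommGroup F] [NormedSpace ℝ F] {U V : Set E} (hUV : U ⊆ V) {φ : E → F}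
    (h : IsTest U φ) : IsTest V φ := ⟨h.1, h.2.1, h.2.2.trans hUV⟩

theorem IsTest.continuous {E F : Type*} [NormedAddCommGroup E] [NormedSpace ℝ E]
    [NormedAddCommGroup F] [NormedSpace ℝ F] {U : Set E} {φ : E → F}
    (h : IsTest U φ) : Continuous φ := h.1.continuous

theorem IsTest.memLp {U : Set (Vec d)} {φ : Vec d → G} (h : IsTest U φ) (p : ℝ≥0∞)
    (μ : Measure (Vec d)) [IsFiniteMeasureOnCompacts μ] : MemLp φ p μ :=
  h.continuous.memLp_of_hasCompactSupport h.2.1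

theorem IsTest.continuous_fderiv_apply {U : Set (Vec d)} {φ : Vec d → G} (h : IsTest U φ)
    (v : Vec d) : Continuous fun x => fderiv ℝ φ x v :=
  (h.1.continuous_fderiv (by simp)).clm_apply continuous_const

theorem IsTest.hasCompactSupport_fderiv_apply {U : Set (Vec d)} {φ : Vec d → G} (h : IsTest U φ)
    (v : Vec d) : HasCompactSupport fun x => fderiv ℝ φ x v :=
  h.2.1.fderiv_apply (𝕜 := ℝ) v

theorem IsTest.memLp_fderiv_apply {U : Set (Vec d)} {φ : Vec d → G} (h : IsTest U φ)
    (v : Vec d) (p : ℝ≥0∞) (μ : Measure (Vec d)) [IsFiniteMeasureOnCompacts μ] :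
    MemLp (fun x => fderiv ℝ φ x v) p μ :=
  (h.continuous_fderiv_apply v).memLp_of_hasCompactSupport (h.hasCompactSupport_fderiv_apply v)

theorem integrable_smul_of_memLp_two {α : Type*} [MeasurableSpace α] {μ : Measure α}
    {f : α → ℝ} {g : α → G} (hf : MemLp f 2 μ) (hg : MemLp g 2 μ) :
    Integrable (fun x => f x • g x) μ :=
  memLp_one_iff_integrable.1 (hg.smul hf)

theorem enorm_integral_smul_le {α : Type*} [MeasurableSpace α] {μ : Measure α}
    {f : α → ℝ} {g : α → G} (hf : AEStronglyMeasurable f μ) (hg : AEStronglyMeasurable g μ) :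
    ‖∫ x, f x • g x ∂μ‖ₑ ≤ eLpNorm f 2 μ * eLpNorm g 2 μ := by
  refine (enorm_integral_le_lintegral_enorm _).trans ?_
  rw [← eLpNorm_one_eq_lintegral_enorm]
  exact eLpNorm_smul_le_mul_eLpNorm hg hf

theorem ae_eq_of_forall_isTest [CompleteSpace G] {E : Type*} [NormedAddCommGroup E]
    [NormedSpace ℝ E] [FiniteDimensional ℝ E] [MeasurableSpace E] [BorelSpace E] {μ : Measure E}
    [IsFiniteMeasureOnCompacts μ] {U : Set E} (hU : IsOpen U)
    {g g' : E → G} (hg : LocallyIntegrableOn g U μ) (hg' : LocallyIntegrableOn g' U μ)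
    (h : ∀ φ : E → ℝ, IsTest U φ → ∫ x in U, φ x • g x ∂μ = ∫ x in U, φ x • g' x ∂μ) :
    g =ᵐ[μ.restrict U] g' := by
  have h1 := hU.ae_eq_zero_of_integral_contDiff_smul_eq_zero (μ := μ) (f := g - g') (hg.sub hg') ?_
  · rw [Filter.EventuallyEq, ae_restrict_iff' hU.measurableSet]
    filter_upwards [h1] with x hx hxU
    simpa [sub_eq_zero] using hx hxU
  · intro φ h1 h2 h3
    rw [← setIntegral_eq_integral_of_forall_compl_eq_zero (s := U)
      (fun x hx => by rw [image_eq_zero_of_notMem_tsupport (fun h => hx (h3 h)), zero_smul])]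
    have hi : ∀ {f : E → G}, LocallyIntegrableOn f U μ → IntegrableOn (fun x => φ x • f x) U μ := by
      intro f hf
      have h4 : IntegrableOn f (tsupport φ) μ := hf.integrableOn_compact_subset h3 h2
      have h5 : IntegrableOn (fun x => φ x • f x) (tsupport φ) μ :=
        h4.continuousOn_smul h1.continuous.continuousOn h2
      have h6 : Function.support (fun x => φ x • f x) ⊆ tsupport φ := fun x hx =>
        subset_tsupport φ fun h0 => hx (by simp [h0])
      exact ((integrableOn_iff_integrable_of_support_subset h6).1 h5).integrableOn
    have h7 := h φ ⟨h1, h2, h3⟩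
    simp only [Pi.sub_apply, smul_sub]
    rw [integral_sub (hi hg) (hi hg'), h7, sub_self]

theorem locallyIntegrableOn_of_memLp {α : Type*} [TopologicalSpace α] [MeasurableSpace α]
    [OpensMeasurableSpace α] {μ : Measure α} [IsLocallyFiniteMeasure μ] {U : Set α} {g : α → G}
    {p : ℝ≥0∞} (hp : 1 ≤ p) (hg : MemLp g p (μ.restrict U)) : LocallyIntegrableOn g U μ :=
  locallyIntegrableOn_of_locallyIntegrable_restrict (hg.locallyIntegrable hp)

theorem HasWeakPartial.ae_eq [CompleteSpace G] {U : Set (Vec d)} (hU : IsOpen U) {j : Fin d}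
    {w g g' : Vec d → G} (h : HasWeakPartial U j w g) (h' : HasWeakPartial U j w g') :
    g =ᵐ[volume.restrict U] g' := by
  refine ae_eq_of_forall_isTest hU (locallyIntegrableOn_of_memLp (by norm_num) h.1)
    (locallyIntegrableOn_of_memLp (by norm_num) h'.1) fun φ hφ => ?_
  have h1 := h.2 φ hφ
  rw [h'.2 φ hφ] at h1
  exact (neg_injective h1).symm

theorem hasWeakPartial_weakPartial {U : Set (Vec d)} {j : Fin d}
    {w : Vec d → G} (h : ∃ g, HasWeakPartial U j w g) :
    HasWeakPartial U j w (weakPartial U j w) := by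
  unfold weakPartial
  rw [dif_pos h]
  exact h.choose_spec

theorem HasWeakPartial.weakPartial_ae [CompleteSpace G] {U : Set (Vec d)} (hU : IsOpen U)
    {j : Fin d} {w g : Vec d → G} (h : HasWeakPartial U j w g) :
    weakPartial U j w =ᵐ[volume.restrict U] g :=
  (hasWeakPartial_weakPartial ⟨g, h⟩).ae_eq hU h

theorem HasWeakPartial.congr {U : Set (Vec d)} {j : Fin d} {w w' g g' : Vec d → G}
    (h : HasWeakPartial U j w g) (hw : w =ᵐ[volume.restrict U] w')
    (hg : g =ᵐ[volume.restrict U] g') : HasWeakPartial U j w' g' := by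
  refine ⟨(memLp_congr_ae hg).1 h.1, fun φ hφ => ?_⟩
  have h2 : ∫ x in U, fderiv ℝ φ x (unitVec j) • w' x = ∫ x in U, fderiv ℝ φ x (unitVec j) • w x :=
    integral_congr_ae (hw.mono fun x hx => by simp only [hx])
  have h3 : ∫ x in U, φ x • g' x = ∫ x in U, φ x • g x :=
    integral_congr_ae (hg.mono fun x hx => by simp only [hx])
  rw [h2, h3, h.2 φ hφ]

theorem HasWeakPartial.mono {U V : Set (Vec d)} (hVU : V ⊆ U) {j : Fin d} {w g : Vec d → G}
    (h : HasWeakPartial U j w g) : HasWeakPartial V j w g := by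
  refine ⟨h.1.mono_measure (Measure.restrict_mono_set _ hVU), fun φ hφ => ?_⟩
  have h1 := h.2 φ (hφ.mono hVU)
  have h2 : ∀ x, x ∉ V → φ x = 0 := fun x hx =>
    image_eq_zero_of_notMem_tsupport fun h => hx (hφ.2.2 h)
  have h3 : ∀ x, x ∉ V → fderiv ℝ φ x = 0 := fun x hx =>
    image_eq_zero_of_notMem_tsupport fun h => hx (hφ.2.2 (tsupport_fderiv_subset ℝ h))
  have key : ∀ f : Vec d → G, (∀ x, x ∉ V → f x = 0) → ∫ x in U, f x = ∫ x in V, f x := by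
    intro f hf
    rw [setIntegral_eq_integral_of_forall_compl_eq_zero (fun x hx => hf x fun h => hx (hVU h)),
      setIntegral_eq_integral_of_forall_compl_eq_zero hf]
  rwa [key _ fun x hx => by simp [h3 x hx], key _ fun x hx => by simp [h2 x hx]] at h1

theorem exists_hasWeakPartial_congr {U : Set (Vec d)} {j : Fin d} {w w' : Vec d → G}
    (hw : w =ᵐ[volume.restrict U] w') :
    (∃ g, HasWeakPartial U j w g) ↔ ∃ g, HasWeakPartial U j w' g :=
  ⟨fun ⟨g, h⟩ => ⟨g, h.congr hw .rfl⟩, fun ⟨g, h⟩ => ⟨g, h.congr hw.symm .rfl⟩⟩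

theorem HasWeakPartial.sub {U : Set (Vec d)} {j : Fin d} {w w' g g' : Vec d → G}
    (h : HasWeakPartial U j w g) (h' : HasWeakPartial U j w' g')
    (hw : MemLp w 2 (volume.restrict U)) (hw' : MemLp w' 2 (volume.restrict U)) :
    HasWeakPartial U j (fun x => w x - w' x) (fun x => g x - g' x) := by
  refine ⟨h.1.sub h'.1, fun φ hφ => ?_⟩
  simp only [smul_sub]
  rw [integral_sub (integrable_smul_of_memLp_two (hφ.memLp_fderiv_apply _ 2 _) hw)
      (integrable_smul_of_memLp_two (hφ.memLp_fderiv_apply _ 2 _) hw'),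
    integral_sub (integrable_smul_of_memLp_two (hφ.memLp 2 _) h.1)
      (integrable_smul_of_memLp_two (hφ.memLp 2 _) h'.1), h.2 φ hφ, h'.2 φ hφ]
  abel

/-- The product with a test function on `U` has compact support, so one integrates by parts on the
whole space and no regularity of the boundary of `U` enters. -/
theorem hasWeakPartial_of_contDiff [CompleteSpace G] {U : Set (Vec d)} {j : Fin d}
    {w : Vec d → G} (hw : ContDiff ℝ 1 w)
    (h2 : MemLp (fun x => fderiv ℝ w x (unitVec j)) 2 (volume.restrict U)) :
    HasWeakPartial U j w fun x => fderiv ℝ w x (unitVec j) := by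
  refine ⟨h2, fun φ hφ => ?_⟩
  have h3 : ∀ x, x ∉ U → φ x = 0 := fun x hx =>
    image_eq_zero_of_notMem_tsupport fun h => hx (hφ.2.2 h)
  have h4 : ∀ x, x ∉ U → fderiv ℝ φ x = 0 := fun x hx =>
    image_eq_zero_of_notMem_tsupport fun h => hx (hφ.2.2 (tsupport_fderiv_subset ℝ h))
  rw [setIntegral_eq_integral_of_forall_compl_eq_zero fun x hx => by simp [h4 x hx],
    setIntegral_eq_integral_of_forall_compl_eq_zero fun x hx => by simp [h3 x hx]]
  have hc : Continuous fun x => fderiv ℝ w x (unitVec j) :=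
    (hw.continuous_fderiv (by simp)).clm_apply continuous_const
  have := integral_smul_fderiv_eq_neg_fderiv_smul_of_integrable (μ := (volume : Measure (Vec d)))
    (f := φ) (g := w) (v := unitVec j) ?_ ?_ ?_ (fun x _ => (hφ.1.differentiable (by simp)) x)
    (fun x _ => (hw.differentiable (by simp)) x)
  · rw [this, neg_neg]
  · exact ((hφ.continuous_fderiv_apply _).smul hw.continuous).integrable_of_hasCompactSupport
      (hφ.hasCompactSupport_fderiv_apply _).smul_right
  · exact (hφ.continuous.smul hc).integrable_of_hasCompactSupport hφ.2.1.smul_right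
  · exact (hφ.continuous.smul hw.continuous).integrable_of_hasCompactSupport hφ.2.1.smul_right

theorem memLp_restrict_of_continuous {U : Set (Vec d)} (hU : Bornology.IsBounded U)
    {w : Vec d → G} (hw : Continuous w) (p : ℝ≥0∞) : MemLp w p (volume.restrict U) := by
  have hc : IsCompact (closure U) := hU.isCompact_closure
  have : MemLp w p (volume.restrict (closure U)) := by
    obtain ⟨C, hC⟩ := hc.exists_bound_of_continuousOn hw.continuousOn
    have : IsFiniteMeasure (volume.restrict (closure U) : Measure (Vec d)) :=
      isFiniteMeasure_restrict.2 hc.measure_lt_top.ne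
    exact MemLp.of_bound hw.aestronglyMeasurable C
      (ae_restrict_of_forall_mem isClosed_closure.measurableSet hC)
  exact this.mono_measure (Measure.restrict_mono_set _ subset_closure)

theorem hasWeakPartial_of_contDiff_of_isBounded [CompleteSpace G] {U : Set (Vec d)}
    (hU : Bornology.IsBounded U) {j : Fin d} {w : Vec d → G} (hw : ContDiff ℝ 1 w) :
    HasWeakPartial U j w fun x => fderiv ℝ w x (unitVec j) :=
  hasWeakPartial_of_contDiff hw (memLp_restrict_of_continuous hU
    ((hw.continuous_fderiv (by simp)).clm_apply continuous_const) 2)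

open Classical in
theorem sobolevSq_one (U : Set (Vec d)) (w : Vec d → G) :
    sobolevSq U 1 w = if ∀ j : Fin d, ∃ g, HasWeakPartial U j w g then
      eLpNorm w 2 (volume.restrict U) ^ 2
        + ∑ j : Fin d, eLpNorm (weakPartial U j w) 2 (volume.restrict U) ^ 2
      else ⊤ := by
  simp [sobolevSq, sobolevAuxSq, slobodeckijSq]

theorem exists_hasWeakPartial_of_sobolevSq_one {U : Set (Vec d)} {w : Vec d → G}
    (h : sobolevSq U 1 w < ⊤) (j : Fin d) : ∃ g, HasWeakPartial U j w g := by
  by_contra hc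
  rw [sobolevSq_one, if_neg (fun hh => hc (hh j))] at h
  exact lt_irrefl _ h

theorem eLpNorm_sq_le_sobolevSq_one (U : Set (Vec d)) (w : Vec d → G) :
    eLpNorm w 2 (volume.restrict U) ^ 2 ≤ sobolevSq U 1 w := by
  rw [sobolevSq_one]
  split_ifs
  · exact le_self_add
  · exact le_top

theorem eLpNorm_weakPartial_sq_le_sobolevSq_one (U : Set (Vec d)) (w : Vec d → G) (j : Fin d)  :
    eLpNorm (weakPartial U j w) 2 (volume.restrict U) ^ 2 ≤ sobolevSq U 1 w := by
  rw [sobolevSq_one]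
  split_ifs
  · refine le_trans ?_ le_add_self
    exact Finset.single_le_sum (f := fun j => eLpNorm (weakPartial U j w) 2 (volume.restrict U) ^ 2)
      (fun _ _ => zero_le) (Finset.mem_univ j)
  · exact le_top

/-- For fields in `C_c^∞(Ω)` the integration by parts formula holds against test functions that do
not vanish on the boundary. By Cauchy–Schwarz the defect of the formula is continuous in the `H¹`
norm, hence zero on the closure. -/
theorem hasWeakPartial_univ_of_mem_spaceV {Ω : Set (Vec d)} (hΩ : IsOpen Ω)
    (hb : Bornology.IsBounded Ω)
    {w : L2Vec Ω} (hw : w ∈ spaceV Ω) (j : Fin d) :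
    HasWeakPartial univ j (Ω.indicator w) (Ω.indicator (weakPartial Ω j w)) := by
  obtain ⟨hw1, hw2⟩ := hw
  have hg := hasWeakPartial_weakPartial (exists_hasWeakPartial_of_sobolevSq_one hw1 j)
  have hwL : MemLp w 2 (volume.restrict Ω) := Lp.memLp w
  refine ⟨?_, fun φ hφ => ?_⟩
  · rw [Measure.restrict_univ, memLp_indicator_iff_restrict hΩ.measurableSet]
    exact hg.1
  simp only [Measure.restrict_univ]
  have e1 : (fun x => fderiv ℝ φ x (unitVec j) • Ω.indicator w x)
    = Ω.indicator fun x => fderiv ℝ φ x (unitVec j) • w x := by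
    funext x; by_cases hx : x ∈ Ω <;> simp [hx]
  have e2 : (fun x => φ x • Ω.indicator (weakPartial Ω j w) x)
    = Ω.indicator fun x => φ x • weakPartial Ω j w x := by
    funext x; by_cases hx : x ∈ Ω <;> simp [hx]
  rw [e1, e2, integral_indicator hΩ.measurableSet, integral_indicator hΩ.measurableSet,
    ← sub_eq_zero, sub_neg_eq_add]
  have hφ1 := hφ.memLp_fderiv_apply (unitVec j) 2 (volume.restrict Ω)
  have hφ2 := hφ.memLp 2 (volume.restrict Ω)
  set A := eLpNorm (fun x => fderiv ℝ φ x (unitVec j)) 2 (volume.restrict Ω) with hA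
  set B := eLpNorm φ 2 (volume.restrict Ω) with hB
  have hAB : A + B ≠ ⊤ := ENNReal.add_ne_top.2 ⟨hφ1.2.ne, hφ2.2.ne⟩
  have key : ∀ η : NNReal, 0 < η →
      ‖(∫ x in Ω, fderiv ℝ φ x (unitVec j) • w x) + ∫ x in Ω, φ x • weakPartial Ω j w x‖ₑ
        ≤ (A + B) * η := by
    intro η hη
    -- The approximation is measured in the squared norm, hence `η ^ 2`.
    obtain ⟨ψ, hψ, hlt⟩ := hw2 (η ^ 2) (by positivity)
    have hψL := hψ.memLp 2 (volume.restrict Ω)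
    have hψw : HasWeakPartial Ω j ψ fun x => fderiv ℝ ψ x (unitVec j) :=
      hasWeakPartial_of_contDiff_of_isBounded hb (hψ.1.of_le (by simp))
    have hψu : HasWeakPartial univ j ψ fun x => fderiv ℝ ψ x (unitVec j) :=
      hasWeakPartial_of_contDiff (hψ.1.of_le (by simp)) (hψ.memLp_fderiv_apply _ _ _)
    have hsub := hg.sub hψw hwL hψL
    have h0 := hψu.2 φ hφ
    simp only [Measure.restrict_univ] at h0
    have h3 : ∀ x, x ∉ Ω → ψ x = 0 := fun x hx =>
      image_eq_zero_of_notMem_tsupport fun h => hx (hψ.2.2 h)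
    have h4 : ∀ x, x ∉ Ω → fderiv ℝ ψ x = 0 := fun x hx =>
      image_eq_zero_of_notMem_tsupport fun h => hx (hψ.2.2 (tsupport_fderiv_subset ℝ h))
    have i1 : ∫ x in Ω, fderiv ℝ φ x (unitVec j) • ψ x = ∫ x, fderiv ℝ φ x (unitVec j) • ψ x :=
      setIntegral_eq_integral_of_forall_compl_eq_zero fun x hx => by simp [h3 x hx]
    have i2 : ∫ x in Ω, φ x • fderiv ℝ ψ x (unitVec j) = ∫ x, φ x • fderiv ℝ ψ x (unitVec j) :=
      setIntegral_eq_integral_of_forall_compl_eq_zero fun x hx => by simp [h4 x hx]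
    rw [← i1, ← i2] at h0
    have h5 : (∫ x in Ω, fderiv ℝ φ x (unitVec j) • w x) + ∫ x in Ω, φ x • weakPartial Ω j w x
        = (∫ x in Ω, fderiv ℝ φ x (unitVec j) • (w x - ψ x))
          + ∫ x in Ω, φ x • (weakPartial Ω j w x - fderiv ℝ ψ x (unitVec j)) := by
      simp only [smul_sub]
      rw [integral_sub (integrable_smul_of_memLp_two hφ1 hwL)
          (integrable_smul_of_memLp_two hφ1 hψL),
        integral_sub (integrable_smul_of_memLp_two hφ2 hg.1)
          (integrable_smul_of_memLp_two hφ2 hψw.1), h0]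
      abel
    rw [h5]
    have hη2 : ∀ a : ℝ≥0∞, a ^ 2 ≤ ((η ^ 2 : NNReal) : ℝ≥0∞) → a ≤ η := by
      intro a ha
      rw [ENNReal.coe_pow] at ha
      exact (ENNReal.pow_le_pow_left_iff (by norm_num)).1 ha
    have n1 : eLpNorm (fun x => w x - ψ x) 2 (volume.restrict Ω) ≤ η :=
      hη2 _ ((eLpNorm_sq_le_sobolevSq_one _ _).trans hlt.le)
    have n2 : eLpNorm (fun x => weakPartial Ω j w x - fderiv ℝ ψ x (unitVec j)) 2
        (volume.restrict Ω) ≤ η := by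
      rw [← eLpNorm_congr_ae (hsub.weakPartial_ae hΩ)]
      exact hη2 _ ((eLpNorm_weakPartial_sq_le_sobolevSq_one _ _ j).trans hlt.le)
    refine (enorm_add_le _ _).trans ?_
    rw [add_mul]
    exact add_le_add
      ((enorm_integral_smul_le hφ1.1 (hwL.sub hψL).1).trans (mul_le_mul_right n1 _))
      ((enorm_integral_smul_le hφ2.1 hsub.1.1).trans (mul_le_mul_right n2 _))
  rw [← enorm_eq_zero]
  by_contra hne
  have hpos := pos_iff_ne_zero.2 hne
  have hT : Tendsto (fun η : NNReal => (A + B) * (η : ℝ≥0∞)) (𝓝[>] 0) (𝓝 ((A + B) * (0 : NNReal))) :=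
    ENNReal.Tendsto.const_mul
      ((ENNReal.continuous_coe.tendsto _).mono_left nhdsWithin_le_nhds) (Or.inr hAB)
  rw [ENNReal.coe_zero, mul_zero] at hT
  obtain ⟨η, h1, h2⟩ := ((hT.eventually (gt_mem_nhds hpos)).and self_mem_nhdsWithin).exists
  exact absurd (key η h2) (not_le.2 h1)

end WeakDeriv

/-! ### Decay of the `L¹` oscillation near a hyperplane -/

section Oscillation
variable {d : ℕ} {G : Type*} [NormedAddCommGroup G] [NormedSpace ℝ G]

/-- Pairs of points of `U` at distance less than `r`, the first one at distance less than `r` from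
the hyperplane `⟪n, x⟫ = c`. -/
def oscSet (U : Set (Vec d)) (n : Vec d) (c r : ℝ) : Set (Vec d × Vec d) :=
  {p | p.1 ∈ U ∧ p.2 ∈ U ∧ |inner ℝ n p.1 - c| < r ∧ dist p.2 p.1 < r}

/-- The `L¹` oscillation of `g` at scale `r` near a hyperplane. -/
def osc (U : Set (Vec d)) (n : Vec d) (c : ℝ) (g : Vec d → G) (r : ℝ) : ℝ≥0∞ :=
  ∫⁻ p in oscSet U n c r, ‖g p.1 - g p.2‖ₑ

/-- A decay of the oscillation that is fast enough for traces on the hyperplane to exist. -/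
def OscDecay (U : Set (Vec d)) (n : Vec d) (c : ℝ) (g : Vec d → G) : Prop :=
  ∃ C κ : ℝ, 0 ≤ C ∧ 0 < κ ∧ ∀ r ∈ Ioc (0 : ℝ) 1,
    osc U n c g r ≤ ENNReal.ofReal (C * r ^ ((d : ℝ) + 1 + κ))

theorem measurableSet_oscSet {U : Set (Vec d)} (hU : MeasurableSet U) (n : Vec d) (c r : ℝ) :
    MeasurableSet (oscSet U n c r) := by
  refine (measurable_fst hU).inter ((measurable_snd hU).inter (MeasurableSet.inter ?_ ?_))
  · exact (isOpen_lt (f := fun p : Vec d × Vec d => |inner ℝ n p.1 - c|)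
      (by fun_prop) continuous_const).measurableSet
  · exact (isOpen_lt (f := fun p : Vec d × Vec d => dist p.2 p.1)
      (by fun_prop) continuous_const).measurableSet

theorem osc_congr {U : Set (Vec d)} (hU : MeasurableSet U) {n : Vec d} {c : ℝ} {g g' : Vec d → G}
    (h : g =ᵐ[volume.restrict U] g') (r : ℝ) : osc U n c g r = osc U n c g' r := by
  refine lintegral_congr_ae ?_
  have h1 : ∀ᵐ x : Vec d, x ∈ U → g x = g' x := (ae_restrict_iff' hU).1 h
  rw [Filter.EventuallyEq, ae_restrict_iff' (measurableSet_oscSet hU n c r)]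
  filter_upwards [Measure.quasiMeasurePreserving_fst.ae h1,
    Measure.quasiMeasurePreserving_snd.ae h1] with p hp1 hp2 hp
  rw [hp1 hp.1, hp2 hp.2.1]

theorem OscDecay.congr {U : Set (Vec d)} (hU : MeasurableSet U) {n : Vec d} {c : ℝ}
    {g g' : Vec d → G} (h : g =ᵐ[volume.restrict U] g') (hg : OscDecay U n c g) :
    OscDecay U n c g' := by
  obtain ⟨C, κ, hC, hκ, H⟩ := hg
  exact ⟨C, κ, hC, hκ, fun r hr => by rw [← osc_congr hU h]; exact H r hr⟩

theorem OscDecay.of_ae_eq_set {U V : Set (Vec d)} {n : Vec d} {c : ℝ}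
    {g : Vec d → G} (h : V =ᵐ[volume] U) (hg : OscDecay U n c g) : OscDecay V n c g := by
  obtain ⟨C, κ, hC, hκ, H⟩ := hg
  refine ⟨C, κ, hC, hκ, fun r hr => le_trans (le_of_eq ?_) (H r hr)⟩
  unfold osc
  rw [Measure.restrict_congr_set]
  rw [eventuallyEq_set] at h ⊢
  filter_upwards [Measure.quasiMeasurePreserving_fst.ae h,
    Measure.quasiMeasurePreserving_snd.ae h] with p hp1 hp2
  exact ⟨fun hp => ⟨hp1.1 hp.1, hp2.1 hp.2.1, hp.2.2⟩, fun hp => ⟨hp1.2 hp.1, hp2.2 hp.2.1, hp.2.2⟩⟩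

/-- The first point ranges over a strip of volume `O(r)`, the second over a ball of volume `O(r ^
d)`. The exponent `d + 1` is the baseline that the positive `κ` of `OscDecay` has to beat. -/
theorem volume_oscSet_le {U : Set (Vec d)} (hU : MeasurableSet U) (hb : Bornology.IsBounded U)
    {n : Vec d} (hn : ‖n‖ = 1) :
    ∃ C : ℝ, 0 ≤ C ∧ ∀ c r : ℝ, 0 < r →
      volume (oscSet U n c r) ≤ ENNReal.ofReal (C * r ^ (d + 1)) := by
  obtain ⟨R, hR⟩ := hb.subset_ball 0
  obtain ⟨C, hC, h⟩ := volume_strip_inter_ball_le hn R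
  refine ⟨C * (volume (Metric.ball (0 : Vec d) 1)).toReal, by positivity, fun c r hr => ?_⟩
  rw [Measure.volume_eq_prod, Measure.prod_apply (measurableSet_oscSet hU n c r)]
  calc _ ≤ ∫⁻ y : Vec d, ({x : Vec d | |inner ℝ n x - c| ≤ r} ∩ Metric.ball 0 R).indicator
        (fun _ => volume (Metric.ball (0 : Vec d) 1) * ENNReal.ofReal (r ^ d)) y := by
        refine lintegral_mono fun y => ?_
        by_cases hy : y ∈ {x : Vec d | |inner ℝ n x - c| ≤ r} ∩ Metric.ball 0 R
        · rw [indicator_of_mem hy]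
          calc _ ≤ volume (Metric.ball y r) := measure_mono fun z hz => hz.2.2.2
            _ = _ := by
              rw [Measure.addHaar_ball_of_pos _ _ hr, mul_comm]; simp
        · rw [indicator_of_notMem hy]
          refine le_of_eq (measure_mono_null (fun z hz => hy ?_) measure_empty)
          exact ⟨le_of_lt (show |inner ℝ n y - c| < r from hz.2.2.1), hR hz.1⟩
    _ = volume (Metric.ball (0 : Vec d) 1) * ENNReal.ofReal (r ^ d) *
          volume ({x : Vec d | |inner ℝ n x - c| ≤ r} ∩ Metric.ball 0 R) := by
        rw [lintegral_indicator, setLIntegral_const]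
        exact (isClosed_le (f := fun x : Vec d => |inner ℝ n x - c|)
          (by fun_prop) continuous_const).measurableSet.inter measurableSet_ball
    _ ≤ volume (Metric.ball (0 : Vec d) 1) * ENNReal.ofReal (r ^ d) * ENNReal.ofReal (C * r) := by
        gcongr; exact h c r hr.le
    _ = _ := by
        conv_lhs => rw [← ENNReal.ofReal_toReal (measure_ball_lt_top (μ := (volume : Measure (Vec d))) (x := 0) (r := 1)).ne]
        rw [← ENNReal.ofReal_mul ENNReal.toReal_nonneg, ← ENNReal.ofReal_mul (by positivity)]
        congr 1; ring

theorem OscDecay.of_lipschitz {U : Set (Vec d)} (hU : MeasurableSet U)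
    (hb : Bornology.IsBounded U) {n : Vec d} (hn : ‖n‖ = 1) (c : ℝ) {g : Vec d → G} {L : NNReal}
    (hg : LipschitzOnWith L g U) : OscDecay U n c g := by
  obtain ⟨C, hC, h⟩ := volume_oscSet_le hU hb hn
  refine ⟨L * C, 1, by positivity, one_pos, fun r hr => ?_⟩
  calc _ ≤ ∫⁻ p in oscSet U n c r, ENNReal.ofReal (L * r) := by
        refine setLIntegral_mono' (measurableSet_oscSet hU n c r) fun p hp => ?_
        rw [← ofReal_norm]
        refine ENNReal.ofReal_le_ofReal ?_
        have := hg.norm_sub_le hp.1 hp.2.1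
        refine this.trans ?_
        gcongr
        rw [← dist_eq_norm, dist_comm]; exact hp.2.2.2.le
    _ = ENNReal.ofReal (L * r) * volume (oscSet U n c r) := setLIntegral_const _ _
    _ ≤ ENNReal.ofReal (L * r) * ENNReal.ofReal (C * r ^ (d + 1)) := by gcongr; exact h c r hr.1
    _ = _ := by
        have := hr.1
        rw [← ENNReal.ofReal_mul (by positivity)]
        congr 1
        have e : (d : ℝ) + 1 + 1 = ((d + 1 + 1 : ℕ) : ℝ) := by push_cast; ring
        rw [e, Real.rpow_natCast]; ring

/-- With `t = ‖g x - g y‖` and `ρ = ‖x - y‖ ^ (d + 2θ)`, Young's inequality bounds `t` by `λ t² / ρ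
+ ρ / λ`. The first term integrates to `λ` times the Slobodeckij integral, the second is bounded
through the volume of the set of pairs. The gain is `κ = θ - 1/2`, so order above one half is
exactly what is used. -/
theorem OscDecay.of_slobodeckij {U : Set (Vec d)} (hU : MeasurableSet U)
    (hb : Bornology.IsBounded U) {n : Vec d} (hn : ‖n‖ = 1) (c : ℝ) {g : Vec d → G}
    (hgm : StronglyMeasurable g) {θ : ℝ} (hθ : 1 / 2 < θ) (hfin : slobodeckijSq U θ g < ⊤) :
    OscDecay U n c g := by
  obtain ⟨C, hC, h⟩ := volume_oscSet_le hU hb hn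
  rw [slobodeckijSq, if_neg (by linarith)] at hfin
  set e : ℝ := (d : ℝ) + 2 * θ with he
  have he0 : 0 < e := by positivity
  set S : Vec d × Vec d → ℝ≥0∞ := fun p =>
    ENNReal.ofReal (‖g p.1 - g p.2‖ ^ 2 / ‖p.1 - p.2‖ ^ e) with hS
  have hSm : Measurable S := by
    have h1 : Measurable fun p : Vec d × Vec d => ‖g p.1 - g p.2‖ :=
      ((hgm.comp_measurable measurable_fst).sub
        (hgm.comp_measurable measurable_snd)).norm.measurable
    exact ENNReal.measurable_ofReal.comp ((h1.pow_const 2).div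
      ((measurable_fst.sub measurable_snd).norm.pow_const e))
  set I := ∫⁻ p in U ×ˢ U, S p with hI
  have hI' : I < ⊤ := by
    rw [hI, Measure.volume_eq_prod, ← Measure.prod_restrict,
      lintegral_prod _ hSm.aemeasurable]
    exact hfin
  refine ⟨I.toReal + C, θ - 1 / 2, by positivity, by linarith, fun r hr => ?_⟩
  have hr0 := hr.1
  -- The weight that balances the two terms: `r ^ (d + 2θ) / lam * r ^ (d + 1) = lam`.
  set lam : ℝ := r ^ ((d : ℝ) + θ + 1 / 2) with hlam
  have hlam0 : 0 < lam := by positivity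
  calc osc U n c g r ≤ ∫⁻ p in oscSet U n c r,
        (ENNReal.ofReal lam * S p + ENNReal.ofReal (r ^ e / lam)) := by
        refine setLIntegral_mono' (measurableSet_oscSet hU n c r) fun p hp => ?_
        rw [← ofReal_norm, hS, ← ENNReal.ofReal_mul hlam0.le,
          ← ENNReal.ofReal_add (by positivity) (by positivity)]
        refine ENNReal.ofReal_le_ofReal ?_
        rcases eq_or_ne p.1 p.2 with heq | hne
        · rw [heq, sub_self, norm_zero]; positivity
        have hρ : 0 < ‖p.1 - p.2‖ := norm_pos_iff.2 (sub_ne_zero.2 hne)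
        set ρ := ‖p.1 - p.2‖ ^ e with hρe
        have hρ0 : 0 < ρ := by positivity
        have hρr : ρ ≤ r ^ e := by
          have : ‖p.1 - p.2‖ ≤ r := by
            rw [← dist_eq_norm, dist_comm]; exact hp.2.2.2.le
          exact Real.rpow_le_rpow hρ.le this he0.le
        set t := ‖g p.1 - g p.2‖
        have h1 : t ≤ lam * (t ^ 2 / ρ) + ρ / lam := by
          have h2 : 0 < ρ * lam := by positivity
          have h3 : lam * (t ^ 2 / ρ) + ρ / lam - t
            = ((lam * t - ρ / 2) ^ 2 + 3 / 4 * ρ ^ 2) / (ρ * lam) := by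
            field_simp; ring
          have h4 : 0 ≤ ((lam * t - ρ / 2) ^ 2 + 3 / 4 * ρ ^ 2) / (ρ * lam) := by positivity
          linarith
        have h2 : ρ / lam ≤ r ^ e / lam := by gcongr
        linarith
    _ = ENNReal.ofReal lam * (∫⁻ p in oscSet U n c r, S p)
          + ENNReal.ofReal (r ^ e / lam) * volume (oscSet U n c r) := by
        rw [lintegral_add_right _ measurable_const, lintegral_const_mul _ hSm, setLIntegral_const]
    _ ≤ ENNReal.ofReal lam * I + ENNReal.ofReal (r ^ e / lam) * ENNReal.ofReal (C * r ^ (d + 1)) := by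
        gcongr
        · exact lintegral_mono_set fun p hp => ⟨hp.1, hp.2.1⟩
        · exact h c r hr0
    _ = _ := by
        rw [← ENNReal.ofReal_toReal hI'.ne, ← ENNReal.ofReal_mul hlam0.le,
          ← ENNReal.ofReal_mul (by positivity), ← ENNReal.ofReal_add (by positivity)
          (by positivity), ENNReal.toReal_ofReal ENNReal.toReal_nonneg]
        congr 1
        have e1 : (d : ℝ) + 1 + (θ - 1 / 2) = (d : ℝ) + θ + 1 / 2 := by ring
        have e2 : r ^ e / lam * (C * r ^ (d + 1)) = C * lam := by
          rw [hlam, ← Real.rpow_sub hr0]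
          have : r ^ (d + 1) = r ^ ((d : ℝ) + 1) := by
            rw [← Real.rpow_natCast]; push_cast; rfl
          rw [this, mul_left_comm, ← Real.rpow_add hr0]
          congr 2; rw [he]; ring
        rw [e1, e2]; ring

end Oscillation

/-! ### The translation formula and oscillation of `H¹` functions on convex sets -/

section Translation
variable {d : ℕ} {G : Type*} [NormedAddCommGroup G] [NormedSpace ℝ G]

theorem fderiv_apply_eq_sum (φ : Vec d → ℝ) (x h : Vec d) :
    fderiv ℝ φ x h = ∑ j, h j * fderiv ℝ φ x (unitVec j) := by
  have : h = ∑ j, h j • unitVec j := by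
    have := (EuclideanSpace.basisFun (Fin d) ℝ).sum_repr h
    simpa [unitVec] using this.symm
  conv_lhs => rw [this]
  simp [map_sum]

theorem integral_fderiv_apply_smul {U : Set (Vec d)} {w : Vec d → G} {g : Fin d → Vec d → G}
    (hw : MemLp w 2 (volume.restrict U))
    (hg : ∀ j, HasWeakPartial U j w (g j)) (h : Vec d) {φ : Vec d → ℝ} (hφ : IsTest U φ) :
    ∫ x in U, fderiv ℝ φ x h • w x = - ∫ x in U, φ x • ∑ j, h j • g j x := by
  have e1 : ∀ x, fderiv ℝ φ x h • w x = ∑ j, h j • (fderiv ℝ φ x (unitVec j) • w x) := by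
    intro x
    rw [fderiv_apply_eq_sum, Finset.sum_smul]
    simp [mul_smul]
  have e2 : ∀ x, φ x • ∑ j, h j • g j x = ∑ j, h j • (φ x • g j x) := by
    intro x
    rw [Finset.smul_sum]
    exact Finset.sum_congr rfl fun j _ => smul_comm _ _ _
  simp_rw [e1, e2]
  rw [integral_finsetSum, integral_finsetSum, ← Finset.sum_neg_distrib]
  · refine Finset.sum_congr rfl fun j _ => ?_
    rw [integral_smul, integral_smul, (hg j).2 φ hφ, smul_neg]
  · exact fun j _ => (integrable_smul_of_memLp_two (hφ.memLp 2 _) (hg j).1).smul (h j)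
  · exact fun j _ => (integrable_smul_of_memLp_two (hφ.memLp_fderiv_apply _ 2 _) hw).smul (h j)

theorem measurePreserving_shear (h : Vec d) (μ : Measure ℝ) [SFinite μ] :
    MeasurePreserving (fun p : ℝ × Vec d => (p.1, p.2 + p.1 • h)) (μ.prod volume)
      (μ.prod volume) := by
  refine (MeasurePreserving.id μ).skew_product (g := fun t y => y + t • h) (by fun_prop) ?_
  exact Eventually.of_forall fun t => (measurePreserving_add_right volume (t • h)).map_eq

theorem integrable_shear (h : Vec d) {D : Vec d → G} (hD : Integrable D) :
    Integrable (fun p : ℝ × Vec d => D (p.2 + p.1 • h))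
      ((volume.restrict (Ioc (0 : ℝ) 1)).prod volume) := by
  have h1 : Integrable (fun p : ℝ × Vec d => D p.2)
      ((volume.restrict (Ioc (0 : ℝ) 1)).prod volume) := hD.comp_snd _
  exact (measurePreserving_shear h _).integrable_comp_of_integrable h1

theorem IsTest.comp_sub {U V : Set (Vec d)} {φ : Vec d → ℝ} (hφ : IsTest V φ) (a : Vec d)
    (hVU : ∀ y ∈ V, y + a ∈ U) : IsTest U fun y => φ (y - a) := by
  have e : (fun y => φ (y - a)) = φ ∘ (Homeomorph.subRight a) := rfl
  refine ⟨hφ.1.comp (contDiff_id.sub contDiff_const), ?_, ?_⟩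
  · rw [e]; exact hφ.2.1.comp_homeomorph _
  · rw [e, tsupport_comp_eq_preimage]
    intro y hy
    have := hVU _ (hφ.2.2 hy)
    simpa using this

/-- A weak form of the fundamental theorem of calculus along `h`. Against a test function `φ`
supported where both `y` and `y + h` lie in `U`, Fubini and a change of variables move the
translation to `φ (· - t • h)`; the weak derivative falls on this function, and the classical
fundamental theorem in `t` finishes. -/
theorem add_sub_ae_eq_integral [CompleteSpace G] {U : Set (Vec d)} (hU : IsOpen U)
    (hconv : Convex ℝ U) {w : Vec d → G} {g : Fin d → Vec d → G} (hb : Bornology.IsBounded U)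
    (hw2 : MemLp w 2 volume) (hw : Integrable w) (hg : ∀ j, HasWeakPartial U j w (g j))
    (hgi : ∀ j, Integrable (g j)) (hg0 : ∀ j x, x ∉ U → g j x = 0) (h : Vec d) :
    ∀ᵐ y, y ∈ U → y + h ∈ U →
      w (y + h) - w y = ∫ t in Ioc (0 : ℝ) 1, ∑ j, h j • g j (y + t • h) := by
  set V : Set (Vec d) := {y | y ∈ U ∧ y + h ∈ U} with hV
  have hVo : IsOpen V := hU.inter (hU.preimage (continuous_id.add continuous_const))
  set D : Vec d → G := fun y => ∑ j, h j • g j y with hD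
  have hDi : Integrable D := integrable_finsetSum _ fun j _ => (hgi j).smul (h j)
  have hsh := integrable_shear h hDi
  have hf2 : Integrable fun y => ∫ t in Ioc (0 : ℝ) 1, D (y + t • h) :=
    hsh.integral_prod_right
  have hwh : Integrable fun y => w (y + h) := hw.comp_add_right h
  suffices hmain : (fun y => w (y + h) - w y) =ᵐ[volume.restrict V]
      fun y => ∫ t in Ioc (0 : ℝ) 1, D (y + t • h) by
    rw [Filter.EventuallyEq, ae_restrict_iff' hVo.measurableSet] at hmain
    filter_upwards [hmain] with y hy h1 h2 using hy ⟨h1, h2⟩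
  refine ae_eq_of_forall_isTest hVo ((hwh.sub hw).locallyIntegrable.locallyIntegrableOn V)
    (hf2.locallyIntegrable.locallyIntegrableOn V) fun φ hφ => ?_
  have hφ0 : ∀ x, x ∉ V → φ x = 0 := fun x hx =>
    image_eq_zero_of_notMem_tsupport fun h => hx (hφ.2.2 h)
  rw [setIntegral_eq_integral_of_forall_compl_eq_zero fun x hx => by simp [hφ0 x hx],
    setIntegral_eq_integral_of_forall_compl_eq_zero fun x hx => by simp [hφ0 x hx]]
  obtain ⟨Cφ, hCφ⟩ := hφ.continuous.bounded_above_of_compact_support hφ.2.1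
  have hφh : Continuous fun x => fderiv ℝ φ x h := hφ.continuous_fderiv_apply h
  obtain ⟨Cφ', hCφ'⟩ := hφh.bounded_above_of_compact_support (hφ.hasCompactSupport_fderiv_apply h)
  -- the right-hand side
  have hR : ∫ y, φ y • ∫ t in Ioc (0 : ℝ) 1, D (y + t • h)
      = ∫ t in Ioc (0 : ℝ) 1, ∫ y, φ y • D (y + t • h) := by
    have h1 : Integrable (fun p : ℝ × Vec d => φ p.2 • D (p.2 + p.1 • h))
        ((volume.restrict (Ioc (0 : ℝ) 1)).prod volume) :=
      hsh.bdd_smul Cφ (hφ.continuous.comp continuous_snd).aestronglyMeasurable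
        (Eventually.of_forall fun p => hCφ p.2)
    rw [integral_integral_swap h1]
    refine integral_congr_ae (Eventually.of_forall fun y => ?_)
    exact (integral_smul _ _).symm
  have hS : ∀ t ∈ Ioc (0 : ℝ) 1, ∫ y, φ y • D (y + t • h)
      = - ∫ y, fderiv ℝ φ (y - t • h) h • w y := by
    intro t ht
    -- The place where convexity enters: with `y` and `y + h`, also `y + t • h` lies in `U`.
    have hT : IsTest U fun y => φ (y - t • h) := by
      refine hφ.comp_sub _ fun y hy => ?_
      have := hconv hy.1 hy.2 (sub_nonneg.2 ht.2) ht.1.le (by ring)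
      convert this using 1
      rw [smul_add, ← add_assoc, ← add_smul]; simp
    have h1 := integral_fderiv_apply_smul (hw2.restrict U) hg h hT
    have hd : ∀ y, fderiv ℝ (fun y => φ (y - t • h)) y = fderiv ℝ φ (y - t • h) := fun y =>
      fderiv_comp_sub _
    simp_rw [hd] at h1
    have hT0 : ∀ x, x ∉ U → φ (x - t • h) = 0 := fun x hx =>
      image_eq_zero_of_notMem_tsupport (f := fun y => φ (y - t • h)) fun h => hx (hT.2.2 h)
    have hT1 : ∀ x, x ∉ U → fderiv ℝ φ (x - t • h) = 0 := fun x hx => by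
      rw [← hd]
      exact image_eq_zero_of_notMem_tsupport fun h => hx (hT.2.2 (tsupport_fderiv_subset ℝ h))
    rw [setIntegral_eq_integral_of_forall_compl_eq_zero fun x hx => by simp [hT1 x hx],
      setIntegral_eq_integral_of_forall_compl_eq_zero fun x hx => by simp [hT0 x hx]] at h1
    rw [h1, neg_neg, ← integral_add_right_eq_self (fun y => φ (y - t • h) • ∑ j, h j • g j y) (t • h)]
    simp [hD]
  rw [hR, setIntegral_congr_fun measurableSet_Ioc hS, integral_neg]
  have hQ : ∫ t in Ioc (0 : ℝ) 1, ∫ y, fderiv ℝ φ (y - t • h) h • w y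
      = ∫ y, (φ y - φ (y - h)) • w y := by
    have h1 : Integrable (fun p : ℝ × Vec d => fderiv ℝ φ (p.2 - p.1 • h) h • w p.2)
        ((volume.restrict (Ioc (0 : ℝ) 1)).prod volume) := by
      refine Integrable.bdd_smul (f := fun p : ℝ × Vec d => w p.2) (hw.comp_snd _) Cφ' ?_ ?_
      · exact (hφh.comp (by fun_prop : Continuous fun p : ℝ × Vec d => p.2 - p.1 • h)).aestronglyMeasurable
      · exact Eventually.of_forall fun p => hCφ' _
    rw [integral_integral_swap h1]
    refine integral_congr_ae (Eventually.of_forall fun y => ?_)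
    simp only
    rw [integral_smul_const]
    congr 1
    rw [← intervalIntegral.integral_of_le zero_le_one]
    have h2 := intervalIntegral.integral_eq_sub_of_hasDerivAt (a := (0 : ℝ)) (b := 1)
      (f := fun t => - φ (y - t • h)) (f' := fun t => fderiv ℝ φ (y - t • h) h) ?_ ?_
    · rw [h2]; simp; ring
    · intro t _
      have h3 : HasDerivAt (fun t : ℝ => y - t • h) (-h) t := by
        simpa using ((hasDerivAt_id t).smul_const h).const_sub y
      have h4 : HasFDerivAt φ (fderiv ℝ φ (y - t • h)) (y - t • h) :=
        ((hφ.1.differentiable (by simp)) _).hasFDerivAt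
      have h5 := (h4.comp_hasDerivAt t h3).neg
      rw [map_neg, neg_neg] at h5
      exact h5
    · exact (hφh.comp (by fun_prop : Continuous fun t : ℝ => y - t • h)).intervalIntegrable _ _
  rw [hQ]
  simp only [sub_smul, smul_sub]
  have b1 : Integrable fun y => φ y • w y :=
    hw.bdd_smul Cφ hφ.continuous.aestronglyMeasurable (Eventually.of_forall hCφ)
  have b2 : Integrable fun y => φ (y - h) • w y :=
    hw.bdd_smul Cφ (hφ.continuous.comp (by fun_prop)).aestronglyMeasurable
      (Eventually.of_forall fun _ => hCφ _)
  have b3 : Integrable fun y => φ y • w (y + h) :=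
    hwh.bdd_smul Cφ hφ.continuous.aestronglyMeasurable (Eventually.of_forall hCφ)
  rw [integral_sub b3 b1, integral_sub b1 b2, neg_sub]
  congr 1
  rw [← integral_add_right_eq_self (fun y => φ (y - h) • w y) h]
  simp

theorem norm_coord_le (h : Vec d) (j : Fin d) : |h j| ≤ ‖h‖ := by
  have := EuclideanSpace.norm_sq_eq h
  have h2 : ‖h j‖ ^ 2 ≤ ‖h‖ ^ 2 := by
    rw [this]
    exact Finset.single_le_sum (f := fun i => ‖h i‖ ^ 2) (fun _ _ => by positivity)
      (Finset.mem_univ j)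
  have := abs_le_of_sq_le_sq h2 (norm_nonneg _)
  rwa [abs_of_nonneg (norm_nonneg _), Real.norm_eq_abs] at this

/-- The pairs are parametrised as `(y, y + h)` with `‖h‖ < r`. The translation formula bounds the
difference by `r` times the gradient on the segment, all of whose points lie in the strip of doubled
width; integrating over `y` first removes the dependence on `h` and `t`. -/
theorem osc_le_of_translation [CompleteSpace G] {U : Set (Vec d)} (hU : IsOpen U)
    {n : Vec d} (hn : ‖n‖ = 1) (c : ℝ)
    {w : Vec d → G} {g : Fin d → Vec d → G} (hwm : StronglyMeasurable w)
    (hgm : ∀ j, StronglyMeasurable (g j)) (hg0 : ∀ j x, x ∉ U → g j x = 0)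
    (htr : ∀ h : Vec d, ∀ᵐ y, y ∈ U → y + h ∈ U →
      w (y + h) - w y = ∫ t in Ioc (0 : ℝ) 1, ∑ j, h j • g j (y + t • h)) {r : ℝ} (hr : 0 < r) :
    osc U n c w r ≤ volume (Metric.ball (0 : Vec d) r) * (ENNReal.ofReal r *
      ∑ j, ∫⁻ y in U ∩ {y | |inner ℝ n y - c| < 2 * r}, ‖g j y‖ₑ) := by
  set S : ℝ → Set (Vec d) := fun r => {y | |inner ℝ n y - c| < r} with hSdef
  have hSm : ∀ r, MeasurableSet (S r) := fun r =>
    (isOpen_lt (f := fun p : Vec d => |inner ℝ n p - c|) (by fun_prop) continuous_const).measurableSet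
  set f : Vec d × Vec d → ℝ≥0∞ := (oscSet U n c r).indicator fun p => ‖w p.1 - w p.2‖ₑ with hf
  have hfm : Measurable f := by
    refine Measurable.indicator ?_ (measurableSet_oscSet hU.measurableSet n c r)
    exact ((hwm.comp_measurable measurable_fst).sub (hwm.comp_measurable measurable_snd)).enorm
  have e1 : osc U n c w r = ∫⁻ h, ∫⁻ y, f (y, y + h) := by
    rw [osc, ← lintegral_indicator (measurableSet_oscSet hU.measurableSet n c r),
      Measure.volume_eq_prod, lintegral_prod _ hfm.aemeasurable]
    rw [lintegral_lintegral_swap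
      (f := fun h y => f (y, y + h)) (hfm.comp (by fun_prop)).aemeasurable]
    refine lintegral_congr fun y => ?_
    exact (lintegral_add_left_eq_self (fun z => f (y, z)) y).symm
  rw [e1]
  have key : ∀ h : Vec d, ∫⁻ y, f (y, y + h) ≤ (Metric.ball (0 : Vec d) r).indicator
      (fun _ => ENNReal.ofReal r * ∑ j, ∫⁻ y in U ∩ S (2 * r), ‖g j y‖ₑ) h := by
    intro h
    by_cases hh : h ∈ Metric.ball (0 : Vec d) r
    swap
    · rw [indicator_of_notMem hh]
      refine le_of_eq ?_
      refine (lintegral_congr fun y => ?_).trans lintegral_zero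
      refine indicator_of_notMem (fun hy => hh ?_) _
      have := hy.2.2.2
      simpa [dist_eq_norm] using this
    rw [indicator_of_mem hh]
    rw [mem_ball_zero_iff] at hh
    set D : Vec d → G := fun y => ∑ j, h j • g j y with hD
    have hDm : StronglyMeasurable D := by
      rw [hD]
      exact Finset.stronglyMeasurable_fun_sum _ fun j _ => (hgm j).const_smul (h j)
    calc ∫⁻ y, f (y, y + h) ≤ ∫⁻ y, ∫⁻ t in Ioc (0 : ℝ) 1, (S r).indicator 1 y * ‖D (y + t • h)‖ₑ := by
          refine lintegral_mono_ae ?_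
          filter_upwards [htr h] with y hy
          by_cases hyA : (y, y + h) ∈ oscSet U n c r
          · rw [hf, indicator_of_mem hyA]
            have hyS : y ∈ S r := hyA.2.2.1
            rw [indicator_of_mem hyS]
            simp only [Pi.one_apply, one_mul]
            rw [← enorm_neg, neg_sub, hy hyA.1 hyA.2.1]
            exact enorm_integral_le_lintegral_enorm _
          · rw [hf, indicator_of_notMem hyA]; exact zero_le
      _ = ∫⁻ t in Ioc (0 : ℝ) 1, ∫⁻ y, (S r).indicator 1 y * ‖D (y + t • h)‖ₑ := by
          refine lintegral_lintegral_swap (Measurable.aemeasurable ?_)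
          refine Measurable.mul ?_ ?_
          · exact (measurable_one.indicator (hSm r)).comp measurable_fst
          · exact (hDm.comp_measurable (by fun_prop)).enorm
      _ ≤ ∫⁻ t in Ioc (0 : ℝ) 1, ENNReal.ofReal r * ∑ j, ∫⁻ y in U ∩ S (2 * r), ‖g j y‖ₑ := by
          refine setLIntegral_mono' measurableSet_Ioc fun t ht => ?_
          rw [← lintegral_finsetSum' _ fun j _ => (hgm j).enorm.aemeasurable,
            ← lintegral_const_mul' _ _ ENNReal.ofReal_ne_top,
            ← lintegral_indicator (hU.measurableSet.inter (hSm _)),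
            ← lintegral_add_right_eq_self ((U ∩ S (2 * r)).indicator _) (t • h)]
          refine lintegral_mono fun y => ?_
          by_cases hyS : y ∈ S r
          swap
          · rw [indicator_of_notMem hyS, zero_mul]; exact zero_le
          rw [indicator_of_mem hyS, Pi.one_apply, one_mul]
          by_cases hyU : y + t • h ∈ U
          swap
          · have : D (y + t • h) = 0 := by
              simp only [hD]
              exact Finset.sum_eq_zero fun j _ => by rw [hg0 j _ hyU, smul_zero]
            rw [this, enorm_zero]; exact zero_le
          have hy2 : y + t • h ∈ S (2 * r) := by
            simp only [hSdef, mem_ofPred_eq, inner_add_right, inner_smul_right] at hyS ⊢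
            have h1 : |t * inner ℝ n h| < r := by
              rw [abs_mul, abs_of_pos ht.1]
              have := abs_real_inner_le_norm n h
              rw [hn, one_mul] at this
              calc t * |inner ℝ n h| ≤ 1 * ‖h‖ := by gcongr; exact ht.2
                _ < r := by rwa [one_mul]
            calc |inner ℝ n y + t * inner ℝ n h - c| = |(inner ℝ n y - c) + t * inner ℝ n h| := by
                  congr 1; ring
              _ ≤ _ := abs_add_le _ _
              _ < 2 * r := by linarith
          rw [indicator_of_mem (show y + t • h ∈ U ∩ S (2 * r) from ⟨hyU, hy2⟩), Finset.mul_sum]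
          refine (enorm_sum_le _ _).trans (Finset.sum_le_sum fun j _ => ?_)
          rw [enorm_smul]
          gcongr
          rw [← ofReal_norm]
          exact ENNReal.ofReal_le_ofReal ((norm_coord_le h j).trans hh.le)
      _ = _ := by rw [setLIntegral_const]; simp
  calc _ ≤ ∫⁻ h, (Metric.ball (0 : Vec d) r).indicator
          (fun _ => ENNReal.ofReal r * ∑ j, ∫⁻ y in U ∩ S (2 * r), ‖g j y‖ₑ) h := lintegral_mono key
    _ = _ := by rw [lintegral_indicator measurableSet_ball, setLIntegral_const, mul_comm]

/-- Functions in `H¹(U)`, `U` convex, have traces. -/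
theorem OscDecay.of_hasWeakPartial [CompleteSpace G] {U : Set (Vec d)} (hU : IsOpen U)
    (hconv : Convex ℝ U) (hb : Bornology.IsBounded U) {n : Vec d} (hn : ‖n‖ = 1) (c : ℝ)
    {w : Vec d → G} {g : Fin d → Vec d → G}
    (hw : MemLp w 2 (volume.restrict U)) (hg : ∀ j, HasWeakPartial U j w (g j)) :
    OscDecay U n c w := by
  have hfin : IsFiniteMeasure (volume.restrict U : Measure (Vec d)) :=
    isFiniteMeasure_restrict.2 hb.measure_lt_top.ne
  set w' : Vec d → G := U.indicator (hw.1.mk w) with hw'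
  have hww' : w =ᵐ[volume.restrict U] w' :=
    hw.1.ae_eq_mk.trans (indicator_ae_eq_restrict hU.measurableSet).symm
  set g' : Fin d → Vec d → G := fun j => U.indicator ((hg j).1.1.mk (g j)) with hg'
  have hgg' : ∀ j, g j =ᵐ[volume.restrict U] g' j := fun j =>
    (hg j).1.1.ae_eq_mk.trans (indicator_ae_eq_restrict hU.measurableSet).symm
  have hwm : StronglyMeasurable w' := hw.1.stronglyMeasurable_mk.indicator hU.measurableSet
  have hgm : ∀ j, StronglyMeasurable (g' j) := fun j =>
    (hg j).1.1.stronglyMeasurable_mk.indicator hU.measurableSet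
  have hw2 : MemLp w' 2 volume := by
    rw [hw', memLp_indicator_iff_restrict hU.measurableSet]
    exact (memLp_congr_ae hw.1.ae_eq_mk).1 hw
  have hg2 : ∀ j, MemLp (g' j) 2 volume := fun j => by
    simp only [hg']
    rw [memLp_indicator_iff_restrict hU.measurableSet]
    exact (memLp_congr_ae (hg j).1.1.ae_eq_mk).1 (hg j).1
  have hwi : Integrable w' := by
    rw [hw', integrable_indicator_iff hU.measurableSet]
    exact (((memLp_congr_ae hw.1.ae_eq_mk).1 hw).mono_exponent (by norm_num)).integrable le_rfl
  have hgi : ∀ j, Integrable (g' j) := fun j => by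
    simp only [hg']
    rw [integrable_indicator_iff hU.measurableSet]
    exact (((memLp_congr_ae (hg j).1.1.ae_eq_mk).1 (hg j).1).mono_exponent
      (by norm_num)).integrable le_rfl
  have hg0 : ∀ j x, x ∉ U → g' j x = 0 := fun j x hx => indicator_of_notMem hx _
  have hgw : ∀ j, HasWeakPartial U j w' (g' j) := fun j => (hg j).congr hww' (hgg' j)
  refine OscDecay.congr hU.measurableSet hww'.symm ?_
  have htr := add_sub_ae_eq_integral hU hconv hb hw2 hwi hgw hgi hg0
  obtain ⟨R, hR⟩ := hb.subset_ball 0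
  obtain ⟨C, hC, hvol⟩ := volume_strip_inter_ball_le hn R
  set N : Fin d → ℝ≥0∞ := fun j => ∫⁻ y, ‖g' j y‖ₑ ^ 2 with hN
  have hNfin : ∀ j, N j ≠ ⊤ := fun j => by
    have := (hg2 j).eLpNorm_lt_top
    rw [eLpNorm_lt_top_iff_lintegral_rpow_enorm_lt_top (by norm_num) (by norm_num)] at this
    simpa [hN] using this.ne
  set v1 := (volume (Metric.ball (0 : Vec d) 1)).toReal with hv1
  refine ⟨v1 * ∑ j, ((N j).toReal + C * 2), 1 / 2, by positivity, by norm_num, fun r hr => ?_⟩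
  have hr0 := hr.1
  refine (osc_le_of_translation hU hn c hwm hgm hg0 htr hr0).trans ?_
  have hSm : MeasurableSet (U ∩ {y : Vec d | |inner ℝ n y - c| < 2 * r}) :=
    hU.measurableSet.inter (isOpen_lt (f := fun p : Vec d => |inner ℝ n p - c|)
      (by fun_prop) continuous_const).measurableSet
  -- Young's inequality with weight `s = r ^ (1/2)`, that is `a ≤ s a² + 1 / s`, on a strip of
  -- volume `O(r)`, gives `O(r ^ (1/2))`. Together with the factors `r ^ d` and `r` this is the
  -- decay with `κ = 1/2`.
  have hj : ∀ j, ∫⁻ y in U ∩ {y | |inner ℝ n y - c| < 2 * r}, ‖g' j y‖ₑ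
      ≤ ENNReal.ofReal (((N j).toReal + C * 2) * r ^ (1 / 2 : ℝ)) := by
    intro j
    set s : ℝ := r ^ (1 / 2 : ℝ) with hs
    have hs0 : 0 < s := by positivity
    have hss : s * s = r := by rw [hs, ← Real.rpow_add hr0]; norm_num
    calc _ ≤ ∫⁻ y in U ∩ {y | |inner ℝ n y - c| < 2 * r},
          (ENNReal.ofReal s * ‖g' j y‖ₑ ^ 2 + ENNReal.ofReal s⁻¹) := by
          refine lintegral_mono fun y => ?_
          rw [← ofReal_norm, ← ENNReal.ofReal_pow (norm_nonneg _), ← ENNReal.ofReal_mul hs0.le,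
            ← ENNReal.ofReal_add (by positivity) (by positivity)]
          refine ENNReal.ofReal_le_ofReal ?_
          set a := ‖g' j y‖
          have : s * a ^ 2 + s⁻¹ - a = ((s * a - 1 / 2) ^ 2 + 3 / 4) / s := by field_simp; ring
          have h2 : 0 ≤ ((s * a - 1 / 2) ^ 2 + 3 / 4) / s := by positivity
          linarith
      _ = ENNReal.ofReal s * (∫⁻ y in U ∩ {y | |inner ℝ n y - c| < 2 * r}, ‖g' j y‖ₑ ^ 2)
          + ENNReal.ofReal s⁻¹ * volume (U ∩ {y | |inner ℝ n y - c| < 2 * r}) := by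
          rw [lintegral_add_right _ measurable_const,
            lintegral_const_mul' _ _ ENNReal.ofReal_ne_top, setLIntegral_const]
      _ ≤ ENNReal.ofReal s * N j + ENNReal.ofReal s⁻¹ * ENNReal.ofReal (C * (2 * r)) := by
          gcongr
          · exact setLIntegral_le_lintegral _ _
          · refine (measure_mono ?_).trans (hvol c (2 * r) (by positivity))
            exact fun y hy => ⟨le_of_lt (show |inner ℝ n y - c| < 2 * r from hy.2), hR hy.1⟩
      _ = _ := by
          rw [← ENNReal.ofReal_toReal (hNfin j), ← ENNReal.ofReal_mul hs0.le,
            ← ENNReal.ofReal_mul (by positivity), ← ENNReal.ofReal_add (by positivity)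
            (by positivity), ENNReal.toReal_ofReal ENNReal.toReal_nonneg]
          congr 1
          have : s⁻¹ * (C * (2 * r)) = C * 2 * s := by rw [← hss]; field_simp
          rw [this]; ring
  calc _ ≤ volume (Metric.ball (0 : Vec d) r) * (ENNReal.ofReal r *
      ∑ j, ENNReal.ofReal (((N j).toReal + C * 2) * r ^ (1 / 2 : ℝ))) := by
        gcongr with j; exact hj j
    _ = _ := by
        rw [Measure.addHaar_ball_of_pos _ _ hr0,
          ← ENNReal.ofReal_toReal (measure_ball_lt_top (μ := (volume : Measure (Vec d))) (x := 0) (r := 1)).ne,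
          ← ENNReal.ofReal_sum_of_nonneg fun j _ => by positivity,
          ← ENNReal.ofReal_mul hr0.le, ← ENNReal.ofReal_mul (by positivity),
          ← ENNReal.ofReal_mul (by positivity), ← Finset.sum_mul, finrank_euclideanSpace_fin]
        congr 1
        rw [Real.rpow_add hr0, Real.rpow_add hr0, Real.rpow_natCast, Real.rpow_one]
        ring

end Translation

/-! ### Comparison of averages with the oscillation -/

section Averages
variable {α G : Type*} [MeasurableSpace α] {μ : Measure α}
  [NormedAddCommGroup G] [NormedSpace ℝ G] [CompleteSpace G]

theorem enorm_sub_setAverage_le {B : Set α} (hB0 : μ B ≠ 0) (hB : μ B ≠ ⊤)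
    {g : α → G} (hg : IntegrableOn g B μ) (a : G) :
    ‖a - ⨍ z in B, g z ∂μ‖ₑ ≤ (μ B)⁻¹ * ∫⁻ z in B, ‖a - g z‖ₑ ∂μ := by
  have h1 : a - ⨍ z in B, g z ∂μ = (μ.real B)⁻¹ • ∫ z in B, (a - g z) ∂μ := by
    have hi : IntegrableOn (fun _ : α => a) B μ := integrableOn_const hB enorm_ne_top
    rw [integral_sub hi hg, setIntegral_const, smul_sub, smul_smul,
      inv_mul_cancel₀, one_smul, setAverage_eq]
    exact (ENNReal.toReal_pos hB0 hB).ne'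
  rw [h1, enorm_smul]
  have h2 : ‖(μ.real B)⁻¹‖ₑ = (μ B)⁻¹ := by
    rw [Real.enorm_eq_ofReal (by positivity), Measure.real, ENNReal.ofReal_inv_of_pos
      (ENNReal.toReal_pos hB0 hB), ENNReal.ofReal_toReal hB]
  rw [h2]
  gcongr
  exact enorm_integral_le_lintegral_enorm _

theorem enorm_setAverage_sub_setAverage_le {A B : Set α} (hA0 : μ A ≠ 0) (hA : μ A ≠ ⊤)
    (hB0 : μ B ≠ 0) (hB : μ B ≠ ⊤) {g : α → G} (hgA : IntegrableOn g A μ)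
    (hgB : IntegrableOn g B μ) :
    ‖(⨍ y in A, g y ∂μ) - ⨍ z in B, g z ∂μ‖ₑ
      ≤ (μ A)⁻¹ * ((μ B)⁻¹ * ∫⁻ y in A, ∫⁻ z in B, ‖g y - g z‖ₑ ∂μ ∂μ) := by
  rw [← enorm_neg, neg_sub]
  refine (enorm_sub_setAverage_le hA0 hA hgA _).trans ?_
  rw [← lintegral_const_mul' _ _ (ENNReal.inv_ne_top.2 hB0)]
  gcongr with y
  rw [← enorm_neg, neg_sub]
  exact enorm_sub_setAverage_le hB0 hB hgB _

end Averages

/-! ### Traces on a facet as limits of averages -/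

section Trace
variable {d : ℕ} {G : Type*} [NormedAddCommGroup G] [NormedSpace ℝ G] [CompleteSpace G]

/-- The average of `g` over `B_r(x) ∩ U`. -/
def ave (U : Set (Vec d)) (g : Vec d → G) (x : Vec d) (r : ℝ) : G :=
  ⨍ y in Metric.ball x r ∩ U, g y

/-- The `L¹` oscillation of `g` on `B_r(x) ∩ U`. -/
def locOsc (U : Set (Vec d)) (g : Vec d → G) (r : ℝ) (x : Vec d) : ℝ≥0∞ :=
  ∫⁻ y in Metric.ball x r ∩ U, ∫⁻ z in Metric.ball x r ∩ U, ‖g y - g z‖ₑ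

/-- `x` is not a cusp of `V`. -/
def DensityBound (V : Set (Vec d)) (x : Vec d) (a : ℝ) : Prop :=
  0 < a ∧ ∀ r ∈ Ioc (0 : ℝ) 1, ENNReal.ofReal (a * r ^ d) ≤ volume (Metric.ball x r ∩ V)

theorem DensityBound.volume_ne_zero {V : Set (Vec d)} {x : Vec d} {a : ℝ}
    (h : DensityBound V x a) {r : ℝ} (hr : r ∈ Ioc (0 : ℝ) 1) :
    volume (Metric.ball x r ∩ V) ≠ 0 := by
  have h1 := h.1
  have h2 := hr.1
  refine fun h0 => absurd (h.2 r hr) ?_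
  rw [h0, not_le, ENNReal.ofReal_pos]; positivity

theorem DensityBound.inv_le {V : Set (Vec d)} {x : Vec d} {a : ℝ}
    (h : DensityBound V x a) {r : ℝ} (hr : r ∈ Ioc (0 : ℝ) 1) :
    (volume (Metric.ball x r ∩ V))⁻¹ ≤ ENNReal.ofReal (a * r ^ d)⁻¹ := by
  have h1 := h.1
  have h2 := hr.1
  rw [ENNReal.ofReal_inv_of_pos (by positivity)]
  exact ENNReal.inv_le_inv.2 (h.2 r hr)

theorem volume_ball_inter_ne_top (V : Set (Vec d)) (x : Vec d) (r : ℝ) :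
    volume (Metric.ball x r ∩ V) ≠ ⊤ :=
  ((measure_mono inter_subset_left).trans_lt measure_ball_lt_top).ne

/-- The two averages may be taken over different subsets `V` and `W` of `U` at different radii. This
freedom later shows that the two elements at a facet and the exterior of the domain all see the same
trace of an `H¹` function. -/
theorem enorm_ave_sub_ave_le {U V W : Set (Vec d)} (hV : V ⊆ U) (hW : W ⊆ U) {g : Vec d → G}
    (hg : IntegrableOn g U) {x : Vec d} {a b : ℝ} (hVx : DensityBound V x a)
    (hWx : DensityBound W x b) {s r : ℝ} (hs : s ∈ Ioc (0 : ℝ) 1) (hr : r ∈ Ioc (0 : ℝ) 1)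
    (hsr : s ≤ r) :
    ‖ave V g x s - ave W g x r‖ₑ
      ≤ ENNReal.ofReal (a * s ^ d)⁻¹ * (ENNReal.ofReal (b * r ^ d)⁻¹ * locOsc U g r x) := by
  have hsub : Metric.ball x s ∩ V ⊆ Metric.ball x r ∩ U :=
    inter_subset_inter (Metric.ball_subset_ball hsr) hV
  have hsub' : Metric.ball x r ∩ W ⊆ Metric.ball x r ∩ U := inter_subset_inter_right _ hW
  refine (enorm_setAverage_sub_setAverage_le (hVx.volume_ne_zero hs)
    (volume_ball_inter_ne_top _ _ _) (hWx.volume_ne_zero hr) (volume_ball_inter_ne_top _ _ _)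
    (hg.mono_set (inter_subset_right.trans hV)) (hg.mono_set (inter_subset_right.trans hW))).trans ?_
  refine mul_le_mul' (hVx.inv_le hs) (mul_le_mul' (hWx.inv_le hr) ?_)
  refine (lintegral_mono_set hsub).trans ?_
  exact lintegral_mono fun y => lintegral_mono_set hsub'

/-- The radii along which traces are computed. -/
def radius (k : ℕ) : ℝ := (1 / 2) ^ (k + 1)

theorem radius_pos (k : ℕ) : 0 < radius k := by unfold radius; positivity

theorem radius_le_half (k : ℕ) : radius k ≤ 1 / 2 := by
  unfold radius
  calc (1 / 2 : ℝ) ^ (k + 1) ≤ (1 / 2) ^ 1 :=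
        pow_le_pow_of_le_one (by norm_num) (by norm_num) (by omega)
    _ = _ := by norm_num

theorem radius_mem (k : ℕ) : radius k ∈ Ioc (0 : ℝ) 1 :=
  ⟨radius_pos k, (radius_le_half k).trans (by norm_num)⟩

theorem two_mul_radius_mem (k : ℕ) : 2 * radius k ∈ Ioc (0 : ℝ) 1 :=
  ⟨by linarith [radius_pos k], by linarith [radius_le_half k]⟩

theorem radius_succ (k : ℕ) : radius (k + 1) = radius k / 2 := by
  unfold radius; rw [pow_succ _ (k + 1)]; ring

theorem tendsto_radius : Tendsto radius atTop (𝓝 0) :=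
  (tendsto_pow_atTop_nhds_zero_of_lt_one (by norm_num) (by norm_num)).comp (tendsto_add_atTop_nat 1)

theorem radius_anti : Antitone radius := fun k l hkl =>
  pow_le_pow_of_le_one (by norm_num) (by norm_num) (by omega)

theorem exists_radius_near {r : ℝ} (hr : 0 < r) (hr2 : r ≤ 1 / 2) :
    ∃ k, radius (k + 1) < r ∧ r ≤ radius k := by
  obtain ⟨m, h1, h2⟩ := exists_nat_pow_near_of_lt_one (x := 2 * r) (y := (1 / 2 : ℝ)) (by linarith)
    (by linarith) (by norm_num) (by norm_num)
  refine ⟨m, ?_, ?_⟩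
  · unfold radius; rw [pow_succ]; linarith
  · unfold radius; rw [pow_succ]; linarith

/-- The hypotheses under which traces on `F` of functions on `U` are constructed. -/
structure TraceSetting (U F : Set (Vec d)) (n : Vec d) (c : ℝ) (g : Vec d → G) (a : ℝ) : Prop where
  norm_normal : ‖n‖ = 1
  measU : MeasurableSet U
  measF : MeasurableSet F
  bddF : Bornology.IsBounded F
  subF : ∀ x ∈ F, inner ℝ n x = c
  meas : StronglyMeasurable g
  int : IntegrableOn g U
  density : ∀ x ∈ F, DensityBound U x a
  decay : OscDecay U n c g

namespace TraceSetting
variable {U F : Set (Vec d)} {n : Vec d} {c : ℝ} {g : Vec d → G} {a : ℝ}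

theorem surf_lt_top (h : TraceSetting U F n c g a) : surf n c F < ⊤ := by
  obtain ⟨R, hR⟩ := h.bddF.subset_ball 0
  rcases le_or_gt R 0 with hR0 | hR0
  · rw [Metric.ball_eq_empty.2 hR0, subset_empty_iff] at hR
    simp [hR]
  obtain ⟨C, hC, hS⟩ := surf_ball_le h.norm_normal c
  exact ((measure_mono hR).trans (hS 0 R hR0.le)).trans_lt ENNReal.ofReal_lt_top

theorem dim_pos (h : TraceSetting U F n c g a) : 1 ≤ d := by
  by_contra hd
  have : d = 0 := by omega
  subst this
  have h1 := h.norm_normal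
  rw [Subsingleton.elim n 0, norm_zero] at h1
  exact zero_ne_one h1

theorem measurable_enorm_sub (h : TraceSetting U F n c g a) :
    Measurable fun p : Vec d × Vec d => ‖g p.1 - g p.2‖ₑ :=
  ((h.meas.comp_measurable measurable_fst).sub (h.meas.comp_measurable measurable_snd)).enorm

theorem locOsc_eq (h : TraceSetting U F n c g a) (r : ℝ) (x : Vec d) :
    locOsc U g r x = ∫⁻ p : Vec d × Vec d,
      ((Metric.ball x r ∩ U) ×ˢ (Metric.ball x r ∩ U)).indicator
        (fun p => ‖g p.1 - g p.2‖ₑ) p := by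
  have hm : MeasurableSet (Metric.ball x r ∩ U) := measurableSet_ball.inter h.measU
  rw [lintegral_indicator (hm.prod hm), Measure.volume_eq_prod, ← Measure.prod_restrict,
    lintegral_prod _ h.measurable_enorm_sub.aemeasurable]
  rfl

theorem measurable_locOsc_aux (h : TraceSetting U F n c g a) (r : ℝ) :
    Measurable fun q : Vec d × (Vec d × Vec d) =>
      ((Metric.ball q.1 r ∩ U) ×ˢ (Metric.ball q.1 r ∩ U)).indicator
        (fun p => ‖g p.1 - g p.2‖ₑ) q.2 := by
  have e : (fun q : Vec d × (Vec d × Vec d) =>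
      ((Metric.ball q.1 r ∩ U) ×ˢ (Metric.ball q.1 r ∩ U)).indicator
        (fun p => ‖g p.1 - g p.2‖ₑ) q.2) =
      ({q : Vec d × (Vec d × Vec d) | (dist q.2.1 q.1 < r ∧ q.2.1 ∈ U) ∧
        (dist q.2.2 q.1 < r ∧ q.2.2 ∈ U)}).indicator fun q => ‖g q.2.1 - g q.2.2‖ₑ := by
    funext q
    by_cases hq : (dist q.2.1 q.1 < r ∧ q.2.1 ∈ U) ∧ (dist q.2.2 q.1 < r ∧ q.2.2 ∈ U)
    · rw [indicator_of_mem (show q ∈ {q : Vec d × (Vec d × Vec d) | (dist q.2.1 q.1 < r ∧ q.2.1 ∈ U) ∧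
        (dist q.2.2 q.1 < r ∧ q.2.2 ∈ U)} from hq), indicator_of_mem]
      exact ⟨⟨hq.1.1, hq.1.2⟩, ⟨hq.2.1, hq.2.2⟩⟩
    · rw [indicator_of_notMem (show q ∉ {q : Vec d × (Vec d × Vec d) | (dist q.2.1 q.1 < r ∧ q.2.1 ∈ U) ∧
        (dist q.2.2 q.1 < r ∧ q.2.2 ∈ U)} from hq),
        indicator_of_notMem]
      exact fun hh => hq ⟨⟨hh.1.1, hh.1.2⟩, ⟨hh.2.1, hh.2.2⟩⟩
  rw [e]
  refine (h.measurable_enorm_sub.comp measurable_snd).indicator ?_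
  refine MeasurableSet.inter (MeasurableSet.inter ?_ ?_) (MeasurableSet.inter ?_ ?_)
  · exact (isOpen_lt (f := fun q : Vec d × (Vec d × Vec d) => dist q.2.1 q.1) (by fun_prop)
      continuous_const).measurableSet
  · exact (measurable_fst.comp measurable_snd) h.measU
  · exact (isOpen_lt (f := fun q : Vec d × (Vec d × Vec d) => dist q.2.2 q.1) (by fun_prop)
      continuous_const).measurableSet
  · exact (measurable_snd.comp measurable_snd) h.measU

theorem measurable_locOsc (h : TraceSetting U F n c g a) (r : ℝ) : Measurable (locOsc U g r) := by
  have e : locOsc U g r = fun x => ∫⁻ p : Vec d × Vec d,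
      ((Metric.ball x r ∩ U) ×ˢ (Metric.ball x r ∩ U)).indicator
        (fun p => ‖g p.1 - g p.2‖ₑ) p := funext fun x => h.locOsc_eq r x
  rw [e]
  exact (h.measurable_locOsc_aux r).lintegral_prod_right'

/-- Tonelli: a fixed pair of points is seen only from the `x` in a ball of radius `r` around the
first point, a set of surface measure `O(r ^ (d - 1))`; and such a pair lies in the oscillation set
of scale `2 * r`. -/
theorem lintegral_locOsc_le (h : TraceSetting U F n c g a) :
    ∃ C : ℝ, 0 ≤ C ∧ ∀ r : ℝ, 0 < r →
      ∫⁻ x in F, locOsc U g r x ∂(surf n c)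
        ≤ ENNReal.ofReal (C * r ^ (d - 1)) * osc U n c g (2 * r) := by
  obtain ⟨C, hC, hS⟩ := surf_ball_le h.norm_normal c
  refine ⟨C, hC, fun r hr => ?_⟩
  simp_rw [h.locOsc_eq]
  rw [lintegral_lintegral_swap (h.measurable_locOsc_aux r).aemeasurable, osc,
    ← lintegral_const_mul' _ _ ENNReal.ofReal_ne_top,
    ← lintegral_indicator (measurableSet_oscSet h.measU n c _)]
  refine lintegral_mono fun p => ?_
  calc _ ≤ ∫⁻ x in F, (Metric.ball p.1 r).indicator (fun _ =>
        (oscSet U n c (2 * r)).indicator (fun p => ‖g p.1 - g p.2‖ₑ) p) x ∂(surf n c) := by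
        refine setLIntegral_mono' h.measF fun x hx => ?_
        by_cases hp : p ∈ (Metric.ball x r ∩ U) ×ˢ (Metric.ball x r ∩ U)
        swap
        · rw [indicator_of_notMem hp]; exact zero_le
        have hp1 : dist p.1 x < r := hp.1.1
        have hp2 : dist p.2 x < r := hp.2.1
        rw [indicator_of_mem hp, indicator_of_mem (show x ∈ Metric.ball p.1 r by
          rw [Metric.mem_ball, dist_comm]; exact hp1), indicator_of_mem]
        refine ⟨hp.1.2, hp.2.2, ?_, ?_⟩
        · rw [← h.subF x hx, ← inner_sub_right]
          have := abs_real_inner_le_norm n (p.1 - x)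
          rw [h.norm_normal, one_mul, ← dist_eq_norm] at this
          linarith
        · calc dist p.2 p.1 ≤ dist p.2 x + dist p.1 x := dist_triangle_right _ _ _
            _ < _ := by linarith
    _ ≤ ∫⁻ x, (Metric.ball p.1 r).indicator (fun _ =>
        (oscSet U n c (2 * r)).indicator (fun p => ‖g p.1 - g p.2‖ₑ) p) x ∂(surf n c) :=
        setLIntegral_le_lintegral _ _
    _ = (oscSet U n c (2 * r)).indicator (fun p => ‖g p.1 - g p.2‖ₑ) p *
          surf n c (Metric.ball p.1 r) := by
        rw [lintegral_indicator measurableSet_ball, setLIntegral_const]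
    _ ≤ (oscSet U n c (2 * r)).indicator (fun p => ‖g p.1 - g p.2‖ₑ) p *
          ENNReal.ofReal (C * r ^ (d - 1)) := by
        gcongr
        have := hS p.1 r hr.le
        rwa [finrank_euclideanSpace_fin] at this
    _ = _ := by
        by_cases hp : p ∈ oscSet U n c (2 * r)
        · rw [indicator_of_mem hp, indicator_of_mem hp, mul_comm]
        · rw [indicator_of_notMem hp, indicator_of_notMem hp, zero_mul]

/-- The scaled local oscillation that controls the differences of the averages. -/
def stepOsc (U : Set (Vec d)) (g : Vec d → G) (k : ℕ) (x : Vec d) : ℝ≥0∞ :=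
  ENNReal.ofReal ((radius k ^ (2 * d))⁻¹) * locOsc U g (radius k) x

/-- Counting exponents of the radius: `(d - 1) + (d + 1 + κ) - 2 d = κ`. Along dyadic radii this is
a geometric sequence with ratio `(1/2) ^ κ`, so almost every point of the facet has a summable
sequence of steps. -/
theorem lintegral_stepOsc_le (h : TraceSetting U F n c g a) :
    ∃ C q : ℝ, 0 ≤ C ∧ 0 < q ∧ q < 1 ∧ ∀ k,
      ∫⁻ x in F, stepOsc U g k x ∂(surf n c) ≤ ENNReal.ofReal (C * q ^ k) := by
  obtain ⟨C, hC, hL⟩ := h.lintegral_locOsc_le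
  obtain ⟨C', κ, hC', hκ, hJ⟩ := h.decay
  refine ⟨C * (C' * 2 ^ ((d : ℝ) + 1 + κ) * (1 / 2 : ℝ) ^ κ), (1 / 2 : ℝ) ^ κ, by positivity,
    by positivity, Real.rpow_lt_one (by norm_num) (by norm_num) hκ, fun k => ?_⟩
  have hr := radius_pos k
  have hd := h.dim_pos
  unfold stepOsc
  rw [lintegral_const_mul' _ _ ENNReal.ofReal_ne_top]
  calc _ ≤ ENNReal.ofReal ((radius k ^ (2 * d))⁻¹) * (ENNReal.ofReal (C * radius k ^ (d - 1)) *
        ENNReal.ofReal (C' * (2 * radius k) ^ ((d : ℝ) + 1 + κ))) := by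
        gcongr
        exact (hL _ hr).trans (by gcongr; exact hJ _ (two_mul_radius_mem k))
    _ = _ := by
        rw [← ENNReal.ofReal_mul (by positivity), ← ENNReal.ofReal_mul (by positivity)]
        congr 1
        have e1 : (radius k) ^ κ = (1 / 2 : ℝ) ^ κ * ((1 / 2 : ℝ) ^ κ) ^ k := by
          unfold radius
          rw [← Real.rpow_natCast, ← Real.rpow_natCast, ← Real.rpow_mul (by norm_num),
            ← Real.rpow_mul (by norm_num), ← Real.rpow_add (by norm_num)]
          congr 1; push_cast; ring
        have e2 : (radius k) ^ ((d : ℝ) + 1 + κ) = radius k ^ (d + 1) * radius k ^ κ := by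
          rw [Real.rpow_add hr]
          congr 1
          rw [← Real.rpow_natCast]; push_cast; rfl
        have e3 : radius k ^ (2 * d) = radius k ^ (d - 1) * radius k ^ (d + 1) := by
          rw [← pow_add]; congr 1; omega
        rw [Real.mul_rpow (by norm_num) hr.le, e2, e1, e3]
        field_simp

theorem tsum_lintegral_stepOsc_ne_top (h : TraceSetting U F n c g a) :
    ∑' k, ∫⁻ x in F, stepOsc U g k x ∂(surf n c) ≠ ⊤ := by
  obtain ⟨C, q, hC, hq0, hq1, hk⟩ := h.lintegral_stepOsc_le
  have hs : Summable fun k : ℕ => C * q ^ k := (summable_geometric_of_lt_one hq0.le hq1).mul_left C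
  refine ((ENNReal.tsum_le_tsum hk).trans_lt ?_).ne
  rw [← ENNReal.ofReal_tsum_of_nonneg (fun k => by positivity) hs]
  exact ENNReal.ofReal_lt_top

theorem measurable_stepOsc (h : TraceSetting U F n c g a) (k : ℕ) : Measurable (stepOsc U g k) :=
  (h.measurable_locOsc _).const_mul _

theorem ae_tsum_stepOsc_ne_top (h : TraceSetting U F n c g a) :
    ∀ᵐ x ∂(surf n c).restrict F, ∑' k, stepOsc U g k x ≠ ⊤ := by
  have h1 : ∫⁻ x in F, ∑' k, stepOsc U g k x ∂(surf n c) ≠ ⊤ := by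
    rw [lintegral_tsum fun k => (h.measurable_stepOsc k).aemeasurable]
    exact h.tsum_lintegral_stepOsc_ne_top
  filter_upwards [ae_lt_top (Measurable.tsum fun k => h.measurable_stepOsc k) h1] with x hx
  exact hx.ne

theorem enorm_ave_sub_ave_radius_le (h : TraceSetting U F n c g a) {V : Set (Vec d)} (hV : V ⊆ U)
    {x : Vec d} (hx : x ∈ F) {b : ℝ} (hb : DensityBound V x b) {k : ℕ} {r : ℝ}
    (hr1 : radius (k + 1) ≤ r) (hr2 : r ≤ radius k) :
    ‖ave V g x r - ave U g x (radius k)‖ₑ ≤ ENNReal.ofReal (2 ^ d / (b * a)) * stepOsc U g k x := by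
  have hr0 : 0 < r := (radius_pos _).trans_le hr1
  have hk := radius_pos k
  have ha := (h.density x hx).1
  have hb0 := hb.1
  refine (enorm_ave_sub_ave_le hV subset_rfl h.int hb (h.density x hx)
    ⟨hr0, hr2.trans (radius_mem k).2⟩ (radius_mem k) hr2).trans ?_
  rw [stepOsc, ← mul_assoc, ← mul_assoc, ← ENNReal.ofReal_mul (by positivity),
    ← ENNReal.ofReal_mul (by positivity)]
  refine mul_le_mul_left (ENNReal.ofReal_le_ofReal ?_) _
  rw [radius_succ] at hr1
  -- Since `r` is at least half of `radius k`, replacing the one by the other costs the factor `2 ^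
  -- d`.
  have h1 : (radius k / 2) ^ d ≤ r ^ d := pow_le_pow_left₀ (by positivity) hr1 d
  calc (b * r ^ d)⁻¹ * (a * radius k ^ d)⁻¹ ≤ (b * (radius k / 2) ^ d)⁻¹ * (a * radius k ^ d)⁻¹ := by
        gcongr
    _ = _ := by
        have : radius k ^ (2 * d) = radius k ^ d * radius k ^ d := by rw [two_mul, pow_add]
        rw [div_pow, this]
        field_simp

/-- Summable steps make the dyadic averages over `U` a Cauchy sequence, with a tail bound for the
distance to the limit. An average over any `V ⊆ U` without cusp, at any radius, differs from a
neighbouring dyadic average over `U` by a multiple of a single step, which tends to zero; hence the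
limit does not depend on `V`. -/
theorem exists_tendsto_ave_of_tsum (h : TraceSetting U F n c g a) {x : Vec d} (hx : x ∈ F)
    (hs : ∑' k, stepOsc U g k x ≠ ⊤) :
    ∃ T : G, (∀ k, ‖ave U g x (radius k) - T‖ₑ
        ≤ ENNReal.ofReal (2 ^ d / (a * a)) * ∑' i, stepOsc U g (i + k) x) ∧
      ∀ V ⊆ U, ∀ b, DensityBound V x b → Tendsto (ave V g x) (𝓝[>] 0) (𝓝 T) := by
  have hstep : ∀ k, edist (ave U g x (radius k)) (ave U g x (radius (k + 1)))
      ≤ ENNReal.ofReal (2 ^ d / (a * a)) * stepOsc U g k x := fun k => by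
    rw [edist_comm, edist_eq_enorm_sub]
    exact h.enorm_ave_sub_ave_radius_le subset_rfl hx (h.density x hx) le_rfl (radius_anti (by omega))
  have hsum : ∑' k, ENNReal.ofReal (2 ^ d / (a * a)) * stepOsc U g k x ≠ ⊤ := by
    rw [ENNReal.tsum_mul_left]
    exact ENNReal.mul_ne_top ENNReal.ofReal_ne_top hs
  obtain ⟨T, hT⟩ := cauchySeq_tendsto_of_complete
    (cauchySeq_of_edist_le_of_tsum_ne_top _ hstep hsum)
  refine ⟨T, fun k => ?_, fun V hV b hb => ?_⟩
  · rw [← edist_eq_enorm_sub, ← ENNReal.tsum_mul_left]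
    have := edist_le_tsum_of_edist_le_of_tendsto _ hstep hT k
    simpa [add_comm] using this
  · rw [Metric.tendsto_nhdsWithin_nhds]
    intro η hη
    have hz : Tendsto (fun k => ENNReal.ofReal (2 ^ d / (b * a)) * stepOsc U g k x) atTop (𝓝 0) := by
      have := ENNReal.Tendsto.const_mul (a := ENNReal.ofReal (2 ^ d / (b * a)))
        (ENNReal.tendsto_atTop_zero_of_tsum_ne_top hs) (Or.inr ENNReal.ofReal_ne_top)
      simpa using this
    have hη2 : (0 : ℝ≥0∞) < ENNReal.ofReal (η / 2) := ENNReal.ofReal_pos.2 (by linarith)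
    obtain ⟨N, hN⟩ := eventually_atTop.1 ((hz.eventually (gt_mem_nhds hη2)).and
      (Metric.tendsto_nhds.1 hT (η / 2) (by linarith)))
    refine ⟨radius N, radius_pos N, fun {r} hr0 hr => ?_⟩
    have hr0' : 0 < r := hr0
    rw [dist_zero_right, Real.norm_of_nonneg hr0'.le] at hr
    obtain ⟨k, hk1, hk2⟩ := exists_radius_near hr0' (hr.le.trans (radius_le_half N))
    have hkN : N ≤ k := by
      by_contra hlt
      exact absurd (radius_anti (show k + 1 ≤ N by omega)) (not_le.2 (hk1.trans hr))
    have h1 := (h.enorm_ave_sub_ave_radius_le hV hx hb hk1.le hk2).trans_lt (hN k hkN).1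
    rw [← edist_eq_enorm_sub, edist_dist, ENNReal.ofReal_lt_ofReal_iff (by linarith)] at h1
    calc dist (ave V g x r) T ≤ _ := dist_triangle _ (ave U g x (radius k)) _
      _ < η := by linarith [(hN k hkN).2]

theorem ae_tendsto_ave (h : TraceSetting U F n c g a) :
    ∀ᵐ x ∂(surf n c).restrict F, ∃ T : G, ∀ V ⊆ U, ∀ b, DensityBound V x b →
      Tendsto (ave V g x) (𝓝[>] 0) (𝓝 T) := by
  filter_upwards [h.ae_tsum_stepOsc_ne_top, ae_restrict_mem h.measF] with x h1 h2
  obtain ⟨T, _, hT⟩ := h.exists_tendsto_ave_of_tsum h2 h1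
  exact ⟨T, hT⟩

theorem ae_tendsto_trace (h : TraceSetting U F n c g a) :
    ∀ᵐ x ∂(surf n c).restrict F, Tendsto (ave U g x) (𝓝[>] 0) (𝓝 (trace U g x)) := by
  filter_upwards [h.ae_tendsto_ave, ae_restrict_mem h.measF] with x h1 h2
  obtain ⟨T, hT⟩ := h1
  have := hT U subset_rfl a (h.density x h2)
  have e : trace U g x = T := this.limUnder_eq
  rwa [e]

theorem stronglyMeasurable_ave (h : TraceSetting U F n c g a) (r : ℝ) :
    StronglyMeasurable fun x => ave U g x r := by
  have hS : MeasurableSet {p : Vec d × Vec d | dist p.2 p.1 < r ∧ p.2 ∈ U} :=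
    (isOpen_lt (f := fun p : Vec d × Vec d => dist p.2 p.1) (by fun_prop)
      continuous_const).measurableSet.inter (measurable_snd h.measU)
  have e : (fun x => ave U g x r) = fun x => (volume.real (Metric.ball x r ∩ U))⁻¹ •
      ∫ y, ({p : Vec d × Vec d | dist p.2 p.1 < r ∧ p.2 ∈ U}).indicator (fun p => g p.2) (x, y) := by
    funext x
    rw [ave, setAverage_eq, ← integral_indicator (measurableSet_ball.inter h.measU)]
    rfl
  rw [e]
  refine StronglyMeasurable.smul ?_ ?_
  · have : Measurable fun x => volume (Metric.ball x r ∩ U) := measurable_measure_prodMk_left hS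
    exact this.ennreal_toReal.inv.stronglyMeasurable
  · exact ((h.meas.comp_measurable measurable_snd).indicator hS).integral_prod_right'

theorem aestronglyMeasurable_trace (h : TraceSetting U F n c g a) :
    AEStronglyMeasurable (trace U g) ((surf n c).restrict F) := by
  refine aestronglyMeasurable_of_tendsto_ae atTop
    (fun k => (h.stronglyMeasurable_ave (radius k)).aestronglyMeasurable) ?_
  filter_upwards [h.ae_tendsto_trace] with x hx
  exact hx.comp (tendsto_nhdsWithin_iff.2 ⟨tendsto_radius, Eventually.of_forall radius_pos⟩)

/-- The distance to the trace is bounded by the tail of the series of steps, whose integral is the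
tail of a convergent series. -/
theorem lintegral_ave_sub_trace (h : TraceSetting U F n c g a) :
    Tendsto (fun k => ∫⁻ x in F, ‖ave U g x (radius k) - trace U g x‖ₑ ∂(surf n c)) atTop (𝓝 0) := by
  have h1 := ENNReal.tendsto_sum_nat_add _ h.tsum_lintegral_stepOsc_ne_top
  have h2 := ENNReal.Tendsto.const_mul (a := ENNReal.ofReal (2 ^ d / (a * a))) h1
    (Or.inr ENNReal.ofReal_ne_top)
  rw [mul_zero] at h2
  refine tendsto_of_tendsto_of_tendsto_of_le_of_le tendsto_const_nhds h2 (fun _ => zero_le)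
    fun k => ?_
  rw [← lintegral_tsum fun i => (h.measurable_stepOsc _).aemeasurable,
    ← lintegral_const_mul' _ _ ENNReal.ofReal_ne_top]
  refine lintegral_mono_ae ?_
  filter_upwards [h.ae_tsum_stepOsc_ne_top, ae_restrict_mem h.measF] with x h1 h2
  obtain ⟨T, hT1, hT⟩ := h.exists_tendsto_ave_of_tsum h2 h1
  have e : trace U g x = T := (hT U subset_rfl a (h.density x h2)).limUnder_eq
  rw [e]
  exact hT1 k

/-- For `x` in `F` and `|s| < r`, the point `x + s • n` forms a pair of the oscillation set of scale
`2 * r` with every point of `B_r(x) ∩ U`; so the mean over that ball is controlled by the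
oscillation, and Fubini along the normals sums up. -/
theorem lintegral_slab_ave_le (h : TraceSetting U F n c g a) (r : ℝ) (hr : r ∈ Ioc (0 : ℝ) 1) :
    ∫⁻ x in F, ∫⁻ s in Ioo (-r) r, U.indicator (fun y => ‖g y - ave U g x r‖ₑ) (x + s • n) ∂volume ∂(surf n c)
      ≤ ENNReal.ofReal (a * r ^ d)⁻¹ * osc U n c g (2 * r) := by
  set H : Vec d → ℝ≥0∞ := fun y => ∫⁻ z, (oscSet U n c (2 * r)).indicator
    (fun p => ‖g p.1 - g p.2‖ₑ) (y, z) with hH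
  have hHm : Measurable H :=
    (h.measurable_enorm_sub.indicator (measurableSet_oscSet h.measU n c _)).lintegral_prod_right'
  have hnn : inner ℝ n n = (1 : ℝ) := by rw [real_inner_self_eq_norm_sq, h.norm_normal]; norm_num
  have e1 : osc U n c g (2 * r) = ∫⁻ x, ∫⁻ s : ℝ, H (x + s • n) ∂volume ∂(surf n c) := by
    have hmp := measurePreserving_surf h.norm_normal c
    rw [osc, ← lintegral_indicator (measurableSet_oscSet h.measU n c _), Measure.volume_eq_prod,
      lintegral_prod _ (h.measurable_enorm_sub.indicator
        (measurableSet_oscSet h.measU n c _)).aemeasurable]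
    rw [← hmp.lintegral_comp hHm, lintegral_prod]
    exact (hHm.comp (by fun_prop)).aemeasurable
  rw [e1, ← lintegral_const_mul' _ _ ENNReal.ofReal_ne_top]
  refine le_trans ?_ (setLIntegral_le_lintegral F _)
  refine setLIntegral_mono' h.measF fun x hx => ?_
  rw [← lintegral_const_mul' _ _ ENNReal.ofReal_ne_top]
  refine le_trans ?_ (setLIntegral_le_lintegral (Ioo (-r) r) _)
  refine setLIntegral_mono' measurableSet_Ioo fun s hs => ?_
  by_cases hy : x + s • n ∈ U
  swap
  · rw [indicator_of_notMem hy]; exact zero_le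
  rw [indicator_of_mem hy]
  have hs' : |s| < r := abs_lt.2 hs
  refine (enorm_sub_setAverage_le ((h.density x hx).volume_ne_zero hr)
    (volume_ball_inter_ne_top _ _ _) (h.int.mono_set inter_subset_right) _).trans ?_
  refine mul_le_mul' ((h.density x hx).inv_le hr) ?_
  rw [hH, ← lintegral_indicator (measurableSet_ball.inter h.measU)]
  refine lintegral_mono fun z => ?_
  by_cases hz : z ∈ Metric.ball x r ∩ U
  swap
  · rw [indicator_of_notMem hz]; exact zero_le
  rw [indicator_of_mem hz, indicator_of_mem]
  refine ⟨hy, hz.2, ?_, ?_⟩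
  · rw [inner_add_right, inner_smul_right, hnn, h.subF x hx, mul_one, add_sub_cancel_left]
    linarith [hr.1]
  · have h1 : dist z x < r := hz.1
    have h2 : dist (x + s • n) x = |s| := by
      rw [dist_eq_norm, add_sub_cancel_left, norm_smul, h.norm_normal, mul_one, Real.norm_eq_abs]
    calc dist z (x + s • n) ≤ dist z x + dist (x + s • n) x := dist_triangle_right _ _ _
      _ < 2 * r := by linarith

/-- On thin slabs next to `F`, `g` is close to its trace in the mean. -/
theorem tendsto_slab (h : TraceSetting U F n c g a) :
    Tendsto (fun k => ENNReal.ofReal (radius k)⁻¹ * ∫⁻ x in F, ∫⁻ s in Ioo (-radius k) (radius k),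
      U.indicator (fun y => ‖g y - trace U g x‖ₑ) (x + s • n) ∂volume ∂(surf n c)) atTop (𝓝 0) := by
  obtain ⟨C', κ, hC', hκ, hJ⟩ := h.decay
  -- The average at the scale of the slab is inserted between `g` and its trace. The first part
  -- decays like `radius k ^ κ`; in the second the width `2 * radius k` of the slab cancels the
  -- prefactor.
  have hb : ∀ k, ENNReal.ofReal (radius k)⁻¹ * ∫⁻ x in F, ∫⁻ s in Ioo (-radius k) (radius k),
      U.indicator (fun y => ‖g y - trace U g x‖ₑ) (x + s • n) ∂volume ∂(surf n c) ≤
      ENNReal.ofReal (a⁻¹ * C' * 2 ^ ((d : ℝ) + 1 + κ) * radius k ^ κ) +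
      2 * ∫⁻ x in F, ‖ave U g x (radius k) - trace U g x‖ₑ ∂(surf n c) := by
    intro k
    have hr := radius_pos k
    rcases F.eq_empty_or_nonempty with hF | ⟨x0, hx0⟩
    · simp [hF]
    have ha := (h.density x0 hx0).1
    calc _ ≤ ENNReal.ofReal (radius k)⁻¹ * ∫⁻ x in F,
            ((∫⁻ s in Ioo (-radius k) (radius k),
              U.indicator (fun y => ‖g y - ave U g x (radius k)‖ₑ) (x + s • n))
            + ENNReal.ofReal (2 * radius k) * ‖ave U g x (radius k) - trace U g x‖ₑ) ∂(surf n c) := by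
          gcongr with x
          calc _ ≤ ∫⁻ s in Ioo (-radius k) (radius k),
              (U.indicator (fun y => ‖g y - ave U g x (radius k)‖ₑ) (x + s • n)
                + ‖ave U g x (radius k) - trace U g x‖ₑ) := by
                refine lintegral_mono fun s => ?_
                by_cases hy : x + s • n ∈ U
                · rw [indicator_of_mem hy, indicator_of_mem hy]
                  have : g (x + s • n) - trace U g x = (g (x + s • n) - ave U g x (radius k))
                    + (ave U g x (radius k) - trace U g x) := by abel
                  rw [this]
                  exact enorm_add_le _ _
                · rw [indicator_of_notMem hy]; exact zero_le
            _ = _ := by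
                rw [lintegral_add_right _ measurable_const, setLIntegral_const, Real.volume_Ioo,
                  mul_comm]
                congr 3; ring
      _ = ENNReal.ofReal (radius k)⁻¹ * ((∫⁻ x in F, ∫⁻ s in Ioo (-radius k) (radius k),
              U.indicator (fun y => ‖g y - ave U g x (radius k)‖ₑ) (x + s • n) ∂volume ∂(surf n c))
            + ENNReal.ofReal (2 * radius k) *
              ∫⁻ x in F, ‖ave U g x (radius k) - trace U g x‖ₑ ∂(surf n c)) := by
          rw [lintegral_add_right' _ ?_, lintegral_const_mul' _ _ ENNReal.ofReal_ne_top]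
          exact (((h.stronglyMeasurable_ave _).aestronglyMeasurable.sub
            h.aestronglyMeasurable_trace).enorm).const_mul _
      _ ≤ ENNReal.ofReal (radius k)⁻¹ * (ENNReal.ofReal (a * radius k ^ d)⁻¹ *
            ENNReal.ofReal (C' * (2 * radius k) ^ ((d : ℝ) + 1 + κ))
            + ENNReal.ofReal (2 * radius k) *
              ∫⁻ x in F, ‖ave U g x (radius k) - trace U g x‖ₑ ∂(surf n c)) := by
          gcongr
          exact (h.lintegral_slab_ave_le _ (radius_mem k)).trans
            (by gcongr; exact hJ _ (two_mul_radius_mem k))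
      _ = _ := by
          rw [mul_add, ← mul_assoc, ← mul_assoc, ← ENNReal.ofReal_mul (by positivity),
            ← ENNReal.ofReal_mul (by positivity), ← ENNReal.ofReal_mul (by positivity)]
          congr 2
          · have e2 : (radius k) ^ ((d : ℝ) + 1 + κ) = radius k ^ d * radius k * radius k ^ κ := by
              rw [Real.rpow_add hr, Real.rpow_add hr, Real.rpow_natCast, Real.rpow_one]
            rw [Real.mul_rpow (by norm_num) hr.le, e2]
            field_simp
          · have : (radius k)⁻¹ * (2 * radius k) = 2 := by field_simp
            rw [this]; norm_num
  have ht : Tendsto (fun k => ENNReal.ofReal (a⁻¹ * C' * 2 ^ ((d : ℝ) + 1 + κ) * radius k ^ κ) +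
      2 * ∫⁻ x in F, ‖ave U g x (radius k) - trace U g x‖ₑ ∂(surf n c)) atTop (𝓝 0) := by
    have h1 : Tendsto (fun k => a⁻¹ * C' * 2 ^ ((d : ℝ) + 1 + κ) * radius k ^ κ) atTop (𝓝 0) := by
      have : Tendsto (fun k => radius k ^ κ) atTop (𝓝 0) := by
        have := (Real.continuousAt_rpow_const 0 κ (Or.inr hκ.le)).tendsto.comp tendsto_radius
        rwa [Real.zero_rpow hκ.ne'] at this
      simpa using this.const_mul (a⁻¹ * C' * 2 ^ ((d : ℝ) + 1 + κ))
    have h2 := ENNReal.tendsto_ofReal h1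
    have h3 := ENNReal.Tendsto.const_mul (a := 2) h.lintegral_ave_sub_trace (Or.inr (by norm_num))
    simpa using h2.add h3
  exact tendsto_of_tendsto_of_tendsto_of_le_of_le tendsto_const_nhds ht (fun _ => zero_le) hb

/-- The trace is at finite `L¹` distance from the averages at some fixed radius, and those are
bounded uniformly on `F` by the density bound. -/
theorem integrable_trace (h : TraceSetting U F n c g a) :
    Integrable (trace U g) ((surf n c).restrict F) := by
  refine ⟨h.aestronglyMeasurable_trace, ?_⟩
  rcases F.eq_empty_or_nonempty with hF | ⟨x0, hx0⟩
  · simp [hF, HasFiniteIntegral]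
  have ha := (h.density x0 hx0).1
  obtain ⟨k, hk⟩ := (h.lintegral_ave_sub_trace.eventually (gt_mem_nhds one_pos)).exists
  have hk' : ∫⁻ x in F, ‖ave U g x (radius k) - trace U g x‖ₑ ∂(surf n c) < ⊤ :=
    hk.trans ENNReal.one_lt_top
  have hr := radius_pos k
  set B : ℝ≥0∞ := ENNReal.ofReal (a * radius k ^ d)⁻¹ * ∫⁻ z in U, ‖g z‖ₑ with hB
  have hBt : B < ⊤ := ENNReal.mul_lt_top ENNReal.ofReal_lt_top h.int.2
  have hA : ∀ x ∈ F, ‖ave U g x (radius k)‖ₑ ≤ B := by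
    intro x hx
    have h1 := enorm_sub_setAverage_le ((h.density x hx).volume_ne_zero (radius_mem k))
      (volume_ball_inter_ne_top _ _ _) (h.int.mono_set inter_subset_right) (0 : G)
    simp only [zero_sub, enorm_neg] at h1
    exact h1.trans (mul_le_mul' ((h.density x hx).inv_le (radius_mem k))
      (lintegral_mono_set inter_subset_right))
  calc ∫⁻ x in F, ‖trace U g x‖ₑ ∂(surf n c)
      ≤ ∫⁻ x in F, (‖ave U g x (radius k) - trace U g x‖ₑ + B) ∂(surf n c) := by
        refine setLIntegral_mono' h.measF fun x hx => ?_
        have e : trace U g x = - (ave U g x (radius k) - trace U g x) + ave U g x (radius k) := by abel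
        calc ‖trace U g x‖ₑ = _ := by rw [e]
          _ ≤ _ := enorm_add_le _ _
          _ ≤ _ := by
            rw [enorm_neg]
            exact add_le_add le_rfl (hA x hx)
    _ = (∫⁻ x in F, ‖ave U g x (radius k) - trace U g x‖ₑ ∂(surf n c)) + B * surf n c F := by
        rw [lintegral_add_right _ measurable_const, setLIntegral_const]
    _ < ⊤ := ENNReal.add_lt_top.2 ⟨hk', ENNReal.mul_lt_top hBt h.surf_lt_top⟩

end TraceSetting

end Trace

/-! ### Facets and polytopes -/

section Polytope
variable {d : ℕ}

theorem finrank_orthogonal_singleton_add_one {n : Vec d} (hn : ‖n‖ = 1) :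
    Module.finrank ℝ (ℝ ∙ n)ᗮ + 1 = d := by
  have h1 : Module.finrank ℝ (ℝ ∙ n) = 1 := finrank_span_singleton (by rintro rfl; simp at hn)
  have := (ℝ ∙ n).finrank_add_finrank_orthogonal
  rw [h1, finrank_euclideanSpace_fin] at this
  omega

theorem IsFacet.inner_eq {K F : Set (Vec d)} {n : Vec d} (h : IsFacet K n F) {x y : Vec d}
    (hx : x ∈ F) (hy : y ∈ F) : inner ℝ n x = inner ℝ n y := by
  rw [h.2.1] at hx hy
  exact le_antisymm (hy.2 x hx.1) (hx.2 y hy.1)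

theorem IsFacet.subset {K F : Set (Vec d)} {n : Vec d} (h : IsFacet K n F) : F ⊆ K := by
  rw [h.2.1]; exact fun x hx => hx.1

theorem IsFacet.inner_le {K F : Set (Vec d)} {n : Vec d} (h : IsFacet K n F) {x y : Vec d}
    (hx : x ∈ F) (hy : y ∈ K) : inner ℝ n y ≤ inner ℝ n x := by
  rw [h.2.1] at hx
  exact hx.2 y hy

theorem IsFacet.nonempty {K F : Set (Vec d)} {n : Vec d} (hd : 2 ≤ d) (h : IsFacet K n F) :
    F.Nonempty := by
  by_contra hF
  rw [not_nonempty_iff_eq_empty] at hF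
  have := h.2.2
  rw [hF, vectorSpan_empty, finrank_bot] at this
  omega

theorem IsFacet.vectorSpan_eq {K F : Set (Vec d)} {n : Vec d} (h : IsFacet K n F) :
    vectorSpan ℝ F = (ℝ ∙ n)ᗮ := by
  refine Submodule.eq_of_le_of_finrank_eq ?_ ?_
  · rw [vectorSpan_def, Submodule.span_le]
    rintro v ⟨x, hx, y, hy, rfl⟩
    rw [SetLike.mem_coe, Submodule.mem_orthogonal_singleton_iff_inner_right]
    change inner ℝ n (x - y) = 0
    rw [inner_sub_right, h.inner_eq hx hy, sub_self]
  · have := finrank_orthogonal_singleton_add_one h.1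
    have := h.2.2
    omega

theorem eq_or_eq_neg_of_mem_span {n n' : Vec d} (hn : ‖n‖ = 1) (hn' : ‖n'‖ = 1)
    (h : n' ∈ ℝ ∙ n) : n' = n ∨ n' = -n := by
  obtain ⟨t, rfl⟩ := Submodule.mem_span_singleton.1 h
  rw [norm_smul, hn, mul_one, Real.norm_eq_abs] at hn'
  rcases (abs_eq zero_le_one).1 hn' with h | h
  · left; rw [h, one_smul]
  · right; rw [h, neg_one_smul]

theorem IsFacet.normal_eq_or {K K' F : Set (Vec d)} {n n' : Vec d} (h : IsFacet K n F)
    (h' : IsFacet K' n' F) : n' = n ∨ n' = -n := by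
  refine eq_or_eq_neg_of_mem_span h.1 h'.1 ?_
  have h1 := h.vectorSpan_eq.symm.trans h'.vectorSpan_eq
  have h2 : (ℝ ∙ n)ᗮᗮ = (ℝ ∙ n')ᗮᗮ := by rw [h1]
  rw [Submodule.orthogonal_orthogonal, Submodule.orthogonal_orthogonal] at h2
  rw [h2]
  exact Submodule.mem_span_singleton_self n'

/-- The faces of a nonredundant system of affine inequalities are facets. -/
theorem exists_isFacet_of_affine {ι : Type*} [Finite ι] (L : ι → Vec d →ᵃ[ℝ] ℝ) {K : Set (Vec d)}
    (hK : K = {x | ∀ i, 0 ≤ L i x}) {p0 : Vec d} (hp0 : ∀ i, 0 < L i p0) (i : ι) {p : Vec d}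
    (hp : L i p = 0) (hp' : ∀ k, k ≠ i → 0 < L k p) :
    ∃ (n : Vec d) (F : Set (Vec d)), IsFacet K n F ∧
      ∀ x, L i x < 0 → ∀ y ∈ F, inner ℝ n y < inner ℝ n x := by
  have hpK : p ∈ K := by
    rw [hK]
    intro k
    rcases eq_or_ne k i with rfl | hk
    · exact hp.ge
    · exact (hp' k hk).le
  set l : Vec d →L[ℝ] ℝ := LinearMap.toContinuousLinearMap (L i).linear with hl
  set a : Vec d := (InnerProductSpace.toDual ℝ (Vec d)).symm l with ha
  have hla : ∀ v, (L i).linear v = inner ℝ a v := fun v => by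
    rw [ha, InnerProductSpace.toDual_symm_apply]; rfl
  have hdiff : ∀ x y, L i x - L i y = inner ℝ a (x - y) := fun x y => by
    rw [← hla, ← vsub_eq_sub x y, AffineMap.linearMap_vsub]; rfl
  have ha0 : a ≠ 0 := by
    intro h0
    have := hdiff p0 p
    rw [h0, inner_zero_left, hp, sub_zero] at this
    exact (hp0 i).ne' this
  have hna : 0 < ‖a‖ := norm_pos_iff.2 ha0
  set n : Vec d := -(‖a‖⁻¹ • a) with hn
  have hn1 : ‖n‖ = 1 := by rw [hn, norm_neg, norm_smul, norm_inv, norm_norm, inv_mul_cancel₀ hna.ne']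
  have hin : ∀ x y, inner ℝ n x - inner ℝ n y = ‖a‖⁻¹ * (L i y - L i x) := fun x y => by
    rw [hdiff, ← inner_sub_right, hn, inner_neg_left, inner_smul_left, RCLike.conj_to_real,
      ← neg_sub x y, inner_neg_right]
    ring
  have hF : {x | x ∈ K ∧ L i x = 0} = {x ∈ K | ∀ y ∈ K, inner ℝ n y ≤ inner ℝ n x} := by
    ext x
    constructor
    · rintro ⟨hx, hx0⟩
      refine ⟨hx, fun y hy => ?_⟩
      have h1 := hin y x
      rw [hK] at hy
      have h2 : 0 ≤ ‖a‖⁻¹ * L i y := mul_nonneg (by positivity) (hy i)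
      rw [hx0] at h1
      nlinarith
    · rintro ⟨hx, hx0⟩
      refine ⟨hx, le_antisymm ?_ (by rw [hK] at hx; exact hx i)⟩
      have h1 := hin p x
      rw [hp, sub_zero] at h1
      have h2 : ‖a‖⁻¹ * L i x ≤ 0 := by rw [← h1]; linarith [hx0 p hpK]
      by_contra hc
      push Not at hc
      have : 0 < ‖a‖⁻¹ * L i x := by positivity
      linarith
  refine ⟨n, {x | x ∈ K ∧ L i x = 0}, ⟨hn1, hF, ?_⟩, ?_⟩
  · have hv : vectorSpan ℝ {x | x ∈ K ∧ L i x = 0} = (ℝ ∙ n)ᗮ := by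
      refine le_antisymm ?_ ?_
      · rw [vectorSpan_def, Submodule.span_le]
        rintro v ⟨x, hx, y, hy, rfl⟩
        rw [SetLike.mem_coe, Submodule.mem_orthogonal_singleton_iff_inner_right]
        change inner ℝ n (x - y) = 0
        rw [inner_sub_right, hin, hx.2, hy.2, sub_self, mul_zero]
      · intro v hv
        rw [Submodule.mem_orthogonal_singleton_iff_inner_right] at hv
        -- At `p` all other inequalities are strict, so a short step in any direction orthogonal to
        -- `n` stays in the face; hence the face spans the full orthogonal complement.
        have hev : ∀ᶠ t in 𝓝 (0 : ℝ), ∀ k, k ≠ i → 0 < L k (p + t • v) := by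
          rw [eventually_all]
          intro k
          by_cases hk : k = i
          · exact Eventually.of_forall fun t h => absurd hk h
          have hc : Continuous fun t : ℝ => L k (p + t • v) :=
            (L k).continuous_of_finiteDimensional.comp (by fun_prop)
          have : Tendsto (fun t : ℝ => L k (p + t • v)) (𝓝 0) (𝓝 (L k p)) := by
            have := hc.tendsto 0
            simpa using this
          exact (this.eventually (lt_mem_nhds (hp' k hk))).mono fun t ht _ => ht
        obtain ⟨t, ht, ht0⟩ := ((hev.filter_mono nhdsWithin_le_nhds).and
          (self_mem_nhdsWithin : Ioi (0 : ℝ) ∈ 𝓝[>] 0)).exists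
        have ht0' : (0 : ℝ) < t := ht0
        have hi0 : L i (p + t • v) = 0 := by
          have := hin (p + t • v) p
          rw [← inner_sub_right, add_sub_cancel_left, inner_smul_right, hv, mul_zero, hp,
            zero_sub] at this
          have h3 : ‖a‖⁻¹ ≠ 0 := by positivity
          rcases mul_eq_zero.1 this.symm with h | h
          · exact absurd h h3
          · linarith
        have hq : p + t • v ∈ {x | x ∈ K ∧ L i x = 0} := by
          refine ⟨?_, hi0⟩
          rw [hK]
          intro k
          rcases eq_or_ne k i with rfl | hk
          · exact hi0.ge
          · exact (ht k hk).le
        have h1 := vsub_mem_vectorSpan ℝ hq (show p ∈ {x | x ∈ K ∧ L i x = 0} from ⟨hpK, hp⟩)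
        rw [vsub_eq_sub, add_sub_cancel_left] at h1
        have h2 := (vectorSpan ℝ {x | x ∈ K ∧ L i x = 0}).smul_mem t⁻¹ h1
        rwa [smul_smul, inv_mul_cancel₀ ht0'.ne', one_smul] at h2
    rw [hv]
    exact finrank_orthogonal_singleton_add_one hn1
  · intro x hx y hy
    have h1 := hin x y
    rw [hy.2, zero_sub] at h1
    have : 0 < ‖a‖⁻¹ * (-L i x) := mul_pos (by positivity) (by linarith)
    linarith

/-- Closed convex sets with interior points that are cut out by their facets. -/
structure IsPolytope (K : Set (Vec d)) : Prop where
  convex : Convex ℝ K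
  isClosed : IsClosed K
  interior_nonempty : (interior K).Nonempty
  facets : ∀ x, x ∉ K → ∃ n F, IsFacet K n F ∧ ∀ y ∈ F, inner ℝ n y < inner ℝ n x

theorem isPolytope_of_affine {ι : Type*} [Finite ι] (L : ι → Vec d →ᵃ[ℝ] ℝ) {K : Set (Vec d)}
    (hK : K = {x | ∀ i, 0 ≤ L i x}) {p0 : Vec d} (hp0 : ∀ i, 0 < L i p0)
    (hp : ∀ i, ∃ p, L i p = 0 ∧ ∀ k, k ≠ i → 0 < L k p) : IsPolytope K := by
  have hc : ∀ i, Continuous (L i) := fun i => (L i).continuous_of_finiteDimensional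
  have hK' : K = ⋂ i, (L i) ⁻¹' Ici 0 := by rw [hK]; ext x; simp
  refine ⟨?_, ?_, ⟨p0, ?_⟩, fun x hx => ?_⟩
  · rw [hK']
    exact convex_iInter fun i => (convex_Ici 0).affine_preimage (L i)
  · rw [hK']
    exact isClosed_iInter fun i => isClosed_Ici.preimage (hc i)
  · rw [mem_interior]
    refine ⟨⋂ i, (L i) ⁻¹' Ioi 0, ?_, isOpen_iInter_of_finite fun i => isOpen_Ioi.preimage (hc i),
      mem_iInter.2 hp0⟩
    rw [hK']
    exact iInter_mono fun i x hx => le_of_lt (show 0 < L i x from hx)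
  · rw [hK] at hx
    obtain ⟨i, hi⟩ := not_forall.1 hx
    obtain ⟨p, h1, h2⟩ := hp i
    obtain ⟨n, F, hF, h⟩ := exists_isFacet_of_affine L hK hp0 i h1 h2
    exact ⟨n, F, hF, h x (not_le.1 hi)⟩

/-- The reference elements are cut out by the affine functions `x i` together with `1 - Σ x i`,
respectively by `x i` and `1 - x i`. For each of them an explicit point is given where it vanishes
and all others are positive; all is transported by `A`. -/
theorem isPolytope_image_ref (hd : 1 ≤ d) (kind : MeshKind) (A : Vec d ≃ᵃ[ℝ] Vec d) :
    IsPolytope (A '' kind.ref d) := by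
  have hd0 : (0 : ℝ) < d := by exact_mod_cast hd
  have himg : ∀ S : Set (Vec d), A '' S = {x | A.symm x ∈ S} := fun S => by
    ext x
    constructor
    · rintro ⟨y, hy, rfl⟩; simpa using hy
    · intro hx; exact ⟨A.symm x, hx, by simp⟩
  let co : Fin d → Vec d →ᵃ[ℝ] ℝ := fun i => ((EuclideanSpace.proj i : Vec d →L[ℝ] ℝ) :
    Vec d →ₗ[ℝ] ℝ).toAffineMap
  have hco : ∀ i x, co i x = x i := fun i x => rfl
  cases kind with
  | simplicial =>
    let su : Vec d →ᵃ[ℝ] ℝ := ((∑ i, (EuclideanSpace.proj i : Vec d →L[ℝ] ℝ) : Vec d →L[ℝ] ℝ) :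
      Vec d →ₗ[ℝ] ℝ).toAffineMap
    have hsu : ∀ x, su x = ∑ i, x i := fun x => by
      change (∑ i, (EuclideanSpace.proj i : Vec d →L[ℝ] ℝ) : Vec d →L[ℝ] ℝ) x = _
      simp
    let l : Option (Fin d) → Vec d →ᵃ[ℝ] ℝ := fun o => o.elim (AffineMap.const ℝ (Vec d) 1 - su) co
    have hl0 : ∀ x, l none x = 1 - ∑ i, x i := fun x => by
      change (AffineMap.const ℝ (Vec d) 1 - su : Vec d →ᵃ[ℝ] ℝ) x = _
      simp [hsu]
    have hl1 : ∀ i x, l (some i) x = x i := fun i x => rfl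
    let L : Option (Fin d) → Vec d →ᵃ[ℝ] ℝ := fun o => (l o).comp (A.symm : Vec d →ᵃ[ℝ] Vec d)
    have hL : ∀ o x, L o x = l o (A.symm x) := fun o x => rfl
    refine isPolytope_of_affine L (p0 := A (WithLp.toLp 2 fun _ => 1 / ((d : ℝ) + 1))) ?_ ?_ ?_
    · rw [himg]
      ext x
      simp only [MeshKind.ref, mem_ofPred_eq, hL, Option.forall, hl0, hl1]
      constructor
      · rintro ⟨h1, h2⟩; exact ⟨by linarith, h1⟩
      · rintro ⟨h1, h2⟩; exact ⟨h2, by linarith⟩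
    · intro o
      rw [hL, AffineEquiv.symm_apply_apply]
      cases o with
      | none =>
        rw [hl0]
        simp only [Finset.sum_const, Finset.card_univ, Fintype.card_fin, nsmul_eq_mul]
        rw [sub_pos, mul_one_div, div_lt_one (by positivity)]; linarith
      | some i => rw [hl1]; positivity
    · intro o
      cases o with
      | none =>
        refine ⟨A (WithLp.toLp 2 fun _ => 1 / (d : ℝ)), ?_, ?_⟩
        · rw [hL, AffineEquiv.symm_apply_apply, hl0]
          simp only [Finset.sum_const, Finset.card_univ, Fintype.card_fin, nsmul_eq_mul]
          field_simp; simp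
        · intro k hk
          cases k with
          | none => exact absurd rfl hk
          | some i => rw [hL, AffineEquiv.symm_apply_apply, hl1]; positivity
      | some i =>
        refine ⟨A (WithLp.toLp 2 fun j => if j = i then 0 else 1 / ((d : ℝ) + 1)), ?_, ?_⟩
        · rw [hL, AffineEquiv.symm_apply_apply, hl1]; simp
        · intro k hk
          cases k with
          | none =>
            rw [hL, AffineEquiv.symm_apply_apply, hl0, sub_pos]
            calc ∑ j, (if j = i then (0 : ℝ) else 1 / ((d : ℝ) + 1))
                ≤ ∑ j : Fin d, 1 / ((d : ℝ) + 1) := by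
                  refine Finset.sum_le_sum fun j _ => ?_
                  split_ifs
                  · positivity
                  · exact le_rfl
              _ < 1 := by
                  simp only [Finset.sum_const, Finset.card_univ, Fintype.card_fin, nsmul_eq_mul]
                  rw [mul_one_div, div_lt_one (by positivity)]; linarith
          | some j =>
            rw [hL, AffineEquiv.symm_apply_apply, hl1]
            have : j ≠ i := fun h => hk (by rw [h])
            simp only [this, if_false]; positivity
  | tensorProduct =>
    let l : Fin d × Bool → Vec d →ᵃ[ℝ] ℝ := fun o =>
      if o.2 then AffineMap.const ℝ (Vec d) 1 - co o.1 else co o.1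
    have hl0 : ∀ i x, l (i, true) x = 1 - x i := fun i x => by simp [l, hco]
    have hl1 : ∀ i x, l (i, false) x = x i := fun i x => by simp [l, hco]
    let L : Fin d × Bool → Vec d →ᵃ[ℝ] ℝ := fun o => (l o).comp (A.symm : Vec d →ᵃ[ℝ] Vec d)
    have hL : ∀ o x, L o x = l o (A.symm x) := fun o x => rfl
    refine isPolytope_of_affine L (p0 := A (WithLp.toLp 2 fun _ => 1 / 2)) ?_ ?_ ?_
    · rw [himg]
      ext x
      simp only [MeshKind.ref, mem_ofPred_eq, hL, Prod.forall, Bool.forall_bool, hl0, hl1]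
      refine forall_congr' fun i => and_congr_right fun _ => ⟨fun h => by linarith, fun h => by linarith⟩
    · rintro ⟨i, b⟩
      rw [hL, AffineEquiv.symm_apply_apply]
      cases b
      · rw [hl1]; norm_num
      · rw [hl0]; norm_num
    · rintro ⟨i, b⟩
      refine ⟨A (WithLp.toLp 2 fun j => if j = i then (if b then 1 else 0) else 1 / 2), ?_, ?_⟩
      · rw [hL, AffineEquiv.symm_apply_apply]
        cases b
        · rw [hl1]; simp
        · rw [hl0]; simp
      · rintro ⟨k, b'⟩ hk
        rw [hL, AffineEquiv.symm_apply_apply]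
        by_cases hki : k = i
        · subst hki
          cases b <;> cases b'
          · exact absurd rfl hk
          · rw [hl0]; simp
          · rw [hl1]; simp
          · exact absurd rfl hk
        · cases b'
          · rw [hl1]; simp [hki]
          · rw [hl0]; simp only [hki, if_false]; norm_num

/-- By convexity, the homothety with centre `x` and ratio `r / D` maps `K` into itself, and into
`B_r(x)` if `D` exceeds the diameter. Its image has volume `(r / D) ^ d * |K|`, with constants
independent of `x`. -/
theorem volume_image_homothety_le {K : Set (Vec d)} (hK : Convex ℝ K) (hb : Bornology.IsBounded K)
    (hi : (interior K).Nonempty) : ∃ a : ℝ, ∀ x ∈ K, DensityBound K x a := by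
  obtain ⟨R0, hR0⟩ := hb.subset_closedBall 0
  set R : ℝ := max R0 0 with hR
  have hR1 : 0 ≤ R := le_max_right _ _
  -- The summand `1` makes the image fit into the open ball, and makes the ratio at most one for
  -- radii up to one.
  set D : ℝ := 2 * R + 1 with hD
  have hD1 : 1 ≤ D := by linarith
  have hvol : volume K ≠ ⊤ := hb.measure_lt_top.ne
  have hvol0 : volume K ≠ 0 :=
    ((isOpen_interior.measure_pos volume hi).trans_le (measure_mono interior_subset)).ne'
  have hvp : 0 < (volume K).toReal := ENNReal.toReal_pos hvol0 hvol
  refine ⟨(volume K).toReal / D ^ d, fun x hx => ⟨by positivity, fun r hr => ?_⟩⟩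
  have hr0 := hr.1
  have hle : r / D ≤ 1 := by rw [div_le_one (by linarith)]; exact hr.2.trans hD1
  have hsub : AffineMap.homothety x (r / D) '' K ⊆ Metric.ball x r ∩ K := by
    rintro _ ⟨y, hy, rfl⟩
    have hxn : ‖x‖ ≤ R := (mem_closedBall_zero_iff.1 (hR0 hx)).trans (le_max_left _ _)
    have hyn : ‖y‖ ≤ R := (mem_closedBall_zero_iff.1 (hR0 hy)).trans (le_max_left _ _)
    rw [AffineMap.homothety_apply, vsub_eq_sub, vadd_eq_add]
    refine ⟨?_, ?_⟩
    · rw [Metric.mem_ball, dist_eq_norm, add_sub_cancel_right, norm_smul,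
        Real.norm_of_nonneg (by positivity)]
      have h1 : ‖y - x‖ ≤ 2 * R := (norm_sub_le _ _).trans (by linarith)
      calc r / D * ‖y - x‖ ≤ r / D * (2 * R) := by gcongr
        _ < r / D * D := by gcongr; linarith
        _ = r := by field_simp
    · have := hK hx hy (sub_nonneg.2 hle) (by positivity : 0 ≤ r / D) (by ring)
      convert this using 1
      rw [smul_sub, sub_smul, one_smul]; abel
  refine le_trans (le_of_eq ?_) (measure_mono hsub)
  rw [Measure.addHaar_image_homothety, finrank_euclideanSpace_fin, abs_of_nonneg (by positivity)]
  conv_rhs => rw [← ENNReal.ofReal_toReal hvol]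
  rw [← ENNReal.ofReal_mul (by positivity)]
  congr 1
  rw [div_pow]; ring

end Polytope

/-! ### Local geometry of the mesh away from the ridges -/

theorem exists_inner_lt_of_mem_interior {d : ℕ} {K : Set (Vec d)} {z n : Vec d}
    (hz : z ∈ interior K) (hn : n ≠ 0) : ∃ y ∈ K, inner ℝ n z < inner ℝ n y := by
  have h1 : ∀ᶠ t in 𝓝 (0 : ℝ), z + t • n ∈ K := by
    have hc : Tendsto (fun t : ℝ => z + t • n) (𝓝 0) (𝓝 z) := by
      have : Continuous fun t : ℝ => z + t • n := by fun_prop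
      simpa using this.tendsto 0
    exact hc.eventually (mem_interior_iff_mem_nhds.1 hz)
  obtain ⟨t, ht, ht0⟩ := ((h1.filter_mono nhdsWithin_le_nhds).and
    (self_mem_nhdsWithin : Ioi (0 : ℝ) ∈ 𝓝[>] 0)).exists
  have ht0' : (0 : ℝ) < t := ht0
  refine ⟨_, ht, ?_⟩
  rw [inner_add_right, inner_smul_right, real_inner_self_eq_norm_sq]
  have : 0 < ‖n‖ := norm_pos_iff.2 hn
  have : 0 < t * ‖n‖ ^ 2 := by positivity
  linarith

theorem ne_zero_of_norm_eq_one {d : ℕ} {n : Vec d} (hn : ‖n‖ = 1) : n ≠ 0 := by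
  rintro rfl; simp at hn

namespace Mesh

variable {d : ℕ} {kind : MeshKind} {Ω : Set (Vec d)} (M : Mesh kind Ω)

open Classical in
/-- The value of `⟪n_F, ·⟫` on `F`. -/
def offset (F : Set (Vec d)) : ℝ :=
  if h : F.Nonempty then inner ℝ (M.normal F) h.some else 0

/-- The signed distance to the hyperplane spanned by `F`, positive in direction of `n_F`. -/
def lev (F : Set (Vec d)) (x : Vec d) : ℝ := inner ℝ (M.normal F) x - M.offset F

/-- The union of the intersections of nonparallel facet hyperplanes. -/
def ridges : Set (Vec d) :=
  {x | ∃ F ∈ M.facets, ∃ F' ∈ M.facets,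
    M.normal F' ∉ (ℝ ∙ M.normal F) ∧ M.lev F x = 0 ∧ M.lev F' x = 0}

variable {M}

theorem isPolytope (hd : 2 ≤ d) {K : Set (Vec d)} (hK : K ∈ M.elements) : IsPolytope K := by
  obtain ⟨A, rfl⟩ := M.isElement K hK
  exact isPolytope_image_ref (by omega) kind A

theorem subset_closure {K : Set (Vec d)} (hK : K ∈ M.elements) : K ⊆ closure Ω := by
  rw [M.cover]
  exact subset_biUnion_of_mem (u := fun K => K) (Finset.mem_coe.2 hK)

theorem interior_subset_domain (hΩ : interior (closure Ω) = Ω) {K : Set (Vec d)}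
    (hK : K ∈ M.elements) : interior K ⊆ Ω := by
  rw [← hΩ]; exact interior_mono (M.subset_closure hK)

theorem isBounded (hb : Bornology.IsBounded Ω) {K : Set (Vec d)} (hK : K ∈ M.elements) :
    Bornology.IsBounded K := hb.closure.subset (M.subset_closure hK)

theorem norm_normal {F : Set (Vec d)} (hF : F ∈ M.facets) : ‖M.normal F‖ = 1 :=
  (M.isFacet_plus F hF).1

theorem facet_nonempty (hd : 2 ≤ d) {F : Set (Vec d)} (hF : F ∈ M.facets) : F.Nonempty :=
  (M.isFacet_plus F hF).nonempty hd

theorem lev_eq_zero {F : Set (Vec d)} (hF : F ∈ M.facets) {x : Vec d} (hx : x ∈ F) :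
    M.lev F x = 0 := by
  have h : F.Nonempty := ⟨x, hx⟩
  rw [lev, offset, dif_pos h, sub_eq_zero]
  exact (M.isFacet_plus F hF).inner_eq hx h.some_mem

theorem lev_eq_inner_sub {F : Set (Vec d)} (hF : F ∈ M.facets) {x : Vec d} (hx : x ∈ F)
    (y : Vec d) : M.lev F y = inner ℝ (M.normal F) y - inner ℝ (M.normal F) x := by
  have := M.lev_eq_zero hF hx
  rw [lev] at this ⊢
  linarith

theorem continuous_lev (F : Set (Vec d)) : Continuous (M.lev F) := by
  unfold lev; fun_prop

theorem isClosed_facet (hd : 2 ≤ d) {F : Set (Vec d)} (hF : F ∈ M.facets) : IsClosed F := by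
  have h := M.isFacet_plus F hF
  obtain ⟨x, hx⟩ := M.facet_nonempty hd hF
  have : F = M.plus F ∩ {y | inner ℝ (M.normal F) y = inner ℝ (M.normal F) x} := by
    ext y
    constructor
    · exact fun hy => ⟨h.subset hy, h.inner_eq hy hx⟩
    · rintro ⟨hy, hy'⟩
      rw [h.2.1]
      exact ⟨hy, fun z hz => (h.inner_le hx hz).trans hy'.ge⟩
  rw [this]
  exact (M.isPolytope hd (M.plus_mem F hF)).isClosed.inter
    (isClosed_eq (by fun_prop) continuous_const)

theorem facet_mem_facets {K F : Set (Vec d)} {n : Vec d} (hK : K ∈ M.elements)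
    (h : IsFacet K n F) : F ∈ M.facets := (M.mem_facets F).2 ⟨K, hK, n, h⟩

theorem normal_eq_or {K F : Set (Vec d)} {n : Vec d} (hK : K ∈ M.elements)
    (h : IsFacet K n F) : n = M.normal F ∨ n = -M.normal F :=
  (M.isFacet_plus F (M.facet_mem_facets hK h)).normal_eq_or h

theorem not_isFacet_neg (hd : 2 ≤ d) {K F F' : Set (Vec d)} {n : Vec d} {x : Vec d}
    (hK : K ∈ M.elements) (h : IsFacet K n F) (hx : x ∈ F) (hx' : x ∈ F') : ¬ IsFacet K (-n) F' := by
  intro h'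
  obtain ⟨p, hp⟩ := (M.isPolytope hd hK).interior_nonempty
  obtain ⟨y, hy, hlt⟩ := exists_inner_lt_of_mem_interior hp (ne_zero_of_norm_eq_one h.1)
  have h1 := h.inner_le hx hy
  have h2 := h'.inner_le hx' (interior_subset hp)
  rw [inner_neg_left, inner_neg_left] at h2
  linarith

/-- Off the ridges, two facets of an element through one point have parallel normals. Opposite
normals would squeeze the element into a hyperplane, although it has interior points; and equal
normals determine the facet. -/
theorem isFacet_unique (hd : 2 ≤ d) {K F F' : Set (Vec d)} {n n' : Vec d} {x : Vec d}
    (hK : K ∈ M.elements) (h : IsFacet K n F) (h' : IsFacet K n' F') (hx : x ∈ F) (hx' : x ∈ F')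
    (hr : x ∉ M.ridges) : F' = F ∧ n' = n := by
  have hF := M.facet_mem_facets hK h
  have hF' := M.facet_mem_facets hK h'
  have hpar : n' ∈ (ℝ ∙ n) := by
    by_contra hc
    refine hr ⟨F, hF, F', hF', ?_, M.lev_eq_zero hF hx, M.lev_eq_zero hF' hx'⟩
    rcases M.normal_eq_or hK h with h1 | h1 <;> rcases M.normal_eq_or hK h' with h2 | h2 <;>
      simpa [h1, h2, ← Set.neg_singleton, Submodule.span_neg] using hc
  rcases eq_or_eq_neg_of_mem_span h.1 h'.1 hpar with rfl | rfl
  · exact ⟨h'.2.1.trans h.2.1.symm, rfl⟩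
  · exact absurd h' (M.not_isFacet_neg hd hK h hx hx')

/-- A facet inequality that is strict at `x` stays so nearby, and only finitely many pairs of a
facet and a normal have to be considered. -/
theorem eventually_inner_le (hd : 2 ≤ d) {K : Set (Vec d)} {x : Vec d} (hK : K ∈ M.elements)
    (hx : x ∈ K) : ∀ᶠ y in 𝓝 x, ∀ n F, IsFacet K n F → x ∉ F →
      ∃ z ∈ F, inner ℝ n y ≤ inner ℝ n z := by
  have key : ∀ F ∈ M.facets, ∀ n : Vec d, ∀ᶠ y in 𝓝 x, IsFacet K n F → x ∉ F →
      ∃ z ∈ F, inner ℝ n y ≤ inner ℝ n z := by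
    intro F hF n
    by_cases h : IsFacet K n F ∧ x ∉ F
    · obtain ⟨h, hxF⟩ := h
      obtain ⟨z, hz⟩ := h.nonempty hd
      have hlt : inner ℝ n x < inner ℝ n z := by
        refine lt_of_le_of_ne (h.inner_le hz hx) fun he => hxF ?_
        rw [h.2.1]
        exact ⟨hx, fun y hy => (h.inner_le hz hy).trans he.ge⟩
      have hc : Continuous fun y : Vec d => (inner ℝ n y : ℝ) := by fun_prop
      exact (hc.continuousAt.eventually (gt_mem_nhds hlt)).mono fun y hy _ _ => ⟨z, hz, hy.le⟩
    · exact Eventually.of_forall fun y h1 h2 => absurd ⟨h1, h2⟩ h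
  have h1 := (Filter.eventually_all_finset M.facets).2 fun F hF => key F hF (M.normal F)
  have h2 := (Filter.eventually_all_finset M.facets).2 fun F hF => key F hF (-M.normal F)
  filter_upwards [h1, h2] with y hy1 hy2 n F h hxF
  have hF := M.facet_mem_facets hK h
  rcases M.normal_eq_or hK h with rfl | rfl
  · exact hy1 F hF h hxF
  · exact hy2 F hF h hxF

/-- If no facet contained `x`, all facet inequalities would persist in a neighbourhood of `x`; as
they cut out `K`, the point would be interior. -/
theorem exists_facet_of_notMem_interior (hd : 2 ≤ d) {K : Set (Vec d)} {x : Vec d}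
    (hK : K ∈ M.elements) (hx : x ∈ K) (hxi : x ∉ interior K) : ∃ n F, IsFacet K n F ∧ x ∈ F := by
  by_contra! hc
  refine hxi (mem_interior_iff_mem_nhds.2 ?_)
  filter_upwards [M.eventually_inner_le hd hK hx] with y hy
  by_contra hyK
  obtain ⟨n, F, h, hlt⟩ := (M.isPolytope hd hK).facets y hyK
  obtain ⟨z, hz, hle⟩ := hy n F h (hc n F h)
  exact absurd (hlt z hz) (not_lt.2 hle)

/-- Near a point of the relative interior of a facet, an element is a half space. -/
theorem eventually_mem_element (hd : 2 ≤ d) {K F : Set (Vec d)} {n : Vec d} {x : Vec d}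
    (hK : K ∈ M.elements) (h : IsFacet K n F) (hx : x ∈ F) (hr : x ∉ M.ridges) :
    ∀ᶠ y in 𝓝 x, (y ∈ K ↔ inner ℝ n y ≤ inner ℝ n x) := by
  filter_upwards [M.eventually_inner_le hd hK (h.subset hx)] with y hy
  refine ⟨fun hyK => h.inner_le hx hyK, fun hle => ?_⟩
  by_contra hyK
  obtain ⟨n', F', h', hlt⟩ := (M.isPolytope hd hK).facets y hyK
  by_cases hx' : x ∈ F'
  · obtain ⟨rfl, rfl⟩ := M.isFacet_unique hd hK h h' hx hx' hr
    exact absurd (hlt x hx) (not_lt.2 hle)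
  · obtain ⟨z, hz, hle'⟩ := hy n' F' h' hx'
    exact absurd (hlt z hz) (not_lt.2 hle')

/-- A linear functional that attains its maximum over `K` at an interior point is zero, so it
exposes all of `K`. -/
theorem eq_of_isExposed {K B : Set (Vec d)} (h : IsExposed ℝ K B) {z : Vec d}
    (hz : z ∈ interior K) (hzB : z ∈ B) : B = K := by
  obtain ⟨l, hl⟩ := h ⟨z, hzB⟩
  set a : Vec d := (InnerProductSpace.toDual ℝ (Vec d)).symm l with ha
  have hla : ∀ v, l v = inner ℝ a v := fun v => by
    rw [ha, InnerProductSpace.toDual_symm_apply]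
  have hz' := hzB
  rw [hl] at hz'
  have ha0 : a = 0 := by
    by_contra h0
    obtain ⟨y, hy, hlt⟩ := exists_inner_lt_of_mem_interior hz h0
    rw [← hla, ← hla] at hlt
    exact absurd (hz'.2 y hy) (not_le.2 hlt)
  rw [hl]
  ext x
  simp [hla, ha0]

/-- The common face of two different elements would contain an interior point of `K`, hence be all
of `K`. Then `K ⊆ K'`, and the same argument on the other side gives equality. -/
theorem eq_of_mem_interior (hd : 2 ≤ d) {K K' : Set (Vec d)} {z : Vec d} (hK : K ∈ M.elements)
    (hK' : K' ∈ M.elements) (hz : z ∈ interior K) (hz' : z ∈ K') : K = K' := by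
  by_contra hne
  have h := M.conforming K hK K' hK' hne
  have h1 := eq_of_isExposed h.1 hz ⟨interior_subset hz, hz'⟩
  have hsub : K ⊆ K' := inter_eq_left.1 h1
  have h2 := eq_of_isExposed h.2 (interior_mono hsub hz) ⟨interior_subset hz, hz'⟩
  exact hne (h1.symm.trans h2)

/-- Two elements that coincide near `x` with the same half space share interior points. -/
theorem eq_of_eventually {K K' : Set (Vec d)} {n x : Vec d} (hd : 2 ≤ d) (hn : n ≠ 0)
    (hK : K ∈ M.elements) (hK' : K' ∈ M.elements)
    (h : ∀ᶠ y in 𝓝 x, (y ∈ K ↔ inner ℝ n y ≤ inner ℝ n x))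
    (h' : ∀ᶠ y in 𝓝 x, (y ∈ K' ↔ inner ℝ n y ≤ inner ℝ n x)) : K = K' := by
  have hc : Tendsto (fun t : ℝ => x - t • n) (𝓝[>] 0) (𝓝 x) := by
    have : Continuous fun t : ℝ => x - t • n := by fun_prop
    simpa using (this.tendsto 0).mono_left nhdsWithin_le_nhds
  obtain ⟨t, ⟨h1, h2⟩, ht⟩ := ((hc.eventually (h.eventually_nhds.and h')).and
    (self_mem_nhdsWithin : Ioi (0 : ℝ) ∈ 𝓝[>] 0)).exists
  have ht0 : (0 : ℝ) < t := ht
  have hlt : inner ℝ n (x - t • n) < inner ℝ n x := by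
    rw [inner_sub_right, inner_smul_right, real_inner_self_eq_norm_sq]
    have : 0 < ‖n‖ := norm_pos_iff.2 hn
    have : 0 < t * ‖n‖ ^ 2 := by positivity
    linarith
  refine M.eq_of_mem_interior hd hK hK' (z := x - t • n) ?_ (h2.2 hlt.le)
  rw [mem_interior_iff_mem_nhds]
  have hcont : Continuous fun y : Vec d => (inner ℝ n y : ℝ) := by fun_prop
  filter_upwards [h1, hcont.continuousAt.eventually (gt_mem_nhds hlt)] with y hy hy'
  exact hy.2 hy'.le

variable {F : Set (Vec d)} {x : Vec d}

theorem eventually_mem_plus (hd : 2 ≤ d) (hF : F ∈ M.facets) (hx : x ∈ F) (hr : x ∉ M.ridges) :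
    ∀ᶠ y in 𝓝 x, (y ∈ M.plus F ↔ M.lev F y ≤ 0) := by
  filter_upwards [M.eventually_mem_element hd (M.plus_mem F hF) (M.isFacet_plus F hF) hx hr] with y hy
  rw [hy, M.lev_eq_inner_sub hF hx, sub_nonpos]

/-- The normal of the second element at `F` is `±n_F`. With the plus sign both elements would be the
same half space near `x`, hence equal, against `minus_ne`. -/
theorem eventually_mem_minus (hd : 2 ≤ d) (hF : F ∈ M.facets) (hi : ¬ F ⊆ frontier Ω) (hx : x ∈ F)
    (hr : x ∉ M.ridges) :
    IsFacet (M.minus F) (-M.normal F) F ∧ ∀ᶠ y in 𝓝 x, (y ∈ M.minus F ↔ 0 ≤ M.lev F y) := by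
  obtain ⟨n, hn⟩ := M.isFacet_minus F hF hi
  have hm := M.minus_mem F hF hi
  have h := M.eventually_mem_element hd hm hn hx hr
  rcases M.normal_eq_or hm hn with rfl | rfl
  · exact absurd (M.eq_of_eventually hd (ne_zero_of_norm_eq_one hn.1) hm (M.plus_mem F hF) h
      (M.eventually_mem_element hd (M.plus_mem F hF) (M.isFacet_plus F hF) hx hr)) (M.minus_ne F hF hi)
  · refine ⟨hn, ?_⟩
    filter_upwards [h] with y hy
    rw [hy, M.lev_eq_inner_sub hF hx, inner_neg_left, inner_neg_left, sub_nonneg, neg_le_neg_iff]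

/-- Two opposite half spaces fill a neighbourhood of `x`, and a domain that equals the interior of
its closure has no slits. -/
theorem mem_domain_of_eventually (hΩ : interior (closure Ω) = Ω) {K K' : Set (Vec d)} {n : Vec d}
    (hK : K ∈ M.elements) (hK' : K' ∈ M.elements)
    (h : ∀ᶠ y in 𝓝 x, (y ∈ K ↔ inner ℝ n y ≤ inner ℝ n x))
    (h' : ∀ᶠ y in 𝓝 x, (y ∈ K' ↔ inner ℝ (-n) y ≤ inner ℝ (-n) x)) : x ∈ Ω := by
  rw [← hΩ, mem_interior_iff_mem_nhds]
  filter_upwards [h, h'] with y h1 h2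
  rcases le_total (inner ℝ n y) (inner ℝ n x) with hle | hle
  · exact M.subset_closure hK (h1.2 hle)
  · refine M.subset_closure hK' (h2.2 ?_)
    rwa [inner_neg_left, inner_neg_left, neg_le_neg_iff]

theorem mem_domain_of_interior_facet (hd : 2 ≤ d) (hΩ : interior (closure Ω) = Ω)
    (hF : F ∈ M.facets) (hi : ¬ F ⊆ frontier Ω) (hx : x ∈ F) (hr : x ∉ M.ridges) : x ∈ Ω :=
  M.mem_domain_of_eventually hΩ (M.plus_mem F hF) (M.minus_mem F hF hi)
    (M.eventually_mem_element hd (M.plus_mem F hF) (M.isFacet_plus F hF) hx hr)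
    (M.eventually_mem_element hd (M.minus_mem F hF hi) (M.eventually_mem_minus hd hF hi hx hr).1 hx hr)

theorem notMem_of_subset_frontier (ho : IsOpen Ω) (hb : F ⊆ frontier Ω) (hx : x ∈ F) : x ∉ Ω := by
  have := hb hx
  rw [ho.frontier_eq] at this
  exact this.2

/-- Off the ridges both facets have parallel normals. Equal normals force equal plus elements. For
opposite normals the plus element of `F'` lies beyond `F`: it is the minus element of `F` if `F` is
interior, and for a boundary facet it would put `x` into `Ω`. -/
theorem eq_of_mem_facets (hd : 2 ≤ d) (ho : IsOpen Ω) (hΩ : interior (closure Ω) = Ω)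
    {F' : Set (Vec d)} (hF : F ∈ M.facets) (hF' : F' ∈ M.facets) (hx : x ∈ F) (hx' : x ∈ F')
    (hr : x ∉ M.ridges) : F' = F := by
  have hf := M.isFacet_plus F hF
  have hf' := M.isFacet_plus F' hF'
  have hp := M.plus_mem F hF
  have hp' := M.plus_mem F' hF'
  have h := M.eventually_mem_element hd hp hf hx hr
  have h' := M.eventually_mem_element hd hp' hf' hx' hr
  have hpar : M.normal F' ∈ (ℝ ∙ M.normal F) := by
    by_contra hc
    exact hr ⟨F, hF, F', hF', hc, M.lev_eq_zero hF hx, M.lev_eq_zero hF' hx'⟩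
  rcases eq_or_eq_neg_of_mem_span hf.1 hf'.1 hpar with he | he
  · rw [he] at h' hf'
    have := M.eq_of_eventually hd (ne_zero_of_norm_eq_one hf.1) hp hp' h h'
    rw [← this] at hf'
    exact hf'.2.1.trans hf.2.1.symm
  · rw [he] at h' hf'
    by_cases hi : F ⊆ frontier Ω
    · exact absurd (M.mem_domain_of_eventually hΩ hp hp' h h') (notMem_of_subset_frontier ho hi hx)
    · have hm := M.minus_mem F hF hi
      have hfm := (M.eventually_mem_minus hd hF hi hx hr).1
      have := M.eq_of_eventually hd (ne_zero_of_norm_eq_one hfm.1) hm hp'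
        (M.eventually_mem_element hd hm hfm hx hr) h'
      rw [← this] at hf'
      exact hf'.2.1.trans hfm.2.1.symm

/-- No element other than `M.plus F` contains `x`: it would have `F` itself as a facet, so it would
either fill the same half space and be the plus element, or fill the opposite one and put `x` into
the interior of the domain. -/
theorem eventually_mem_closure_domain (hd : 2 ≤ d) (ho : IsOpen Ω) (hΩ : interior (closure Ω) = Ω)
    (hF : F ∈ M.facets) (hb : F ⊆ frontier Ω) (hx : x ∈ F) (hr : x ∉ M.ridges) :
    ∀ᶠ y in 𝓝 x, (y ∈ closure Ω ↔ M.lev F y ≤ 0) := by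
  have hp := M.plus_mem F hF
  have hf := M.isFacet_plus F hF
  have h := M.eventually_mem_element hd hp hf hx hr
  have hxΩ := notMem_of_subset_frontier ho hb hx
  have hothers : ∀ K ∈ M.elements, ∀ᶠ y in 𝓝 x, K ≠ M.plus F → y ∉ K := by
    intro K hK
    by_cases hKp : K = M.plus F
    · exact Eventually.of_forall fun y hy => absurd hKp hy
    by_cases hxK : x ∈ K
    · exfalso
      have hxi : x ∉ interior K := fun hx' => hxΩ (M.interior_subset_domain hΩ hK hx')
      obtain ⟨n, F', hf', hx'⟩ := M.exists_facet_of_notMem_interior hd hK hxK hxi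
      obtain rfl := M.eq_of_mem_facets hd ho hΩ hF (M.facet_mem_facets hK hf') hx hx' hr
      have h' := M.eventually_mem_element hd hK hf' hx hr
      rcases hf.normal_eq_or hf' with rfl | rfl
      · exact hKp (M.eq_of_eventually hd (ne_zero_of_norm_eq_one hf.1) hK hp h' h)
      · exact hxΩ (M.mem_domain_of_eventually hΩ hp hK h h')
    · filter_upwards [(M.isPolytope hd hK).isClosed.isOpen_compl.mem_nhds hxK] with y hy _ using hy
  filter_upwards [M.eventually_mem_plus hd hF hx hr,
    (Filter.eventually_all_finset M.elements).2 hothers] with y hy hy'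
  rw [← hy, M.cover, mem_iUnion₂]
  constructor
  · rintro ⟨K, hK, hyK⟩
    by_contra hc
    exact hy' K hK (by rintro rfl; exact hc hyK) hyK
  · exact fun h => ⟨_, hp, h⟩

theorem lev_add_smul (hF : F ∈ M.facets) (x : Vec d) (t : ℝ) :
    M.lev F (x + t • M.normal F) = M.lev F x + t := by
  rw [lev, lev, inner_add_right, inner_smul_right, real_inner_self_eq_norm_sq, M.norm_normal hF]
  ring

theorem eventually_mem_domain (hd : 2 ≤ d) (ho : IsOpen Ω) (hΩ : interior (closure Ω) = Ω)
    (hF : F ∈ M.facets) (hb : F ⊆ frontier Ω) (hx : x ∈ F) (hr : x ∉ M.ridges) :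
    ∀ᶠ y in 𝓝 x, (y ∈ Ω ↔ M.lev F y < 0) := by
  filter_upwards [(M.eventually_mem_closure_domain hd ho hΩ hF hb hx hr).eventually_nhds] with y hy
  constructor
  · intro hyΩ
    -- A point of `Ω` on the hyperplane itself could be pushed outwards without leaving the open set
    -- `Ω`, contradicting the description of the closure.
    have hc : Tendsto (fun t : ℝ => y + t • M.normal F) (𝓝[>] 0) (𝓝 y) := by
      have : Continuous fun t : ℝ => y + t • M.normal F := by fun_prop
      simpa using (this.tendsto 0).mono_left nhdsWithin_le_nhds
    obtain ⟨t, ⟨h1, h2⟩, ht⟩ := ((hc.eventually (hy.and (ho.mem_nhds hyΩ))).and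
      (self_mem_nhdsWithin : Ioi (0 : ℝ) ∈ 𝓝[>] 0)).exists
    have ht0 : (0 : ℝ) < t := ht
    have := h1.1 (_root_.subset_closure h2)
    rw [M.lev_add_smul hF] at this
    linarith
  · intro hlt
    rw [← hΩ, mem_interior_iff_mem_nhds]
    filter_upwards [hy, (M.continuous_lev F).continuousAt.eventually (gt_mem_nhds hlt)] with z hz hz'
    exact hz.2 hz'.le

theorem eventually_mem_facet (hd : 2 ≤ d) (hF : F ∈ M.facets) (hx : x ∈ F) (hr : x ∉ M.ridges) :
    ∀ᶠ y in 𝓝 x, (y ∈ F ↔ M.lev F y = 0) := by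
  have hf := M.isFacet_plus F hF
  filter_upwards [M.eventually_mem_plus hd hF hx hr] with y hy
  refine ⟨fun h => M.lev_eq_zero hF h, fun h => ?_⟩
  rw [hf.2.1]
  refine ⟨hy.2 h.le, fun z hz => ?_⟩
  have := hf.inner_le hx hz
  rw [M.lev_eq_inner_sub hF hx] at h
  linarith

theorem notMem_facet_of_mem_interior (hd : 2 ≤ d) {K : Set (Vec d)} (hK : K ∈ M.elements)
    (hF : F ∈ M.facets) (hx : x ∈ interior K) : x ∉ F := by
  intro hxF
  have hf := M.isFacet_plus F hF
  obtain rfl := M.eq_of_mem_interior hd hK (M.plus_mem F hF) hx (hf.subset hxF)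
  obtain ⟨y, hy, hlt⟩ := exists_inner_lt_of_mem_interior hx (ne_zero_of_norm_eq_one hf.1)
  exact absurd (hf.inner_le hxF hy) (not_le.2 hlt)

/-- Of two nonparallel facet hyperplanes, at least one is not parallel to `F`, and it meets the
hyperplane of `F` in a null set. -/
theorem surf_ridges (hF : F ∈ M.facets) : surf (M.normal F) (M.offset F) M.ridges = 0 := by
  have hsub : M.ridges ⊆ ⋃ F1 ∈ {F1 ∈ (M.facets : Set (Set (Vec d))) |
      M.normal F1 ∉ (ℝ ∙ M.normal F)}, {x | inner ℝ (M.normal F1) x = M.offset F1} := by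
    rintro x ⟨F1, h1, F2, h2, hpar, hl1, hl2⟩
    by_cases hc : M.normal F1 ∈ (ℝ ∙ M.normal F)
    · refine mem_iUnion₂.2 ⟨F2, ⟨h2, fun hc2 => hpar ?_⟩, sub_eq_zero.1 hl2⟩
      have : M.normal F ∈ (ℝ ∙ M.normal F1) := by
        rcases eq_or_eq_neg_of_mem_span (M.norm_normal hF) (M.norm_normal h1) hc with h | h
        · rw [h]; exact Submodule.mem_span_singleton_self _
        · rw [h, ← Set.neg_singleton, Submodule.span_neg]; exact Submodule.mem_span_singleton_self _
      exact (Submodule.span_singleton_le_iff_mem _ _).2 this hc2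
    · exact mem_iUnion₂.2 ⟨F1, ⟨h1, hc⟩, sub_eq_zero.1 hl1⟩
  refine measure_mono_null hsub ((measure_biUnion_null_iff
    ((M.facets.finite_toSet.subset (sep_subset _ _)).countable)).2 fun F1 h1 => ?_)
  exact surf_hyperplane_eq_zero h1.2 _ _

end Mesh

/-! ### Functionals on test functions: localisation and removal of sets -/

section Localization
variable {E : Type*} [NormedAddCommGroup E] [NormedSpace ℝ E]

theorem IsTest.mul_left {U V : Set E} {φ χ : E → ℝ} (hφ : IsTest U φ) (hχ : ContDiff ℝ ∞ χ)
    (hV : tsupport φ ∩ tsupport χ ⊆ V) : IsTest V fun x => χ x * φ x :=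
  ⟨hχ.mul hφ.1, hφ.2.1.mul_left,
    (subset_inter tsupport_mul_subset_right tsupport_mul_subset_left).trans hV⟩

theorem IsTest.zero (U : Set E) {G : Type*} [NormedAddCommGroup G] [NormedSpace ℝ G] :
    IsTest U (0 : E → G) :=
  ⟨contDiff_const, HasCompactSupport.zero, by rw [tsupport, Function.support_zero, closure_empty]; exact empty_subset _⟩

theorem IsTest.add {U : Set E} {G : Type*} [NormedAddCommGroup G] [NormedSpace ℝ G] {φ ψ : E → G}
    (hφ : IsTest U φ) (hψ : IsTest U ψ) : IsTest U (φ + ψ) := by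
  refine ⟨hφ.1.add hψ.1, hφ.2.1.add hψ.2.1, (tsupport_add φ ψ).trans (union_subset hφ.2.2 hψ.2.2)⟩

/-- A linear functional on test functions vanishes if it vanishes locally. -/
theorem eq_zero_of_locally [FiniteDimensional ℝ E] (I : (E → ℝ) → ℝ) (h0 : I 0 = 0)
    (hadd : ∀ φ ψ, IsTest univ φ → IsTest univ ψ → I (φ + ψ) = I φ + I ψ) {φ : E → ℝ}
    (hφ : IsTest univ φ)
    (h : ∀ x ∈ tsupport φ, ∃ U, IsOpen U ∧ x ∈ U ∧ ∀ ψ, IsTest U ψ → I ψ = 0) : I φ = 0 := by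
  choose! U hUo hxU hU using h
  obtain ⟨t, hcov⟩ := hφ.2.1.elim_nhds_subcover' (fun x _ => U x)
    fun x hx => (hUo x hx).mem_nhds (hxU x hx)
  obtain ⟨f, hf⟩ := SmoothPartitionOfUnity.exists_isSubordinate (modelWithCornersSelf ℝ E)
    (isClosed_tsupport φ) (fun x : t => U x.1.1) (fun x => hUo _ x.1.2) (by
      intro (x : E) hx
      obtain ⟨y, hy, hxy⟩ := mem_iUnion₂.1 (show x ∈ ⋃ y ∈ t, U y.1 from hcov hx)
      exact mem_iUnion.2 ⟨⟨y, hy⟩, hxy⟩)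
  have hterm : ∀ i, IsTest (U i.1.1) fun x => f i x * φ x := fun i =>
    hφ.mul_left (f i).contMDiff.contDiff (inter_subset_right.trans (hf i))
  have hsum : φ = ∑ i, fun x => f i x * φ x := by
    ext x
    rw [Finset.sum_apply, ← Finset.sum_mul]
    by_cases hx : x ∈ tsupport φ
    · have := f.sum_eq_one hx
      rw [finsum_eq_sum_of_fintype] at this
      rw [this, one_mul]
    · rw [image_eq_zero_of_notMem_tsupport hx, mul_zero]
  have key : ∀ s : Finset t, IsTest univ (∑ i ∈ s, fun x => f i x * φ x) ∧
      I (∑ i ∈ s, fun x => f i x * φ x) = 0 := by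
    classical
    intro s
    induction s using Finset.induction_on with
    | empty => exact ⟨by rw [Finset.sum_empty]; exact IsTest.zero _, by rw [Finset.sum_empty]; exact h0⟩
    | insert i s hi ih =>
      have h1 := (hterm i).mono (subset_univ _)
      rw [Finset.sum_insert hi]
      refine ⟨h1.add ih.1, ?_⟩
      rw [hadd _ _ h1 ih.1, ih.2, hU _ i.1.2 _ (hterm i), add_zero]
  rw [hsum]
  exact (key Finset.univ).2

/-- A functional on test functions vanishes if it vanishes away from finitely many sets which are
removable one at a time. -/
theorem eq_zero_of_removable {ι : Type*} (I : (E → ℝ) → ℝ) (Z : ι → Set E) (s : Finset ι)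
    (hrem : ∀ i ∈ s, ∀ φ, IsTest univ φ → ∃ φk : ℕ → E → ℝ,
      (∀ k, IsTest univ (φk k) ∧ tsupport (φk k) ⊆ tsupport φ \ Z i) ∧
      Tendsto (fun k => I (φk k)) atTop (𝓝 (I φ)))
    (h : ∀ φ, IsTest univ φ → (∀ i ∈ s, Disjoint (tsupport φ) (Z i)) → I φ = 0)
    {φ : E → ℝ} (hφ : IsTest univ φ) : I φ = 0 := by
  classical
  -- Induction on the set `t` of indices whose `Z i` may still meet the support. Removing one set
  -- only shrinks the support, so disjointness from the sets removed before is kept.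
  have key : ∀ t ⊆ s, ∀ φ, IsTest univ φ → (∀ i ∈ s \ t, Disjoint (tsupport φ) (Z i)) → I φ = 0 := by
    intro t
    induction t using Finset.induction_on with
    | empty => exact fun _ φ hφ hd => h φ hφ fun i hi => hd i (by simpa using hi)
    | insert a t ha ih =>
      intro hts φ hφ hd
      obtain ⟨φk, h1, h2⟩ := hrem a (hts (Finset.mem_insert_self a t)) φ hφ
      refine tendsto_nhds_unique h2 ?_
      have : (fun k => I (φk k)) = fun _ => 0 := by
        ext k
        refine ih (fun i hi => hts (Finset.mem_insert_of_mem hi)) _ (h1 k).1 fun i hi => ?_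
        by_cases hia : i = a
        · subst hia
          exact disjoint_sdiff_left.mono_left (h1 k).2
        · refine (hd i ?_).mono_left ((h1 k).2.trans sdiff_subset)
          simp only [Finset.mem_sdiff, Finset.mem_insert, not_or] at hi ⊢
          exact ⟨hi.1, hia, hi.2⟩
      rw [this]
      exact tendsto_const_nhds
  exact key s subset_rfl φ hφ (by simp)

end Localization

/-! ### Removability of intersections of two hyperplanes -/

section Removability

theorem exists_bound_deriv_smoothTransition :
    ∃ C : ℝ, 0 ≤ C ∧ ∀ x, |deriv Real.smoothTransition x| ≤ C := by
  have hc : Continuous (deriv Real.smoothTransition) :=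
    (Real.smoothTransition.contDiff (n := 1)).continuous_deriv (by simp)
  obtain ⟨C, hC⟩ := (isCompact_Icc (a := (0 : ℝ)) (b := 1)).exists_bound_of_continuousOn hc.continuousOn
  refine ⟨max C 0, le_max_right _ _, fun x => ?_⟩
  rcases lt_or_ge x 0 with h | h
  · have : Real.smoothTransition =ᶠ[𝓝 x] fun _ => 0 := by
      filter_upwards [Iio_mem_nhds h] with y hy
      exact Real.smoothTransition.zero_of_nonpos (le_of_lt (show y < 0 from hy))
    rw [this.deriv_eq]; simp
  rcases lt_or_ge 1 x with h' | h'
  · have : Real.smoothTransition =ᶠ[𝓝 x] fun _ => 1 := by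
      filter_upwards [Ioi_mem_nhds h'] with y hy
      exact Real.smoothTransition.one_of_one_le (le_of_lt (show 1 < y from hy))
    rw [this.deriv_eq]; simp
  · exact (hC x ⟨h, h'⟩).trans (le_max_left _ _)

theorem deriv_smoothTransition_eq_zero {x : ℝ} (hx : x < 0 ∨ 1 < x) :
    deriv Real.smoothTransition x = 0 := by
  rcases hx with h | h'
  · have : Real.smoothTransition =ᶠ[𝓝 x] fun _ => 0 := by
      filter_upwards [Iio_mem_nhds h] with y hy
      exact Real.smoothTransition.zero_of_nonpos (le_of_lt (show y < 0 from hy))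
    rw [this.deriv_eq]; simp
  · have : Real.smoothTransition =ᶠ[𝓝 x] fun _ => 1 := by
      filter_upwards [Ioi_mem_nhds h'] with y hy
      exact Real.smoothTransition.one_of_one_le (le_of_lt (show 1 < y from hy))
    rw [this.deriv_eq]; simp

/-- By Cauchy–Schwarz the integral is at most `C / r` times the `L²` norm of `A` on `S k` times the
square root of a volume `O(r²)`. The powers of `r` cancel, and the `L²` norm over sets shrinking in
measure tends to zero. Square integrability is just enough in codimension two. -/
theorem tendsto_integral_of_concentrated {α G : Type*} [MeasurableSpace α] [NormedAddCommGroup G]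
    {μ : Measure α} {A : α → G} (hA : MemLp A 2 μ) {C : ℝ} (hC : 0 ≤ C) {S : ℕ → Set α}
    (hS : ∀ k, MeasurableSet (S k)) (hvol : ∀ k, μ (S k) ≤ ENNReal.ofReal (C * radius k ^ 2))
    {f : ℕ → α → ℝ} (hf : ∀ k x, |f k x| ≤ (S k).indicator (fun x => C / radius k * ‖A x‖) x) :
    Tendsto (fun k => ∫ x, f k x ∂μ) atTop (𝓝 0) := by
  rw [tendsto_zero_iff_enorm_tendsto_zero]
  have hS0 : Tendsto (μ ∘ S) atTop (𝓝 0) := by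
    refine tendsto_of_tendsto_of_tendsto_of_le_of_le tendsto_const_nhds
      (h := fun k => ENNReal.ofReal (C * radius k ^ 2)) ?_ (fun _ => zero_le) hvol
    have : Tendsto (fun k => C * radius k ^ 2) atTop (𝓝 (C * 0 ^ 2)) :=
      (tendsto_radius.pow 2).const_mul C
    have := ENNReal.tendsto_ofReal this
    simpa using this
  have hfin : ∫⁻ x, ‖A x‖ₑ ^ (2 : ℝ) ∂μ ≠ ⊤ := by
    have := hA.2
    rw [eLpNorm_lt_top_iff_lintegral_rpow_enorm_lt_top (by norm_num) (by norm_num)] at this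
    simpa using this.ne
  have h1 : ∀ k, eLpNorm A 2 (μ.restrict (S k)) = (∫⁻ x in S k, ‖A x‖ₑ ^ (2 : ℝ) ∂μ) ^ (1 / 2 : ℝ) := by
    intro k
    rw [eLpNorm_eq_lintegral_rpow_enorm_toReal (by norm_num) (by norm_num)]
    simp
  have h2 : Tendsto (fun k => eLpNorm A 2 (μ.restrict (S k))) atTop (𝓝 0) := by
    simp_rw [h1]
    have := (ENNReal.continuous_rpow_const (y := (1 / 2 : ℝ))).tendsto 0 |>.comp
      (tendsto_setLIntegral_zero hfin hS0)
    simpa [ENNReal.zero_rpow_of_pos, Function.comp_def] using this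
  have h3 : Tendsto (fun k => ENNReal.ofReal (C * Real.sqrt C) * eLpNorm A 2 (μ.restrict (S k))) atTop
      (𝓝 0) := by
    have := ENNReal.Tendsto.const_mul h2 (Or.inr (ENNReal.ofReal_ne_top (r := C * Real.sqrt C)))
    simpa using this
  refine tendsto_of_tendsto_of_tendsto_of_le_of_le tendsto_const_nhds h3 (fun _ => zero_le) fun k => ?_
  have hr := radius_pos k
  calc ‖∫ x, f k x ∂μ‖ₑ ≤ ∫⁻ x, ‖f k x‖ₑ ∂μ := enorm_integral_le_lintegral_enorm _
    _ ≤ ∫⁻ x, (S k).indicator (fun x => ENNReal.ofReal (C / radius k) * ‖A x‖ₑ) x ∂μ := by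
        refine lintegral_mono fun x => ?_
        have := hf k x
        rw [← ofReal_norm, Real.norm_eq_abs]
        by_cases hx : x ∈ S k
        · rw [indicator_of_mem hx] at this ⊢
          rw [← ofReal_norm, ← ENNReal.ofReal_mul (by positivity)]
          exact ENNReal.ofReal_le_ofReal this
        · rw [indicator_of_notMem hx] at this ⊢
          rw [ENNReal.ofReal_of_nonpos this]
    _ = ENNReal.ofReal (C / radius k) * eLpNorm A 1 (μ.restrict (S k)) := by
        rw [lintegral_indicator (hS k), lintegral_const_mul' _ _ ENNReal.ofReal_ne_top,
          eLpNorm_one_eq_lintegral_enorm]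
    _ ≤ ENNReal.ofReal (C / radius k) * (eLpNorm A 2 (μ.restrict (S k)) *
          (ENNReal.ofReal (C * radius k ^ 2)) ^ (1 / 2 : ℝ)) := by
        gcongr
        refine (eLpNorm_le_eLpNorm_mul_rpow_measure_univ (by norm_num : (1 : ℝ≥0∞) ≤ 2)
          hA.1.restrict).trans ?_
        rw [Measure.restrict_apply_univ]
        gcongr
        have : (1 / (1 : ℝ≥0∞).toReal - 1 / (2 : ℝ≥0∞).toReal) = 1 / 2 := by norm_num
        rw [this]
        exact ENNReal.rpow_le_rpow (hvol k) (by norm_num)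
    _ = ENNReal.ofReal (C * Real.sqrt C) * eLpNorm A 2 (μ.restrict (S k)) := by
        rw [ENNReal.ofReal_rpow_of_nonneg (by positivity) (by norm_num), ← Real.sqrt_eq_rpow,
          Real.sqrt_mul hC, Real.sqrt_sq hr.le, mul_left_comm, ← ENNReal.ofReal_mul (by positivity),
          mul_comm]
        congr 2
        field_simp

variable {d : ℕ}

/-- The functional `φ ↦ ∫ Dφ · A + ∫ φ B + Σ ∫ φ c_i dμ_i`. -/
def firstOrder {ι : Type*} (Ω : Set (Vec d)) (A : Vec d → Vec d) (B : Vec d → ℝ) (s : Finset ι)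
    (m : ι → Measure (Vec d)) (c : ι → Vec d → ℝ) (φ : Vec d → ℝ) : ℝ :=
  (∫ x in Ω, fderiv ℝ φ x (A x)) + (∫ x in Ω, φ x * B x) + ∑ i ∈ s, ∫ x, φ x * c i x ∂(m i)

theorem IsTest.exists_bound {E G : Type*} [NormedAddCommGroup E] [NormedSpace ℝ E]
    [NormedAddCommGroup G] [NormedSpace ℝ G] {U : Set E} {φ : E → G} (h : IsTest U φ) :
    ∃ C, 0 ≤ C ∧ ∀ x, ‖φ x‖ ≤ C := by
  obtain ⟨C, hC⟩ := h.2.1.exists_bound_of_continuous h.continuous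
  exact ⟨C, (norm_nonneg _).trans (hC 0), hC⟩

theorem IsTest.exists_bound_fderiv {E G : Type*} [NormedAddCommGroup E] [NormedSpace ℝ E]
    [NormedAddCommGroup G] [NormedSpace ℝ G] {U : Set E} {φ : E → G} (h : IsTest U φ) :
    ∃ C, 0 ≤ C ∧ ∀ x, ‖fderiv ℝ φ x‖ ≤ C := by
  obtain ⟨C, hC⟩ := (h.2.1.fderiv (𝕜 := ℝ)).exists_bound_of_continuous
    (h.1.continuous_fderiv (by simp))
  exact ⟨C, (norm_nonneg _).trans (hC 0), hC⟩

theorem IsTest.integrable_mul {U : Set (Vec d)} {φ : Vec d → ℝ} (h : IsTest U φ)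
    {μ : Measure (Vec d)} {B : Vec d → ℝ} (hB : Integrable B μ) :
    Integrable (fun x => φ x * B x) μ := by
  obtain ⟨C, _, hC⟩ := h.exists_bound
  exact hB.bdd_mul h.continuous.aestronglyMeasurable (Eventually.of_forall hC)

theorem IsTest.integrable_fderiv_apply {U : Set (Vec d)} {φ : Vec d → ℝ} (h : IsTest U φ)
    {μ : Measure (Vec d)} {A : Vec d → Vec d} (hA : Integrable A μ) :
    Integrable (fun x => fderiv ℝ φ x (A x)) μ := by
  obtain ⟨C, hC0, hC⟩ := h.exists_bound_fderiv
  refine Integrable.mono' (hA.norm.const_mul C) ?_ (Eventually.of_forall fun x => ?_)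
  · exact isBoundedBilinearMap_apply.continuous.comp_aestronglyMeasurable
      ((h.1.continuous_fderiv (by simp)).aestronglyMeasurable.prodMk hA.1)
  · exact ((fderiv ℝ φ x).le_opNorm _).trans (by gcongr; exact hC x)

theorem firstOrder_zero {ι : Type*} (Ω : Set (Vec d)) (A : Vec d → Vec d) (B : Vec d → ℝ)
    (s : Finset ι) (m : ι → Measure (Vec d)) (c : ι → Vec d → ℝ) :
    firstOrder Ω A B s m c 0 = 0 := by
  simp [firstOrder]

theorem firstOrder_add {ι : Type*} {Ω : Set (Vec d)} {A : Vec d → Vec d} {B : Vec d → ℝ}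
    {s : Finset ι} {m : ι → Measure (Vec d)} {c : ι → Vec d → ℝ}
    (hA : IntegrableOn A Ω) (hB : IntegrableOn B Ω) (hc : ∀ i ∈ s, Integrable (c i) (m i))
    {φ ψ : Vec d → ℝ} (hφ : IsTest univ φ) (hψ : IsTest univ ψ) :
    firstOrder Ω A B s m c (φ + ψ) = firstOrder Ω A B s m c φ + firstOrder Ω A B s m c ψ := by
  have e1 : ∫ x in Ω, fderiv ℝ (φ + ψ) x (A x)
      = (∫ x in Ω, fderiv ℝ φ x (A x)) + ∫ x in Ω, fderiv ℝ ψ x (A x) := by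
    rw [← integral_add (hφ.integrable_fderiv_apply hA) (hψ.integrable_fderiv_apply hA)]
    refine integral_congr_ae (Eventually.of_forall fun x => ?_)
    simp only
    rw [fderiv_add (hφ.1.differentiable (by simp) x) (hψ.1.differentiable (by simp) x),
      add_apply]
  have e2 : ∫ x in Ω, (φ + ψ) x * B x = (∫ x in Ω, φ x * B x) + ∫ x in Ω, ψ x * B x := by
    rw [← integral_add (hφ.integrable_mul hB) (hψ.integrable_mul hB)]
    simp [add_mul]
  have e3 : ∑ i ∈ s, ∫ x, (φ + ψ) x * c i x ∂(m i)
      = (∑ i ∈ s, ∫ x, φ x * c i x ∂(m i)) + ∑ i ∈ s, ∫ x, ψ x * c i x ∂(m i) := by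
    rw [← Finset.sum_add_distrib]
    refine Finset.sum_congr rfl fun i hi => ?_
    rw [← integral_add (hφ.integrable_mul (hc i hi)) (hψ.integrable_mul (hc i hi))]
    simp [add_mul]
  unfold firstOrder
  rw [e1, e2, e3]; ring

/-- A cutoff around the intersection of two hyperplanes. -/
def cutoff (n n' : Vec d) (b b' : ℝ) (k : ℕ) (x : Vec d) : ℝ :=
  Real.smoothTransition (((inner ℝ n x - b) ^ 2 + (inner ℝ n' x - b') ^ 2) / radius k ^ 2 - 1)

theorem contDiff_cutoff (n n' : Vec d) (b b' : ℝ) (k : ℕ) : ContDiff ℝ ∞ (cutoff n n' b b' k) := by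
  have h : ContDiff ℝ ∞ fun x : Vec d =>
      ((inner ℝ n x - b) ^ 2 + (inner ℝ n' x - b') ^ 2) / radius k ^ 2 - 1 := by
    have h1 : ∀ a : Vec d, ContDiff ℝ ∞ fun x : Vec d => (inner ℝ a x : ℝ) := fun a =>
      (innerSL ℝ a).contDiff
    exact (((((h1 n).sub contDiff_const).pow 2).add (((h1 n').sub contDiff_const).pow 2)).div_const _).sub
      contDiff_const
  exact (Real.smoothTransition.contDiff (n := ⊤)).comp h

theorem abs_cutoff_le (n n' : Vec d) (b b' : ℝ) (k : ℕ) (x : Vec d) :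
    |cutoff n n' b b' k x| ≤ 1 := by
  rw [cutoff, abs_of_nonneg (Real.smoothTransition.nonneg _)]
  exact Real.smoothTransition.le_one _

theorem tendsto_cutoff {n n' : Vec d} {b b' : ℝ} {x : Vec d}
    (hx : ¬ (inner ℝ n x = b ∧ inner ℝ n' x = b')) :
    Tendsto (fun k => cutoff n n' b b' k x) atTop (𝓝 1) := by
  set q : ℝ := (inner ℝ n x - b) ^ 2 + (inner ℝ n' x - b') ^ 2 with hq
  have hq0 : 0 < q := by
    rcases not_and_or.1 hx with h | h
    · have : inner ℝ n x - b ≠ 0 := sub_ne_zero.2 h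
      positivity
    · have : inner ℝ n' x - b' ≠ 0 := sub_ne_zero.2 h
      positivity
  have h1 : Tendsto (fun k => 2 * radius k ^ 2) atTop (𝓝 0) := by
    have := (tendsto_radius.pow 2).const_mul (2 : ℝ)
    simpa using this
  refine tendsto_const_nhds.congr' ?_
  filter_upwards [h1.eventually (gt_mem_nhds hq0)] with k hk
  have hr := radius_pos k
  refine (Real.smoothTransition.one_of_one_le ?_).symm
  rw [← hq, le_sub_iff_add_le, le_div_iff₀ (by positivity)]
  linarith

theorem tsupport_cutoff_subset (n n' : Vec d) (b b' : ℝ) (k : ℕ) :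
    tsupport (cutoff n n' b b' k) ⊆ {x | inner ℝ n x = b ∧ inner ℝ n' x = b'}ᶜ := by
  have hr := radius_pos k
  have hcl : IsClosed {x : Vec d | radius k ^ 2 ≤ (inner ℝ n x - b) ^ 2 + (inner ℝ n' x - b') ^ 2} :=
    isClosed_le (f := fun _ => radius k ^ 2)
      (g := fun x : Vec d => ((inner ℝ n x : ℝ) - b) ^ 2 + ((inner ℝ n' x : ℝ) - b') ^ 2)
      continuous_const (by fun_prop)
  refine (closure_minimal (fun x hx => ?_) hcl).trans ?_
  · show radius k ^ 2 ≤ _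
    by_contra hc
    push Not at hc
    refine hx (Real.smoothTransition.zero_of_nonpos ?_)
    rw [sub_nonpos, div_le_one (by positivity)]
    exact hc.le
  · rintro x hx ⟨h1, h2⟩
    have hx' : radius k ^ 2 ≤ (inner ℝ n x - b) ^ 2 + (inner ℝ n' x - b') ^ 2 := hx
    rw [h1, h2, sub_self, sub_self] at hx'
    have : 0 < radius k ^ 2 := by positivity
    linarith

/-- With `q` the sum of the two squares, the cutoff varies only where `r² ≤ q ≤ 2 r²`. There both
distances are at most `2 r`, and the gradient of `q / r²` is `O(1 / r)`. -/
theorem abs_fderiv_cutoff_le {n n' : Vec d} (hn : ‖n‖ = 1) (hn' : ‖n'‖ = 1) :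
    ∃ C : ℝ, 0 ≤ C ∧ ∀ (b b' : ℝ) (k : ℕ) (x v : Vec d), |fderiv ℝ (cutoff n n' b b' k) x v| ≤
      {x : Vec d | |inner ℝ n x - b| ≤ 2 * radius k ∧ |inner ℝ n' x - b'| ≤ 2 * radius k}.indicator
        (fun _ => C / radius k * ‖v‖) x := by
  obtain ⟨C, hC, hb⟩ := exists_bound_deriv_smoothTransition
  -- The derivative of the sum of squares `l ^ 2 + l' ^ 2` in direction `v` is at most `2 (2r + 2r)
  -- ‖v‖`, which accounts for the factor `8`.
  refine ⟨C * 8, by positivity, fun b b' k x v => ?_⟩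
  have hr := radius_pos k
  set l : ℝ := inner ℝ n x - b with hl
  set l' : ℝ := inner ℝ n' x - b' with hl'
  have hin : ∀ (a : Vec d) (e : ℝ), HasFDerivAt (fun x : Vec d => (inner ℝ a x : ℝ) - e)
      (innerSL ℝ a) x := fun a e => (innerSL ℝ a).hasFDerivAt.sub_const e
  have hq : HasFDerivAt (fun x : Vec d =>
      ((inner ℝ n x - b) ^ 2 + (inner ℝ n' x - b') ^ 2) * (radius k ^ 2)⁻¹ - 1)
      ((radius k ^ 2)⁻¹ • ((2 * l ^ 1) • innerSL ℝ n + (2 * l' ^ 1) • innerSL ℝ n')) x := by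
    have h1 := ((hin n b).pow 2).add ((hin n' b').pow 2)
    have h2 := (h1.mul_const (radius k ^ 2)⁻¹).sub_const 1
    refine HasFDerivAt.congr_fderiv (show HasFDerivAt (fun x : Vec d =>
      ((inner ℝ n x - b) ^ 2 + (inner ℝ n' x - b') ^ 2) * (radius k ^ 2)⁻¹ - 1) _ x from h2) ?_
    simp [nsmul_eq_mul, hl, hl']
  have hd : HasFDerivAt (cutoff n n' b b' k)
      (deriv Real.smoothTransition ((l ^ 2 + l' ^ 2) * (radius k ^ 2)⁻¹ - 1) •
        ((radius k ^ 2)⁻¹ • ((2 * l ^ 1) • innerSL ℝ n + (2 * l' ^ 1) • innerSL ℝ n'))) x := by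
    have hs : HasDerivAt Real.smoothTransition
        (deriv Real.smoothTransition ((l ^ 2 + l' ^ 2) * (radius k ^ 2)⁻¹ - 1))
        ((l ^ 2 + l' ^ 2) * (radius k ^ 2)⁻¹ - 1) :=
      ((Real.smoothTransition.contDiff (n := 1)).differentiable (by simp) _).hasDerivAt
    exact hs.comp_hasFDerivAt x hq
  rw [hd.fderiv]
  set D := deriv Real.smoothTransition ((l ^ 2 + l' ^ 2) * (radius k ^ 2)⁻¹ - 1) with hD
  have hval : (D • ((radius k ^ 2)⁻¹ • ((2 * l ^ 1) • innerSL ℝ n + (2 * l' ^ 1) • innerSL ℝ n'))) v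
      = D * ((radius k ^ 2)⁻¹ * (2 * l * inner ℝ n v + 2 * l' * inner ℝ n' v)) := by
    simp [mul_add]
  rw [hval]
  by_cases hx : |l| ≤ 2 * radius k ∧ |l'| ≤ 2 * radius k
  · rw [indicator_of_mem (show x ∈ {x : Vec d | |inner ℝ n x - b| ≤ 2 * radius k ∧
      |inner ℝ n' x - b'| ≤ 2 * radius k} from hx), abs_mul, abs_mul]
    have h1 : |inner ℝ n v| ≤ ‖v‖ := by simpa [hn] using abs_real_inner_le_norm n v
    have h2 : |inner ℝ n' v| ≤ ‖v‖ := by simpa [hn'] using abs_real_inner_le_norm n' v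
    have h3 : |2 * l * inner ℝ n v + 2 * l' * inner ℝ n' v| ≤ 8 * radius k * ‖v‖ := by
      refine (abs_add_le _ _).trans ?_
      rw [abs_mul, abs_mul, abs_mul, abs_mul, abs_two]
      have := mul_le_mul hx.1 h1 (abs_nonneg _) (by positivity)
      have := mul_le_mul hx.2 h2 (abs_nonneg _) (by positivity)
      nlinarith
    calc |D| * (|(radius k ^ 2)⁻¹| * |2 * l * inner ℝ n v + 2 * l' * inner ℝ n' v|)
        ≤ C * ((radius k ^ 2)⁻¹ * (8 * radius k * ‖v‖)) := by
          rw [abs_of_nonneg (by positivity : 0 ≤ (radius k ^ 2)⁻¹)]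
          gcongr
          exact hb _
      _ = C * 8 / radius k * ‖v‖ := by field_simp
  · rw [indicator_of_notMem (show x ∉ {x : Vec d | |inner ℝ n x - b| ≤ 2 * radius k ∧
      |inner ℝ n' x - b'| ≤ 2 * radius k} from hx)]
    have h4 : 4 * radius k ^ 2 < l ^ 2 + l' ^ 2 := by
      rcases not_and_or.1 hx with h | h
      · push Not at h
        have : (2 * radius k) ^ 2 < l ^ 2 := by
          rw [← sq_abs l]; exact pow_lt_pow_left₀ h (by positivity) (by norm_num)
        nlinarith [sq_nonneg l']
      · push Not at h
        have : (2 * radius k) ^ 2 < l' ^ 2 := by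
          rw [← sq_abs l']; exact pow_lt_pow_left₀ h (by positivity) (by norm_num)
        nlinarith [sq_nonneg l]
    have : D = 0 := by
      refine deriv_smoothTransition_eq_zero (Or.inr ?_)
      have h5 : 4 < (l ^ 2 + l' ^ 2) * (radius k ^ 2)⁻¹ := by
        rw [← div_eq_mul_inv, lt_div_iff₀ (by positivity)]; exact h4
      linarith
    rw [this, zero_mul, abs_zero]

theorem volume_tube_le {n n' : Vec d} (hn : ‖n‖ = 1) (hn' : n' ∉ ℝ ∙ n) {Ω : Set (Vec d)}
    (hΩ : Bornology.IsBounded Ω) (b b' : ℝ) : ∃ C : ℝ, 0 ≤ C ∧ ∀ δ : ℝ, 0 ≤ δ →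
      volume.restrict Ω {x : Vec d | |inner ℝ n x - b| ≤ δ ∧ |inner ℝ n' x - b'| ≤ δ}
        ≤ ENNReal.ofReal (C * δ ^ 2) := by
  obtain ⟨R, hR⟩ := hΩ.subset_ball 0
  obtain ⟨C, hC, h⟩ := volume_tube_inter_ball_le hn hn' R
  refine ⟨C, hC, fun δ hδ => le_trans ?_ (h b b' δ hδ)⟩
  refine (Measure.restrict_mono_set _ hR _).trans ?_
  rw [Measure.restrict_apply]
  exact (isClosed_le (f := fun x : Vec d => |inner ℝ n x - b|) (by fun_prop) continuous_const).inter
    (isClosed_le (f := fun x : Vec d => |inner ℝ n' x - b'|) (by fun_prop) continuous_const)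
    |>.measurableSet

/-- The test function is multiplied by the cutoffs. All terms converge by dominated convergence,
since the removed set is null for every measure involved, except the one where the derivative falls
on the cutoff; that one is concentrated on a thin tube and tends to zero. -/
theorem exists_tendsto_firstOrder {ι : Type*} {Ω : Set (Vec d)} (hΩ : Bornology.IsBounded Ω)
    {A : Vec d → Vec d} {B : Vec d → ℝ}
    {s : Finset ι} {m : ι → Measure (Vec d)} {c : ι → Vec d → ℝ}
    (hA : MemLp A 2 (volume.restrict Ω)) (hB : IntegrableOn B Ω)
    (hc : ∀ i ∈ s, Integrable (c i) (m i))
    {n n' : Vec d} (hn : ‖n‖ = 1) (hn1 : ‖n'‖ = 1) (hn' : n' ∉ ℝ ∙ n) (b b' : ℝ)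
    (hm : ∀ i ∈ s, m i {x | inner ℝ n x = b ∧ inner ℝ n' x = b'} = 0)
    {φ : Vec d → ℝ} (hφ : IsTest univ φ) : ∃ φk : ℕ → Vec d → ℝ,
      (∀ k, IsTest univ (φk k) ∧
        tsupport (φk k) ⊆ tsupport φ \ {x | inner ℝ n x = b ∧ inner ℝ n' x = b'}) ∧
      Tendsto (fun k => firstOrder Ω A B s m c (φk k)) atTop (𝓝 (firstOrder Ω A B s m c φ)) := by
  have hfin : IsFiniteMeasure (volume.restrict Ω : Measure (Vec d)) :=
    isFiniteMeasure_restrict.2 hΩ.measure_lt_top.ne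
  have hA1 : IntegrableOn A Ω := hA.integrable (by norm_num)
  set χ := cutoff n n' b b' with hχ
  have hχc : ∀ k, ContDiff ℝ ∞ (χ k) := contDiff_cutoff n n' b b'
  refine ⟨fun k x => χ k x * φ x, fun k => ⟨hφ.mul_left (hχc k) (subset_univ _), ?_⟩, ?_⟩
  · exact subset_sdiff.2 ⟨tsupport_mul_subset_right,
      (disjoint_compl_left.mono_left (tsupport_cutoff_subset n n' b b' k)).mono_left
        tsupport_mul_subset_left⟩
  have hdct : ∀ (μ : Measure (Vec d)) (g : Vec d → ℝ), Integrable g μ →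
      μ {x | inner ℝ n x = b ∧ inner ℝ n' x = b'} = 0 →
      Tendsto (fun k => ∫ x, χ k x * g x ∂μ) atTop (𝓝 (∫ x, g x ∂μ)) := by
    intro μ g hg h0
    refine tendsto_integral_of_dominated_convergence (fun x => ‖g x‖) (fun k =>
      (hχc k).continuous.aestronglyMeasurable.mul hg.1) hg.norm
      (fun k => Eventually.of_forall fun x => ?_) ?_
    · rw [norm_mul]
      exact mul_le_of_le_one_left (norm_nonneg _) (abs_cutoff_le n n' b b' k x)
    · filter_upwards [measure_eq_zero_iff_ae_notMem.1 h0] with x hx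
      simpa using (tendsto_cutoff hx).mul_const (g x)
  have hvol0 : volume.restrict Ω {x : Vec d | inner ℝ n x = b ∧ inner ℝ n' x = b'} = 0 := by
    obtain ⟨C, hC, h⟩ := volume_tube_le hn hn' hΩ b b'
    have := h 0 le_rfl
    rw [zero_pow (by norm_num), mul_zero, ENNReal.ofReal_zero, nonpos_iff_eq_zero] at this
    refine measure_mono_null ?_ this
    rintro x ⟨h1, h2⟩
    exact ⟨by rw [h1]; simp, by rw [h2]; simp⟩
  have hfd : ∀ k x v, fderiv ℝ (fun x => χ k x * φ x) x v
      = χ k x * fderiv ℝ φ x v + φ x * fderiv ℝ (χ k) x v := by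
    intro k x v
    rw [fderiv_fun_mul ((hχc k).differentiable (by simp) x) (hφ.1.differentiable (by simp) x)]
    simp
  have hint1 : ∀ k, IntegrableOn (fun x => χ k x * fderiv ℝ φ x (A x)) Ω := fun k =>
    (hφ.integrable_fderiv_apply hA1).bdd_mul (hχc k).continuous.aestronglyMeasurable
      (Eventually.of_forall fun x => abs_cutoff_le n n' b b' k x)
  have hint2 : ∀ k, IntegrableOn (fun x => φ x * fderiv ℝ (χ k) x (A x)) Ω := by
    intro k
    have h := ((hφ.mul_left (hχc k) (subset_univ _)).integrable_fderiv_apply hA1).sub (hint1 k)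
    refine h.congr (Eventually.of_forall fun x => ?_)
    simp only [Pi.sub_apply]
    rw [hfd]; ring
  have h1 : Tendsto (fun k => ∫ x in Ω, fderiv ℝ (fun x => χ k x * φ x) x (A x)) atTop
      (𝓝 (∫ x in Ω, fderiv ℝ φ x (A x))) := by
    have e : ∀ k, ∫ x in Ω, fderiv ℝ (fun x => χ k x * φ x) x (A x)
        = (∫ x in Ω, χ k x * fderiv ℝ φ x (A x)) + ∫ x in Ω, φ x * fderiv ℝ (χ k) x (A x) := fun k => by
      rw [← integral_add (hint1 k) (hint2 k)]
      simp only [hfd]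
    simp_rw [e]
    rw [← add_zero (∫ x in Ω, fderiv ℝ φ x (A x))]
    refine (hdct _ _ (hφ.integrable_fderiv_apply hA1) hvol0).add ?_
    obtain ⟨Cφ, hCφ, hbφ⟩ := hφ.exists_bound
    obtain ⟨C1, hC1, hb1⟩ := abs_fderiv_cutoff_le hn hn1
    obtain ⟨C2, hC2, hb2⟩ := volume_tube_le hn hn' hΩ b b'
    -- One constant has to serve both the gradient bound and the volume bound; the `4` comes from
    -- tubes of half-width `2 * radius k`.
    refine tendsto_integral_of_concentrated hA (C := Cφ * C1 + 4 * C2) (by positivity)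
      (S := fun k => {x : Vec d | |inner ℝ n x - b| ≤ 2 * radius k ∧
        |inner ℝ n' x - b'| ≤ 2 * radius k}) ?_ ?_ ?_
    · intro k
      exact (isClosed_le (f := fun x : Vec d => |inner ℝ n x - b|) (by fun_prop) continuous_const).inter
        (isClosed_le (f := fun x : Vec d => |inner ℝ n' x - b'|) (by fun_prop) continuous_const)
        |>.measurableSet
    · intro k
      have hr := radius_pos k
      refine (hb2 _ (by positivity)).trans (ENNReal.ofReal_le_ofReal ?_)
      have : 0 ≤ Cφ * C1 * radius k ^ 2 := by positivity
      nlinarith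
    · intro k x
      have hr := radius_pos k
      rw [abs_mul]
      refine (mul_le_mul (hbφ x) (hb1 b b' k x (A x)) (abs_nonneg _) hCφ).trans ?_
      by_cases hx : x ∈ {x : Vec d | |inner ℝ n x - b| ≤ 2 * radius k ∧
        |inner ℝ n' x - b'| ≤ 2 * radius k}
      · rw [indicator_of_mem hx, indicator_of_mem hx, ← mul_assoc, ← mul_div_assoc]
        gcongr
        linarith
      · rw [indicator_of_notMem hx, indicator_of_notMem hx, mul_zero]
  have h2 : Tendsto (fun k => ∫ x in Ω, (χ k x * φ x) * B x) atTop (𝓝 (∫ x in Ω, φ x * B x)) := by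
    simp_rw [mul_assoc]
    exact hdct _ _ (hφ.integrable_mul hB) hvol0
  have h3 : Tendsto (fun k => ∑ i ∈ s, ∫ x, (χ k x * φ x) * c i x ∂(m i)) atTop
      (𝓝 (∑ i ∈ s, ∫ x, φ x * c i x ∂(m i))) := by
    refine tendsto_finsetSum _ fun i hi => ?_
    simp_rw [mul_assoc]
    exact hdct _ _ (hφ.integrable_mul (hc i hi)) (hm i hi)
  exact (h1.add h2).add h3

end Removability

/-! ### Removing the ridges of a mesh -/

namespace Mesh
variable {d : ℕ} {kind : MeshKind} {Ω : Set (Vec d)} {M : Mesh kind Ω}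

/-- A functional `φ ↦ ∫ Dφ · A + ∫ φ B + Σ ∫_F φ c_F` vanishes if it does so locally away from the
`(d - 2)`-skeleton. -/
theorem firstOrder_eq_zero (hΩ : Bornology.IsBounded Ω) {A : Vec d → Vec d} {B : Vec d → ℝ}
    {c : Set (Vec d) → Vec d → ℝ} {m : Set (Vec d) → Measure (Vec d)}
    (hA : MemLp A 2 (volume.restrict Ω)) (hB : IntegrableOn B Ω)
    (hc : ∀ F ∈ M.facets, Integrable (c F) (m F)) (hm : ∀ F ∈ M.facets, m F M.ridges = 0)
    (h : ∀ x, x ∉ M.ridges → ∃ U, IsOpen U ∧ x ∈ U ∧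
      ∀ ψ, IsTest U ψ → firstOrder Ω A B M.facets m c ψ = 0)
    {φ : Vec d → ℝ} (hφ : IsTest univ φ) : firstOrder Ω A B M.facets m c φ = 0 := by
  classical
  have hfin : IsFiniteMeasure (volume.restrict Ω : Measure (Vec d)) :=
    isFiniteMeasure_restrict.2 hΩ.measure_lt_top.ne
  have hA1 : IntegrableOn A Ω := hA.integrable (by norm_num)
  refine eq_zero_of_removable (firstOrder Ω A B M.facets m c)
    (fun p : Set (Vec d) × Set (Vec d) =>
      {x | inner ℝ (M.normal p.1) x = M.offset p.1 ∧ inner ℝ (M.normal p.2) x = M.offset p.2})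
    ((M.facets ×ˢ M.facets).filter fun p => M.normal p.2 ∉ (ℝ ∙ M.normal p.1)) ?_ ?_ hφ
  · intro p hp φ hφ
    rw [Finset.mem_filter, Finset.mem_product] at hp
    refine exists_tendsto_firstOrder hΩ hA hB hc (M.norm_normal hp.1.1) (M.norm_normal hp.1.2) hp.2 _ _
      (fun F hF => measure_mono_null ?_ (hm F hF)) hφ
    rintro x ⟨h1, h2⟩
    exact ⟨p.1, hp.1.1, p.2, hp.1.2, hp.2, sub_eq_zero.2 h1, sub_eq_zero.2 h2⟩
  · intro φ hφ hd
    refine eq_zero_of_locally _ (firstOrder_zero _ _ _ _ _ _)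
      (fun φ ψ hφ hψ => firstOrder_add hA1 hB hc hφ hψ) hφ fun x hx => h x ?_
    rintro ⟨F, hF, F', hF', hpar, h1, h2⟩
    refine disjoint_left.1 (hd (F, F') ?_) hx ⟨sub_eq_zero.1 h1, sub_eq_zero.1 h2⟩
    rw [Finset.mem_filter, Finset.mem_product]
    exact ⟨⟨hF, hF'⟩, hpar⟩

end Mesh

/-! ### Weighted integrals over shrinking strips -/

section Strip
variable {d : ℕ}

/-- The majorant for the next theorem: its first part is the distance of `g` from its trace on the
slab, its second part comes from the variation of the test field over a distance `radius k`. -/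
theorem tendsto_lintegral_slab_bound {U F : Set (Vec d)} {n : Vec d} {c a : ℝ} {g : Vec d → Vec d}
    (h : TraceSetting U F n c g a) {Cρ Cθ L : ℝ} (hCρ : 0 ≤ Cρ) (hCθ : 0 ≤ Cθ) (hL : 0 ≤ L) :
    Tendsto (fun k => ∫⁻ x in F, ∫⁻ s in Ioo (-radius k) (radius k),
      ENNReal.ofReal (Cρ * (radius k)⁻¹) * (ENNReal.ofReal Cθ *
        U.indicator (fun y => ‖g y - trace U g x‖ₑ) (x + s • n) +
        ENNReal.ofReal (L * radius k) * ‖trace U g x‖ₑ) ∂volume ∂(surf n c)) atTop (𝓝 0) := by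
  have hT := h.integrable_trace
  have hTfin : ∫⁻ x in F, ‖trace U g x‖ₑ ∂(surf n c) ≠ ⊤ := hT.2.ne
  have e : ∀ k, ∫⁻ x in F, ∫⁻ s in Ioo (-radius k) (radius k),
      ENNReal.ofReal (Cρ * (radius k)⁻¹) * (ENNReal.ofReal Cθ *
        U.indicator (fun y => ‖g y - trace U g x‖ₑ) (x + s • n) +
        ENNReal.ofReal (L * radius k) * ‖trace U g x‖ₑ) ∂volume ∂(surf n c) =
      ENNReal.ofReal (Cρ * Cθ) * (ENNReal.ofReal (radius k)⁻¹ * ∫⁻ x in F, ∫⁻ s in Ioo (-radius k) (radius k),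
      U.indicator (fun y => ‖g y - trace U g x‖ₑ) (x + s • n) ∂volume ∂(surf n c)) +
      ENNReal.ofReal (2 * Cρ * L * radius k) * ∫⁻ x in F, ‖trace U g x‖ₑ ∂(surf n c) := by
    intro k
    have hr := radius_pos k
    have e1 : ∀ x, ∫⁻ s in Ioo (-radius k) (radius k),
        ENNReal.ofReal (Cρ * (radius k)⁻¹) * (ENNReal.ofReal Cθ *
          U.indicator (fun y => ‖g y - trace U g x‖ₑ) (x + s • n) +
          ENNReal.ofReal (L * radius k) * ‖trace U g x‖ₑ) =
        ENNReal.ofReal (Cρ * Cθ) * (ENNReal.ofReal (radius k)⁻¹ * ∫⁻ s in Ioo (-radius k) (radius k),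
          U.indicator (fun y => ‖g y - trace U g x‖ₑ) (x + s • n)) +
        ENNReal.ofReal (2 * Cρ * L * radius k) * ‖trace U g x‖ₑ := by
      intro x
      rw [lintegral_const_mul' _ _ ENNReal.ofReal_ne_top, lintegral_add_right _ measurable_const,
        lintegral_const_mul' _ _ ENNReal.ofReal_ne_top, lintegral_const, Measure.restrict_apply_univ,
        Real.volume_Ioo, mul_add]
      congr 1
      · rw [← mul_assoc, ← mul_assoc, ← ENNReal.ofReal_mul (by positivity),
          ← ENNReal.ofReal_mul (by positivity)]
        congr 2; ring
      · rw [mul_comm (ENNReal.ofReal (L * radius k)) _, mul_assoc, ← ENNReal.ofReal_mul (by positivity),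
          mul_left_comm, ← ENNReal.ofReal_mul (by positivity), mul_comm]
        congr 2; field_simp; ring
    simp_rw [e1]
    rw [lintegral_add_right' _ (hT.1.enorm.const_mul _), lintegral_const_mul' _ _ ENNReal.ofReal_ne_top,
      lintegral_const_mul' _ _ ENNReal.ofReal_ne_top, lintegral_const_mul' _ _ ENNReal.ofReal_ne_top]
  simp_rw [e]
  have t1 := ENNReal.Tendsto.const_mul h.tendsto_slab
    (Or.inr (ENNReal.ofReal_ne_top (r := Cρ * Cθ)))
  have t2 : Tendsto (fun k => ENNReal.ofReal (2 * Cρ * L * radius k)) atTop (𝓝 0) := by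
    have := ENNReal.tendsto_ofReal (tendsto_radius.const_mul (2 * Cρ * L))
    simpa using this
  have t3 := ENNReal.Tendsto.mul_const t2 (Or.inr hTfin)
  simpa using t1.add t3

/-- Weighted integrals over shrinking strips along a facet converge to the integral of the trace. -/
theorem tendsto_integral_strip {U F B : Set (Vec d)} {n : Vec d} {c a : ℝ} {g : Vec d → Vec d}
    (h : TraceSetting U F n c g a) {H : Set ℝ} (hH : MeasurableSet H)
    (hHs : ∀ r : ℝ, 0 < r → ∀ s, s / r ∈ H ↔ s ∈ H) (hB : IsOpen B)
    (hUB : ∀ y ∈ B, (y ∈ U ↔ inner ℝ n y - c ∈ H)) (hFB : ∀ y ∈ B, inner ℝ n y = c → y ∈ F)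
    {θ : Vec d → Vec d} (hθ : IsTest B θ) {ρ : ℝ → ℝ} (hρ : Continuous ρ)
    (hρ1 : ∀ s, 1 ≤ |s| → ρ s = 0) :
    Tendsto (fun k => ∫ y in U, (radius k)⁻¹ * ρ ((inner ℝ n y - c) / radius k) * inner ℝ (g y) (θ y))
      atTop (𝓝 ((∫ s in H, ρ s) * ∫ x in F, inner ℝ (trace U g x) (θ x) ∂(surf n c))) := by
  have hn := h.norm_normal
  have hnn : inner ℝ n n = (1 : ℝ) := by rw [real_inner_self_eq_norm_sq, hn]; norm_num
  have hT := h.integrable_trace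
  obtain ⟨Cθ, hCθ, hbθ⟩ := hθ.exists_bound
  obtain ⟨L, hL⟩ := hθ.1.lipschitzWith_of_hasCompactSupport hθ.2.1 (by simp)
  have hρs : HasCompactSupport ρ := HasCompactSupport.intro (isCompact_Icc (a := (-1 : ℝ)) (b := 1))
    fun s hs => hρ1 s (by
      by_contra hc
      push Not at hc
      exact hs ⟨(abs_lt.1 hc).1.le, (abs_lt.1 hc).2.le⟩)
  obtain ⟨Cρ, hbρ⟩ := hρs.exists_bound_of_continuous hρ
  have hCρ : 0 ≤ Cρ := (norm_nonneg _).trans (hbρ 0)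
  obtain ⟨η, hη, hηB⟩ := hθ.2.1.exists_cthickening_subset_open hB hθ.2.2
  have hnear : ∀ (x y : Vec d), x ∈ tsupport θ → dist y x ≤ η → y ∈ B := fun x y hx hy =>
    hηB (Metric.mem_cthickening_of_dist_le y x η _ hx hy)
  -- the two integrands on the product space
  set f : ℕ → Vec d → ℝ := fun k => U.indicator fun y =>
    (radius k)⁻¹ * ρ ((inner ℝ n y - c) / radius k) * inner ℝ (g y) (θ y) with hf
  -- The limiting integrand, a product of a function on the facet and a rescaled function on the
  -- line. As `H` is invariant under scaling, its integral is the asserted limit for every `k`.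
  set q : ℕ → Vec d × ℝ → ℝ := fun k p => F.indicator (fun x => inner ℝ (trace U g x) (θ x)) p.1 *
    ((radius k)⁻¹ * H.indicator ρ (p.2 / radius k)) with hq
  have hint : IntegrableOn (fun y => (inner ℝ (g y) (θ y) : ℝ)) U := by
    refine Integrable.mono' (h.int.norm.mul_const Cθ)
      (h.int.1.inner hθ.continuous.aestronglyMeasurable) (Eventually.of_forall fun y => ?_)
    exact (norm_inner_le_norm _ _).trans (by gcongr; exact hbθ y)
  have hfint : ∀ k, Integrable (f k) := by
    intro k
    rw [hf, integrable_indicator_iff h.measU]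
    refine hint.bdd_mul (c := (radius k)⁻¹ * Cρ) ?_ (Eventually.of_forall fun y => ?_)
    · exact Continuous.aestronglyMeasurable (by fun_prop)
    · rw [norm_mul, Real.norm_of_nonneg (inv_nonneg.2 (radius_pos k).le)]
      exact mul_le_mul_of_nonneg_left (hbρ _) (inv_nonneg.2 (radius_pos k).le)
  have hρi : Integrable (H.indicator ρ) := (hρ.integrable_of_hasCompactSupport hρs).indicator hH
  have hTθ : Integrable (fun x => (inner ℝ (trace U g x) (θ x) : ℝ)) ((surf n c).restrict F) := by
    refine Integrable.mono' (hT.norm.mul_const Cθ)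
      (hT.1.inner hθ.continuous.aestronglyMeasurable) (Eventually.of_forall fun y => ?_)
    exact (norm_inner_le_norm _ _).trans (by gcongr; exact hbθ y)
  have hqint : ∀ k, Integrable (q k) ((surf n c).prod volume) := by
    intro k
    refine Integrable.mul_prod (f := F.indicator fun x => (inner ℝ (trace U g x) (θ x) : ℝ))
      (g := fun s : ℝ => (radius k)⁻¹ * H.indicator ρ (s / radius k)) ?_ ?_
    · rw [integrable_indicator_iff h.measF]; exact hTθ
    · exact (hρi.comp_div (radius_pos k).ne').const_mul _
  have hqval : ∀ k, ∫ p, q k p ∂((surf n c).prod volume)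
      = (∫ s in H, ρ s) * ∫ x in F, inner ℝ (trace U g x) (θ x) ∂(surf n c) := by
    intro k
    have hr := radius_pos k
    have := integral_prod_mul (μ := surf n c) (ν := (volume : Measure ℝ))
      (F.indicator fun x => (inner ℝ (trace U g x) (θ x) : ℝ))
      (fun s : ℝ => (radius k)⁻¹ * H.indicator ρ (s / radius k))
    refine this.trans ?_
    rw [integral_indicator h.measF, integral_const_mul,
      Measure.integral_comp_div (H.indicator ρ), integral_indicator hH, abs_of_pos hr, smul_eq_mul,
      inv_mul_cancel_left₀ hr.ne', mul_comm]
  have hmp := measurePreserving_surf hn c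
  have hfval : ∀ k, ∫ y in U, (radius k)⁻¹ * ρ ((inner ℝ n y - c) / radius k) * inner ℝ (g y) (θ y)
      = ∫ p : Vec d × ℝ, f k (p.1 + p.2 • n) ∂((surf n c).prod volume) := by
    intro k
    rw [← integral_indicator h.measU]
    change ∫ y, f k y = _
    rw [← hmp.map_eq, integral_map hmp.measurable.aemeasurable]
    rw [hmp.map_eq]; exact (hfint k).1
  have hfpint : ∀ k, Integrable (fun p : Vec d × ℝ => f k (p.1 + p.2 • n)) ((surf n c).prod volume) :=
    fun k => hmp.integrable_comp_of_integrable (hfint k)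
  simp_rw [hfval]
  rw [tendsto_iff_edist_tendsto_0]
  have hbound := tendsto_lintegral_slab_bound h hCρ hCθ L.2
  refine tendsto_of_tendsto_of_tendsto_of_le_of_le' tendsto_const_nhds hbound
    (Eventually.of_forall fun _ => zero_le) ?_
  filter_upwards [tendsto_radius.eventually (gt_mem_nhds hη)] with k hk
  have hr := radius_pos k
  rw [edist_eq_enorm_sub, ← hqval k, ← integral_sub (hfpint k) (hqint k)]
  refine (enorm_integral_le_lintegral_enorm _).trans ?_
  rw [lintegral_prod (fun p : Vec d × ℝ => ‖f k (p.1 + p.2 • n) - q k p‖ₑ)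
    ((hfpint k).sub (hqint k)).1.enorm, ← lintegral_indicator h.measF]
  refine lintegral_mono_ae ?_
  filter_upwards [surf_ae hn c] with x hx
  have hlev : ∀ s : ℝ, inner ℝ n (x + s • n) - c = s := fun s => by
    rw [inner_add_right, inner_smul_right, hnn, hx]; ring
  have hsplit : ∀ s : ℝ, f k (x + s • n) - q k (x, s) = (radius k)⁻¹ * ρ (s / radius k) *
      (U.indicator (fun y => inner ℝ (g y) (θ y)) (x + s • n) -
        H.indicator (fun _ => F.indicator (fun x => inner ℝ (trace U g x) (θ x)) x) s) := by
    intro s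
    have e1 : f k (x + s • n) = (radius k)⁻¹ * ρ (s / radius k) *
        U.indicator (fun y => inner ℝ (g y) (θ y)) (x + s • n) := by
      by_cases hU : x + s • n ∈ U
      · simp only [hf, indicator_of_mem hU, hlev]
      · simp only [hf, indicator_of_notMem hU, mul_zero]
    have e2 : q k (x, s) = (radius k)⁻¹ * ρ (s / radius k) *
        H.indicator (fun _ => F.indicator (fun x => inner ℝ (trace U g x) (θ x)) x) s := by
      by_cases hs : s ∈ H
      · simp only [hq, indicator_of_mem hs, indicator_of_mem ((hHs _ hr s).2 hs)]; ring
      · simp only [hq, indicator_of_notMem hs, indicator_of_notMem (fun hc => hs ((hHs _ hr s).1 hc)),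
          mul_zero]
    rw [e1, e2]; ring
  have hzero : ∀ s : ℝ, s ∉ Ioo (-radius k) (radius k) → f k (x + s • n) - q k (x, s) = 0 := by
    intro s hs
    rw [hsplit, hρ1 _, mul_zero, zero_mul]
    by_contra hc
    push Not at hc
    rw [abs_div, abs_of_pos hr, div_lt_one hr] at hc
    exact hs ⟨(abs_lt.1 hc).1, (abs_lt.1 hc).2⟩
  have hsub : ∀ s ∈ Ioo (-radius k) (radius k), dist (x + s • n) x ≤ radius k := by
    intro s hs
    rw [dist_eq_norm, add_sub_cancel_left, norm_smul, hn, mul_one, Real.norm_eq_abs]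
    exact (abs_lt.2 hs).le
  have hest : ∀ s ∈ Ioo (-radius k) (radius k),
      ‖U.indicator (fun y => inner ℝ (g y) (θ y)) (x + s • n) -
        H.indicator (fun _ => F.indicator (fun x => inner ℝ (trace U g x) (θ x)) x) s‖ₑ ≤
      F.indicator (fun x => ENNReal.ofReal Cθ *
          U.indicator (fun y => ‖g y - trace U g x‖ₑ) (x + s • n) +
        ENNReal.ofReal (L * radius k) * ‖trace U g x‖ₑ) x := by
    intro s hs
    -- If the support of `θ` contains one of the two points, both lie in `B`, because `radius k` is
    -- below the distance `η` from the support to the complement of `B`; so the description of `U`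
    -- and `F` in `B` applies.
    by_cases hsupp : x ∈ tsupport θ ∨ x + s • n ∈ tsupport θ
    · have hd := (hsub s hs).trans hk.le
      have hxB : x ∈ B := by
        rcases hsupp with h1 | h1
        · exact hθ.2.2 h1
        · exact hnear _ _ h1 (by rw [dist_comm]; exact hd)
      have hyB : x + s • n ∈ B := by
        rcases hsupp with h1 | h1
        · exact hnear _ _ h1 hd
        · exact hθ.2.2 h1
      have hxF := hFB x hxB hx
      have hiff := hUB _ hyB
      rw [hlev] at hiff
      by_cases hsH : s ∈ H
      · have hyU := hiff.2 hsH
        rw [indicator_of_mem hyU, indicator_of_mem hsH, indicator_of_mem hxF, indicator_of_mem hxF,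
          indicator_of_mem hyU]
        have e : (inner ℝ (g (x + s • n)) (θ (x + s • n)) - inner ℝ (trace U g x) (θ x) : ℝ)
            = inner ℝ (g (x + s • n) - trace U g x) (θ (x + s • n))
              + inner ℝ (trace U g x) (θ (x + s • n) - θ x) := by
          rw [inner_sub_left, inner_sub_right]; ring
        rw [e]
        refine (enorm_add_le _ _).trans (add_le_add ?_ ?_)
        · rw [← ofReal_norm, ← ofReal_norm, ← ENNReal.ofReal_mul hCθ]
          refine ENNReal.ofReal_le_ofReal ((norm_inner_le_norm _ _).trans ?_)
          rw [mul_comm]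
          gcongr
          exact hbθ _
        · rw [← ofReal_norm, ← ofReal_norm, ← ENNReal.ofReal_mul (by positivity)]
          refine ENNReal.ofReal_le_ofReal ((norm_inner_le_norm _ _).trans ?_)
          rw [mul_comm]
          gcongr
          rw [← dist_eq_norm]
          exact (hL.dist_le_mul _ _).trans (by gcongr; exact hsub s hs)
      · have hyU : x + s • n ∉ U := fun hc => hsH (hiff.1 hc)
        rw [indicator_of_notMem hyU, indicator_of_notMem hsH, sub_zero, enorm_zero]
        exact zero_le
    · rw [not_or] at hsupp
      have h1 := image_eq_zero_of_notMem_tsupport hsupp.1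
      have h2 := image_eq_zero_of_notMem_tsupport hsupp.2
      have e1 : U.indicator (fun y => (inner ℝ (g y) (θ y) : ℝ)) (x + s • n) = 0 := by
        by_cases hU : x + s • n ∈ U
        · rw [indicator_of_mem hU, h2, inner_zero_right]
        · rw [indicator_of_notMem hU]
      have e2 : H.indicator (fun _ => F.indicator (fun x => (inner ℝ (trace U g x) (θ x) : ℝ)) x) s = 0 := by
        by_cases hU : s ∈ H
        · rw [indicator_of_mem hU]
          by_cases hF : x ∈ F
          · rw [indicator_of_mem hF, h1, inner_zero_right]
          · rw [indicator_of_notMem hF]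
        · rw [indicator_of_notMem hU]
      rw [e1, e2, sub_zero, enorm_zero]
      exact zero_le
  calc ∫⁻ s, ‖f k (x + s • n) - q k (x, s)‖ₑ
      = ∫⁻ s in Ioo (-radius k) (radius k), ‖f k (x + s • n) - q k (x, s)‖ₑ := by
        rw [← lintegral_indicator measurableSet_Ioo]
        refine lintegral_congr fun s => ?_
        by_cases hs : s ∈ Ioo (-radius k) (radius k)
        · rw [indicator_of_mem hs]
        · rw [indicator_of_notMem hs, hzero s hs, enorm_zero]
    _ ≤ ∫⁻ s in Ioo (-radius k) (radius k), ENNReal.ofReal (Cρ * (radius k)⁻¹) *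
        F.indicator (fun x => ENNReal.ofReal Cθ *
          U.indicator (fun y => ‖g y - trace U g x‖ₑ) (x + s • n) +
          ENNReal.ofReal (L * radius k) * ‖trace U g x‖ₑ) x := by
        refine setLIntegral_mono' measurableSet_Ioo fun s hs => ?_
        rw [hsplit, enorm_mul]
        refine mul_le_mul' ?_ (hest s hs)
        rw [← ofReal_norm]
        refine ENNReal.ofReal_le_ofReal ?_
        rw [norm_mul, Real.norm_of_nonneg (inv_nonneg.2 hr.le), mul_comm]
        exact mul_le_mul_of_nonneg_right (hbρ _) (inv_nonneg.2 hr.le)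
    _ = _ := by
        by_cases hF : x ∈ F
        · simp only [indicator_of_mem hF]
          rfl
        · simp only [indicator_of_notMem hF, mul_zero, lintegral_zero]

end Strip

/-! ### Transition profiles and the strip limit from both sides of a facet -/

section Facet
variable {d : ℕ}

/-- Smooth transition profiles from `1` to `0` on `[-1, 1]`. -/
structure IsProfile (Φ : ℝ → ℝ) : Prop where
  contDiff : ContDiff ℝ ∞ Φ
  eq_one : ∀ s, s ≤ -1 → Φ s = 1
  eq_zero : ∀ s, 1 ≤ s → Φ s = 0
  abs_le : ∀ s, |Φ s| ≤ 1

theorem smoothTransition_half : Real.smoothTransition (1 / 2) = 1 / 2 := by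
  have h := expNegInvGlue.pos_of_pos (x := 1 / 2) (by norm_num)
  rw [Real.smoothTransition]
  have e : (1 : ℝ) - 1 / 2 = 1 / 2 := by norm_num
  rw [e]; field_simp; norm_num

/-- The derivative of a profile has integral `Φ 0 - 1` over the negative half line and `-Φ 0` over
the positive one. The value `1/2` therefore weighs the two traces equally and produces the average
on an interior facet. -/
theorem exists_isProfile_half : ∃ Φ, IsProfile Φ ∧ Φ 0 = 1 / 2 := by
  refine ⟨fun s => Real.smoothTransition ((1 - s) / 2), ⟨?_, fun s hs => ?_, fun s hs => ?_, fun s => ?_⟩, ?_⟩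
  · exact (Real.smoothTransition.contDiff (n := ⊤)).comp ((contDiff_const.sub contDiff_id).div_const _)
  · exact Real.smoothTransition.one_of_one_le (by linarith)
  · exact Real.smoothTransition.zero_of_nonpos (by linarith)
  · rw [abs_of_nonneg (Real.smoothTransition.nonneg _)]; exact Real.smoothTransition.le_one _
  · simp only [sub_zero]; exact smoothTransition_half

/-- For boundary facets: since the profile already vanishes for `s ≥ -1/2`, the smoothed field keeps
a positive distance from the boundary and is an admissible test field on `Ω`. -/
theorem exists_isProfile_zero : ∃ Φ, IsProfile Φ ∧ Φ 0 = 0 ∧ ∀ s, -1 / 2 ≤ s → Φ s = 0 := by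
  refine ⟨fun s => Real.smoothTransition (-2 * s - 1), ⟨?_, fun s hs => ?_, fun s hs => ?_, fun s => ?_⟩,
    ?_, fun s hs => ?_⟩
  · exact (Real.smoothTransition.contDiff (n := ⊤)).comp
      ((contDiff_const.mul contDiff_id).sub contDiff_const)
  · exact Real.smoothTransition.one_of_one_le (by linarith)
  · exact Real.smoothTransition.zero_of_nonpos (by linarith)
  · rw [abs_of_nonneg (Real.smoothTransition.nonneg _)]; exact Real.smoothTransition.le_one _
  · exact Real.smoothTransition.zero_of_nonpos (by norm_num)
  · exact Real.smoothTransition.zero_of_nonpos (by linarith)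

namespace IsProfile
variable {Φ : ℝ → ℝ}

theorem continuous_deriv (h : IsProfile Φ) : Continuous (deriv Φ) := h.contDiff.continuous_deriv (by simp)

theorem hasDerivAt (h : IsProfile Φ) (s : ℝ) : HasDerivAt Φ (deriv Φ s) s :=
  (h.contDiff.differentiable (by simp) s).hasDerivAt

theorem deriv_eq_zero (h : IsProfile Φ) (s : ℝ) (hs : 1 ≤ |s|) : deriv Φ s = 0 := by
  have h1 : ∀ s, 1 < |s| → deriv Φ s = 0 := by
    intro s hs
    rcases lt_abs.1 hs with h' | h'
    · have : Φ =ᶠ[𝓝 s] fun _ => 0 := by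
        filter_upwards [Ioi_mem_nhds h'] with y hy using h.eq_zero y (le_of_lt hy)
      rw [this.deriv_eq]; simp
    · have : Φ =ᶠ[𝓝 s] fun _ => 1 := by
        filter_upwards [Iio_mem_nhds (show s < -1 by linarith)] with y hy using h.eq_one y (le_of_lt hy)
      rw [this.deriv_eq]; simp
  have h2 : IsClosed {s | deriv Φ s = 0} := isClosed_eq h.continuous_deriv continuous_const
  have h3 : closure {s : ℝ | 1 < |s|} ⊆ {s | deriv Φ s = 0} := closure_minimal h1 h2
  refine h3 ?_
  rcases le_abs.1 hs with h' | h'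
  · refine closure_mono (s := Ioi 1) (fun y hy => lt_of_lt_of_le hy (le_abs_self y)) ?_
    rw [closure_Ioi]; exact h'
  · refine closure_mono (s := Iio (-1)) (fun y hy => ?_) ?_
    · have : y < -1 := hy
      exact lt_of_lt_of_le (by linarith) (neg_le_abs y)
    · rw [closure_Iio]; show s ≤ -1; linarith

theorem integrable_deriv (h : IsProfile Φ) : Integrable (deriv Φ) := by
  refine h.continuous_deriv.integrable_of_hasCompactSupport
    (HasCompactSupport.intro (isCompact_Icc (a := (-1 : ℝ)) (b := 1)) fun s hs => h.deriv_eq_zero s ?_)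
  by_contra hc
  push Not at hc
  exact hs ⟨(abs_lt.1 hc).1.le, (abs_lt.1 hc).2.le⟩

theorem integral_Iic (h : IsProfile Φ) : ∫ s in Iic 0, deriv Φ s = Φ 0 - 1 := by
  refine integral_Iic_of_hasDerivAt_of_tendsto (h.hasDerivAt 0).continuousAt.continuousWithinAt
    (fun x _ => h.hasDerivAt x) h.integrable_deriv.integrableOn ?_
  refine tendsto_const_nhds.congr' ?_
  filter_upwards [eventually_le_atBot (-1)] with s hs using (h.eq_one s hs).symm

theorem integral_Ici (h : IsProfile Φ) : ∫ s in Ici 0, deriv Φ s = - Φ 0 := by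
  rw [integral_Ici_eq_integral_Ioi, ← zero_sub]
  refine integral_Ioi_of_hasDerivAt_of_tendsto (h.hasDerivAt 0).continuousAt.continuousWithinAt
    (fun x _ => h.hasDerivAt x) h.integrable_deriv.integrableOn ?_
  refine tendsto_const_nhds.congr' ?_
  filter_upwards [eventually_ge_atTop 1] with s hs using (h.eq_zero s hs).symm

end IsProfile

/-- The smoothed indicator function of the half space `⟪n, ·⟫ < c`. -/
def smoothHalf (Φ : ℝ → ℝ) (n : Vec d) (c : ℝ) (k : ℕ) (y : Vec d) : ℝ :=
  Φ ((inner ℝ n y - c) / radius k)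

section smoothHalf
variable {Φ : ℝ → ℝ} {n : Vec d} {c : ℝ}

theorem contDiff_smoothHalf (h : IsProfile Φ) (k : ℕ) : ContDiff ℝ ∞ (smoothHalf Φ n c k) := by
  have h1 : ContDiff ℝ ∞ fun y : Vec d => (inner ℝ n y - c) / radius k :=
    ((innerSL ℝ n).contDiff.sub contDiff_const).div_const _
  exact h.contDiff.comp h1

theorem fderiv_smoothHalf (h : IsProfile Φ) (k : ℕ) (y v : Vec d) :
    fderiv ℝ (smoothHalf Φ n c k) y v
      = (radius k)⁻¹ * deriv Φ ((inner ℝ n y - c) / radius k) * inner ℝ n v := by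
  have h1 : HasFDerivAt (fun y : Vec d => (inner ℝ n y - c) / radius k)
      ((radius k)⁻¹ • innerSL ℝ n) y := by
    simp_rw [div_eq_mul_inv]
    exact (((innerSL ℝ n).hasFDerivAt).sub_const c).mul_const _
  rw [show smoothHalf Φ n c k = Φ ∘ fun y => (inner ℝ n y - c) / radius k from rfl,
    ((h.hasDerivAt _).comp_hasFDerivAt y h1).fderiv]
  simp; ring

theorem tendsto_smoothHalf (h : IsProfile Φ) {y : Vec d} (hy : inner ℝ n y ≠ c) :
    Tendsto (fun k => smoothHalf Φ n c k y) atTop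
      (𝓝 ({y : Vec d | inner ℝ n y < c}.indicator (fun _ => 1) y)) := by
  have hpos : 0 < |inner ℝ n y - c| := abs_pos.2 (sub_ne_zero.2 hy)
  refine tendsto_const_nhds.congr' ?_
  filter_upwards [tendsto_radius.eventually (gt_mem_nhds hpos)] with k hk
  have hr := radius_pos k
  rcases lt_or_gt_of_ne hy with hlt | hgt
  · rw [indicator_of_mem (show y ∈ {y : Vec d | inner ℝ n y < c} from hlt), smoothHalf, h.eq_one]
    rw [abs_of_neg (by linarith)] at hk
    rw [div_le_iff₀ hr]; linarith
  · rw [indicator_of_notMem (show y ∉ {y : Vec d | inner ℝ n y < c} from not_lt.2 hgt.le), smoothHalf,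
      h.eq_zero]
    rw [abs_of_pos (by linarith)] at hk
    rw [le_div_iff₀ hr]; linarith

theorem volume_hyperplane (hn : ‖n‖ = 1) (c : ℝ) : volume {y : Vec d | inner ℝ n y = c} = 0 := by
  have h : ∀ N : ℕ, volume ({y : Vec d | inner ℝ n y = c} ∩ Metric.ball 0 N) = 0 := by
    intro N
    obtain ⟨C, hC, h⟩ := volume_strip_inter_ball_le hn N
    have := h c 0 le_rfl
    rw [mul_zero, ENNReal.ofReal_zero, nonpos_iff_eq_zero] at this
    refine measure_mono_null (inter_subset_inter_left _ fun y hy => ?_) this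
    show |inner ℝ n y - c| ≤ 0
    rw [show inner ℝ n y = c from hy]; simp
  have hU : {y : Vec d | inner ℝ n y = c} = ⋃ N : ℕ, {y : Vec d | inner ℝ n y = c} ∩ Metric.ball 0 N := by
    rw [← inter_iUnion, Metric.iUnion_ball_nat, inter_univ]
  rw [hU]
  exact measure_iUnion_null h

theorem ae_inner_ne (hn : ‖n‖ = 1) (c : ℝ) : ∀ᵐ y : Vec d, inner ℝ n y ≠ c :=
  measure_eq_zero_iff_ae_notMem.1 (volume_hyperplane hn c)

theorem tendsto_integral_smoothHalf_mul (h : IsProfile Φ) (hn : ‖n‖ = 1) {μ : Measure (Vec d)}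
    (hμ : μ ≪ volume) {Y : Vec d → ℝ} (hY : Integrable Y μ) :
    Tendsto (fun k => ∫ y, smoothHalf Φ n c k y * Y y ∂μ) atTop
      (𝓝 (∫ y, {y : Vec d | inner ℝ n y < c}.indicator Y y ∂μ)) := by
  refine tendsto_integral_of_dominated_convergence (fun x => ‖Y x‖) (fun k =>
    (contDiff_smoothHalf h k).continuous.aestronglyMeasurable.mul hY.1) hY.norm
    (fun k => Eventually.of_forall fun x => ?_) ?_
  · rw [norm_mul]
    exact mul_le_of_le_one_left (norm_nonneg _) (h.abs_le _)
  · filter_upwards [hμ.ae_le (ae_inner_ne hn c)] with x hx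
    have := (tendsto_smoothHalf h hx).mul_const (Y x)
    convert this using 2
    by_cases hm : x ∈ {y : Vec d | inner ℝ n y < c}
    · rw [indicator_of_mem hm, indicator_of_mem hm, one_mul]
    · rw [indicator_of_notMem hm, indicator_of_notMem hm, zero_mul]

end smoothHalf

/-- A neighbourhood `B` of a point of a facet `F`: the domain is a full neighbourhood or a half
space there, the two sides of `F` being `Kp` and `Km`. -/
structure FacetNhd (Ω B F Kp Km : Set (Vec d)) (n : Vec d) (c : ℝ) (two : Prop) : Prop where
  norm_normal : ‖n‖ = 1
  isOpen : IsOpen B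
  mem_facet : ∀ y ∈ B, inner ℝ n y = c → y ∈ F
  mem_plus : ∀ y ∈ B, (y ∈ Kp ↔ inner ℝ n y ≤ c)
  interior : two → B ⊆ Ω ∧ ∀ y ∈ B, (y ∈ Km ↔ c ≤ inner ℝ n y)
  boundary : ¬ two → ∀ y ∈ B, (y ∈ Ω ↔ inner ℝ n y < c)

namespace FacetNhd
variable {Ω B F Kp Km : Set (Vec d)} {n : Vec d} {c : ℝ} {two : Prop}

/-- The limit of weighted strip integrals, from both sides. -/
theorem tendsto_integral_strip_two (h : FacetNhd Ω B F Kp Km n c two) (hΩm : MeasurableSet Ω)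
    {g : Vec d → Vec d} {a a' : ℝ}
    (hp : TraceSetting Kp F n c g a) (hm : two → TraceSetting Km F n c g a')
    {θ θp θm : Vec d → Vec d} (hθp : IsTest B θp) (hθm : IsTest B θm)
    (h1 : ∀ᵐ y ∂volume.restrict Ω, inner ℝ n y < c → θ y = θp y)
    (h2 : ∀ᵐ y ∂volume.restrict Ω, c < inner ℝ n y → θ y = θm y)
    {Φ : ℝ → ℝ} (hΦ : IsProfile Φ) (hcase : two ∨ Φ 0 = 0 ∨ θm = 0) :
    Tendsto (fun k => ∫ y in Ω, (radius k)⁻¹ * deriv Φ ((inner ℝ n y - c) / radius k)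
        * inner ℝ (g y) (θ y)) atTop
      (𝓝 ((Φ 0 - 1) * (∫ x in F, inner ℝ (trace Kp g x) (θp x) ∂(surf n c))
        - Φ 0 * ∫ x in F, inner ℝ (trace Km g x) (θm x) ∂(surf n c))) := by
  have hn := h.norm_normal
  have hscale : ∀ r : ℝ, 0 < r → ∀ s, s / r ∈ Iic (0 : ℝ) ↔ s ∈ Iic (0 : ℝ) := fun r hr s => by
    rw [mem_Iic, mem_Iic, div_le_iff₀ hr, zero_mul]
  have hscale' : ∀ r : ℝ, 0 < r → ∀ s, s / r ∈ Ici (0 : ℝ) ↔ s ∈ Ici (0 : ℝ) := fun r hr s => by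
    rw [mem_Ici, mem_Ici, le_div_iff₀ hr, zero_mul]
  have tp := tendsto_integral_strip hp measurableSet_Iic hscale h.isOpen
    (fun y hy => by rw [h.mem_plus y hy, mem_Iic, sub_nonpos]) h.mem_facet hθp
    hΦ.continuous_deriv hΦ.deriv_eq_zero
  rw [hΦ.integral_Iic] at tp
  have hint : ∀ {K : Set (Vec d)} {b : ℝ}, TraceSetting K F n c g b → ∀ {η : Vec d → Vec d}, IsTest B η →
      ∀ k, IntegrableOn (fun y => (radius k)⁻¹ * deriv Φ ((inner ℝ n y - c) / radius k)
        * inner ℝ (g y) (η y)) K := by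
    intro K b hK η hη k
    obtain ⟨Cη, hCη, hbη⟩ := hη.exists_bound
    have hi : IntegrableOn (fun y => (inner ℝ (g y) (η y) : ℝ)) K := by
      refine Integrable.mono' (hK.int.norm.mul_const Cη)
        (hK.int.1.inner hη.continuous.aestronglyMeasurable) (Eventually.of_forall fun y => ?_)
      exact (norm_inner_le_norm _ _).trans (by gcongr; exact hbη y)
    have hcs : HasCompactSupport (deriv Φ) :=
      HasCompactSupport.intro (isCompact_Icc (a := (-1 : ℝ)) (b := 1)) fun s hs =>
        hΦ.deriv_eq_zero s (by
          by_contra hc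
          push Not at hc
          exact hs ⟨(abs_lt.1 hc).1.le, (abs_lt.1 hc).2.le⟩)
    obtain ⟨C, hC⟩ := hcs.exists_bound_of_continuous hΦ.continuous_deriv
    refine hi.bdd_mul (c := (radius k)⁻¹ * C) ?_ (Eventually.of_forall fun y => ?_)
    · have := hΦ.continuous_deriv
      exact Continuous.aestronglyMeasurable (by fun_prop)
    · rw [norm_mul, Real.norm_of_nonneg (inv_nonneg.2 (radius_pos k).le)]
      exact mul_le_mul_of_nonneg_left (hC _) (inv_nonneg.2 (radius_pos k).le)
  have hne := ae_inner_ne hn c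
  have h1' := (ae_restrict_iff' hΩm).1 h1
  have h2' := (ae_restrict_iff' hΩm).1 h2
  have hz : ∀ {η : Vec d → Vec d}, IsTest B η → ∀ y ∉ B, η y = 0 := fun hη y hy =>
    image_eq_zero_of_notMem_tsupport fun hc => hy (hη.2.2 hc)
  by_cases ht : two
  · obtain ⟨hBΩ, hKm⟩ := h.interior ht
    have hm' := hm ht
    have tm := tendsto_integral_strip hm' measurableSet_Ici hscale' h.isOpen
      (fun y hy => by rw [hKm y hy, mem_Ici, sub_nonneg]) h.mem_facet hθm
      hΦ.continuous_deriv hΦ.deriv_eq_zero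
    rw [hΦ.integral_Ici] at tm
    have := tp.add tm
    rw [neg_mul, ← sub_eq_add_neg] at this
    refine this.congr fun k => ?_
    rw [← integral_indicator hp.measU, ← integral_indicator hm'.measU, ← integral_indicator hΩm,
      ← integral_add ((integrable_indicator_iff hp.measU).2 (hint hp hθp k))
        ((integrable_indicator_iff hm'.measU).2 (hint hm' hθm k))]
    refine integral_congr_ae ?_
    filter_upwards [hne, h1', h2'] with y hy hy1 hy2
    by_cases hyB : y ∈ B
    · rcases lt_or_gt_of_ne hy with hlt | hgt
      · rw [indicator_of_mem ((h.mem_plus y hyB).2 hlt.le),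
          indicator_of_notMem (fun hc => absurd ((hKm y hyB).1 hc) (not_le.2 hlt)),
          indicator_of_mem (hBΩ hyB), hy1 (hBΩ hyB) hlt, add_zero]
      · rw [indicator_of_mem ((hKm y hyB).2 hgt.le),
          indicator_of_notMem (fun hc => absurd ((h.mem_plus y hyB).1 hc) (not_le.2 hgt)),
          indicator_of_mem (hBΩ hyB), hy2 (hBΩ hyB) hgt, zero_add]
    · have z1 : ∀ S : Set (Vec d), S.indicator (fun y => (radius k)⁻¹ *
          deriv Φ ((inner ℝ n y - c) / radius k) * inner ℝ (g y) (θp y)) y = 0 := fun S => by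
        rw [indicator_apply_eq_zero, hz hθp y hyB, inner_zero_right, mul_zero]; exact fun _ => rfl
      have z2 : ∀ S : Set (Vec d), S.indicator (fun y => (radius k)⁻¹ *
          deriv Φ ((inner ℝ n y - c) / radius k) * inner ℝ (g y) (θm y)) y = 0 := fun S => by
        rw [indicator_apply_eq_zero, hz hθm y hyB, inner_zero_right, mul_zero]; exact fun _ => rfl
      rw [z1, z2, add_zero, eq_comm, indicator_apply_eq_zero]
      intro hyΩ
      have : θ y = 0 := by
        rcases lt_or_gt_of_ne hy with hlt | hgt
        · rw [hy1 hyΩ hlt, hz hθp y hyB]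
        · rw [hy2 hyΩ hgt, hz hθm y hyB]
      rw [this, inner_zero_right, mul_zero]
  · have hside := h.boundary ht
    -- On a boundary facet nothing is assumed about `Km`, so its term must vanish through the
    -- profile or the field.
    have hterm : Φ 0 * ∫ x in F, inner ℝ (trace Km g x) (θm x) ∂(surf n c) = 0 := by
      rcases hcase with hc | hc | hc
      · exact absurd hc ht
      · rw [hc, zero_mul]
      · simp [hc]
    rw [hterm, sub_zero]
    refine tp.congr fun k => ?_
    rw [← integral_indicator hp.measU, ← integral_indicator hΩm]
    refine integral_congr_ae ?_
    filter_upwards [hne, h1', h2'] with y hy hy1 hy2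
    by_cases hyB : y ∈ B
    · rcases lt_or_gt_of_ne hy with hlt | hgt
      · have hyΩ := (hside y hyB).2 hlt
        rw [indicator_of_mem ((h.mem_plus y hyB).2 hlt.le), indicator_of_mem hyΩ, hy1 hyΩ hlt]
      · rw [indicator_of_notMem (fun hc => absurd ((h.mem_plus y hyB).1 hc) (not_le.2 hgt)),
          indicator_of_notMem (fun hc => absurd ((hside y hyB).1 hc) (not_lt.2 hgt.le))]
    · have z1 : Kp.indicator (fun y => (radius k)⁻¹ *
          deriv Φ ((inner ℝ n y - c) / radius k) * inner ℝ (g y) (θp y)) y = 0 := by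
        rw [indicator_apply_eq_zero, hz hθp y hyB, inner_zero_right, mul_zero]; exact fun _ => rfl
      rw [z1, eq_comm, indicator_apply_eq_zero]
      intro hyΩ
      have : θ y = 0 := by
        rcases lt_or_gt_of_ne hy with hlt | hgt
        · rw [hy1 hyΩ hlt, hz hθp y hyB]
        · rw [hy2 hyΩ hgt, hz hθm y hyB]
      rw [this, inner_zero_right, mul_zero]

end FacetNhd

end Facet

/-! ### Testing a balance law with fields that jump across a facet -/

section Facet
variable {d : ℕ}

theorem surf_pos_of_isOpen {n : Vec d} (hn : ‖n‖ = 1) {c : ℝ} {W : Set (Vec d)} (hW : IsOpen W)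
    {x : Vec d} (hx : x ∈ W) (hxc : inner ℝ n x = c) : 0 < surf n c W := by
  unfold surf
  rw [Measure.map_apply (by fun_prop) hW.measurableSet]
  refine IsOpen.measure_pos _ (hW.preimage (by fun_prop)) ?_
  have : x ∈ range (fun x : (ℝ ∙ n)ᗮ => (x : Vec d) + c • n) := by
    rw [orthogonal_add_range hn]; exact hxc
  obtain ⟨z, hz⟩ := this
  have hz' : (z : Vec d) + c • n = x := hz
  exact ⟨z, by rw [mem_preimage, hz']; exact hx⟩

theorem DensityBound.trace_const {K : Set (Vec d)} {x : Vec d} {a : ℝ} (h : DensityBound K x a)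
    (v : Vec d) : trace K (fun _ => v) x = v := by
  refine Tendsto.limUnder_eq (tendsto_const_nhds.congr' ?_)
  filter_upwards [Ioc_mem_nhdsGT (show (0 : ℝ) < 1 by norm_num)] with r hr
  rw [setAverage_const (h.volume_ne_zero hr) (volume_ball_inter_ne_top K x r)]

theorem IsTest.smul {U : Set (Vec d)} {ψ : Vec d → ℝ} (hψ : IsTest U ψ) {q : Vec d → Vec d}
    (hq : ContDiff ℝ ∞ q) : IsTest U fun y => ψ y • q y :=
  ⟨hψ.1.smul hq, hψ.2.1.smul_right, (tsupport_smul_subset_left ψ q).trans hψ.2.2⟩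

theorem IsTest.const_smul {U : Set (Vec d)} {q : Vec d → Vec d} (hq : IsTest U q) (a : ℝ) :
    IsTest U fun y => a • q y := by
  have hs : tsupport (fun y => a • q y) ⊆ tsupport q := tsupport_smul_subset_right (fun _ => a) q
  exact ⟨hq.1.const_smul a, hq.2.1.of_isClosed_subset (isClosed_tsupport _) hs, hs.trans hq.2.2⟩

theorem IsTest.smoothHalf_smul {U : Set (Vec d)} {G : Type*} [NormedAddCommGroup G] [NormedSpace ℝ G]
    {q : Vec d → G} (hq : IsTest U q) {Φ : ℝ → ℝ}
    (hΦ : IsProfile Φ) (n : Vec d) (c : ℝ) (k : ℕ) : IsTest U fun y => smoothHalf Φ n c k y • q y :=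
  ⟨(contDiff_smoothHalf hΦ k).smul hq.1, hq.2.1.smul_left,
    (tsupport_smul_subset_right (smoothHalf Φ n c k) q).trans hq.2.2⟩

theorem IsTest.eq_zero {U : Set (Vec d)} {G : Type*} [NormedAddCommGroup G] [NormedSpace ℝ G]
    {q : Vec d → G} (hq : IsTest U q) {y : Vec d} (hy : y ∉ U) : q y = 0 :=
  image_eq_zero_of_notMem_tsupport fun hc => hy (hq.2.2 hc)

theorem fderiv_smoothHalf_smul {G : Type*} [NormedAddCommGroup G] [NormedSpace ℝ G]
    {q : Vec d → G} (hq : ContDiff ℝ ∞ q) {Φ : ℝ → ℝ}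
    (hΦ : IsProfile Φ) (n : Vec d) (c : ℝ) (k : ℕ) (y v : Vec d) :
    fderiv ℝ (fun y => smoothHalf Φ n c k y • q y) y v = smoothHalf Φ n c k y • fderiv ℝ q y v
      + ((radius k)⁻¹ * deriv Φ ((inner ℝ n y - c) / radius k) * inner ℝ n v) • q y := by
  rw [fderiv_fun_smul ((contDiff_smoothHalf hΦ k).differentiable (by simp) y)
    (hq.differentiable (by simp) y)]
  simp [fderiv_smoothHalf hΦ]

theorem IsProfile.exists_bound_deriv {Φ : ℝ → ℝ} (hΦ : IsProfile Φ) :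
    ∃ C, 0 ≤ C ∧ ∀ s, |deriv Φ s| ≤ C := by
  have hcs : HasCompactSupport (deriv Φ) :=
    HasCompactSupport.intro (isCompact_Icc (a := (-1 : ℝ)) (b := 1)) fun s hs =>
      hΦ.deriv_eq_zero s (by
        by_contra hc
        push Not at hc
        exact hs ⟨(abs_lt.1 hc).1.le, (abs_lt.1 hc).2.le⟩)
  obtain ⟨C, hC⟩ := hcs.exists_bound_of_continuous hΦ.continuous_deriv
  exact ⟨C, (norm_nonneg _).trans (hC 0), hC⟩

theorem integrable_strip_mul {Φ : ℝ → ℝ} (hΦ : IsProfile Φ) (n : Vec d) (c : ℝ) (k : ℕ)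
    {μ : Measure (Vec d)} {f : Vec d → ℝ} (hf : Integrable f μ) :
    Integrable (fun y => (radius k)⁻¹ * deriv Φ ((inner ℝ n y - c) / radius k) * f y) μ := by
  obtain ⟨C, hC0, hC⟩ := hΦ.exists_bound_deriv
  have h0 : 0 ≤ (radius k)⁻¹ := inv_nonneg.2 (radius_pos k).le
  refine hf.bdd_mul (c := (radius k)⁻¹ * C) ?_ (Eventually.of_forall fun y => ?_)
  · have := hΦ.continuous_deriv
    exact Continuous.aestronglyMeasurable (by fun_prop)
  · rw [norm_mul, Real.norm_of_nonneg h0]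
    exact mul_le_mul_of_nonneg_left (hC _) h0

theorem IsTest.integrable_inner {U : Set (Vec d)} {η : Vec d → Vec d} (hη : IsTest U η)
    {μ : Measure (Vec d)} {g : Vec d → Vec d} (hg : Integrable g μ) :
    Integrable (fun y => (inner ℝ (g y) (η y) : ℝ)) μ := by
  obtain ⟨C, hC, hb⟩ := hη.exists_bound
  refine Integrable.mono' (hg.norm.mul_const C)
    (hg.1.inner hη.continuous.aestronglyMeasurable) (Eventually.of_forall fun y => ?_)
  exact (norm_inner_le_norm _ _).trans (by gcongr; exact hb y)

theorem IsTest.fderiv_apply {U : Set (Vec d)} {η : Vec d → Vec d} (hη : IsTest U η) (v : Vec d) :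
    IsTest U fun y => fderiv ℝ η y v :=
  ⟨(hη.1.fderiv_right (m := ∞) (by simp)).clm_apply contDiff_const,
    hη.hasCompactSupport_fderiv_apply v, (tsupport_fderiv_apply_subset ℝ v).trans hη.2.2⟩

theorem inner_unitVec (n : Vec d) (j : Fin d) : inner ℝ n (unitVec j) = n j := by
  simp [unitVec, EuclideanSpace.inner_single_right]

/-- The integrand `Σ_j σ_j · ∂_j w + G · w`. -/
def formDensity (σ : Fin d → Vec d → Vec d) (G w : Vec d → Vec d) (y : Vec d) : ℝ :=
  (∑ j, inner ℝ (σ j y) (fderiv ℝ w y (unitVec j))) + inner ℝ (G y) (w y)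

theorem IsTest.integrable_formDensity {U : Set (Vec d)} {w : Vec d → Vec d} (hw : IsTest U w)
    {μ : Measure (Vec d)} {σ : Fin d → Vec d → Vec d} {G : Vec d → Vec d}
    (hσ : ∀ j, Integrable (σ j) μ) (hG : Integrable G μ) : Integrable (formDensity σ G w) μ :=
  (integrable_finsetSum _ fun j _ => (hw.fderiv_apply (unitVec j)).integrable_inner (hσ j)).add
    (hw.integrable_inner hG)

theorem inner_eq_sum (n v : Vec d) : inner ℝ n v = ∑ j, n j * inner ℝ (unitVec j) v := by
  rw [PiLp.inner_apply]
  refine Finset.sum_congr rfl fun j _ => ?_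
  have : inner ℝ (unitVec j) v = v j := by rw [real_inner_comm, inner_unitVec]
  rw [this]
  simp [mul_comm]

/-- The product rule separates the terms in which the derivative falls on the profile. In these the
pressure occurs only through the normal component of the jump, since the gradient of the profile is
parallel to `n`. -/
theorem formDensity_add_smoothHalf_smul {σ : Fin d → Vec d → Vec d} {g : Fin d → Vec d → Vec d}
    {p : Vec d → ℝ} {G : Vec d → Vec d} (hσ : ∀ j y, σ j y = g j y - p y • unitVec j)
    {P J : Vec d → Vec d} (hP : ContDiff ℝ ∞ P) (hJ : ContDiff ℝ ∞ J) {Φ : ℝ → ℝ} (hΦ : IsProfile Φ)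
    (n : Vec d) (c : ℝ) (k : ℕ) (y : Vec d) :
    formDensity σ G (P + fun y => smoothHalf Φ n c k y • J y) y =
      formDensity σ G P y + (smoothHalf Φ n c k y * formDensity σ G J y +
      (∑ j, (radius k)⁻¹ * deriv Φ ((inner ℝ n y - c) / radius k) * inner ℝ (g j y) (n j • J y)) -
      (radius k)⁻¹ * deriv Φ ((inner ℝ n y - c) / radius k) * (p y * inner ℝ n (J y))) := by
  have hfd : ∀ j, fderiv ℝ (P + fun y => smoothHalf Φ n c k y • J y) y (unitVec j) =
      fderiv ℝ P y (unitVec j) + (smoothHalf Φ n c k y • fderiv ℝ J y (unitVec j)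
      + ((radius k)⁻¹ * deriv Φ ((inner ℝ n y - c) / radius k) * n j) • J y) := by
    intro j
    have hdiff : DifferentiableAt ℝ (fun y => smoothHalf Φ n c k y • J y) y :=
      ((contDiff_smoothHalf hΦ k).smul hJ).differentiable (by simp) y
    rw [fderiv_add (hP.differentiable (by simp) y) hdiff, add_apply,
      fderiv_smoothHalf_smul hJ hΦ, inner_unitVec]
  unfold formDensity
  simp only [Pi.add_apply, hfd]
  rw [inner_eq_sum n (J y)]
  set X := (radius k)⁻¹ * deriv Φ ((inner ℝ n y - c) / radius k)
  have e1 : ∀ j, inner ℝ (σ j y) (fderiv ℝ P y (unitVec j) + (smoothHalf Φ n c k y • fderiv ℝ J y (unitVec j)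
      + (X * n j) • J y)) = inner ℝ (σ j y) (fderiv ℝ P y (unitVec j)) +
      smoothHalf Φ n c k y * inner ℝ (σ j y) (fderiv ℝ J y (unitVec j)) +
      (X * inner ℝ (g j y) (n j • J y) - X * (p y * (n j * inner ℝ (unitVec j) (J y)))) := by
    intro j
    rw [inner_add_right, inner_add_right, inner_smul_right, inner_smul_right, inner_smul_right,
      hσ j y, inner_sub_left (g j y) _ (J y), inner_smul_left]
    simp only [RCLike.conj_to_real]
    ring
  rw [Finset.sum_congr rfl fun j _ => e1 j, Finset.sum_add_distrib, Finset.sum_add_distrib,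
    Finset.sum_sub_distrib, ← Finset.mul_sum, ← Finset.mul_sum, ← Finset.mul_sum, ← Finset.mul_sum,
    inner_add_right, inner_smul_right]
  ring

namespace FacetNhd
variable {Ω B F Kp Km : Set (Vec d)} {n : Vec d} {c : ℝ} {two : Prop}

/-- The normal component of a solenoidal, piecewise smooth field does not jump. -/
theorem inner_jump_eq_zero (h : FacetNhd Ω B F Kp Km n c two) (hΩ : IsOpen Ω) {a a' : ℝ}
    (hp : TraceSetting Kp F n c (fun _ => n) a) (hm : two → TraceSetting Km F n c (fun _ => n) a')
    {v qp qm : Vec d → Vec d} (hv : IntegrableOn v Ω)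
    (hD : ∀ φ : Vec d → ℝ, IsTest univ φ → ∫ y in Ω, fderiv ℝ φ y (v y) = 0)
    (hqp : ContDiff ℝ ∞ qp) (hqm : ContDiff ℝ ∞ qm) (hqm0 : ¬ two → qm = 0)
    (hvp : ∀ᵐ y ∂volume.restrict Ω, y ∈ B → inner ℝ n y < c → v y = qp y)
    (hvm : ∀ᵐ y ∂volume.restrict Ω, y ∈ B → c < inner ℝ n y → v y = qm y)
    {x : Vec d} (hx : x ∈ B) (hxc : inner ℝ n x = c) : inner ℝ n (qp x - qm x) = 0 := by
  have hn := h.norm_normal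
  -- The limit of the solenoidality relation tested with the profile times `ψ`. Test functions need
  -- not vanish on the boundary of `Ω`, so the normal component on boundary facets is covered too.
  have key : ∀ Φ, IsProfile Φ → ∀ ψ : Vec d → ℝ, IsTest B ψ →
      (∫ y in Ω, {y : Vec d | inner ℝ n y < c}.indicator (fun y => fderiv ℝ ψ y (v y)) y) +
      ((Φ 0 - 1) * (∫ x in F, inner ℝ (trace Kp (fun _ => n) x) (ψ x • qp x) ∂(surf n c))
        - Φ 0 * ∫ x in F, inner ℝ (trace Km (fun _ => n) x) (ψ x • qm x) ∂(surf n c)) = 0 := by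
    intro Φ hΦ ψ hψ
    have t1 := tendsto_integral_smoothHalf_mul (c := c) hΦ hn
      (Measure.absolutelyContinuous_of_le Measure.restrict_le_self)
      (hψ.integrable_fderiv_apply hv)
    have t2 := h.tendsto_integral_strip_two hΩ.measurableSet hp hm (θ := fun y => ψ y • v y)
      (hψ.smul hqp) (hψ.smul hqm) (by
        filter_upwards [hvp] with y hy hlt
        by_cases hyB : y ∈ B
        · rw [hy hyB hlt]
        · rw [hψ.eq_zero hyB, zero_smul, zero_smul]) (by
        filter_upwards [hvm] with y hy hlt
        by_cases hyB : y ∈ B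
        · rw [hy hyB hlt]
        · rw [hψ.eq_zero hyB, zero_smul, zero_smul]) hΦ (by
        by_cases ht : two
        · exact Or.inl ht
        · refine Or.inr (Or.inr ?_)
          ext1 y
          rw [hqm0 ht]; simp)
    refine tendsto_nhds_unique (t1.add t2) (tendsto_const_nhds.congr fun k => ?_)
    have hψv : IntegrableOn (fun y => inner ℝ n (ψ y • v y)) Ω := by
      obtain ⟨C, _, hC⟩ := hψ.exists_bound
      have : IntegrableOn (fun y => ψ y • v y) Ω :=
        hv.bdd_smul C hψ.continuous.aestronglyMeasurable (Eventually.of_forall hC)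
      exact this.const_inner n
    rw [← integral_add ((hψ.integrable_fderiv_apply hv).bdd_mul (c := 1)
      (contDiff_smoothHalf hΦ k).continuous.aestronglyMeasurable
      (Eventually.of_forall fun y => hΦ.abs_le _)) (integrable_strip_mul hΦ n c k hψv)]
    rw [← hD _ ((hψ.smoothHalf_smul hΦ n c k).mono (subset_univ _))]
    refine integral_congr_ae (Eventually.of_forall fun y => ?_)
    simp only
    rw [fderiv_smoothHalf_smul hψ.1 hΦ, inner_smul_right]
    simp only [smul_eq_mul]; ring
  -- The volume term does not depend on the profile. Subtracting the relations for `Φ 0 = 1/2` and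
  -- `Φ 0 = 0` leaves half of the integral of the normal jump against `ψ`.
  obtain ⟨Φ1, h1, e1⟩ := exists_isProfile_half
  obtain ⟨Φ0, h0, e0, -⟩ := exists_isProfile_zero
  have hint : ∀ ψ : Vec d → ℝ, IsTest B ψ → ∫ x in F, ψ x * inner ℝ n (qp x - qm x) ∂(surf n c) = 0 := by
    intro ψ hψ
    have k1 := key Φ1 h1 ψ hψ
    have k0 := key Φ0 h0 ψ hψ
    rw [e1] at k1
    rw [e0] at k0
    have hfin : IsFiniteMeasure ((surf n c).restrict F) := isFiniteMeasure_restrict.2 hp.surf_lt_top.ne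
    have c1 : ∫ x in F, inner ℝ (trace Kp (fun _ => n) x) (ψ x • qp x) ∂(surf n c)
        = ∫ x in F, inner ℝ n (ψ x • qp x) ∂(surf n c) := by
      refine setIntegral_congr_fun hp.measF fun x hx => ?_
      rw [(hp.density x hx).trace_const]
    have c2 : ∫ x in F, inner ℝ (trace Km (fun _ => n) x) (ψ x • qm x) ∂(surf n c)
        = ∫ x in F, inner ℝ n (ψ x • qm x) ∂(surf n c) := by
      refine setIntegral_congr_fun hp.measF fun x hx => ?_
      by_cases ht : two
      · rw [((hm ht).density x hx).trace_const]
      · rw [hqm0 ht]; simp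
    rw [c1, c2] at k1
    rw [c1, c2] at k0
    have i1 := (hψ.smul hqp).integrable_inner (integrable_const n (μ := (surf n c).restrict F))
    have i2 := (hψ.smul hqm).integrable_inner (integrable_const n (μ := (surf n c).restrict F))
    have : ∫ x in F, ψ x * inner ℝ n (qp x - qm x) ∂(surf n c)
        = (∫ x in F, inner ℝ n (ψ x • qp x) ∂(surf n c)) - ∫ x in F, inner ℝ n (ψ x • qm x) ∂(surf n c) := by
      rw [← integral_sub i1 i2]
      refine integral_congr_ae (Eventually.of_forall fun x => ?_)
      simp only [inner_smul_right, inner_sub_right]; ring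
    rw [this]
    linarith
  set m : Vec d → ℝ := fun x => inner ℝ n (qp x - qm x) with hm'
  have hmc : Continuous m := by
    have := hqp.continuous
    have := hqm.continuous
    fun_prop
  have hfin : IsFiniteMeasure ((surf n c).restrict F) := isFiniteMeasure_restrict.2 hp.surf_lt_top.ne
  have hae := ae_eq_of_forall_isTest (μ := (surf n c).restrict F) h.isOpen
    (hmc.locallyIntegrable.locallyIntegrableOn B)
    ((continuous_const (y := (0 : ℝ))).locallyIntegrable.locallyIntegrableOn B) fun ψ hψ => by
      rw [setIntegral_eq_integral_of_forall_compl_eq_zero (s := B)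
        (fun y hy => by rw [hψ.eq_zero hy, zero_smul])]
      simpa using hint ψ hψ
  by_contra hne
  -- The normal jump is continuous; if it were nonzero at a point of the hyperplane it would be so
  -- on a relatively open piece, which has positive surface measure.
  set W := B ∩ {y | m y ≠ 0} with hW
  have hWo : IsOpen W := h.isOpen.inter (isOpen_ne_fun hmc continuous_const)
  have hpos := surf_pos_of_isOpen hn hWo (x := x) ⟨hx, hne⟩ hxc
  have hzero : surf n c W = 0 := by
    rw [Measure.restrict_restrict h.isOpen.measurableSet] at hae
    have h3 := (ae_restrict_iff' (h.isOpen.measurableSet.inter hp.measF)).1 hae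
    refine measure_eq_zero_iff_ae_notMem.2 ?_
    filter_upwards [h3, surf_ae hn c] with y hy hyc hyW
    exact hyW.2 (hy ⟨hyW.1, h.mem_facet y hyW.1 hyc⟩)
  exact hpos.ne' hzero

/-- Comparison with the foot point on the hyperplane, where the normal component vanishes; test
fields are Lipschitz. -/
theorem smul_pos_strip_bound {η : Vec d → Vec d} {U : Set (Vec d)} (hη : IsTest U η) (hn : ‖n‖ = 1)
    (h0 : ∀ x, inner ℝ n x = c → inner ℝ n (η x) = 0) :
    ∃ L, 0 ≤ L ∧ ∀ y, |inner ℝ n (η y)| ≤ L * |inner ℝ n y - c| := by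
  obtain ⟨L, hL⟩ := hη.1.lipschitzWith_of_hasCompactSupport hη.2.1 (by simp)
  refine ⟨L, L.2, fun y => ?_⟩
  set z := y - (inner ℝ n y - c) • n with hz
  have hzc : inner ℝ n z = c := by
    rw [hz, inner_sub_right, inner_smul_right, real_inner_self_eq_norm_sq, hn]; ring
  have e : inner ℝ n (η y) = (inner ℝ n (η y - η z) : ℝ) := by
    rw [inner_sub_right, h0 z hzc, sub_zero]
  rw [e]
  refine (abs_real_inner_le_norm _ _).trans ?_
  rw [hn, one_mul, ← dist_eq_norm]
  refine (hL.dist_le_mul _ _).trans (le_of_eq ?_)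
  rw [dist_eq_norm, hz, sub_sub_cancel, norm_smul, hn, mul_one, Real.norm_eq_abs]

set_option maxHeartbeats 400000 in
/-- Testing with smoothed versions of fields that jump across a facet. -/
theorem integral_eq (h : FacetNhd Ω B F Kp Km n c two) (hΩ : IsOpen Ω)
    {σ g : Fin d → Vec d → Vec d} {p : Vec d → ℝ} {G : Vec d → Vec d} {a a' : ℝ}
    (hσg : ∀ j y, σ j y = g j y - p y • unitVec j)
    (hp : ∀ j, TraceSetting Kp F n c (g j) a) (hm : ∀ j, two → TraceSetting Km F n c (g j) a')
    (hg : ∀ j, IntegrableOn (g j) Ω) (hpi : IntegrableOn p Ω) (hG : IntegrableOn G Ω)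
    (hE : ∀ w : Vec d → Vec d, IsTest Ω w →
      ∫ y in Ω, formDensity σ G w y = 0)
    {P J : Vec d → Vec d} (hP : IsTest B P) (hJ : IsTest B J) (hP0 : ¬ two → P = 0)
    (hJ0 : ∀ x, inner ℝ n x = c → inner ℝ n (J x) = 0)
    {κ : ℝ} (hκ : two → κ = 1 / 2) (hκ' : ¬ two → κ = 0) :
    (∫ y in Ω, formDensity σ G P y) +
    (∫ y in Ω, {y : Vec d | inner ℝ n y < c}.indicator (formDensity σ G J) y) =
    (1 - κ) * (∑ j, ∫ x in F, inner ℝ (trace Kp (g j) x) (n j • J x) ∂(surf n c)) +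
      κ * ∑ j, ∫ x in F, inner ℝ (trace Km (g j) x) (n j • J x) ∂(surf n c) := by
  have hn := h.norm_normal
  -- Both kinds of facets are treated at once: `κ` is the weight of the minus side, `1/2` in the
  -- interior and `0` at the boundary.
  obtain ⟨Φ, hΦ, hΦκ, hΦ'⟩ : ∃ Φ, IsProfile Φ ∧ Φ 0 = κ ∧ (¬ two → ∀ s, -1 / 2 ≤ s → Φ s = 0) := by
    by_cases ht : two
    · obtain ⟨Φ, h1, h2⟩ := exists_isProfile_half
      exact ⟨Φ, h1, by rw [h2, hκ ht], fun hc => absurd ht hc⟩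
    · obtain ⟨Φ, h1, h2, h3⟩ := exists_isProfile_zero
      exact ⟨Φ, h1, by rw [h2, hκ' ht], fun _ => h3⟩
  have hσ : ∀ j, IntegrableOn (σ j) Ω := fun j => by
    have e : σ j = fun y => g j y - p y • unitVec j := funext (hσg j)
    have h1 : IntegrableOn (fun y => p y • (unitVec j : Vec d)) Ω := hpi.smul_const _
    rw [e]
    exact Integrable.sub (hg j) h1
  have hnJ : ∀ j, IsTest B fun x => n j • J x := fun j => hJ.const_smul _
  have t1 := tendsto_integral_smoothHalf_mul (c := c) hΦ hn
    (Measure.absolutelyContinuous_of_le (Measure.restrict_le_self (s := Ω))) (hJ.integrable_formDensity hσ hG)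
  have t2 := tendsto_finsetSum (Finset.univ : Finset (Fin d)) fun j _ =>
    h.tendsto_integral_strip_two hΩ.measurableSet (hp j) (hm j) (θ := fun x => n j • J x) (hnJ j) (hnJ j)
      (Eventually.of_forall fun _ _ => rfl) (Eventually.of_forall fun _ _ => rfl) hΦ (by
        by_cases ht : two
        · exact Or.inl ht
        · exact Or.inr (Or.inl (by rw [hΦκ, hκ' ht])))
  obtain ⟨CJ, hCJ, hbJ⟩ := hJ.exists_bound
  have hpJ : IntegrableOn (fun y => p y * inner ℝ n (J y)) Ω := by
    have := hJ.integrable_inner (hpi.smul_const n)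
    refine this.congr (Eventually.of_forall fun y => ?_)
    simp only [inner_smul_left, RCLike.conj_to_real]
  -- The pressure term. In the strip the normal component of `J` is at most `L * radius k`, which
  -- cancels the factor `(radius k)⁻¹`, so `C * L * ‖p‖` dominates. Off the hyperplane the integrand
  -- is eventually zero. No trace of `p` is needed.
  have t3 : Tendsto (fun k => ∫ y in Ω, (radius k)⁻¹ * deriv Φ ((inner ℝ n y - c) / radius k)
      * (p y * inner ℝ n (J y))) atTop (𝓝 0) := by
    obtain ⟨L, hL, hb⟩ := smul_pos_strip_bound hJ hn hJ0
    obtain ⟨C, hC, hbC⟩ := hΦ.exists_bound_deriv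
    rw [← integral_zero (Vec d) ℝ (μ := volume.restrict Ω)]
    refine tendsto_integral_of_dominated_convergence (fun y => C * L * ‖p y‖)
      (fun k => (integrable_strip_mul hΦ n c k hpJ).1) (hpi.norm.const_mul _)
      (fun k => Eventually.of_forall fun y => ?_) ?_
    · have hr := radius_pos k
      by_cases hy : 1 ≤ |(inner ℝ n y - c) / radius k|
      · rw [hΦ.deriv_eq_zero _ hy, mul_zero, zero_mul, norm_zero]; positivity
      · push Not at hy
        rw [abs_div, abs_of_pos hr, div_lt_one hr] at hy
        rw [norm_mul, norm_mul, norm_mul, Real.norm_of_nonneg (inv_nonneg.2 hr.le), Real.norm_eq_abs,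
          Real.norm_eq_abs (inner ℝ n (J y))]
        have h5 : |inner ℝ n (J y)| ≤ L * radius k := (hb y).trans (by gcongr)
        calc (radius k)⁻¹ * |deriv Φ ((inner ℝ n y - c) / radius k)| * (‖p y‖ * |inner ℝ n (J y)|)
            ≤ (radius k)⁻¹ * C * (‖p y‖ * (L * radius k)) := by
              gcongr
              exact hbC _
          _ = C * L * ‖p y‖ := by field_simp
    · filter_upwards [ae_restrict_of_ae (ae_inner_ne hn c)] with y hy
      have hpos : 0 < |inner ℝ n y - c| := abs_pos.2 (sub_ne_zero.2 hy)
      refine tendsto_const_nhds.congr' ?_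
      filter_upwards [tendsto_radius.eventually (gt_mem_nhds hpos)] with k hk
      have hr := radius_pos k
      rw [hΦ.deriv_eq_zero _ (by rw [abs_div, abs_of_pos hr, le_div_iff₀ hr]; linarith), mul_zero, zero_mul]
  -- Admissibility of the smoothed fields. At a boundary facet, `P` vanishes and the profile keeps
  -- the support at depth at least `radius k / 2`.
  have hw : ∀ k, IsTest Ω (P + fun y => smoothHalf Φ n c k y • J y) := by
    intro k
    by_cases ht : two
    · exact (hP.add (hJ.smoothHalf_smul hΦ n c k)).mono (h.interior ht).1
    · rw [hP0 ht, zero_add]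
      refine ⟨(hJ.smoothHalf_smul hΦ n c k).1, (hJ.smoothHalf_smul hΦ n c k).2.1, ?_⟩
      have hr := radius_pos k
      have hcl : IsClosed {y : Vec d | inner ℝ n y - c ≤ - (radius k / 2)} :=
        isClosed_le (f := fun y : Vec d => (inner ℝ n y : ℝ) - c) (by fun_prop) continuous_const
      have hs1 : tsupport (fun y => smoothHalf Φ n c k y • J y) ⊆
          {y : Vec d | inner ℝ n y - c ≤ - (radius k / 2)} := by
        refine closure_minimal (fun y hy => ?_) hcl
        show inner ℝ n y - c ≤ - (radius k / 2)
        by_contra hc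
        push Not at hc
        refine hy ?_
        simp only
        rw [smoothHalf, hΦ' ht, zero_smul]
        rw [le_div_iff₀ hr]; linarith
      intro y hy
      have hyB := (hJ.smoothHalf_smul hΦ n c k).2.2 hy
      have hy2 : inner ℝ n y - c ≤ - (radius k / 2) := hs1 hy
      exact (h.boundary ht y hyB).2 (by linarith)
  have hEk : ∀ k, (∫ y in Ω, formDensity σ G P y) +
      ((∫ y in Ω, smoothHalf Φ n c k y * formDensity σ G J y) +
      (∑ j, ∫ y in Ω, (radius k)⁻¹ * deriv Φ ((inner ℝ n y - c) / radius k)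
        * inner ℝ (g j y) (n j • J y)) - ∫ y in Ω, (radius k)⁻¹ * deriv Φ ((inner ℝ n y - c) / radius k)
      * (p y * inner ℝ n (J y))) = 0 := by
    intro k
    have i1 : IntegrableOn (fun y => smoothHalf Φ n c k y * formDensity σ G J y) Ω :=
      (hJ.integrable_formDensity hσ hG).bdd_mul (c := 1) (contDiff_smoothHalf hΦ k).continuous.aestronglyMeasurable
        (Eventually.of_forall fun y => hΦ.abs_le _)
    have i2 : ∀ j, IntegrableOn (fun y => (radius k)⁻¹ * deriv Φ ((inner ℝ n y - c) / radius k)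
        * inner ℝ (g j y) (n j • J y)) Ω := fun j =>
      integrable_strip_mul hΦ n c k ((hnJ j).integrable_inner (hg j))
    have i3 := integrable_strip_mul hΦ n c k hpJ
    have i2s : IntegrableOn (fun y => ∑ j, (radius k)⁻¹ * deriv Φ ((inner ℝ n y - c) / radius k)
        * inner ℝ (g j y) (n j • J y)) Ω := integrable_finsetSum _ fun j _ => i2 j
    have i12 : IntegrableOn (fun y => smoothHalf Φ n c k y * formDensity σ G J y +
        ∑ j, (radius k)⁻¹ * deriv Φ ((inner ℝ n y - c) / radius k) * inner ℝ (g j y) (n j • J y)) Ω :=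
      Integrable.add i1 i2s
    have i123 : IntegrableOn (fun y => smoothHalf Φ n c k y * formDensity σ G J y +
        (∑ j, (radius k)⁻¹ * deriv Φ ((inner ℝ n y - c) / radius k) * inner ℝ (g j y) (n j • J y)) -
        (radius k)⁻¹ * deriv Φ ((inner ℝ n y - c) / radius k) * (p y * inner ℝ n (J y))) Ω :=
      Integrable.sub i12 i3
    rw [← integral_finsetSum _ fun j _ => i2 j, ← integral_add i1 i2s, ← integral_sub i12 i3,
      ← integral_add (hP.integrable_formDensity hσ hG) i123, ← hE _ (hw k)]
    refine integral_congr_ae (Eventually.of_forall fun y => ?_)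
    exact (formDensity_add_smoothHalf_smul hσg hP.1 hJ.1 hΦ n c k y).symm
  have hlim := (t1.add t2).sub t3
  have hlim' := (tendsto_const_nhds (x := ∫ y in Ω, formDensity σ G P y)).add hlim
  have hfinal := tendsto_nhds_unique hlim' (tendsto_const_nhds.congr fun k => (hEk k).symm)
  rw [Finset.sum_sub_distrib, ← Finset.mul_sum, ← Finset.mul_sum, hΦκ] at hfinal
  linarith

end FacetNhd

end Facet

/-! ### The first-order functional of a momentum balance -/

section Local
variable {d : ℕ}

theorem trace_congr {G : Type*} [NormedAddCommGroup G] [NormedSpace ℝ G] {K : Set (Vec d)}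
    {w w' : Vec d → G} (h : w =ᵐ[volume.restrict K] w') (x : Vec d) : trace K w x = trace K w' x := by
  unfold trace
  congr 1
  ext1 r
  refine average_congr ?_
  exact ae_restrict_of_ae_restrict_of_subset inter_subset_right h

theorem DensityBound.tendsto_of_continuous {K : Set (Vec d)} {x : Vec d} {a : ℝ} (h : DensityBound K x a)
    {G : Type*} [NormedAddCommGroup G] [NormedSpace ℝ G] [CompleteSpace G] {q : Vec d → G} (hq : Continuous q) :
    Tendsto (ave K q x) (𝓝[>] 0) (𝓝 (q x)) := by
  rw [Metric.nhds_basis_closedBall.tendsto_right_iff]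
  intro ε hε
  obtain ⟨δ, hδ, hb⟩ := Metric.continuous_iff.1 hq x ε hε
  filter_upwards [Ioc_mem_nhdsGT (show (0 : ℝ) < min δ 1 by positivity)] with r hr
  have hr1 : r ∈ Ioc (0 : ℝ) 1 := ⟨hr.1, hr.2.trans (min_le_right _ _)⟩
  refine (convex_closedBall _ _).set_average_mem Metric.isClosed_closedBall (h.volume_ne_zero hr1)
    (volume_ball_inter_ne_top K x r) ?_ ?_
  · refine ae_restrict_of_ae_restrict_of_subset inter_subset_left ?_
    filter_upwards [ae_restrict_mem measurableSet_ball] with y hy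
    exact (hb y ((Metric.mem_ball.1 hy).trans_le (hr.2.trans (min_le_left _ _)))).le
  · exact ((hq.continuousOn.integrableOn_compact (isCompact_closedBall x r)).mono_set
      Metric.ball_subset_closedBall).mono_set inter_subset_left

theorem DensityBound.trace_eq {K : Set (Vec d)} {x : Vec d} {a : ℝ} (h : DensityBound K x a)
    {G : Type*} [NormedAddCommGroup G] [NormedSpace ℝ G] [CompleteSpace G] {q v : Vec d → G}
    (hq : Continuous q) (hv : v =ᵐ[volume.restrict K] q) : trace K v x = q x := by
  rw [trace_congr hv]
  exact (h.tendsto_of_continuous hq).limUnder_eq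

/-- The integrand of `∫ Dψ(A) + ψ B` is that of the weak formulation, for the test field `ψ q`. -/
theorem formDensity_smul {σ : Fin d → Vec d → Vec d} {G : Vec d → Vec d} {ψ : Vec d → ℝ}
    {q : Vec d → Vec d} (hψ : ContDiff ℝ ∞ ψ) (hq : ContDiff ℝ ∞ q) (y : Vec d) :
    formDensity σ G (fun y => ψ y • q y) y =
      fderiv ℝ ψ y (∑ j, inner ℝ (σ j y) (q y) • unitVec j) +
      ψ y * ((∑ j, inner ℝ (σ j y) (fderiv ℝ q y (unitVec j))) + inner ℝ (G y) (q y)) := by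
  have h1 : ∀ j, fderiv ℝ (fun y => ψ y • q y) y (unitVec j) =
      ψ y • fderiv ℝ q y (unitVec j) + fderiv ℝ ψ y (unitVec j) • q y := fun j => by
    rw [fderiv_fun_smul (hψ.differentiable (by simp) y) (hq.differentiable (by simp) y)]
    simp
  unfold formDensity
  simp only [h1, inner_add_right, inner_smul_right, map_sum, map_smul, smul_eq_mul,
    Finset.sum_add_distrib, mul_add, Finset.mul_sum]
  have e : ∑ j, fderiv ℝ ψ y (unitVec j) * inner ℝ (σ j y) (q y)
      = ∑ j, inner ℝ (σ j y) (q y) * fderiv ℝ ψ y (unitVec j) :=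
    Finset.sum_congr rfl fun j _ => mul_comm _ _
  rw [e]; ring

theorem formDensity_add {σ : Fin d → Vec d → Vec d} {G w w' : Vec d → Vec d} (hw : ContDiff ℝ ∞ w)
    (hw' : ContDiff ℝ ∞ w') (y : Vec d) :
    formDensity σ G (w + w') y = formDensity σ G w y + formDensity σ G w' y := by
  unfold formDensity
  rw [fderiv_add (hw.differentiable (by simp) y) (hw'.differentiable (by simp) y)]
  simp only [add_apply, inner_add_right, Finset.sum_add_distrib, Pi.add_apply]
  ring

theorem IsTest.formDensity_eq_zero {U : Set (Vec d)} {w : Vec d → Vec d} (hw : IsTest U w)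
    (σ : Fin d → Vec d → Vec d) (G : Vec d → Vec d) {y : Vec d} (hy : y ∉ U) :
    formDensity σ G w y = 0 := by
  unfold formDensity
  rw [hw.eq_zero hy]
  simp only [(hw.fderiv_apply _).eq_zero hy, inner_zero_right, Finset.sum_const_zero, add_zero]

namespace Mesh
variable {kind : MeshKind} {Ω : Set (Vec d)} {M : Mesh kind Ω}

/-- Collects the local descriptions of the elements and of the domain at a point off the ridges. The
neighbourhood also avoids all other facets, so that only `F` contributes to the functional there. -/
theorem exists_facetNhd (hd : 2 ≤ d) (ho : IsOpen Ω) (hΩ : interior (closure Ω) = Ω)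
    {F : Set (Vec d)} (hF : F ∈ M.facets) {x : Vec d} (hx : x ∈ F) (hr : x ∉ M.ridges) :
    ∃ B, x ∈ B ∧ FacetNhd Ω B F (M.plus F) (M.minus F) (M.normal F) (M.offset F) (¬ F ⊆ frontier Ω) ∧
      ∀ F' ∈ M.facets, F' ≠ F → ∀ y ∈ B, y ∉ F' := by
  have h1 := M.eventually_mem_facet hd hF hx hr
  have h2 := M.eventually_mem_plus hd hF hx hr
  have h3 : ∀ᶠ y in 𝓝 x, ∀ F' ∈ M.facets, F' ≠ F → y ∉ F' := by
    rw [Finset.eventually_all]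
    intro F' hF'
    by_cases hne : F' = F
    · exact Eventually.of_forall fun y hc => absurd hne hc
    · have : x ∉ F' := fun hxF' => hne (M.eq_of_mem_facets hd ho hΩ hF hF' hx hxF' hr)
      filter_upwards [(M.isClosed_facet hd hF').isOpen_compl.mem_nhds this] with y hy _
      exact hy
  have h4 : ∀ᶠ y in 𝓝 x, ¬ F ⊆ frontier Ω → y ∈ Ω ∧ (y ∈ M.minus F ↔ M.offset F ≤ inner ℝ (M.normal F) y) := by
    by_cases hi : F ⊆ frontier Ω
    · exact Eventually.of_forall fun y hc => absurd hi hc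
    · filter_upwards [(M.eventually_mem_minus hd hF hi hx hr).2,
        ho.mem_nhds (M.mem_domain_of_interior_facet hd hΩ hF hi hx hr)] with y hy hyΩ _
      exact ⟨hyΩ, by rw [hy, lev, sub_nonneg]⟩
  have h5 : ∀ᶠ y in 𝓝 x, F ⊆ frontier Ω → (y ∈ Ω ↔ inner ℝ (M.normal F) y < M.offset F) := by
    by_cases hi : F ⊆ frontier Ω
    · filter_upwards [M.eventually_mem_domain hd ho hΩ hF hi hx hr] with y hy _
      rw [hy, lev, sub_neg]
    · exact Eventually.of_forall fun y hc => absurd hc hi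
  obtain ⟨B, hB, hBo, hxB⟩ := eventually_nhds_iff.1 (h1.and (h2.and (h3.and (h4.and h5))))
  refine ⟨B, hxB, ⟨M.norm_normal hF, hBo, fun y hy hyc => (hB y hy).1.2 (by rw [lev, hyc, sub_self]),
    fun y hy => by rw [(hB y hy).2.1, lev, sub_nonpos],
    fun hi => ⟨fun y hy => ((hB y hy).2.2.2.1 hi).1, fun y hy => ((hB y hy).2.2.2.1 hi).2⟩,
    fun hi y hy => (hB y hy).2.2.2.2 (not_not.1 hi)⟩, fun F' hF' hne y hy => (hB y hy).2.2.1 F' hF' hne⟩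

/-- A weak momentum balance `Σ_j ∂_j (g_j - p e_j) = G` in `Ω`, and a solenoidal piecewise smooth
field `v` with vanishing normal component on `∂Ω` to test it with. -/
structure Balance (M : Mesh kind Ω) (v : Vec d → Vec d) (q : Set (Vec d) → Vec d → Vec d)
    (g : Fin d → Vec d → Vec d) (p : Vec d → ℝ) (G : Vec d → Vec d) : Prop where
  contDiff : ∀ K ∈ M.elements, ContDiff ℝ ∞ (q K)
  ae_eq : ∀ K ∈ M.elements, v =ᵐ[volume.restrict K] q K
  solenoidal : ∀ φ : Vec d → ℝ, IsTest univ φ → ∫ y in Ω, fderiv ℝ φ y (v y) = 0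
  memLp_v : MemLp v ⊤ (volume.restrict Ω)
  memLp_g : ∀ j, MemLp (g j) 2 (volume.restrict Ω)
  memLp_p : MemLp p 2 (volume.restrict Ω)
  memLp_G : MemLp G 2 (volume.restrict Ω)
  balance : ∀ w : Vec d → Vec d, IsTest Ω w →
    ∫ y in Ω, formDensity (fun j y => g j y - p y • unitVec j) G w y = 0
  trace_plus : ∀ F ∈ M.facets, ∃ a, ∀ j,
    TraceSetting (M.plus F) F (M.normal F) (M.offset F) (g j) a
  trace_minus : ∀ F ∈ M.facets, ¬ F ⊆ frontier Ω → ∃ a, ∀ j,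
    TraceSetting (M.minus F) F (M.normal F) (M.offset F) (g j) a

namespace Balance
variable {v : Vec d → Vec d} {q : Set (Vec d) → Vec d → Vec d} {g : Fin d → Vec d → Vec d}
  {p : Vec d → ℝ} {G : Vec d → Vec d}

/-- The stress tensor. -/
def stress (g : Fin d → Vec d → Vec d) (p : Vec d → ℝ) (j : Fin d) (y : Vec d) : Vec d :=
  g j y - p y • unitVec j

/-- Formally testing the balance with `ψ • v`, the factor of `Dψ` is `flux`, and that of `ψ` is
`source`, with `D` the elementwise derivatives of `v`. -/
def flux (v : Vec d → Vec d) (g : Fin d → Vec d → Vec d) (p : Vec d → ℝ) (y : Vec d) : Vec d :=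
  ∑ j, inner ℝ (stress g p j y) (v y) • (unitVec j : Vec d)

def source (v : Vec d → Vec d) (D : Fin d → Vec d → Vec d) (g : Fin d → Vec d → Vec d) (p : Vec d → ℝ)
    (G : Vec d → Vec d) (y : Vec d) : ℝ :=
  (∑ j, inner ℝ (stress g p j y) (D j y)) + inner ℝ (G y) (v y)

/-- The part of the derivative of `v` concentrated on the facet, paired with the averaged traces.
Only `g` enters and not the pressure, because the jump of `v` is tangential. -/
def facetFlux (M : Mesh kind Ω) (v : Vec d → Vec d) (g : Fin d → Vec d → Vec d) (F : Set (Vec d))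
    (x : Vec d) : ℝ :=
  - ∑ j, inner ℝ (M.avg F (g j) x) (M.normal F j • M.jump F v x)

theorem trace_plus_eq (h : Balance M v q g p G) {F : Set (Vec d)} (hF : F ∈ M.facets) (hd : 2 ≤ d)
    {x : Vec d} (hx : x ∈ F) : trace (M.plus F) v x = q (M.plus F) x := by
  obtain ⟨a, ha⟩ := h.trace_plus F hF
  exact ((ha ⟨0, by omega⟩).density x hx).trace_eq (h.contDiff _ (M.plus_mem F hF)).continuous
    (h.ae_eq _ (M.plus_mem F hF))

theorem trace_minus_eq (h : Balance M v q g p G) {F : Set (Vec d)} (hF : F ∈ M.facets)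
    (hi : ¬ F ⊆ frontier Ω) (hd : 2 ≤ d)
    {x : Vec d} (hx : x ∈ F) : trace (M.minus F) v x = q (M.minus F) x := by
  obtain ⟨a, ha⟩ := h.trace_minus F hF hi
  exact ((ha ⟨0, by omega⟩).density x hx).trace_eq (h.contDiff _ (M.minus_mem F hF hi)).continuous
    (h.ae_eq _ (M.minus_mem F hF hi))

end Balance
end Mesh
end Local

/-! ### Testing the balance with a solenoidal piecewise smooth field -/

section Local
variable {d : ℕ}

theorem _root_.MeasureTheory.MemLp.exists_ae_norm_le {α G : Type*} [MeasurableSpace α] {μ : Measure α}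
    [NormedAddCommGroup G] {v : α → G} (h : MemLp v ⊤ μ) : ∃ C, 0 ≤ C ∧ ∀ᵐ y ∂μ, ‖v y‖ ≤ C := by
  refine ⟨(eLpNormEssSup v μ).toReal, ENNReal.toReal_nonneg, ?_⟩
  have hlt : eLpNormEssSup v μ ≠ ⊤ := by
    have := h.2
    rw [eLpNorm_exponent_top] at this
    exact this.ne
  filter_upwards [ae_le_eLpNormEssSup (f := v) (μ := μ)] with y hy
  rw [← toReal_enorm]
  exact ENNReal.toReal_mono hlt hy

theorem _root_.MeasureTheory.MemLp.inner_of_top {α G : Type*} [MeasurableSpace α] {μ : Measure α}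
    [NormedAddCommGroup G] [InnerProductSpace ℝ G] {f v : α → G} (hf : MemLp f 2 μ) (h : MemLp v ⊤ μ) :
    MemLp (fun y => (inner ℝ (f y) (v y) : ℝ)) 2 μ := by
  obtain ⟨C, hC, hb⟩ := h.exists_ae_norm_le
  refine hf.of_le_mul (c := C) (hf.1.inner h.1) ?_
  filter_upwards [hb] with y hy
  refine (norm_inner_le_norm _ _).trans ?_
  rw [mul_comm]
  gcongr

namespace Mesh
variable {kind : MeshKind} {Ω : Set (Vec d)} {M : Mesh kind Ω}

namespace Balance
variable {v : Vec d → Vec d} {q : Set (Vec d) → Vec d → Vec d} {g : Fin d → Vec d → Vec d}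
  {p : Vec d → ℝ} {G : Vec d → Vec d} {D : Fin d → Vec d → Vec d}

/-- The interior integrals of the first order functional. -/
theorem ae_integrand_eq (h : Balance M v q g p G) (hd : 2 ≤ d)
    (hD : ∀ K ∈ M.elements, ∀ j, D j =ᵐ[volume.restrict K] fun y => fderiv ℝ (q K) y (unitVec j))
    {ψ : Vec d → ℝ} (hψ : ContDiff ℝ ∞ ψ) :
    ∀ᵐ y : Vec d, ∀ K ∈ M.elements, y ∈ K →
      fderiv ℝ ψ y (flux v g p y) + ψ y * source v D g p G y =
        formDensity (stress g p) G (fun y => ψ y • q K y) y := by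
  rw [Filter.eventually_all_finset]
  intro K hK
  have hKm : MeasurableSet K := (M.isPolytope hd hK).isClosed.measurableSet
  have h1 := (ae_restrict_iff' hKm).1 (h.ae_eq K hK)
  have h2 := (ae_restrict_iff' hKm).1 (ae_all_iff.2 (hD K hK))
  filter_upwards [h1, h2] with y hy1 hy2 hyK
  rw [formDensity_smul hψ (h.contDiff K hK), flux, source, hy1 hyK]
  simp only [hy2 hyK]

theorem integrableOn_flux_source (h : Balance M v q g p G) (hΩ : Bornology.IsBounded Ω)
    (hD : ∀ j, MemLp (D j) ⊤ (volume.restrict Ω)) :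
    MemLp (flux v g p) 2 (volume.restrict Ω) ∧ IntegrableOn (source v D g p G) Ω := by
  have hfin : IsFiniteMeasure (volume.restrict Ω : Measure (Vec d)) :=
    isFiniteMeasure_restrict.2 hΩ.measure_lt_top.ne
  have hs : ∀ j, MemLp (stress g p j) 2 (volume.restrict Ω) := fun j => by
    have h1 : MemLp (fun y => p y • (unitVec j : Vec d)) 2 (volume.restrict Ω) := by
      refine h.memLp_p.of_le_mul (c := ‖(unitVec j : Vec d)‖) (h.memLp_p.1.smul_const _)
        (Eventually.of_forall fun y => ?_)
      rw [norm_smul, mul_comm]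
    exact (h.memLp_g j).sub h1
  constructor
  · refine memLp_finsetSum _ fun j _ => ?_
    have h2 := (hs j).inner_of_top h.memLp_v
    refine h2.of_le_mul (c := ‖(unitVec j : Vec d)‖) (h2.1.smul_const _)
        (Eventually.of_forall fun y => ?_)
    rw [norm_smul, mul_comm]
  · exact Integrable.add (integrable_finsetSum _ fun j _ => ((hs j).inner_of_top (hD j)).integrable
      (by norm_num)) ((h.memLp_G.inner_of_top h.memLp_v).integrable (by norm_num))

/-- The first order functional near a facet. -/
theorem facet_identity (h : Balance M v q g p G) (hd : 2 ≤ d) (ho : IsOpen Ω)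
    (hΩb : Bornology.IsBounded Ω)
    (hD : ∀ K ∈ M.elements, ∀ j, D j =ᵐ[volume.restrict K] fun y => fderiv ℝ (q K) y (unitVec j))
    {F B : Set (Vec d)} (hF : F ∈ M.facets)
    (hB : FacetNhd Ω B F (M.plus F) (M.minus F) (M.normal F) (M.offset F) (¬ F ⊆ frontier Ω))
    {ψ : Vec d → ℝ} (hψ : IsTest B ψ) :
    (∫ y in Ω, (fderiv ℝ ψ y (flux v g p y) + ψ y * source v D g p G y)) +
      ∫ y, ψ y * facetFlux M v g F y ∂((surf (M.normal F) (M.offset F)).restrict F) = 0 := by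
  classical
  have hfin : IsFiniteMeasure (volume.restrict Ω : Measure (Vec d)) :=
    isFiniteMeasure_restrict.2 hΩb.measure_lt_top.ne
  obtain ⟨a, ha⟩ := h.trace_plus F hF
  obtain ⟨a', ha'⟩ : ∃ a', ∀ j, ¬ F ⊆ frontier Ω →
      TraceSetting (M.minus F) F (M.normal F) (M.offset F) (g j) a' := by
    by_cases hi : F ⊆ frontier Ω
    · exact ⟨0, fun j hc => absurd hi hc⟩
    · obtain ⟨a', ha'⟩ := h.trace_minus F hF hi
      exact ⟨a', fun j _ => ha' j⟩
  set n := M.normal F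
  set c := M.offset F
  set qp : Vec d → Vec d := q (M.plus F) with hqp
  -- Outside the domain the field is continued by zero; then the jump on a boundary facet is the
  -- field itself, and interior and boundary facets can be treated together.
  set qm : Vec d → Vec d := if F ⊆ frontier Ω then 0 else q (M.minus F) with hqm
  set κ : ℝ := if F ⊆ frontier Ω then 0 else 1 / 2 with hκ
  have hqm0 : ¬ ¬ F ⊆ frontier Ω → qm = 0 := fun hc => if_pos (not_not.1 hc)
  have hqm1 : ¬ F ⊆ frontier Ω → qm = q (M.minus F) := fun hc => if_neg hc
  have hκ0 : ¬ ¬ F ⊆ frontier Ω → κ = 0 := fun hc => if_pos (not_not.1 hc)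
  have hκ1 : ¬ F ⊆ frontier Ω → κ = 1 / 2 := fun hc => if_neg hc
  have hps : ContDiff ℝ ∞ qp := h.contDiff _ (M.plus_mem F hF)
  have hms : ContDiff ℝ ∞ qm := by
    by_cases hi : F ⊆ frontier Ω
    · rw [hqm0 (not_not.2 hi)]; exact contDiff_const
    · rw [hqm1 hi]; exact h.contDiff _ (M.minus_mem F hF hi)
  have hpK : MeasurableSet (M.plus F) := (M.isPolytope hd (M.plus_mem F hF)).isClosed.measurableSet
  have hvp : ∀ᵐ y ∂volume.restrict Ω, y ∈ B → inner ℝ n y < c → v y = qp y := by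
    filter_upwards [ae_restrict_of_ae ((ae_restrict_iff' hpK).1 (h.ae_eq _ (M.plus_mem F hF)))] with y hy hyB hlt
    exact hy ((hB.mem_plus y hyB).2 hlt.le)
  have hvm : ∀ᵐ y ∂volume.restrict Ω, y ∈ B → c < inner ℝ n y → v y = qm y := by
    by_cases hi : F ⊆ frontier Ω
    · filter_upwards [ae_restrict_mem ho.measurableSet] with y hyΩ hyB hlt
      exact absurd ((hB.boundary (not_not.2 hi) y hyB).1 hyΩ) (not_lt.2 hlt.le)
    · have hmm := M.minus_mem F hF hi
      filter_upwards [ae_restrict_of_ae ((ae_restrict_iff' (M.isPolytope hd hmm).isClosed.measurableSet).1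
        (h.ae_eq _ hmm))] with y hy hyB hlt
      rw [hqm1 hi]
      exact hy (((hB.interior hi).2 y hyB).2 hlt.le)
  have hc : ∀ {K : Set (Vec d)} {a : ℝ} {w : Vec d → Vec d}, TraceSetting K F n c w a → Bornology.IsBounded K →
      TraceSetting K F n c (fun _ => n) a := fun hw hbK =>
    { hw with
      meas := stronglyMeasurable_const
      int := integrableOn_const hbK.measure_lt_top.ne
      decay := OscDecay.of_lipschitz hw.measU hbK hw.norm_normal _ (LipschitzWith.const n).lipschitzOnWith }
  set i0 : Fin d := ⟨0, by omega⟩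
  have hjump : ∀ x, inner ℝ n x = c → inner ℝ n (ψ x • (qp x - qm x)) = 0 := by
    intro x hx
    by_cases hxB : x ∈ B
    · rw [inner_smul_right, hB.inner_jump_eq_zero ho (hc (ha i0) (M.isBounded hΩb (M.plus_mem F hF)))
        (fun hi => hc (ha' i0 hi) (M.isBounded hΩb (M.minus_mem F hF hi))) (h.memLp_v.integrable le_top)
        h.solenoidal hps hms hqm0 hvp hvm hxB hx, mul_zero]
    · rw [hψ.eq_zero hxB, zero_smul, inner_zero_right]
  have hJ : IsTest B fun x => ψ x • (qp x - qm x) := hψ.smul (hps.sub hms)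
  have hP : IsTest B fun x => ψ x • qm x := hψ.smul hms
  have hmain := hB.integral_eq ho (σ := stress g p) (fun _ _ => rfl) ha ha'
    (fun j => (h.memLp_g j).integrable (by norm_num)) (h.memLp_p.integrable (by norm_num))
    (h.memLp_G.integrable (by norm_num)) h.balance hP hJ
    (fun hc => by rw [hqm0 hc]; ext1 y; simp) hjump hκ1 hκ0
  have hσ : ∀ j, IntegrableOn (stress g p j) Ω := fun j =>
    Integrable.sub ((h.memLp_g j).integrable (by norm_num))
      ((h.memLp_p.integrable (by norm_num)).smul_const _)
  -- Up to null sets, `ψ • v` is `ψ • qm` everywhere plus `ψ • (qp - qm)` on the plus side.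
  have hint : ∫ y in Ω, (fderiv ℝ ψ y (flux v g p y) + ψ y * source v D g p G y) =
      (∫ y in Ω, formDensity (stress g p) G (fun x => ψ x • qm x) y) +
      ∫ y in Ω, {y : Vec d | inner ℝ n y < c}.indicator
        (formDensity (stress g p) G fun x => ψ x • (qp x - qm x)) y := by
    have hm : MeasurableSet {y : Vec d | inner ℝ n y < c} :=
      (isOpen_lt (by fun_prop) continuous_const).measurableSet
    rw [← integral_add (hP.integrable_formDensity hσ (h.memLp_G.integrable (by norm_num)))
      ((hJ.integrable_formDensity hσ (h.memLp_G.integrable (by norm_num))).indicator hm)]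
    refine integral_congr_ae ?_
    filter_upwards [ae_restrict_of_ae (h.ae_integrand_eq hd hD hψ.1),
      ae_restrict_of_ae (ae_inner_ne hB.norm_normal c), ae_restrict_mem ho.measurableSet] with y hy hyc hyΩ
    by_cases hyB : y ∈ B
    swap
    · have h0 : fderiv ℝ ψ y = 0 := image_eq_zero_of_notMem_tsupport
        fun hc => hyB (hψ.2.2 (tsupport_fderiv_subset ℝ hc))
      rw [hP.formDensity_eq_zero _ _ hyB, h0, hψ.eq_zero hyB]
      by_cases hlt : inner ℝ n y < c
      · rw [indicator_of_mem (show y ∈ {y : Vec d | inner ℝ n y < c} from hlt), hJ.formDensity_eq_zero _ _ hyB]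
        simp
      · rw [indicator_of_notMem (show y ∉ {y : Vec d | inner ℝ n y < c} from hlt)]
        simp
    rcases lt_or_gt_of_ne hyc with hlt | hgt
    · rw [indicator_of_mem (show y ∈ {y : Vec d | inner ℝ n y < c} from hlt), ← formDensity_add hP.1 hJ.1,
        hy _ (M.plus_mem F hF) ((hB.mem_plus y hyB).2 hlt.le)]
      congr 1
      ext1 z
      simp only [Pi.add_apply, ← smul_add, add_sub_cancel]
      rfl
    · rw [indicator_of_notMem (show y ∉ {y : Vec d | inner ℝ n y < c} from not_lt.2 hgt.le), add_zero]
      have hi : ¬ F ⊆ frontier Ω := fun hi =>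
        absurd ((hB.boundary (not_not.2 hi) y hyB).1 hyΩ) (not_lt.2 hgt.le)
      rw [hqm1 hi]
      exact hy _ (M.minus_mem F hF hi) (((hB.interior hi).2 y hyB).2 hgt.le)
  have hfi : IsFiniteMeasure ((surf n c).restrict F) := isFiniteMeasure_restrict.2 (ha i0).surf_lt_top.ne
  have i1 : ∀ j, Integrable (fun x => (1 - κ) * inner ℝ (trace (M.plus F) (g j) x) (n j • (ψ x • (qp x - qm x))))
      ((surf n c).restrict F) := fun j => ((hJ.const_smul (n j)).integrable_inner (ha j).integrable_trace).const_mul _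
  have i2 : ∀ j, Integrable (fun x => κ * inner ℝ (trace (M.minus F) (g j) x) (n j • (ψ x • (qp x - qm x))))
      ((surf n c).restrict F) := fun j => by
    by_cases hi : F ⊆ frontier Ω
    · rw [hκ0 (not_not.2 hi)]; simp
    · exact ((hJ.const_smul (n j)).integrable_inner (ha' j hi).integrable_trace).const_mul _
  have hsurf : ∫ y, ψ y * facetFlux M v g F y ∂((surf n c).restrict F) =
      - ((1 - κ) * (∑ j, ∫ x in F, inner ℝ (trace (M.plus F) (g j) x) (n j • (ψ x • (qp x - qm x))) ∂(surf n c)) +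
      κ * ∑ j, ∫ x in F, inner ℝ (trace (M.minus F) (g j) x) (n j • (ψ x • (qp x - qm x))) ∂(surf n c)) := by
    rw [Finset.mul_sum, Finset.mul_sum, ← Finset.sum_add_distrib, ← Finset.sum_neg_distrib]
    have e1 : ∀ j, -((1 - κ) * (∫ x in F, inner ℝ (trace (M.plus F) (g j) x) (n j • (ψ x • (qp x - qm x))) ∂(surf n c)) +
      κ * ∫ x in F, inner ℝ (trace (M.minus F) (g j) x) (n j • (ψ x • (qp x - qm x))) ∂(surf n c)) =
      ∫ x in F, -((1 - κ) * inner ℝ (trace (M.plus F) (g j) x) (n j • (ψ x • (qp x - qm x))) +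
        κ * inner ℝ (trace (M.minus F) (g j) x) (n j • (ψ x • (qp x - qm x)))) ∂(surf n c) := fun j => by
      rw [integral_neg, integral_add (i1 j) (i2 j), integral_const_mul, integral_const_mul]
    have i3 : ∀ j, Integrable (fun x => -((1 - κ) * inner ℝ (trace (M.plus F) (g j) x) (n j • (ψ x • (qp x - qm x))) +
        κ * inner ℝ (trace (M.minus F) (g j) x) (n j • (ψ x • (qp x - qm x))))) ((surf n c).restrict F) :=
      fun j => Integrable.neg (Integrable.add (i1 j) (i2 j))
    rw [Finset.sum_congr rfl fun j _ => e1 j, ← integral_finsetSum _ fun j _ => i3 j]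
    refine setIntegral_congr_fun (ha i0).measF fun x hx => ?_
    have hj : M.jump F v x = qp x - qm x := by
      by_cases hi : F ⊆ frontier Ω
      · rw [jump, if_pos hi, hqm0 (not_not.2 hi), h.trace_plus_eq hF hd hx]; simp [hqp]
      · rw [jump, if_neg hi, hqm1 hi, h.trace_plus_eq hF hd hx, h.trace_minus_eq hF hi hd hx]
    have hav : ∀ j, M.avg F (g j) x = (1 - κ) • trace (M.plus F) (g j) x + κ • trace (M.minus F) (g j) x := fun j => by
      by_cases hi : F ⊆ frontier Ω
      · rw [avg, if_pos hi, hκ0 (not_not.2 hi)]; simp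
      · rw [avg, if_neg hi, hκ1 hi, smul_add]; norm_num
    rw [facetFlux, hj, mul_neg, Finset.mul_sum, ← Finset.sum_neg_distrib]
    refine Finset.sum_congr rfl fun j _ => ?_
    rw [hav j, inner_add_left, inner_smul_left, inner_smul_left]
    simp only [inner_smul_right, RCLike.conj_to_real]
    ring
  rw [hint, hsurf, hmain]
  ring

/-- The first order functional vanishes locally, away from the ridges. -/
theorem exists_firstOrder_eq_zero (h : Balance M v q g p G) (hd : 2 ≤ d) (ho : IsOpen Ω)
    (hΩb : Bornology.IsBounded Ω) (hΩ : interior (closure Ω) = Ω)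
    (hD : ∀ K ∈ M.elements, ∀ j, D j =ᵐ[volume.restrict K] fun y => fderiv ℝ (q K) y (unitVec j))
    (hD' : ∀ j, MemLp (D j) ⊤ (volume.restrict Ω))
    {x : Vec d} (hr : x ∉ M.ridges) : ∃ U, IsOpen U ∧ x ∈ U ∧ ∀ ψ, IsTest U ψ →
      firstOrder Ω (flux v g p) (source v D g p G) M.facets
        (fun F => (surf (M.normal F) (M.offset F)).restrict F) (facetFlux M v g) ψ = 0 := by
  have hvol : ∀ ψ : Vec d → ℝ, IsTest univ ψ →
      (∫ y in Ω, fderiv ℝ ψ y (flux v g p y)) + ∫ y in Ω, ψ y * source v D g p G y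
        = ∫ y in Ω, (fderiv ℝ ψ y (flux v g p y) + ψ y * source v D g p G y) := by
    intro ψ hψ
    have hfin : IsFiniteMeasure (volume.restrict Ω : Measure (Vec d)) :=
      isFiniteMeasure_restrict.2 hΩb.measure_lt_top.ne
    have hI := h.integrableOn_flux_source hΩb hD'
    exact (integral_add (hψ.integrable_fderiv_apply (hI.1.integrable (by norm_num)))
      (hψ.integrable_mul hI.2)).symm
  have hfac : ∀ ψ : Vec d → ℝ, ∀ F : Set (Vec d), MeasurableSet F → (∀ y ∈ F, ψ y = 0) →
      ∫ y, ψ y * facetFlux M v g F y ∂((surf (M.normal F) (M.offset F)).restrict F) = 0 := by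
    intro ψ F hFm hF
    rw [setIntegral_congr_fun (g := fun _ => 0) hFm fun y hy => by rw [hF y hy, zero_mul]]
    simp
  have hfm : ∀ F ∈ M.facets, MeasurableSet F := fun F hF => (M.isClosed_facet hd hF).measurableSet
  -- Three cases. Outside the closure every term vanishes; inside an element `ψ • q K` is itself an
  -- admissible test field; on a facet the identity above applies.
  by_cases hxc : x ∈ closure Ω
  swap
  · refine ⟨(closure Ω)ᶜ, isClosed_closure.isOpen_compl, hxc, fun ψ hψ => ?_⟩
    rw [firstOrder, hvol ψ (hψ.mono (subset_univ _)), Finset.sum_eq_zero fun F hF => hfac ψ F (hfm F hF)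
      fun y hy => hψ.eq_zero fun hc => hc (M.subset_closure (M.plus_mem F hF) ((M.isFacet_plus F hF).subset hy)),
      add_zero]
    refine integral_eq_zero_of_ae ?_
    filter_upwards [ae_restrict_mem ho.measurableSet] with y hy
    have hy' : y ∉ (closure Ω)ᶜ := fun hc => hc (_root_.subset_closure hy)
    have h0 : fderiv ℝ ψ y = 0 := image_eq_zero_of_notMem_tsupport
      fun hc => hy' (hψ.2.2 (tsupport_fderiv_subset ℝ hc))
    simp [hψ.eq_zero hy', h0]
  have hx' : x ∈ ⋃ K ∈ M.elements, K := by rw [← M.cover]; exact hxc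
  obtain ⟨K, hK, hxK⟩ := mem_iUnion₂.1 hx'
  by_cases hxi : x ∈ interior K
  · refine ⟨interior K, isOpen_interior, hxi, fun ψ hψ => ?_⟩
    have hKΩ := M.interior_subset_domain hΩ hK
    rw [firstOrder, hvol ψ (hψ.mono (subset_univ _)), Finset.sum_eq_zero fun F hF => hfac ψ F (hfm F hF)
      fun y hy => hψ.eq_zero fun hc => M.notMem_facet_of_mem_interior hd hK hF hc hy,
      add_zero, ← h.balance _ ((hψ.smul (h.contDiff K hK)).mono hKΩ)]
    refine integral_congr_ae ?_
    filter_upwards [ae_restrict_of_ae (h.ae_integrand_eq hd hD hψ.1)] with y hy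
    by_cases hyK : y ∈ interior K
    · exact hy K hK (interior_subset hyK)
    · rw [(hψ.smul (h.contDiff K hK)).formDensity_eq_zero _ _ hyK]
      have h0 : fderiv ℝ ψ y = 0 := image_eq_zero_of_notMem_tsupport
        fun hc => hyK (hψ.2.2 (tsupport_fderiv_subset ℝ hc))
      simp [hψ.eq_zero hyK, h0]
  obtain ⟨n, F, hFn, hxF⟩ := M.exists_facet_of_notMem_interior hd hK hxK hxi
  have hF := M.facet_mem_facets hK hFn
  obtain ⟨B, hxB, hB, hB'⟩ := M.exists_facetNhd hd ho hΩ hF hxF hr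
  refine ⟨B, hB.isOpen, hxB, fun ψ hψ => ?_⟩
  rw [firstOrder, hvol ψ (hψ.mono (subset_univ _)), Finset.sum_eq_single F (fun F' hF' hne =>
    hfac ψ F' (hfm F' hF') fun y hy => hψ.eq_zero fun hc => hB' F' hF' hne y hc hy) (fun hc => absurd hF hc)]
  exact h.facet_identity hd ho hΩb hD hF hB hψ

theorem integrable_facetFlux (h : Balance M v q g p G) (hd : 2 ≤ d) {F : Set (Vec d)} (hF : F ∈ M.facets) :
    Integrable (facetFlux M v g F) ((surf (M.normal F) (M.offset F)).restrict F) := by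
  classical
  obtain ⟨a, ha⟩ := h.trace_plus F hF
  have hfm := (M.isClosed_facet hd hF).measurableSet
  have hc : ∃ m : Vec d → Vec d, Continuous m ∧ ∀ x ∈ F, M.jump F v x = m x := by
    by_cases hi : F ⊆ frontier Ω
    · exact ⟨q (M.plus F), (h.contDiff _ (M.plus_mem F hF)).continuous, fun x hx => by
        rw [jump, if_pos hi, h.trace_plus_eq hF hd hx]⟩
    · exact ⟨q (M.plus F) - q (M.minus F), (h.contDiff _ (M.plus_mem F hF)).continuous.sub
        (h.contDiff _ (M.minus_mem F hF hi)).continuous, fun x hx => by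
        rw [jump, if_neg hi, h.trace_plus_eq hF hd hx, h.trace_minus_eq hF hi hd hx, Pi.sub_apply]⟩
  obtain ⟨m, hm, hmF⟩ := hc
  have hav : ∀ j, Integrable (M.avg F (g j)) ((surf (M.normal F) (M.offset F)).restrict F) := fun j => by
    by_cases hi : F ⊆ frontier Ω
    · have : M.avg F (g j) = trace (M.plus F) (g j) := funext fun x => if_pos hi
      rw [this]; exact (ha j).integrable_trace
    · have : M.avg F (g j) = fun x => (1 / 2 : ℝ) • (trace (M.plus F) (g j) x + trace (M.minus F) (g j) x) :=
        funext fun x => if_neg hi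
      obtain ⟨a', ha'⟩ := h.trace_minus F hF hi
      rw [this]; exact Integrable.smul (1 / 2 : ℝ) ((ha j).integrable_trace.add (ha' j).integrable_trace)
  have hbF : ∃ C, ∀ x ∈ F, ‖m x‖ ≤ C := by
    have hcp : IsCompact F :=
      Metric.isCompact_of_isClosed_isBounded (M.isClosed_facet hd hF) (ha ⟨0, by omega⟩).bddF
    exact hcp.exists_bound_of_continuousOn hm.continuousOn
  obtain ⟨C, hC⟩ := hbF
  refine Integrable.neg (integrable_finsetSum _ fun j _ => ?_)
  refine Integrable.mono' ((hav j).norm.mul_const (‖M.normal F j‖ * C)) ?_ ?_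
  · refine ((hav j).1.inner (hm.const_smul (M.normal F j)).aestronglyMeasurable).congr ?_
    filter_upwards [ae_restrict_mem hfm] with x hx
    rw [hmF x hx, Pi.smul_apply]
  · filter_upwards [ae_restrict_mem hfm] with x hx
    rw [hmF x hx]
    refine (norm_inner_le_norm _ _).trans ?_
    rw [norm_smul]
    exact mul_le_mul_of_nonneg_left (mul_le_mul_of_nonneg_left (hC x hx) (norm_nonneg _)) (norm_nonneg _)

/-- Testing the balance with the piecewise smooth solenoidal field `v`. -/
theorem integral_source_eq (h : Balance M v q g p G) (hd : 2 ≤ d) (ho : IsOpen Ω)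
    (hΩb : Bornology.IsBounded Ω) (hΩ : interior (closure Ω) = Ω)
    (hD : ∀ K ∈ M.elements, ∀ j, D j =ᵐ[volume.restrict K] fun y => fderiv ℝ (q K) y (unitVec j))
    (hD' : ∀ j, MemLp (D j) ⊤ (volume.restrict Ω)) :
    (∫ y in Ω, source v D g p G y) +
      ∑ F ∈ M.facets, ∫ y in F, facetFlux M v g F y ∂(surf (M.normal F) (M.offset F)) = 0 := by
  -- A test function equal to `1` near the closure of `Ω` kills the flux term and leaves the source
  -- and the facet terms unweighted.
  obtain ⟨φ, hφ, hφ1⟩ : ∃ φ : Vec d → ℝ, IsTest univ φ ∧ ∀ y ∈ closure Ω, ∀ᶠ z in 𝓝 y, φ z = 1 := by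
    obtain ⟨R, hR⟩ := hΩb.closure.subset_ball 0
    have hR' : closure Ω ⊆ Metric.ball (0 : Vec d) (max R 1) := hR.trans (Metric.ball_subset_ball (le_max_left _ _))
    have hpos : 0 < max R 1 := lt_max_of_lt_right one_pos
    let b : ContDiffBump (0 : Vec d) := ⟨max R 1, max R 1 + 1, hpos, by linarith⟩
    refine ⟨b, ⟨b.contDiff, b.hasCompactSupport, subset_univ _⟩, fun y hy => ?_⟩
    filter_upwards [Metric.isOpen_ball.mem_nhds (hR' hy)] with z hz
    exact b.one_of_mem_closedBall (Metric.ball_subset_closedBall hz)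
  have hI := h.integrableOn_flux_source hΩb hD'
  have hmain := M.firstOrder_eq_zero hΩb hI.1 hI.2 (fun F hF => h.integrable_facetFlux hd hF)
    (fun F hF => le_antisymm ((Measure.restrict_apply_le _ _).trans (M.surf_ridges hF).le) zero_le)
    (fun x hx => h.exists_firstOrder_eq_zero hd ho hΩb hΩ hD hD' hx) hφ
  rw [firstOrder] at hmain
  have e1 : ∫ x in Ω, fderiv ℝ φ x (flux v g p x) = 0 := by
    refine integral_eq_zero_of_ae ?_
    filter_upwards [ae_restrict_mem ho.measurableSet] with y hy
    have h1 : φ =ᶠ[𝓝 y] fun _ => 1 := hφ1 y (_root_.subset_closure hy)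
    rw [h1.fderiv_eq]; simp
  have e2 : ∫ x in Ω, φ x * source v D g p G x = ∫ x in Ω, source v D g p G x := by
    refine setIntegral_congr_fun ho.measurableSet fun y hy => ?_
    rw [(hφ1 y (_root_.subset_closure hy)).self_of_nhds, one_mul]
  rw [e1, e2, zero_add] at hmain
  rw [← hmain]
  congr 1
  refine Finset.sum_congr rfl fun F hF => ?_
  refine setIntegral_congr_fun (M.isClosed_facet hd hF).measurableSet fun y hy => ?_
  rw [(hφ1 y (M.subset_closure (M.plus_mem F hF) ((M.isFacet_plus F hF).subset hy))).self_of_nhds, one_mul]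

end Balance
end Mesh
end Local

/-! ### Measurability of Sobolev norms on `L²` -/

section Measurability
variable {d : ℕ}

instance : Fact ((2 : ℝ≥0∞) ≠ ⊤) := ⟨by simp⟩

theorem slobodeckijSq_congr {U : Set (Vec d)} {θ : ℝ} {w w' : Vec d → Vec d}
    (h : w =ᵐ[volume.restrict U] w') : slobodeckijSq U θ w = slobodeckijSq U θ w' := by
  unfold slobodeckijSq
  split_ifs
  · rfl
  · refine lintegral_congr_ae ?_
    filter_upwards [h] with x hx
    refine lintegral_congr_ae ?_
    filter_upwards [h] with y hy
    rw [hx, hy]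

theorem weakPartial_congr {U : Set (Vec d)} (hU : IsOpen U) {w w' : Vec d → Vec d}
    (h : w =ᵐ[volume.restrict U] w') (j : Fin d) :
    weakPartial U j w =ᵐ[volume.restrict U] weakPartial U j w' := by
  by_cases he : ∃ g, HasWeakPartial U j w' g
  · exact ((hasWeakPartial_weakPartial he).congr h.symm EventuallyEq.rfl).weakPartial_ae hU
  · have he' : ¬ ∃ g, HasWeakPartial U j w g := fun hc => he ((exists_hasWeakPartial_congr h).1 hc)
    unfold weakPartial
    rw [dif_neg he, dif_neg he']

theorem sobolevAuxSq_congr {U : Set (Vec d)} (hU : IsOpen U) {θ : ℝ} (m : ℕ) {w w' : Vec d → Vec d}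
    (h : w =ᵐ[volume.restrict U] w') : sobolevAuxSq U θ m w = sobolevAuxSq U θ m w' := by
  induction m generalizing w w' with
  | zero => simp only [sobolevAuxSq, eLpNorm_congr_ae h, slobodeckijSq_congr h]
  | succ m ih =>
    simp only [sobolevAuxSq, eLpNorm_congr_ae h, fun j => ih (weakPartial_congr hU h j)]
    classical
    exact if_congr (forall_congr' fun j => exists_hasWeakPartial_congr h) rfl rfl

theorem slobodeckijSq_eq_lintegral_prod {U : Set (Vec d)} {θ : ℝ} (hθ : θ ≠ 0) {w : Vec d → Vec d}
    (hw : StronglyMeasurable w) : slobodeckijSq U θ w =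
      ∫⁻ p : Vec d × Vec d, ENNReal.ofReal (‖w p.1 - w p.2‖ ^ 2 / ‖p.1 - p.2‖ ^ ((d : ℝ) + 2 * θ))
        ∂((volume.restrict U).prod (volume.restrict U)) := by
  rw [slobodeckijSq, if_neg hθ, lintegral_prod]
  have h1 : Measurable w := hw.measurable
  fun_prop

/-- Lower semicontinuity by Fatou's lemma along an almost everywhere convergent subsequence. -/
theorem isClosed_slobodeckijSq_le (U : Set (Vec d)) (θ : ℝ) (R : ℝ≥0∞) :
    IsClosed {w : L2Vec U | slobodeckijSq U θ w ≤ R} := by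
  by_cases hθ : θ = 0
  · simp [slobodeckijSq, hθ]
  refine IsSeqClosed.isClosed fun w w₀ hw hlim => ?_
  obtain ⟨ns, -, hns⟩ := (tendstoInMeasure_of_tendsto_Lp hlim).exists_seq_tendsto_ae
  show slobodeckijSq U θ w₀ ≤ R
  have hm : ∀ w : L2Vec U, Measurable fun p : Vec d × Vec d =>
      ENNReal.ofReal (‖w p.1 - w p.2‖ ^ 2 / ‖p.1 - p.2‖ ^ ((d : ℝ) + 2 * θ)) := fun w => by
    have h1 : Measurable w := (Lp.stronglyMeasurable w).measurable
    fun_prop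
  rw [slobodeckijSq_eq_lintegral_prod hθ (Lp.stronglyMeasurable w₀)]
  calc _ ≤ ∫⁻ p : Vec d × Vec d, liminf (fun i => ENNReal.ofReal (‖w (ns i) p.1 - w (ns i) p.2‖ ^ 2
          / ‖p.1 - p.2‖ ^ ((d : ℝ) + 2 * θ))) atTop ∂((volume.restrict U).prod (volume.restrict U)) := by
        refine lintegral_mono_ae ?_
        have h1 := Measure.quasiMeasurePreserving_fst (μ := volume.restrict U) (ν := volume.restrict U) |>.ae hns
        have h2 := Measure.quasiMeasurePreserving_snd (μ := volume.restrict U) (ν := volume.restrict U) |>.ae hns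
        filter_upwards [h1, h2] with p h1 h2
        refine (Tendsto.liminf_eq ?_).ge
        exact ENNReal.tendsto_ofReal ((((h1.sub h2).norm).pow 2).div_const _)
    _ ≤ liminf (fun i => ∫⁻ p : Vec d × Vec d, ENNReal.ofReal (‖w (ns i) p.1 - w (ns i) p.2‖ ^ 2
          / ‖p.1 - p.2‖ ^ ((d : ℝ) + 2 * θ)) ∂((volume.restrict U).prod (volume.restrict U))) atTop :=
        lintegral_liminf_le' fun i => (hm (w (ns i))).aemeasurable
    _ ≤ R := by
        refine Filter.liminf_le_of_frequently_le' (Frequently.of_forall fun i => ?_)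
        rw [← slobodeckijSq_eq_lintegral_prod hθ (Lp.stronglyMeasurable (w (ns i)))]
        exact hw (ns i)

theorem IsTest.fderiv_apply' {U : Set (Vec d)} {η : Vec d → ℝ} (hη : IsTest U η) (v : Vec d) :
    IsTest U fun y => fderiv ℝ η y v :=
  ⟨(hη.1.fderiv_right (m := ∞) (by simp)).clm_apply contDiff_const,
    hη.2.1.fderiv_apply ℝ v, (tsupport_fderiv_apply_subset ℝ v).trans hη.2.2⟩

theorem inner_toLp_eq {U : Set (Vec d)} {φ : Vec d → Vec d} (hφ : MemLp φ 2 (volume.restrict U))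
    (w : L2Vec U) : inner ℝ (hφ.toLp φ) w = ∫ x in U, inner ℝ (φ x) (w x) := by
  rw [L2.inner_def]
  refine integral_congr_ae ?_
  filter_upwards [hφ.coeFn_toLp] with x hx
  rw [hx]

/-- The relation is an intersection of equations between `L²` inner products with fixed elements,
one for each direction, test function and constant vector. -/
theorem isClosed_hasWeakPartial (U : Set (Vec d)) :
    IsClosed {z : L2Vec U × (Fin d → L2Vec U) | ∀ j, HasWeakPartial U j z.1 (z.2 j)} := by
  have hc : ∀ (ψ : Vec d → ℝ) (v : Vec d), IsTest univ ψ →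
      MemLp (fun x => ψ x • v) 2 (volume.restrict U) := fun ψ v hψ =>
    ((hψ.continuous.smul continuous_const).memLp_of_hasCompactSupport hψ.2.1.smul_right).restrict U
  have key : ∀ (ψ : Vec d → ℝ) (hψ : IsTest univ ψ) (w : L2Vec U) (v : Vec d),
      inner ℝ v (∫ x in U, ψ x • w x) = inner ℝ ((hc ψ v hψ).toLp _) w := by
    intro ψ hψ w v
    have hi : IntegrableOn (fun x => ψ x • w x) U := by
      have hψ2 : MemLp ψ 2 (volume.restrict U) :=
        (hψ.continuous.memLp_of_hasCompactSupport hψ.2.1).restrict U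
      exact memLp_one_iff_integrable.1 ((Lp.memLp w).smul hψ2)
    rw [inner_toLp_eq, ← integral_inner hi]
    refine integral_congr_ae (Eventually.of_forall fun x => ?_)
    simp only [inner_smul_left, inner_smul_right, RCLike.conj_to_real]
  have e : {z : L2Vec U × (Fin d → L2Vec U) | ∀ j, HasWeakPartial U j z.1 (z.2 j)} =
      ⋂ j : Fin d, ⋂ φ : {φ : Vec d → ℝ // IsTest U φ}, ⋂ v : Vec d,
        {z : L2Vec U × (Fin d → L2Vec U) |
          inner ℝ ((hc _ v ((φ.2.fderiv_apply' (unitVec j)).mono (subset_univ U))).toLp _) z.1 =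
          - inner ℝ ((hc φ.1 v (φ.2.mono (subset_univ U))).toLp _) (z.2 j)} := by
    ext z
    simp only [mem_iInter, mem_ofPred_eq]
    refine forall_congr' fun j => ?_
    constructor
    · rintro ⟨-, h⟩ φ v
      rw [← key φ.1 (φ.2.mono (subset_univ U)), ← key _ ((φ.2.fderiv_apply' (unitVec j)).mono (subset_univ U)),
        h φ.1 φ.2, inner_neg_right]
    · intro h
      refine ⟨Lp.memLp _, fun φ hφ => ext_inner_left ℝ fun v => ?_⟩
      rw [inner_neg_right, key _ (hφ.mono (subset_univ U)),
        key _ ((hφ.fderiv_apply' (unitVec j)).mono (subset_univ U))]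
      exact h ⟨φ, hφ⟩ v
  rw [e]
  refine isClosed_iInter fun j => isClosed_iInter fun φ => isClosed_iInter fun v => ?_
  refine isClosed_eq (by fun_prop) (Continuous.neg ?_)
  exact continuous_const.inner ((continuous_apply j).comp continuous_snd)

/-- The set of functions having weak derivatives need not be closed, but the graph of the gradient
is closed in a Polish space, and its projection to the function is injective as weak derivatives are
unique. By the Lusin–Souslin theorem the projection is a measurable embedding; the norm is a
measurable function on the graph, extended by `⊤`. -/
theorem measurable_sobolevAuxSq {U : Set (Vec d)} (hU : IsOpen U) (θ : ℝ) (m : ℕ) :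
    @Measurable _ _ (borel (L2Vec U)) _ fun w : L2Vec U => sobolevAuxSq U θ m w := by
  let : MeasurableSpace (L2Vec U) := borel _
  have : BorelSpace (L2Vec U) := ⟨rfl⟩
  have hn : Measurable fun w : L2Vec U => eLpNorm w 2 (volume.restrict U) ^ 2 := by
    simp only [← Lp.enorm_def]
    fun_prop
  induction m with
  | zero =>
    simp only [sobolevAuxSq]
    refine hn.add (LowerSemicontinuous.measurable ?_)
    rw [lowerSemicontinuous_iff_isClosed_preimage]
    exact fun R => isClosed_slobodeckijSq_le U θ R
  | succ m ih =>
    set Γ := {z : L2Vec U × (Fin d → L2Vec U) | ∀ j, HasWeakPartial U j z.1 (z.2 j)} with hΓ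
    have : PolishSpace (L2Vec U) := inferInstance
    have : PolishSpace Γ := (isClosed_hasWeakPartial U).polishSpace
    let : MeasurableSpace Γ := borel _
    have : BorelSpace Γ := ⟨rfl⟩
    have hinj : Function.Injective fun z : Γ => z.1.1 := by
      rintro ⟨⟨w, g⟩, hz⟩ ⟨⟨w', g'⟩, hz'⟩ (rfl : w = w')
      have : g = g' := funext fun j => Lp.ext ((hz j).ae_eq hU (hz' j))
      exact Subtype.ext (Prod.ext rfl this)
    have hemb : MeasurableEmbedding fun z : Γ => z.1.1 :=
      (continuous_fst.comp continuous_subtype_val).measurableEmbedding hinj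
    have hg : Measurable fun z : Γ => eLpNorm z.1.1 2 (volume.restrict U) ^ 2 +
        ∑ j, sobolevAuxSq U θ m (z.1.2 j) := by
      refine (hn.comp (continuous_fst.comp continuous_subtype_val).measurable).add
        (Finset.measurable_sum _ fun j _ => ih.comp ?_)
      exact ((continuous_apply j).comp (continuous_snd.comp continuous_subtype_val)).measurable
    have hext := hemb.measurable_extend hg (measurable_const (a := (⊤ : ℝ≥0∞)))
    convert hext using 1
    ext w
    by_cases hw : ∀ j : Fin d, ∃ g, HasWeakPartial U j w g
    · have hwp : ∀ j, HasWeakPartial U j w (weakPartial U j w) := fun j => hasWeakPartial_weakPartial (hw j)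
      have hz : (w, fun j => (hwp j).1.toLp _) ∈ Γ := fun j =>
        (hwp j).congr EventuallyEq.rfl (hwp j).1.coeFn_toLp.symm
      have := hinj.extend_apply (fun z : Γ => eLpNorm z.1.1 2 (volume.restrict U) ^ 2 +
        ∑ j, sobolevAuxSq U θ m (z.1.2 j)) (fun _ => ⊤) ⟨_, hz⟩
      rw [show sobolevAuxSq U θ (m + 1) w = _ from if_pos hw]
      refine Eq.trans ?_ this.symm
      congr 1
      exact Finset.sum_congr rfl fun j _ => sobolevAuxSq_congr hU m (hwp j).1.coeFn_toLp.symm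
    · rw [show sobolevAuxSq U θ (m + 1) w = _ from if_neg hw, Function.extend_apply']
      rintro ⟨⟨⟨w', g⟩, hz⟩, (rfl : w' = w)⟩
      exact hw fun j => ⟨_, hz j⟩

/-- The measure is kept as a variable because the twice restricted measure agrees with
`volume.restrict U` only propositionally, and the `Lp` types depend on it. -/
theorem measurable_sobolevAuxSq_of_eq {U : Set (Vec d)} (hU : IsOpen U) (θ : ℝ) (m : ℕ)
    {μ : Measure (Vec d)} (hμ : μ = volume.restrict U) :
    @Measurable _ _ (borel (Lp (Vec d) 2 μ)) _ fun w : Lp (Vec d) 2 μ => sobolevAuxSq U θ m w := by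
  subst hμ
  exact measurable_sobolevAuxSq hU θ m

theorem measurable_sobolevSq {Ω U : Set (Vec d)} (hU : IsOpen U) (hUΩ : U ⊆ Ω) (s : ℝ) :
    @Measurable _ _ (borel (L2Vec Ω)) _ fun w : L2Vec Ω => sobolevSq U s w := by
  let : MeasurableSpace (L2Vec Ω) := borel _
  have : BorelSpace (L2Vec Ω) := ⟨rfl⟩
  have hμ : (volume.restrict Ω).restrict U = volume.restrict U := by
    rw [Measure.restrict_restrict hU.measurableSet, inter_eq_left.2 hUΩ]
  let : MeasurableSpace (Lp (Vec d) 2 ((volume.restrict Ω).restrict U)) := borel _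
  have : BorelSpace (Lp (Vec d) 2 ((volume.restrict Ω).restrict U)) := ⟨rfl⟩
  have h := (measurable_sobolevAuxSq_of_eq hU (Int.fract s) ⌊s⌋₊ hμ).comp
    (LpToLpRestrictCLM (Vec d) (Vec d) ℝ (volume.restrict Ω) 2 U).continuous.measurable
  convert h using 1
  ext w
  refine sobolevAuxSq_congr hU _ ?_
  rw [← hμ]
  exact (LpToLpRestrictCLM_coeFn ℝ U w).symm

/-- A finite lower integral yields finiteness almost everywhere by way of measurability of the
integrand, which is the purpose of this part. -/
theorem Mesh.ae_brokenSobolevSq_lt_top {kind : MeshKind} {Ω : Set (Vec d)} {M : Mesh kind Ω}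
    (hΩ : interior (closure Ω) = Ω) {T s : ℝ} {u : ℝ → L2Vec Ω}
    (h : MemBochnerL2 T (fun w : L2Vec Ω => M.brokenSobolevSq s w) u) :
    ∀ᵐ t ∂volume.restrict (Ioo 0 T), M.brokenSobolevSq s (u t) < ⊤ := by
  let : MeasurableSpace (L2Vec Ω) := borel _
  have : BorelSpace (L2Vec Ω) := ⟨rfl⟩
  have hm : Measurable fun w : L2Vec Ω => M.brokenSobolevSq s w :=
    Finset.measurable_sum _ fun K hK =>
      measurable_sobolevSq isOpen_interior (M.interior_subset_domain hΩ hK) s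
  exact ae_lt_top' (hm.comp_aemeasurable h.1.aemeasurable) h.2.ne

end Measurability

/-! ### Traces of gradients, and facet measures -/

section Regular
variable {d : ℕ}

/-- If the integer part of `3/2 + ε` is one, the derivative has a finite Slobodeckij seminorm of
order `1/2 + ε`. Otherwise it is itself in `H¹`, and the result for convex sets applies. -/
theorem oscDecay_weakPartial_of_sobolevSq {U : Set (Vec d)} (hU : IsOpen U) (hconv : Convex ℝ U)
    (hb : Bornology.IsBounded U) {n : Vec d} (hn : ‖n‖ = 1) (c : ℝ) {ε : ℝ} (hε : 0 < ε)
    {w : Vec d → Vec d} (h : sobolevSq U (3 / 2 + ε) w < ⊤) (j : Fin d) :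
    OscDecay U n c (weakPartial U j w) := by
  have hfl : 1 ≤ ⌊(3 / 2 + ε : ℝ)⌋₊ := Nat.le_floor (by push_cast; linarith)
  obtain ⟨m, hm⟩ := Nat.exists_eq_add_of_le' hfl
  rw [sobolevSq, hm] at h
  have hex : ∀ j : Fin d, ∃ g, HasWeakPartial U j w g := by
    by_contra hc
    rw [show sobolevAuxSq U _ (m + 1) w = _ from if_neg hc] at h
    exact lt_irrefl _ h
  rw [show sobolevAuxSq U _ (m + 1) w = _ from if_pos hex] at h
  have hj := (ENNReal.sum_lt_top.1 (lt_of_le_of_lt le_add_self h)) j (Finset.mem_univ j)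
  have hgL := (hasWeakPartial_weakPartial (hex j)).1
  rcases m with _ | m
  · have hs : slobodeckijSq U (Int.fract (3 / 2 + ε)) (weakPartial U j w) < ⊤ :=
      lt_of_le_of_lt le_add_self hj
    have hθ : 1 / 2 < Int.fract (3 / 2 + ε) := by
      have h1 : ((⌊(3 / 2 + ε : ℝ)⌋₊ : ℕ) : ℤ) = ⌊(3 / 2 + ε : ℝ)⌋ := Int.natCast_floor_eq_floor (by positivity)
      have h2 : ⌊(3 / 2 + ε : ℝ)⌋ = 1 := by rw [← h1, hm]; rfl
      rw [Int.fract, h2]; push_cast; linarith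
    have hae := hgL.1.ae_eq_mk
    rw [slobodeckijSq_congr hae] at hs
    exact (OscDecay.of_slobodeckij hU.measurableSet hb hn c hgL.1.stronglyMeasurable_mk hθ hs).congr
      hU.measurableSet hae.symm
  · have hex2 : ∀ i : Fin d, ∃ g, HasWeakPartial U i (weakPartial U j w) g := by
      by_contra hc
      rw [show sobolevAuxSq U _ (m + 1) (weakPartial U j w) = _ from if_neg hc] at hj
      exact lt_irrefl _ hj
    exact OscDecay.of_hasWeakPartial hU hconv hb hn c hgL fun i => hasWeakPartial_weakPartial (hex2 i)

namespace Mesh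
variable {kind : MeshKind} {Ω : Set (Vec d)} {M : Mesh kind Ω}

theorem restrict_interior_eq (hd : 2 ≤ d) {K : Set (Vec d)} (hK : K ∈ M.elements) :
    (interior K : Set (Vec d)) =ᵐ[volume] K := by
  have h0 := (M.isPolytope hd hK).convex.addHaar_frontier volume
  refine (LE.le.eventuallyLE (interior_subset (s := K))).antisymm ?_
  filter_upwards [measure_eq_zero_iff_ae_notMem.1 h0] with y hy hyK
  by_contra hc
  exact hy ⟨_root_.subset_closure hyK, hc⟩

theorem restrict_interior (hd : 2 ≤ d) {K : Set (Vec d)} (hK : K ∈ M.elements) :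
    (volume.restrict (interior K) : Measure (Vec d)) = volume.restrict K :=
  Measure.restrict_congr_set (M.restrict_interior_eq hd hK)

theorem brokenPartial_eq (hd : 2 ≤ d) {K : Set (Vec d)} (hK : K ∈ M.elements) (j : Fin d)
    (w : Vec d → Vec d) {y : Vec d} (hy : y ∈ interior K) :
    M.brokenPartial j w y = weakPartial (interior K) j w y := by
  rw [brokenPartial, Finset.sum_eq_single K, indicator_of_mem hy]
  · intro K' hK' hne
    refine indicator_of_notMem (fun hc => hne ?_) _
    exact (M.eq_of_mem_interior hd hK' hK hc (interior_subset hy))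
  · exact fun hc => absurd hK hc

theorem brokenPartial_ae_eq (hd : 2 ≤ d) {K : Set (Vec d)} (hK : K ∈ M.elements) (j : Fin d)
    (w : Vec d → Vec d) : M.brokenPartial j w =ᵐ[volume.restrict K] weakPartial (interior K) j w := by
  rw [← M.restrict_interior hd hK]
  filter_upwards [ae_restrict_mem isOpen_interior.measurableSet] with y hy
  exact M.brokenPartial_eq hd hK j w hy

theorem exists_traceSetting (hd : 2 ≤ d) (hb : Bornology.IsBounded Ω) {K F : Set (Vec d)}
    (hK : K ∈ M.elements) (hF : F ∈ M.facets) (hFK : F ⊆ K) : ∃ a, ∀ w : Vec d → Vec d,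
      StronglyMeasurable w → IntegrableOn w K → OscDecay K (M.normal F) (M.offset F) w →
      TraceSetting K F (M.normal F) (M.offset F) w a := by
  have hP := M.isPolytope hd hK
  have hbK := M.isBounded hb hK
  obtain ⟨a, ha⟩ := volume_image_homothety_le hP.convex hbK hP.interior_nonempty
  refine ⟨a, fun w h1 h2 h3 => ⟨M.norm_normal hF, hP.isClosed.measurableSet,
    (M.isClosed_facet hd hF).measurableSet, hbK.subset hFK, fun x hx => ?_, h1, h2,
    fun x hx => ha x (hFK hx), h3⟩⟩
  exact sub_eq_zero.1 (M.lev_eq_zero hF hx)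

/-- The sides of a facet. -/
def IsSide (M : Mesh kind Ω) (F K : Set (Vec d)) : Prop := K = M.plus F ∨ (¬ F ⊆ frontier Ω ∧ K = M.minus F)

theorem IsSide.mem {F K : Set (Vec d)} (h : M.IsSide F K) (hF : F ∈ M.facets) : K ∈ M.elements := by
  rcases h with rfl | ⟨hi, rfl⟩
  · exact M.plus_mem F hF
  · exact M.minus_mem F hF hi

theorem IsSide.subset {F K : Set (Vec d)} (h : M.IsSide F K) (hF : F ∈ M.facets) : F ⊆ K := by
  rcases h with rfl | ⟨hi, rfl⟩
  · exact (M.isFacet_plus F hF).subset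
  · obtain ⟨n, hn⟩ := M.isFacet_minus F hF hi
    exact hn.subset

/-- The surface measure on the facet `F`. -/
def facetMeasure (M : Mesh kind Ω) (F : Set (Vec d)) : Measure (Vec d) :=
  (surf (M.normal F) (M.offset F)).restrict F

theorem facetInt_eq (hd : 2 ≤ d) {F : Set (Vec d)} (hF : F ∈ M.facets) (g : Vec d → ℝ) :
    facetInt F g = ∫ x, g x ∂M.facetMeasure F := by
  have h := restrict_eq_surf_restrict (V := Vec d) (M.norm_normal hF)
    (M.isClosed_facet hd hF).measurableSet (c := M.offset F) fun x hx => sub_eq_zero.1 (M.lev_eq_zero hF hx)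
  rw [facetInt, facetMeasure, ← h]
  simp

theorem restrict_facet_eq (hd : 2 ≤ d) {F : Set (Vec d)} (hF : F ∈ M.facets) :
    (Measure.euclideanHausdorffMeasure (d - 1) : Measure (Vec d)).restrict F = M.facetMeasure F := by
  have h := restrict_eq_surf_restrict (V := Vec d) (M.norm_normal hF)
    (M.isClosed_facet hd hF).measurableSet (c := M.offset F) fun x hx => sub_eq_zero.1 (M.lev_eq_zero hF hx)
  rw [facetMeasure, ← h]
  simp

/-- `w` has a trace on every facet, from either side. -/
def HasTraces (M : Mesh kind Ω) (w : Vec d → Vec d) : Prop :=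
  ∀ F ∈ M.facets, ∀ K, M.IsSide F K → IntegrableOn w K ∧
    (∀ᵐ x ∂M.facetMeasure F, Tendsto (ave K w x) (𝓝[>] 0) (𝓝 (trace K w x))) ∧
    Integrable (trace K w) (M.facetMeasure F)

/-- `TraceSetting` asks for strong measurability, so one passes to a representative; averages and
traces see only the almost everywhere class. -/
theorem HasTraces.of_oscDecay (hd : 2 ≤ d) (hb : Bornology.IsBounded Ω) {w : Vec d → Vec d}
    (hw : ∀ K ∈ M.elements, IntegrableOn w K)
    (h : ∀ K ∈ M.elements, ∀ n c, ‖n‖ = 1 → OscDecay K n c w) : M.HasTraces w := by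
  intro F hF K hK
  have hKm := hK.mem hF
  have hKmeas := (M.isPolytope hd hKm).isClosed.measurableSet
  obtain ⟨a, ha⟩ := M.exists_traceSetting hd hb hKm hF (hK.subset hF)
  have hae := (hw K hKm).1.ae_eq_mk
  have hT := ha _ (hw K hKm).1.stronglyMeasurable_mk ((hw K hKm).congr hae)
    ((h K hKm _ _ (M.norm_normal hF)).congr hKmeas hae)
  have htr : trace K w = trace K ((hw K hKm).1.mk w) := funext fun x => trace_congr hae x
  have hav : ∀ x, ave K w x = ave K ((hw K hKm).1.mk w) x := fun x => by
    ext1 r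
    exact average_congr (ae_restrict_of_ae_restrict_of_subset inter_subset_right hae)
  refine ⟨hw K hKm, ?_, ?_⟩
  · rw [htr]
    filter_upwards [hT.ae_tendsto_trace] with x hx
    rw [hav]
    exact hx
  · rw [htr]
    exact hT.integrable_trace

end Mesh
end Regular

/-! ### Traces of differences and of piecewise smooth fields -/

section Regular
variable {d : ℕ}
namespace Mesh
variable {kind : MeshKind} {Ω : Set (Vec d)} {M : Mesh kind Ω}

theorem ae_facetMeasure_mem (hd : 2 ≤ d) {F : Set (Vec d)} (hF : F ∈ M.facets) :
    ∀ᵐ x ∂M.facetMeasure F, x ∈ F := ae_restrict_mem (M.isClosed_facet hd hF).measurableSet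

theorem exists_densityBound (hd : 2 ≤ d) (hb : Bornology.IsBounded Ω) {K : Set (Vec d)}
    (hK : K ∈ M.elements) : ∃ a, ∀ x ∈ K, DensityBound K x a :=
  volume_image_homothety_le (M.isPolytope hd hK).convex (M.isBounded hb hK) (M.isPolytope hd hK).interior_nonempty

/-- `limUnder` is additive only where both limits exist, hence the statement almost everywhere; this
is why `HasTraces` records convergence of the averages. -/
theorem HasTraces.trace_sub (hd : 2 ≤ d) (hb : Bornology.IsBounded Ω) {w w' : Vec d → Vec d}
    (h : M.HasTraces w) (h' : M.HasTraces w') {F : Set (Vec d)} (hF : F ∈ M.facets) {K : Set (Vec d)}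
    (hK : M.IsSide F K) : ∀ᵐ x ∂M.facetMeasure F, trace K (w - w') x = trace K w x - trace K w' x := by
  obtain ⟨hi, ht, -⟩ := h F hF K hK
  obtain ⟨hi', ht', -⟩ := h' F hF K hK
  filter_upwards [ht, ht'] with x hx hx'
  refine Tendsto.limUnder_eq ((hx.sub hx').congr fun r => ?_)
  unfold ave
  have e1 : IntegrableOn w (Metric.ball x r ∩ K) := hi.mono_set inter_subset_right
  have e2 : IntegrableOn w' (Metric.ball x r ∩ K) := hi'.mono_set inter_subset_right
  rw [setAverage_eq, setAverage_eq, setAverage_eq, ← smul_sub, ← integral_sub e1 e2]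
  rfl

theorem HasTraces.jump_sub (hd : 2 ≤ d) (hb : Bornology.IsBounded Ω) {w w' : Vec d → Vec d}
    (h : M.HasTraces w) (h' : M.HasTraces w') {F : Set (Vec d)} (hF : F ∈ M.facets) :
    ∀ᵐ x ∂M.facetMeasure F, M.jump F (w - w') x = M.jump F w x - M.jump F w' x := by
  by_cases hi : F ⊆ frontier Ω
  · filter_upwards [h.trace_sub hd hb h' hF (Or.inl rfl)] with x hx
    simp only [jump, if_pos hi, hx]
  · filter_upwards [h.trace_sub hd hb h' hF (Or.inl rfl), h.trace_sub hd hb h' hF (Or.inr ⟨hi, rfl⟩)] with x hx hx'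
    simp only [jump, if_neg hi, hx, hx']
    abel

theorem HasTraces.avg_sub (hd : 2 ≤ d) (hb : Bornology.IsBounded Ω) {w w' : Vec d → Vec d}
    (h : M.HasTraces w) (h' : M.HasTraces w') {F : Set (Vec d)} (hF : F ∈ M.facets) :
    ∀ᵐ x ∂M.facetMeasure F, M.avg F (w - w') x = M.avg F w x - M.avg F w' x := by
  by_cases hi : F ⊆ frontier Ω
  · filter_upwards [h.trace_sub hd hb h' hF (Or.inl rfl)] with x hx
    simp only [avg, if_pos hi, hx]
  · filter_upwards [h.trace_sub hd hb h' hF (Or.inl rfl), h.trace_sub hd hb h' hF (Or.inr ⟨hi, rfl⟩)] with x hx hx'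
    simp only [avg, if_neg hi, hx, hx', ← smul_sub]
    congr 1
    abel

theorem HasTraces.integrable_jump {w : Vec d → Vec d}
    (h : M.HasTraces w) {F : Set (Vec d)} (hF : F ∈ M.facets) : Integrable (M.jump F w) (M.facetMeasure F) := by
  by_cases hi : F ⊆ frontier Ω
  · rw [show M.jump F w = trace (M.plus F) w from funext fun x => if_pos hi]
    exact (h F hF _ (Or.inl rfl)).2.2
  · rw [show M.jump F w = fun x => trace (M.plus F) w x - trace (M.minus F) w x from funext fun x => if_neg hi]
    exact (h F hF _ (Or.inl rfl)).2.2.sub (h F hF _ (Or.inr ⟨hi, rfl⟩)).2.2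

theorem HasTraces.integrable_avg {w : Vec d → Vec d}
    (h : M.HasTraces w) {F : Set (Vec d)} (hF : F ∈ M.facets) : Integrable (M.avg F w) (M.facetMeasure F) := by
  by_cases hi : F ⊆ frontier Ω
  · rw [show M.avg F w = trace (M.plus F) w from funext fun x => if_pos hi]
    exact (h F hF _ (Or.inl rfl)).2.2
  · rw [show M.avg F w = fun x => (1 / 2 : ℝ) • (trace (M.plus F) w x + trace (M.minus F) w x)
      from funext fun x => if_neg hi]
    exact Integrable.smul (1 / 2 : ℝ) ((h F hF _ (Or.inl rfl)).2.2.add (h F hF _ (Or.inr ⟨hi, rfl⟩)).2.2)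

theorem jump_congr {w w' : Vec d → Vec d} (h : ∀ K ∈ M.elements, w =ᵐ[volume.restrict K] w')
    {F : Set (Vec d)} (hF : F ∈ M.facets) (x : Vec d) : M.jump F w x = M.jump F w' x := by
  by_cases hi : F ⊆ frontier Ω
  · simp only [jump, if_pos hi, trace_congr (h _ (M.plus_mem F hF)) x]
  · simp only [jump, if_neg hi, trace_congr (h _ (M.plus_mem F hF)) x, trace_congr (h _ (M.minus_mem F hF hi)) x]

theorem avg_congr {w w' : Vec d → Vec d} (h : ∀ K ∈ M.elements, w =ᵐ[volume.restrict K] w')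
    {F : Set (Vec d)} (hF : F ∈ M.facets) (x : Vec d) : M.avg F w x = M.avg F w' x := by
  by_cases hi : F ⊆ frontier Ω
  · simp only [avg, if_pos hi, trace_congr (h _ (M.plus_mem F hF)) x]
  · simp only [avg, if_neg hi, trace_congr (h _ (M.plus_mem F hF)) x, trace_congr (h _ (M.minus_mem F hF hi)) x]

/-- `v` is smooth up to the boundary on every element. -/
structure PiecewiseSmooth (M : Mesh kind Ω) (v : Vec d → Vec d) (q : Set (Vec d) → Vec d → Vec d) : Prop where
  contDiff : ∀ K ∈ M.elements, ContDiff ℝ ∞ (q K)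
  ae_eq : ∀ K ∈ M.elements, v =ᵐ[volume.restrict K] q K

theorem restrict_domain_le (M : Mesh kind Ω) : (volume.restrict Ω : Measure (Vec d)) ≤ volume.restrict (⋃ K ∈ M.elements, K) := by
  rw [← M.cover]
  exact Measure.restrict_mono _root_.subset_closure le_rfl

theorem ae_domain_of_elements {P : Vec d → Prop} (h : ∀ K ∈ M.elements, ∀ᵐ y ∂volume.restrict K, P y) :
    ∀ᵐ y ∂volume.restrict Ω, P y :=
  ae_mono M.restrict_domain_le ((ae_restrict_biUnion_finset_iff _ M.elements P).2 h)

namespace PiecewiseSmooth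
variable {v : Vec d → Vec d} {q : Set (Vec d) → Vec d → Vec d}

theorem memLp_top (h : M.PiecewiseSmooth v q) (hd : 2 ≤ d) (hb : Bornology.IsBounded Ω) :
    MemLp v ⊤ (volume.restrict Ω) := by
  have hC : ∀ K ∈ M.elements, ∃ C, ∀ x ∈ K, ‖q K x‖ ≤ C := fun K hK =>
    (Metric.isCompact_of_isClosed_isBounded (M.isPolytope hd hK).isClosed
      (M.isBounded hb hK)).exists_bound_of_continuousOn (h.contDiff K hK).continuous.continuousOn
  choose! C hC using hC
  obtain ⟨R, hR⟩ := (M.elements.image C).bddAbove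
  refine memLp_top_of_bound ?_ R (M.ae_domain_of_elements fun K hK => ?_)
  · refine AEStronglyMeasurable.mono_measure ?_ M.restrict_domain_le
    rw [show (⋃ K ∈ M.elements, K) = ⋃ K : M.elements, (K : Set (Vec d)) by rw [iUnion_subtype]]
    refine aestronglyMeasurable_iUnion_iff.2 fun ⟨K, hK⟩ => ?_
    exact (h.contDiff K hK).continuous.aestronglyMeasurable.congr (h.ae_eq K hK).symm
  · filter_upwards [h.ae_eq K hK, ae_restrict_mem (M.isPolytope hd hK).isClosed.measurableSet] with y hy hyK
    rw [hy]
    exact (hC K hK y hyK).trans (hR (Finset.mem_coe.2 (Finset.mem_image_of_mem C hK)))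

theorem hasWeakPartial (h : M.PiecewiseSmooth v q) (hd : 2 ≤ d) (hb : Bornology.IsBounded Ω) {K : Set (Vec d)}
    (hK : K ∈ M.elements) (j : Fin d) :
    HasWeakPartial (interior K) j v fun y => fderiv ℝ (q K) y (unitVec j) := by
  refine (hasWeakPartial_of_contDiff_of_isBounded ((M.isBounded hb hK).subset interior_subset)
    ((h.contDiff K hK).of_le (by simp))).congr ?_ EventuallyEq.rfl
  rw [M.restrict_interior hd hK]
  exact (h.ae_eq K hK).symm

theorem brokenPartial (h : M.PiecewiseSmooth v q) (hd : 2 ≤ d) (hb : Bornology.IsBounded Ω) (j : Fin d) :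
    M.PiecewiseSmooth (M.brokenPartial j v) fun K y => fderiv ℝ (q K) y (unitVec j) := by
  refine ⟨fun K hK => ((h.contDiff K hK).fderiv_right (m := ∞) (by simp)).clm_apply contDiff_const,
    fun K hK => (M.brokenPartial_ae_eq hd hK j v).trans ?_⟩
  rw [← M.restrict_interior hd hK]
  exact (h.hasWeakPartial hd hb hK j).weakPartial_ae isOpen_interior

theorem trace_eq (h : M.PiecewiseSmooth v q) (hd : 2 ≤ d) (hb : Bornology.IsBounded Ω) {K : Set (Vec d)}
    (hK : K ∈ M.elements) {x : Vec d} (hx : x ∈ K) : trace K v x = q K x := by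
  obtain ⟨a, ha⟩ := M.exists_densityBound hd hb hK
  exact (ha x hx).trace_eq (h.contDiff K hK).continuous (h.ae_eq K hK)

theorem hasTraces (h : M.PiecewiseSmooth v q) (hd : 2 ≤ d) (hb : Bornology.IsBounded Ω) : M.HasTraces v := by
  refine HasTraces.of_oscDecay hd hb (fun K hK => ?_) fun K hK n c hn => ?_
  · have hcp := Metric.isCompact_of_isClosed_isBounded (M.isPolytope hd hK).isClosed (M.isBounded hb hK)
    have := (h.contDiff K hK).continuous.continuousOn.integrableOn_compact (μ := volume) hcp
    exact this.congr (h.ae_eq K hK).symm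
  · have hP := M.isPolytope hd hK
    have hcp := Metric.isCompact_of_isClosed_isBounded hP.isClosed (M.isBounded hb hK)
    have h1 : ContDiff ℝ 1 (q K) := (h.contDiff K hK).of_le (by simp)
    obtain ⟨L, hL⟩ := (h1.locallyLipschitz.locallyLipschitzOn (s := K)).exists_lipschitzOnWith_of_compact hcp
    exact (OscDecay.of_lipschitz hP.isClosed.measurableSet (M.isBounded hb hK) hn c hL).congr
      hP.isClosed.measurableSet (h.ae_eq K hK).symm

theorem exists_jump_eq (h : M.PiecewiseSmooth v q) (hd : 2 ≤ d) (hb : Bornology.IsBounded Ω)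
    {F : Set (Vec d)} (hF : F ∈ M.facets) : ∃ m : Vec d → Vec d, Continuous m ∧ ∀ x ∈ F, M.jump F v x = m x := by
  have hp := M.plus_mem F hF
  have hs : F ⊆ M.plus F := (M.isFacet_plus F hF).subset
  by_cases hi : F ⊆ frontier Ω
  · exact ⟨q (M.plus F), (h.contDiff _ hp).continuous, fun x hx => by
      rw [jump, if_pos hi, h.trace_eq hd hb hp (hs hx)]⟩
  · have hm := M.minus_mem F hF hi
    exact ⟨fun x => q (M.plus F) x - q (M.minus F) x, (h.contDiff _ hp).continuous.sub (h.contDiff _ hm).continuous,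
      fun x hx => by
        rw [jump, if_neg hi, h.trace_eq hd hb hp (hs hx), h.trace_eq hd hb hm
          (IsSide.subset (Or.inr ⟨hi, rfl⟩) hF hx)]⟩

theorem exists_avg_eq (h : M.PiecewiseSmooth v q) (hd : 2 ≤ d) (hb : Bornology.IsBounded Ω)
    {F : Set (Vec d)} (hF : F ∈ M.facets) : ∃ m : Vec d → Vec d, Continuous m ∧ ∀ x ∈ F, M.avg F v x = m x := by
  have hp := M.plus_mem F hF
  have hs : F ⊆ M.plus F := (M.isFacet_plus F hF).subset
  by_cases hi : F ⊆ frontier Ω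
  · exact ⟨q (M.plus F), (h.contDiff _ hp).continuous, fun x hx => by
      rw [avg, if_pos hi, h.trace_eq hd hb hp (hs hx)]⟩
  · have hm := M.minus_mem F hF hi
    exact ⟨fun x => (1 / 2 : ℝ) • (q (M.plus F) x + q (M.minus F) x),
      by
        have h1 := (h.contDiff _ hp).continuous
        have h2 := (h.contDiff _ hm).continuous
        fun_prop,
      fun x hx => by
        rw [avg, if_neg hi, h.trace_eq hd hb hp (hs hx), h.trace_eq hd hb hm
          (IsSide.subset (Or.inr ⟨hi, rfl⟩) hF hx)]⟩

theorem exists_avgNormalDeriv_eq (h : M.PiecewiseSmooth v q) (hd : 2 ≤ d) (hb : Bornology.IsBounded Ω)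
    {F : Set (Vec d)} (hF : F ∈ M.facets) :
    ∃ m : Vec d → Vec d, Continuous m ∧ ∀ x ∈ F, M.avgNormalDeriv F v x = m x := by
  choose m hm hmF using fun j => (h.brokenPartial hd hb j).exists_avg_eq hd hb hF
  exact ⟨fun x => ∑ j, M.normal F j • m j x, by fun_prop,
    fun x hx => Finset.sum_congr rfl fun j _ => by rw [hmF j x hx]⟩

end PiecewiseSmooth

theorem integrable_facet_inner (hd : 2 ≤ d) (hb : Bornology.IsBounded Ω) {F : Set (Vec d)} (hF : F ∈ M.facets)
    {f g m : Vec d → Vec d} (hf : Integrable f (M.facetMeasure F)) (hm : Continuous m) (hg : ∀ x ∈ F, g x = m x) :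
    MemLp g ⊤ (M.facetMeasure F) ∧ Integrable (fun x => (inner ℝ (f x) (g x) : ℝ)) (M.facetMeasure F) := by
  have hcp : IsCompact F := Metric.isCompact_of_isClosed_isBounded (M.isClosed_facet hd hF)
    ((M.isBounded hb (M.plus_mem F hF)).subset (M.isFacet_plus F hF).subset)
  obtain ⟨C, hC⟩ := hcp.exists_bound_of_continuousOn hm.continuousOn
  have hgm : AEStronglyMeasurable g (M.facetMeasure F) := by
    refine hm.aestronglyMeasurable.congr ?_
    filter_upwards [M.ae_facetMeasure_mem hd hF] with x hx
    exact (hg x hx).symm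
  have hgC : ∀ᵐ x ∂M.facetMeasure F, ‖g x‖ ≤ C := by
    filter_upwards [M.ae_facetMeasure_mem hd hF] with x hx
    rw [hg x hx]; exact hC x hx
  refine ⟨memLp_top_of_bound hgm C hgC, Integrable.mono' (hf.norm.mul_const C) (hf.1.inner hgm) ?_⟩
  filter_upwards [hgC] with x hx
  exact (norm_inner_le_norm _ _).trans (by gcongr)

end Mesh
end Regular

/-! ### Linearity of the discrete forms in the first argument -/

section Regular
variable {d : ℕ}
namespace Mesh
variable {kind : MeshKind} {Ω : Set (Vec d)} {M : Mesh kind Ω}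

theorem ae_element_of_domain (hd : 2 ≤ d) (hΩ : interior (closure Ω) = Ω) {P : Vec d → Prop}
    (h : ∀ᵐ y ∂volume.restrict Ω, P y) {K : Set (Vec d)} (hK : K ∈ M.elements) : ∀ᵐ y ∂volume.restrict K, P y := by
  rw [← M.restrict_interior hd hK]
  exact ae_restrict_of_ae_restrict_of_subset (M.interior_subset_domain hΩ hK) h

theorem _root_.OseenHdiv.memLp_convective {μ : Measure (Vec d)} {b : Vec d → Vec d} (hb : MemLp b ⊤ μ)
    {D : Fin d → Vec d → Vec d} (hD : ∀ j, MemLp (D j) 2 μ) : MemLp (fun x => ∑ j, b x j • D j x) 2 μ := by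
  obtain ⟨C, hC, hbC⟩ := hb.exists_ae_norm_le
  refine memLp_finsetSum _ fun j _ => ?_
  have hm : AEStronglyMeasurable (fun x => b x j) μ :=
    (show Continuous fun y : Vec d => y j by fun_prop).comp_aestronglyMeasurable hb.1
  refine (hD j).of_le_mul (c := C) (hm.smul (hD j).1) ?_
  filter_upwards [hbC] with x hx
  rw [norm_smul]
  gcongr
  exact (PiLp.norm_apply_le (b x) j).trans hx

/-- Functions with broken weak derivatives, that have traces on the facets, as do their derivatives. -/
structure IsRegular (M : Mesh kind Ω) (w : Vec d → Vec d) : Prop where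
  memLp : ∀ K ∈ M.elements, MemLp w 2 (volume.restrict (interior K))
  hasPartial : ∀ K ∈ M.elements, ∀ j, ∃ g, HasWeakPartial (interior K) j w g
  traces : M.HasTraces w
  traces_partial : ∀ j, M.HasTraces (M.brokenPartial j w)

theorem PiecewiseSmooth.isRegular {v : Vec d → Vec d} {q : Set (Vec d) → Vec d → Vec d}
    (h : M.PiecewiseSmooth v q) (hd : 2 ≤ d) (hb : Bornology.IsBounded Ω) : M.IsRegular v :=
  ⟨fun K hK => (memLp_restrict_of_continuous ((M.isBounded hb hK).subset interior_subset)
      (h.contDiff K hK).continuous 2).ae_eq (by rw [M.restrict_interior hd hK]; exact (h.ae_eq K hK).symm), fun _ hK j => ⟨_, h.hasWeakPartial hd hb hK j⟩, h.hasTraces hd hb, fun j => (h.brokenPartial hd hb j).hasTraces hd hb⟩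

theorem brokenPartial_congr (hd : 2 ≤ d) {w w' : Vec d → Vec d}
    (h : ∀ K ∈ M.elements, w =ᵐ[volume.restrict K] w') (j : Fin d) {K : Set (Vec d)} (hK : K ∈ M.elements) :
    M.brokenPartial j w =ᵐ[volume.restrict K] M.brokenPartial j w' := by
  refine (M.brokenPartial_ae_eq hd hK j w).trans (EventuallyEq.trans ?_ (M.brokenPartial_ae_eq hd hK j w').symm)
  have := h K hK
  rw [← M.restrict_interior hd hK] at this ⊢
  exact weakPartial_congr isOpen_interior this j

namespace IsRegular
variable {w w' : Vec d → Vec d}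

theorem memLp_brokenPartial (h : M.IsRegular w) (j : Fin d) :
    MemLp (M.brokenPartial j w) 2 (volume.restrict Ω) := by
  refine (memLp_finsetSum _ fun K hK => ?_).restrict Ω
  rw [memLp_indicator_iff_restrict isOpen_interior.measurableSet]
  exact (hasWeakPartial_weakPartial (h.hasPartial K hK j)).1

theorem brokenPartial_sub (h : M.IsRegular w) (h' : M.IsRegular w') (hd : 2 ≤ d) (j : Fin d)
    {K : Set (Vec d)} (hK : K ∈ M.elements) :
    M.brokenPartial j (w - w') =ᵐ[volume.restrict K] M.brokenPartial j w - M.brokenPartial j w' := by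
  have hs : HasWeakPartial (interior K) j (w - w') (weakPartial (interior K) j w - weakPartial (interior K) j w') :=
    (hasWeakPartial_weakPartial (h.hasPartial K hK j)).sub (hasWeakPartial_weakPartial (h'.hasPartial K hK j))
      (h.memLp K hK) (h'.memLp K hK)
  have h1 := hs.weakPartial_ae isOpen_interior
  rw [M.restrict_interior hd hK] at h1
  filter_upwards [M.brokenPartial_ae_eq hd hK j (w - w'), M.brokenPartial_ae_eq hd hK j w,
    M.brokenPartial_ae_eq hd hK j w', h1] with y e1 e2 e3 e4
  rw [e1, e4, Pi.sub_apply, Pi.sub_apply, e2, e3]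

theorem integrable_avgNormalDeriv (h : M.IsRegular w) {F : Set (Vec d)} (hF : F ∈ M.facets) :
    Integrable (M.avgNormalDeriv F w) (M.facetMeasure F) :=
  integrable_finsetSum _ fun j _ => Integrable.smul (M.normal F j) ((h.traces_partial j).integrable_avg hF)

theorem avgNormalDeriv_sub (h : M.IsRegular w) (h' : M.IsRegular w') (hd : 2 ≤ d) (hb : Bornology.IsBounded Ω)
    {F : Set (Vec d)} (hF : F ∈ M.facets) : ∀ᵐ x ∂M.facetMeasure F,
      M.avgNormalDeriv F (w - w') x = M.avgNormalDeriv F w x - M.avgNormalDeriv F w' x := by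
  have h1 : ∀ j, ∀ᵐ x ∂M.facetMeasure F, M.avg F (M.brokenPartial j (w - w')) x =
      M.avg F (M.brokenPartial j w) x - M.avg F (M.brokenPartial j w') x := fun j => by
    filter_upwards [(h.traces_partial j).avg_sub hd hb (h'.traces_partial j) hF] with x hx
    rw [← hx]
    exact M.avg_congr (fun K hK => h.brokenPartial_sub h' hd j hK) hF x
  filter_upwards [ae_all_iff.2 h1] with x hx
  simp only [avgNormalDeriv, hx, smul_sub, Finset.sum_sub_distrib]

end IsRegular

theorem avgNormalDeriv_congr (hd : 2 ≤ d) {w w' : Vec d → Vec d} (h : ∀ K ∈ M.elements, w =ᵐ[volume.restrict K] w')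
    {F : Set (Vec d)} (hF : F ∈ M.facets) (x : Vec d) : M.avgNormalDeriv F w x = M.avgNormalDeriv F w' x :=
  Finset.sum_congr rfl fun j _ => by
    rw [M.avg_congr (fun K hK => M.brokenPartial_congr hd h j hK) hF x]

/-- All facet terms have this shape. The weight `r` is a constant or made from the normal trace,
hence bounded; the second factor agrees on `F` with a continuous field. So `L¹` traces of the first
argument suffice to split the integral. -/
theorem integral_facet_sub (hd : 2 ≤ d) (hb : Bornology.IsBounded Ω) {F : Set (Vec d)} (hF : F ∈ M.facets)
    {f f' f'' g m : Vec d → Vec d} {r : Vec d → ℝ} (hf : Integrable f (M.facetMeasure F))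
    (hf' : Integrable f' (M.facetMeasure F)) (hs : ∀ᵐ x ∂M.facetMeasure F, f'' x = f x - f' x)
    (hm : Continuous m) (hg : ∀ x ∈ F, g x = m x) (hr : MemLp r ⊤ (M.facetMeasure F)) :
    facetInt F (fun x => r x * inner ℝ (f'' x) (g x)) =
      facetInt F (fun x => r x * inner ℝ (f x) (g x)) - facetInt F fun x => r x * inner ℝ (f' x) (g x) := by
  rw [M.facetInt_eq hd hF, M.facetInt_eq hd hF, M.facetInt_eq hd hF]
  obtain ⟨C, hC, hrC⟩ := hr.exists_ae_norm_le
  rw [← integral_sub ((M.integrable_facet_inner hd hb hF hf hm hg).2.bdd_mul (c := C) hr.1 hrC)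
    ((M.integrable_facet_inner hd hb hF hf' hm hg).2.bdd_mul (c := C) hr.1 hrC)]
  refine integral_congr_ae ?_
  filter_upwards [hs] with x hx
  rw [hx, inner_sub_left, mul_sub]

/-- A chosen normal trace is bounded by definition and the default value is zero, so the existence
of a normal trace need not be shown. -/
theorem memLp_top_normalTrace (hd : 2 ≤ d) {F : Set (Vec d)} (hF : F ∈ M.facets) (b : Vec d → Vec d) :
    MemLp (M.normalTrace b F) ⊤ (M.facetMeasure F) := by
  unfold normalTrace
  split_ifs with h
  · have := h.choose_spec.1
    rwa [M.restrict_facet_eq hd hF] at this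
  · exact MemLp.zero

/-- The difference is given only almost everywhere, as it arises from subtraction in `L²`. Volume
terms split since the broken gradients are in `L²` and those of `v` are bounded; facet terms split
by `integral_facet_sub`. -/
theorem formAh_sub (hd : 2 ≤ d) (hb : Bornology.IsBounded Ω) (hΩ : interior (closure Ω) = Ω)
    {w w' w'' v : Vec d → Vec d} {q : Set (Vec d) → Vec d → Vec d} (h : M.IsRegular w) (h' : M.IsRegular w')
    (hv : M.PiecewiseSmooth v q) (hs : w'' =ᵐ[volume.restrict Ω] w - w') (σ : ℝ) (hF : Set (Vec d) → ℝ) :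
    M.formAh σ hF w'' v = M.formAh σ hF w v - M.formAh σ hF w' v := by
  have hfin : IsFiniteMeasure (volume.restrict Ω : Measure (Vec d)) :=
    isFiniteMeasure_restrict.2 hb.measure_lt_top.ne
  have hsK : ∀ K ∈ M.elements, w'' =ᵐ[volume.restrict K] w - w' := fun K hK => M.ae_element_of_domain hd hΩ hs hK
  have hvol : ∫ x in Ω, ∑ j, inner ℝ (M.brokenPartial j w'' x) (M.brokenPartial j v x) =
      (∫ x in Ω, ∑ j, inner ℝ (M.brokenPartial j w x) (M.brokenPartial j v x)) -
      ∫ x in Ω, ∑ j, inner ℝ (M.brokenPartial j w' x) (M.brokenPartial j v x) := by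
    have hi : ∀ {z}, M.IsRegular z → Integrable
        (fun x => ∑ j, (inner ℝ (M.brokenPartial j z x) (M.brokenPartial j v x) : ℝ)) (volume.restrict Ω) := fun hz =>
      integrable_finsetSum _ fun j _ => ((hz.memLp_brokenPartial j).inner_of_top
        ((hv.brokenPartial hd hb j).memLp_top hd hb)).integrable (by norm_num)
    rw [← integral_sub (hi h) (hi h')]
    refine integral_congr_ae ?_
    have h1 : ∀ j, M.brokenPartial j w'' =ᵐ[volume.restrict Ω] M.brokenPartial j w - M.brokenPartial j w' := fun j =>
      M.ae_domain_of_elements fun K hK => (M.brokenPartial_congr hd hsK j hK).trans (h.brokenPartial_sub h' hd j hK)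
    filter_upwards [ae_all_iff.2 h1] with x hx
    rw [← Finset.sum_sub_distrib]
    exact Finset.sum_congr rfl fun j _ => by rw [hx j, Pi.sub_apply, inner_sub_left]
  have hone : ∀ F ∈ M.facets, MemLp (fun _ => (1 : ℝ)) ⊤ (M.facetMeasure F) := fun F hF =>
    memLp_top_const 1
  have hjs : ∀ F ∈ M.facets, ∀ᵐ x ∂M.facetMeasure F, M.jump F w'' x = M.jump F w x - M.jump F w' x := fun F hF => by
    filter_upwards [h.traces.jump_sub hd hb h'.traces hF] with x hx
    rw [← hx]; exact M.jump_congr hsK hF x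
  have t2 : ∑ F ∈ M.facets, facetInt F (fun x => inner ℝ (M.avgNormalDeriv F w'' x) (M.jump F v x)) =
      (∑ F ∈ M.facets, facetInt F fun x => inner ℝ (M.avgNormalDeriv F w x) (M.jump F v x)) -
      ∑ F ∈ M.facets, facetInt F fun x => inner ℝ (M.avgNormalDeriv F w' x) (M.jump F v x) := by
    rw [← Finset.sum_sub_distrib]
    refine Finset.sum_congr rfl fun F hF => ?_
    obtain ⟨m, hm, hmF⟩ := hv.exists_jump_eq hd hb hF
    have hs2 : ∀ᵐ x ∂M.facetMeasure F, M.avgNormalDeriv F w'' x =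
        M.avgNormalDeriv F w x - M.avgNormalDeriv F w' x := by
      filter_upwards [h.avgNormalDeriv_sub h' hd hb hF] with x hx
      rw [← hx]; exact M.avgNormalDeriv_congr hd hsK hF x
    simpa only [one_mul] using M.integral_facet_sub hd hb hF (h.integrable_avgNormalDeriv hF)
      (h'.integrable_avgNormalDeriv hF) hs2 hm hmF (hone F hF)
  have t3 : ∑ F ∈ M.facets, facetInt F (fun x => inner ℝ (M.jump F w'' x) (M.avgNormalDeriv F v x)) =
      (∑ F ∈ M.facets, facetInt F fun x => inner ℝ (M.jump F w x) (M.avgNormalDeriv F v x)) -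
      ∑ F ∈ M.facets, facetInt F fun x => inner ℝ (M.jump F w' x) (M.avgNormalDeriv F v x) := by
    rw [← Finset.sum_sub_distrib]
    refine Finset.sum_congr rfl fun F hF => ?_
    obtain ⟨m, hm, hmF⟩ := hv.exists_avgNormalDeriv_eq hd hb hF
    simpa only [one_mul] using M.integral_facet_sub hd hb hF (h.traces.integrable_jump hF)
      (h'.traces.integrable_jump hF) (hjs F hF) hm hmF (hone F hF)
  have t4 : ∑ F ∈ M.facets, facetInt F (fun x => σ / hF F * inner ℝ (M.jump F w'' x) (M.jump F v x)) =
      (∑ F ∈ M.facets, facetInt F fun x => σ / hF F * inner ℝ (M.jump F w x) (M.jump F v x)) -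
      ∑ F ∈ M.facets, facetInt F fun x => σ / hF F * inner ℝ (M.jump F w' x) (M.jump F v x) := by
    rw [← Finset.sum_sub_distrib]
    refine Finset.sum_congr rfl fun F hF => ?_
    obtain ⟨m, hm, hmF⟩ := hv.exists_jump_eq hd hb hF
    exact M.integral_facet_sub hd hb hF (h.traces.integrable_jump hF)
      (h'.traces.integrable_jump hF) (hjs F hF) hm hmF (memLp_top_const _)
  unfold formAh
  rw [hvol, t2, t3, t4]
  ring

theorem formCh_sub (hd : 2 ≤ d) (hb : Bornology.IsBounded Ω) (hΩ : interior (closure Ω) = Ω)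
    {w w' w'' v b : Vec d → Vec d} {q : Set (Vec d) → Vec d → Vec d} (h : M.IsRegular w) (h' : M.IsRegular w')
    (hv : M.PiecewiseSmooth v q) (hs : w'' =ᵐ[volume.restrict Ω] w - w') (γ : ℝ)
    (hbt : MemLp b ⊤ (volume.restrict Ω)) :
    M.formCh γ b w'' v = M.formCh γ b w v - M.formCh γ b w' v := by
  have hfin : IsFiniteMeasure (volume.restrict Ω : Measure (Vec d)) :=
    isFiniteMeasure_restrict.2 hb.measure_lt_top.ne
  have hsK : ∀ K ∈ M.elements, w'' =ᵐ[volume.restrict K] w - w' := fun K hK => M.ae_element_of_domain hd hΩ hs hK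
  have hvol : ∫ x in Ω, inner ℝ (∑ j, b x j • M.brokenPartial j w'' x) (v x) =
      (∫ x in Ω, inner ℝ (∑ j, b x j • M.brokenPartial j w x) (v x)) -
      ∫ x in Ω, inner ℝ (∑ j, b x j • M.brokenPartial j w' x) (v x) := by
    have hi : ∀ {z}, M.IsRegular z → Integrable
        (fun x => (inner ℝ (∑ j, b x j • M.brokenPartial j z x) (v x) : ℝ)) (volume.restrict Ω) := fun hz =>
      ((memLp_convective hbt fun j => hz.memLp_brokenPartial j).inner_of_top (hv.memLp_top hd hb)).integrable (by norm_num)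
    rw [← integral_sub (hi h) (hi h')]
    refine integral_congr_ae ?_
    have h1 : ∀ j, M.brokenPartial j w'' =ᵐ[volume.restrict Ω] M.brokenPartial j w - M.brokenPartial j w' := fun j =>
      M.ae_domain_of_elements fun K hK => (M.brokenPartial_congr hd hsK j hK).trans (h.brokenPartial_sub h' hd j hK)
    filter_upwards [ae_all_iff.2 h1] with x hx
    rw [← inner_sub_left, ← Finset.sum_sub_distrib]
    congr 1
    exact Finset.sum_congr rfl fun j _ => by rw [hx j, Pi.sub_apply, smul_sub]
  have hjs : ∀ F ∈ M.facets, ∀ᵐ x ∂M.facetMeasure F, M.jump F w'' x = M.jump F w x - M.jump F w' x := fun F hF => by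
    filter_upwards [h.traces.jump_sub hd hb h'.traces hF] with x hx
    rw [← hx]; exact M.jump_congr hsK hF x
  have hmem : ∀ F ∈ M.interiorFacets, F ∈ M.facets := fun F hF => by
    classical
    unfold interiorFacets at hF
    exact (Finset.mem_filter.1 hF).1
  have t2 : ∑ F ∈ M.interiorFacets, facetInt F (fun x => M.normalTrace b F x * inner ℝ (M.jump F w'' x) (M.avg F v x)) =
      (∑ F ∈ M.interiorFacets, facetInt F fun x => M.normalTrace b F x * inner ℝ (M.jump F w x) (M.avg F v x)) -
      ∑ F ∈ M.interiorFacets, facetInt F fun x => M.normalTrace b F x * inner ℝ (M.jump F w' x) (M.avg F v x) := by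
    rw [← Finset.sum_sub_distrib]
    refine Finset.sum_congr rfl fun F hF => ?_
    obtain ⟨m, hm, hmF⟩ := hv.exists_avg_eq hd hb (hmem F hF)
    exact M.integral_facet_sub hd hb (hmem F hF) (h.traces.integrable_jump (hmem F hF))
      (h'.traces.integrable_jump (hmem F hF)) (hjs F (hmem F hF)) hm hmF (M.memLp_top_normalTrace hd (hmem F hF) b)
  have t3 : ∑ F ∈ M.interiorFacets, facetInt F (fun x => γ / 2 * |M.normalTrace b F x| * inner ℝ (M.jump F w'' x) (M.jump F v x)) =
      (∑ F ∈ M.interiorFacets, facetInt F fun x => γ / 2 * |M.normalTrace b F x| * inner ℝ (M.jump F w x) (M.jump F v x)) -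
      ∑ F ∈ M.interiorFacets, facetInt F fun x => γ / 2 * |M.normalTrace b F x| * inner ℝ (M.jump F w' x) (M.jump F v x) := by
    rw [← Finset.sum_sub_distrib]
    refine Finset.sum_congr rfl fun F hF => ?_
    obtain ⟨m, hm, hmF⟩ := hv.exists_jump_eq hd hb (hmem F hF)
    exact M.integral_facet_sub hd hb (hmem F hF) (h.traces.integrable_jump (hmem F hF))
      (h'.traces.integrable_jump (hmem F hF)) (hjs F (hmem F hF)) hm hmF
      ((M.memLp_top_normalTrace hd (hmem F hF) b).norm.const_mul (γ / 2))
  unfold formCh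
  rw [hvol, t2, t3]
  ring

end Mesh
end Regular

/-! ### Regularity and vanishing jumps of fields in `H¹₀` -/

section Continuous
variable {d : ℕ}
namespace Mesh
variable {kind : MeshKind} {Ω : Set (Vec d)} {M : Mesh kind Ω}

theorem hasWeakPartial_of_mem_spaceV {w : L2Vec Ω} (hw : w ∈ spaceV Ω) (j : Fin d) :
    HasWeakPartial Ω j w (weakPartial Ω j w) :=
  hasWeakPartial_weakPartial (exists_hasWeakPartial_of_sobolevSq_one hw.1 j)

theorem brokenPartial_ae_eq_weakPartial (hd : 2 ≤ d) (hΩ : interior (closure Ω) = Ω) {w g : Vec d → Vec d}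
    {j : Fin d} (h : HasWeakPartial Ω j w g) : M.brokenPartial j w =ᵐ[volume.restrict Ω] g := by
  refine M.ae_domain_of_elements fun K hK => (M.brokenPartial_ae_eq hd hK j w).trans ?_
  rw [← M.restrict_interior hd hK]
  exact (h.mono (M.interior_subset_domain hΩ hK)).weakPartial_ae isOpen_interior

theorem oscDecay_weakPartial (hd : 2 ≤ d) (hb : Bornology.IsBounded Ω) (hΩ : interior (closure Ω) = Ω)
    {w : L2Vec Ω} (hw : w ∈ spaceV Ω) {ε : ℝ} (hε : 0 < ε) (hreg : M.brokenSobolevSq (3 / 2 + ε) w < ⊤)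
    {K : Set (Vec d)} (hK : K ∈ M.elements) {n : Vec d} (hn : ‖n‖ = 1) (c : ℝ) (j : Fin d) :
    OscDecay K n c (weakPartial Ω j w) := by
  have hs : sobolevSq (interior K) (3 / 2 + ε) w < ⊤ := (ENNReal.sum_lt_top.1 hreg) K hK
  have h1 := ((hasWeakPartial_of_mem_spaceV hw j).mono (M.interior_subset_domain hΩ hK)).weakPartial_ae isOpen_interior
  exact ((oscDecay_weakPartial_of_sobolevSq isOpen_interior (M.isPolytope hd hK).convex.interior
    ((M.isBounded hb hK).subset interior_subset) hn c hε hs j).congr isOpen_interior.measurableSet h1).of_ae_eq_set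
    (M.restrict_interior_eq hd hK).symm

/-- The field is in `H¹` of each element, which is convex, so it has traces; its derivatives have
traces by the piecewise regularity. -/
theorem isRegular_of_mem_spaceV (hd : 2 ≤ d) (hb : Bornology.IsBounded Ω) (hΩ : interior (closure Ω) = Ω)
    {w : L2Vec Ω} (hw : w ∈ spaceV Ω) {ε : ℝ} (hε : 0 < ε) (hreg : M.brokenSobolevSq (3 / 2 + ε) w < ⊤) :
    M.IsRegular w := by
  have hm : ∀ K ∈ M.elements, MemLp w 2 (volume.restrict (interior K)) := fun K hK =>
    (Lp.memLp w).mono_measure (Measure.restrict_mono (M.interior_subset_domain hΩ hK) le_rfl)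
  have hp : ∀ K ∈ M.elements, ∀ j, HasWeakPartial (interior K) j w (weakPartial Ω j w) := fun K hK j =>
    (hasWeakPartial_of_mem_spaceV hw j).mono (M.interior_subset_domain hΩ hK)
  have hbi : ∀ K ∈ M.elements, Bornology.IsBounded (interior K) := fun K hK =>
    (M.isBounded hb hK).subset interior_subset
  have hint : ∀ K ∈ M.elements, ∀ {f : Vec d → Vec d}, MemLp f 2 (volume.restrict (interior K)) → IntegrableOn f K := by
    intro K hK f hf
    have : IsFiniteMeasure (volume.restrict (interior K) : Measure (Vec d)) :=
      isFiniteMeasure_restrict.2 (hbi K hK).measure_lt_top.ne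
    have h1 := hf.integrable (by norm_num)
    rwa [M.restrict_interior hd hK] at h1
  refine ⟨hm, fun K hK j => ⟨_, hp K hK j⟩, HasTraces.of_oscDecay hd hb (fun K hK => hint K hK (hm K hK))
    fun K hK n c hn => ?_, fun j => HasTraces.of_oscDecay hd hb (fun K hK => ?_) fun K hK n c hn => ?_⟩
  · exact (OscDecay.of_hasWeakPartial isOpen_interior (M.isPolytope hd hK).convex.interior (hbi K hK) hn c (hm K hK)
      (hp K hK)).of_ae_eq_set (M.restrict_interior_eq hd hK).symm
  · exact (hint K hK (hasWeakPartial_weakPartial ⟨_, hp K hK j⟩).1).congr (M.brokenPartial_ae_eq hd hK j w).symm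
  · exact (oscDecay_weakPartial hd hb hΩ hw hε hreg hK hn c j).congr (M.isPolytope hd hK).isClosed.measurableSet
      (EventuallyEq.symm (M.ae_element_of_domain hd hΩ
        (M.brokenPartial_ae_eq_weakPartial hd hΩ (hasWeakPartial_of_mem_spaceV hw j)) hK))

/-- Near a boundary point, the exterior of `Ω` contains a set without cusp. -/
theorem exists_exterior (hd : 2 ≤ d) (ho : IsOpen Ω) (hΩ : interior (closure Ω) = Ω) {F : Set (Vec d)}
    (hF : F ∈ M.facets) (hi : F ⊆ frontier Ω) {x : Vec d} (hx : x ∈ F) (hr : x ∉ M.ridges) :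
    ∃ V b, V ⊆ Metric.closedBall x 1 ∧ Disjoint V Ω ∧ MeasurableSet V ∧ DensityBound V x b := by
  obtain ⟨ρ, hρ, hB⟩ := Metric.eventually_nhds_iff_ball.1 (M.eventually_mem_domain hd ho hΩ hF hi hx hr)
  set s := min (ρ / 2) 1 with hs
  have hs0 : 0 < s := by positivity
  -- A small half ball on the outer side; being convex with interior points, it has no cusp at `x`.
  set V := Metric.closedBall x s ∩ {y | 0 ≤ M.lev F y} with hV
  have hcl : IsClosed {y | 0 ≤ M.lev F y} := isClosed_le continuous_const (M.continuous_lev F)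
  have hconv : Convex ℝ V := by
    refine (convex_closedBall x s).inter ?_
    have : {y | 0 ≤ M.lev F y} = {y | M.offset F ≤ inner ℝ (M.normal F) y} := by
      ext y
      show 0 ≤ M.lev F y ↔ M.offset F ≤ inner ℝ (M.normal F) y
      rw [lev, sub_nonneg]
    rw [this]
    exact convex_halfSpace_ge (LinearMap.isLinear (innerSL ℝ (M.normal F)).toLinearMap) _
  have hint : (interior V).Nonempty := by
    refine ⟨x + (s / 2) • M.normal F, mem_interior.2
      ⟨Metric.ball x s ∩ {y | 0 < M.lev F y}, fun y hy => ⟨Metric.ball_subset_closedBall hy.1, (show 0 < M.lev F y from hy.2).le⟩,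
      Metric.isOpen_ball.inter (isOpen_lt continuous_const (M.continuous_lev F)), ?_, ?_⟩⟩
    · rw [Metric.mem_ball, dist_eq_norm, add_sub_cancel_left, norm_smul, M.norm_normal hF, mul_one, Real.norm_eq_abs,
        abs_of_pos (by positivity)]
      linarith
    · show 0 < M.lev F _
      rw [M.lev_add_smul hF, M.lev_eq_zero hF hx]; linarith
  obtain ⟨b, hb⟩ := volume_image_homothety_le hconv (Metric.isBounded_closedBall.subset inter_subset_left) hint
  refine ⟨V, b, inter_subset_left.trans (Metric.closedBall_subset_closedBall (min_le_right _ _)), ?_,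
    (Metric.isClosed_closedBall.inter hcl).measurableSet,
    hb x ⟨Metric.mem_closedBall_self hs0.le, (M.lev_eq_zero hF hx).ge⟩⟩
  refine disjoint_left.2 fun y hy hyΩ => ?_
  have hyρ : y ∈ Metric.ball x ρ := by
    rw [Metric.mem_ball]
    have h1 := Metric.mem_closedBall.1 hy.1
    have h2 : s ≤ ρ / 2 := min_le_left _ _
    linarith
  exact absurd ((hB y hyρ).1 hyΩ) (not_lt.2 hy.2)

theorem ave_congr {G : Type*} [NormedAddCommGroup G] [NormedSpace ℝ G] {K : Set (Vec d)}
    {w w' : Vec d → G} (h : w =ᵐ[volume.restrict K] w') (x : Vec d) : ave K w x = ave K w' x := by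
  ext1 r
  exact average_congr (ae_restrict_of_ae_restrict_of_subset inter_subset_right h)

/-- The extension by zero is in `H¹` of a large ball `U`, so at almost every point of `F` its
averages have one limit along all subsets of `U` without cusp. Both elements adjacent to an interior
facet are such subsets, so the one-sided traces agree. At a boundary facet an exterior half ball is
another one, and there the extension is zero. -/
theorem jump_ae_eq_zero (hd : 2 ≤ d) (ho : IsOpen Ω) (hb : Bornology.IsBounded Ω) (hΩ : interior (closure Ω) = Ω)
    {w : L2Vec Ω} (hw : w ∈ spaceV Ω) {F : Set (Vec d)} (hF : F ∈ M.facets) :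
    ∀ᵐ x ∂M.facetMeasure F, M.jump F w x = 0 := by
  obtain ⟨R0, hR0⟩ := hb.closure.subset_closedBall 0
  -- Room for unit balls around points of the closure, which contain the exterior half balls.
  set R := max R0 0 + 2 with hR
  set U := Metric.ball (0 : Vec d) R with hU
  have hRpos : 0 < R := by positivity
  have hclU : ∀ x ∈ closure Ω, Metric.closedBall x 1 ⊆ U := by
    intro x hx y hy
    have h1 : ‖x‖ ≤ R0 := by simpa using hR0 hx
    have h2 : ‖y - x‖ ≤ 1 := by rw [← dist_eq_norm]; exact hy
    rw [hU, mem_ball_zero_iff]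
    calc ‖y‖ = ‖x + (y - x)‖ := by congr 1; abel
      _ ≤ R0 + 1 := (norm_add_le _ _).trans (by linarith)
      _ < R := by have := le_max_left R0 0; linarith
  have hΩU : closure Ω ⊆ U := fun x hx => hclU x hx (Metric.mem_closedBall_self zero_le_one)
  set z : Vec d → Vec d := Ω.indicator w with hz
  have hzL : MemLp z 2 (volume.restrict U) := by
    refine MemLp.restrict U ?_
    rw [hz, memLp_indicator_iff_restrict ho.measurableSet]
    exact Lp.memLp w
  have hzp : ∀ j, HasWeakPartial U j z (Ω.indicator (weakPartial Ω j w)) := fun j =>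
    (hasWeakPartial_univ_of_mem_spaceV ho hb hw j).mono (subset_univ U)
  have hdec := OscDecay.of_hasWeakPartial Metric.isOpen_ball (convex_ball (0 : Vec d) R) Metric.isBounded_ball
    (M.norm_normal hF) (M.offset F) hzL hzp
  obtain ⟨a, ha⟩ := volume_image_homothety_le (convex_ball (0 : Vec d) R) Metric.isBounded_ball
    (by rw [Metric.isOpen_ball.interior_eq]; exact ⟨0, Metric.mem_ball_self hRpos⟩)
  have hFU : F ⊆ U := (M.isFacet_plus F hF).subset.trans ((M.subset_closure (M.plus_mem F hF)).trans hΩU)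
  have hae := hzL.1.ae_eq_mk
  have hfin : IsFiniteMeasure (volume.restrict U : Measure (Vec d)) :=
    isFiniteMeasure_restrict.2 Metric.isBounded_ball.measure_lt_top.ne
  have hT : TraceSetting U F (M.normal F) (M.offset F) (hzL.1.mk z) a :=
    ⟨M.norm_normal hF, measurableSet_ball, (M.isClosed_facet hd hF).measurableSet, Metric.isBounded_ball.subset hFU,
      fun x hx => sub_eq_zero.1 (M.lev_eq_zero hF hx), hzL.1.stronglyMeasurable_mk,
      (hzL.integrable (by norm_num)).congr hae, fun x hx => ha x (hFU hx), hdec.congr measurableSet_ball hae⟩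
  have hside : ∀ K ∈ M.elements, (w : Vec d → Vec d) =ᵐ[volume.restrict K] hzL.1.mk z := by
    intro K hK
    have h1 : hzL.1.mk z =ᵐ[volume.restrict (interior K)] z :=
      ae_restrict_of_ae_restrict_of_subset (interior_subset.trans ((M.subset_closure hK).trans hΩU)) hae.symm
    rw [← M.restrict_interior hd hK]
    filter_upwards [h1, ae_restrict_mem isOpen_interior.measurableSet] with y hy hyK
    rw [hy, hz, indicator_of_mem (M.interior_subset_domain hΩ hK hyK)]
  have hridge : ∀ᵐ x ∂M.facetMeasure F, x ∉ M.ridges :=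
    ae_restrict_of_ae (measure_eq_zero_iff_ae_notMem.1 (M.surf_ridges hF))
  filter_upwards [hT.ae_tendsto_ave, M.ae_facetMeasure_mem hd hF, hridge] with x hx hxF hxr
  obtain ⟨T, hTx⟩ := hx
  have htr : ∀ K, M.IsSide F K → trace K w x = T := by
    intro K hK
    have hKm := hK.mem hF
    obtain ⟨b, hb'⟩ := M.exists_densityBound hd hb hKm
    rw [trace_congr (hside K hKm)]
    exact (hTx K ((M.subset_closure hKm).trans hΩU) b (hb' x (hK.subset hF hxF))).limUnder_eq
  by_cases hi : F ⊆ frontier Ω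
  · rw [jump, if_pos hi, htr _ (Or.inl rfl)]
    obtain ⟨V, b, hV1, hV2, hVm, hVb⟩ := M.exists_exterior hd ho hΩ hF hi hxF hxr
    have hVU : V ⊆ U := hV1.trans (hclU x (M.subset_closure (M.plus_mem F hF) ((M.isFacet_plus F hF).subset hxF)))
    have h0 : hzL.1.mk z =ᵐ[volume.restrict V] fun _ => 0 := by
      filter_upwards [ae_restrict_of_ae_restrict_of_subset hVU hae.symm, ae_restrict_mem hVm] with y hy hyV
      rw [hy, hz, indicator_of_notMem (disjoint_left.1 hV2 hyV)]
    have h1 := hTx V hVU b hVb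
    rw [ave_congr h0 x] at h1
    refine tendsto_nhds_unique h1 (tendsto_const_nhds.congr fun r => ?_)
    simp [ave, average]
  · rw [jump, if_neg hi, htr _ (Or.inl rfl), htr _ (Or.inr ⟨hi, rfl⟩), sub_self]

end Mesh
end Continuous

/-! ### Consistency with solenoidal piecewise smooth test fields -/

section Consistency
variable {d : ℕ}
namespace Mesh
variable {kind : MeshKind} {Ω : Set (Vec d)} {M : Mesh kind Ω}

theorem measurableSet_domain (M : Mesh kind Ω) (hΩ : interior (closure Ω) = Ω) : MeasurableSet Ω := by
  rw [← hΩ]; exact isOpen_interior.measurableSet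

/-- The broken divergence of a weakly solenoidal piecewise smooth field vanishes. -/
theorem PiecewiseSmooth.ae_div_eq_zero {v : Vec d → Vec d} {q : Set (Vec d) → Vec d → Vec d}
    (h : M.PiecewiseSmooth v q) (hd : 2 ≤ d) (hb : Bornology.IsBounded Ω) (hΩ : interior (closure Ω) = Ω)
    (hsol : ∀ φ : Vec d → ℝ, IsTest Ω φ → ∫ y in Ω, fderiv ℝ φ y (v y) = 0) :
    ∀ᵐ y ∂volume.restrict Ω, ∑ j, inner ℝ (unitVec j) (M.brokenPartial j v y) = 0 := by
  refine M.ae_domain_of_elements fun K hK => ?_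
  set D : Fin d → Vec d → Vec d := fun j y => fderiv ℝ (q K) y (unitVec j) with hDdef
  have hDc : ∀ j, Continuous (D j) := fun j => ((h.brokenPartial hd hb j).contDiff K hK).continuous
  have hD := fun j => h.hasWeakPartial hd hb hK j
  have hKΩ := M.interior_subset_domain hΩ hK
  have hdc : Continuous fun y => ∑ j, (inner ℝ (unitVec j) (D j y) : ℝ) := by fun_prop
  have hbi : Bornology.IsBounded (interior K) := (M.isBounded hb hK).subset interior_subset
  have hfin : IsFiniteMeasure (volume.restrict (interior K) : Measure (Vec d)) :=
    isFiniteMeasure_restrict.2 hbi.measure_lt_top.ne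
  have hvL : MemLp v 2 (volume.restrict (interior K)) := (h.isRegular hd hb).memLp K hK
  have key : (fun y => ∑ j, (inner ℝ (unitVec j) (D j y) : ℝ)) =ᵐ[volume.restrict (interior K)] fun _ => (0 : ℝ) := by
    refine ae_eq_of_forall_isTest isOpen_interior (hdc.locallyIntegrable.locallyIntegrableOn _)
      ((continuous_const (y := (0 : ℝ))).locallyIntegrable.locallyIntegrableOn _) fun ψ hψ => ?_
    have hi1 : ∀ j, IntegrableOn (fun y => ψ y • D j y) (interior K) := fun j =>
      ((hψ.continuous.smul (hDc j)).continuousOn.integrableOn_compact hbi.isCompact_closure).mono_set _root_.subset_closure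
    have hi2 : ∀ j, IntegrableOn (fun y => fderiv ℝ ψ y (unitVec j) • v y) (interior K) := fun j => by
      obtain ⟨C, _, hC⟩ := (hψ.fderiv_apply' (unitVec j)).exists_bound
      exact (hvL.integrable (by norm_num)).bdd_smul C (hψ.fderiv_apply' (unitVec j)).continuous.aestronglyMeasurable
        (Eventually.of_forall hC)
    have e1 : ∫ y in interior K, fderiv ℝ ψ y (v y) = 0 := by
      rw [← hsol ψ (hψ.mono hKΩ)]
      rw [← setIntegral_eq_of_subset_of_forall_sdiff_eq_zero (M.measurableSet_domain hΩ) hKΩ]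
      intro y hy
      have h0 : fderiv ℝ ψ y = 0 := image_eq_zero_of_notMem_tsupport
        fun hc => hy.2 (hψ.2.2 (tsupport_fderiv_subset ℝ hc))
      rw [h0]; rfl
    have e2 : ∫ y in interior K, fderiv ℝ ψ y (v y) =
        ∑ j, inner ℝ (unitVec j) (∫ y in interior K, fderiv ℝ ψ y (unitVec j) • v y) := by
      simp_rw [← integral_inner (hi2 _)]
      rw [← integral_finsetSum _ fun j _ => (hi2 j).const_inner (unitVec j)]
      refine integral_congr_ae (Eventually.of_forall fun y => ?_)
      simp only [inner_smul_right]
      rw [fderiv_apply_eq_sum]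
      refine Finset.sum_congr rfl fun j _ => ?_
      rw [real_inner_comm, inner_unitVec, mul_comm]
    have e3 : ∫ y in interior K, ψ y • ∑ j, (inner ℝ (unitVec j) (D j y) : ℝ) =
        ∑ j, inner ℝ (unitVec j) (∫ y in interior K, ψ y • D j y) := by
      simp_rw [← integral_inner (hi1 _)]
      rw [← integral_finsetSum _ fun j _ => (hi1 j).const_inner (unitVec j)]
      refine integral_congr_ae (Eventually.of_forall fun y => ?_)
      simp only [inner_smul_right, smul_eq_mul, Finset.mul_sum]
    rw [e3]
    simp only [smul_zero, integral_zero]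
    rw [e1] at e2
    have e4 : ∀ j, ∫ y in interior K, fderiv ℝ ψ y (unitVec j) • v y = - ∫ y in interior K, ψ y • D j y := fun j =>
      (hD j).2 ψ hψ
    simp only [e4, inner_neg_right, Finset.sum_neg_distrib] at e2
    linarith
  rw [M.restrict_interior hd hK] at key
  filter_upwards [key, ae_all_iff.2 fun j => (h.brokenPartial hd hb j).ae_eq K hK] with y hy hy2
  simp only [hy2]
  exact hy

/-- Consistency: a weak solution, tested with a solenoidal piecewise smooth field. -/
theorem consistency (hd : 2 ≤ d) (ho : IsOpen Ω) (hb : Bornology.IsBounded Ω) (hΩ : interior (closure Ω) = Ω)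
    {w : L2Vec Ω} (hw : w ∈ spaceV Ω) {ε : ℝ} (hε : 0 < ε) (hreg : M.brokenSobolevSq (3 / 2 + ε) w < ⊤)
    {v : Vec d → Vec d} {q : Set (Vec d) → Vec d → Vec d} (hv : M.PiecewiseSmooth v q)
    (hsol : ∀ φ : Vec d → ℝ, IsTest univ φ → ∫ y in Ω, fderiv ℝ φ y (v y) = 0)
    {p : Vec d → ℝ} (hp : MemLp p 2 (volume.restrict Ω)) {G : Vec d → Vec d} (hG : MemLp G 2 (volume.restrict Ω))
    (hE : ∀ φ : Vec d → Vec d, IsTest Ω φ →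
      ∫ y in Ω, formDensity (fun j y => weakPartial Ω j w y - p y • unitVec j) G φ y = 0) :
    (∫ x in Ω, ∑ j, inner ℝ (M.brokenPartial j w x) (M.brokenPartial j v x)) + (∫ x in Ω, inner ℝ (G x) (v x)) =
      ∑ F ∈ M.facets, facetInt F fun x => inner ℝ (M.avgNormalDeriv F w x) (M.jump F v x) := by
  have hfin : IsFiniteMeasure (volume.restrict Ω : Measure (Vec d)) :=
    isFiniteMeasure_restrict.2 hb.measure_lt_top.ne
  have hwp := fun j => hasWeakPartial_of_mem_spaceV hw j
  -- Strongly measurable representatives, as the trace theory requires; the forms do not notice the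
  -- change.
  set g : Fin d → Vec d → Vec d := fun j => (hwp j).1.1.mk _ with hgdef
  have hg : ∀ j, weakPartial Ω j w =ᵐ[volume.restrict Ω] g j := fun j => (hwp j).1.1.ae_eq_mk
  have hgL : ∀ j, MemLp (g j) 2 (volume.restrict Ω) := fun j => (hwp j).1.ae_eq (hg j)
  have hgb : ∀ j, M.brokenPartial j w =ᵐ[volume.restrict Ω] g j := fun j =>
    (M.brokenPartial_ae_eq_weakPartial hd hΩ (hwp j)).trans (hg j)
  have hside : ∀ F ∈ M.facets, ∀ K, M.IsSide F K → ∃ a, ∀ j,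
      TraceSetting K F (M.normal F) (M.offset F) (g j) a := by
    intro F hF K hK
    have hKm := hK.mem hF
    obtain ⟨a, ha⟩ := M.exists_traceSetting hd hb hKm hF (hK.subset hF)
    refine ⟨a, fun j => ha (g j) (hwp j).1.1.stronglyMeasurable_mk ?_ ?_⟩
    · have h1 : IntegrableOn (g j) (interior K) :=
        IntegrableOn.mono_set ((hgL j).integrable (by norm_num)) (M.interior_subset_domain hΩ hKm)
      unfold IntegrableOn at h1 ⊢
      rwa [M.restrict_interior hd hKm] at h1
    · exact (oscDecay_weakPartial hd hb hΩ hw hε hreg hKm (M.norm_normal hF) _ j).congr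
        (M.isPolytope hd hKm).isClosed.measurableSet (M.ae_element_of_domain hd hΩ (hg j) hKm)
  have hB : Balance M v q g p G :=
    { contDiff := hv.contDiff
      ae_eq := hv.ae_eq
      solenoidal := hsol
      memLp_v := hv.memLp_top hd hb
      memLp_g := hgL
      memLp_p := hp
      memLp_G := hG
      balance := fun φ hφ => by
        rw [← hE φ hφ]
        refine integral_congr_ae ?_
        filter_upwards [ae_all_iff.2 hg] with y hy
        simp only [formDensity, hy]
      trace_plus := fun F hF => hside F hF _ (Or.inl rfl)
      trace_minus := fun F hF hi => hside F hF _ (Or.inr ⟨hi, rfl⟩) }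
  have hmain := hB.integral_source_eq hd ho hb hΩ (D := fun j => M.brokenPartial j v)
    (fun K hK j => (hv.brokenPartial hd hb j).ae_eq K hK) (fun j => (hv.brokenPartial hd hb j).memLp_top hd hb)
  have e1 : ∫ y in Ω, Balance.source v (fun j => M.brokenPartial j v) g p G y =
      (∫ x in Ω, ∑ j, inner ℝ (M.brokenPartial j w x) (M.brokenPartial j v x)) + ∫ x in Ω, inner ℝ (G x) (v x) := by
    rw [← integral_add]
    -- The pressure part of the source is `p` times the broken divergence of `v`, which vanishes
    -- almost everywhere.
    · refine integral_congr_ae ?_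
      filter_upwards [ae_all_iff.2 hgb, hv.ae_div_eq_zero hd hb hΩ fun φ hφ => hsol φ (hφ.mono (subset_univ _))]
        with y hy hy2
      simp only [Balance.source, Balance.stress, inner_sub_left, inner_smul_left, RCLike.conj_to_real,
        Finset.sum_sub_distrib, ← Finset.mul_sum, hy2, hy, mul_zero, sub_zero]
    · refine Integrable.congr (f := fun x => ∑ j, (inner ℝ (g j x) (M.brokenPartial j v x) : ℝ)) ?_ ?_
      · exact integrable_finsetSum _ fun j _ => ((hgL j).inner_of_top
          ((hv.brokenPartial hd hb j).memLp_top hd hb)).integrable (by norm_num)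
      · filter_upwards [ae_all_iff.2 hgb] with y hy
        simp only [hy]
    · exact (hG.inner_of_top (hv.memLp_top hd hb)).integrable (by norm_num)
  have e2 : ∀ F ∈ M.facets, ∫ y in F, Balance.facetFlux M v g F y ∂(surf (M.normal F) (M.offset F)) =
      - facetInt F fun x => inner ℝ (M.avgNormalDeriv F w x) (M.jump F v x) := by
    intro F hF
    rw [M.facetInt_eq hd hF, facetMeasure, ← integral_neg]
    refine integral_congr_ae (Eventually.of_forall fun x => ?_)
    simp only [Balance.facetFlux, avgNormalDeriv, sum_inner, inner_smul_left, inner_smul_right, RCLike.conj_to_real]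
    congr 1
    refine Finset.sum_congr rfl fun j _ => ?_
    rw [M.avg_congr (fun K hK => M.ae_element_of_domain hd hΩ (hgb j) hK) hF x]
  rw [e1, Finset.sum_congr rfl e2, Finset.sum_neg_distrib] at hmain
  linarith

end Mesh
end Consistency

/-! ### Discrete velocities: smoothness and exact solenoidality -/

section Discrete
variable {d : ℕ}

theorem contDiff_mvPolynomial_eval (P : MvPolynomial (Fin d) ℝ) :
    ContDiff ℝ ∞ fun x : Vec d => MvPolynomial.eval (fun j => x j) P := by
  induction P using MvPolynomial.induction_on with
  | C a => simpa using contDiff_const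
  | add P Q hP hQ => simpa using hP.add hQ
  | mul_X P i hP =>
    have hi : ContDiff ℝ ∞ fun x : Vec d => x i := contDiff_euclidean.1 contDiff_id i
    simpa using hP.mul hi

theorem HasWeakDiv.ae_eq {Ω : Set (Vec d)} (ho : IsOpen Ω) (hb : Bornology.IsBounded Ω) {w : Vec d → Vec d}
    {g g' : Vec d → ℝ} (h : HasWeakDiv Ω w g) (h' : HasWeakDiv Ω w g') : g =ᵐ[volume.restrict Ω] g' := by
  have hfin : IsFiniteMeasure (volume.restrict Ω : Measure (Vec d)) :=
    isFiniteMeasure_restrict.2 hb.measure_lt_top.ne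
  refine ae_eq_of_forall_isTest ho (IntegrableOn.locallyIntegrableOn (h.1.integrable (by norm_num)))
    (IntegrableOn.locallyIntegrableOn (h'.1.integrable (by norm_num))) fun φ hφ => ?_
  have h1 := h.2 φ hφ
  have h2 := h'.2 φ hφ
  simp only [smul_eq_mul]
  linarith

theorem HasWeakDiv.weakDiv_ae {Ω : Set (Vec d)} (ho : IsOpen Ω) (hb : Bornology.IsBounded Ω) {w : Vec d → Vec d}
    {g : Vec d → ℝ} (h : HasWeakDiv Ω w g) : weakDiv Ω w =ᵐ[volume.restrict Ω] g := by
  have he : ∃ g, HasWeakDiv Ω w g := ⟨g, h⟩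
  unfold weakDiv
  rw [dif_pos he]
  exact he.choose_spec.ae_eq ho hb h

theorem IsTest.hasWeakDiv {Ω : Set (Vec d)} {φ : Vec d → Vec d} (hφ : IsTest Ω φ) :
    HasWeakDiv Ω φ fun y => ∑ j, inner ℝ (unitVec j) (fderiv ℝ φ y (unitVec j)) := by
  have hp : ∀ j, HasWeakPartial Ω j φ fun y => fderiv ℝ φ y (unitVec j) := fun j =>
    hasWeakPartial_of_contDiff (hφ.1.of_le (by simp)) (((hφ.fderiv_apply (unitVec j)).continuous.memLp_of_hasCompactSupport
      (hφ.fderiv_apply (unitVec j)).2.1).restrict Ω)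
  refine ⟨memLp_finsetSum _ fun j _ => (MemLp.const_inner (unitVec j) (hp j).1), fun ψ hψ => ?_⟩
  have hφc : Integrable φ (volume.restrict Ω) := (hφ.continuous.integrable_of_hasCompactSupport hφ.2.1).restrict
  have hi2 : ∀ j, IntegrableOn (fun y => fderiv ℝ ψ y (unitVec j) • φ y) Ω := fun j => by
    obtain ⟨C, _, hC⟩ := (hψ.fderiv_apply' (unitVec j)).exists_bound
    exact hφc.bdd_smul C (hψ.fderiv_apply' (unitVec j)).continuous.aestronglyMeasurable (Eventually.of_forall hC)
  have hi1 : ∀ j, IntegrableOn (fun y => ψ y • fderiv ℝ φ y (unitVec j)) Ω := fun j => by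
    obtain ⟨C, _, hC⟩ := hψ.exists_bound
    have : Integrable (fun y => fderiv ℝ φ y (unitVec j)) (volume.restrict Ω) :=
      ((hφ.fderiv_apply (unitVec j)).continuous.integrable_of_hasCompactSupport (hφ.fderiv_apply (unitVec j)).2.1).restrict
    exact this.bdd_smul C hψ.continuous.aestronglyMeasurable (Eventually.of_forall hC)
  have e2 : ∫ y in Ω, fderiv ℝ ψ y (φ y) =
      ∑ j, inner ℝ (unitVec j) (∫ y in Ω, fderiv ℝ ψ y (unitVec j) • φ y) := by
    simp_rw [← integral_inner (hi2 _)]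
    rw [← integral_finsetSum _ fun j _ => (hi2 j).const_inner (unitVec j)]
    refine integral_congr_ae (Eventually.of_forall fun y => ?_)
    simp only [inner_smul_right]
    rw [fderiv_apply_eq_sum]
    refine Finset.sum_congr rfl fun j _ => ?_
    rw [real_inner_comm, inner_unitVec, mul_comm]
  have e3 : ∫ y in Ω, ψ y * ∑ j, (inner ℝ (unitVec j) (fderiv ℝ φ y (unitVec j)) : ℝ) =
      ∑ j, inner ℝ (unitVec j) (∫ y in Ω, ψ y • fderiv ℝ φ y (unitVec j)) := by
    simp_rw [← integral_inner (hi1 _)]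
    rw [← integral_finsetSum _ fun j _ => (hi1 j).const_inner (unitVec j)]
    refine integral_congr_ae (Eventually.of_forall fun y => ?_)
    simp only [inner_smul_right, Finset.mul_sum]
  rw [e2, e3, ← Finset.sum_neg_distrib]
  exact Finset.sum_congr rfl fun j _ => by rw [(hp j).2 ψ hψ, inner_neg_right]

theorem IsTest.weakPartial_ae {Ω : Set (Vec d)} (ho : IsOpen Ω) {φ : Vec d → Vec d} (hφ : IsTest Ω φ) (j : Fin d) :
    weakPartial Ω j φ =ᵐ[volume.restrict Ω] fun y => fderiv ℝ φ y (unitVec j) :=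
  (hasWeakPartial_of_contDiff (hφ.1.of_le (by simp)) (((hφ.fderiv_apply (unitVec j)).continuous.memLp_of_hasCompactSupport
      (hφ.fderiv_apply (unitVec j)).2.1).restrict Ω)).weakPartial_ae ho

theorem IsTest.toLp_mem_spaceV {Ω : Set (Vec d)} (ho : IsOpen Ω) {φ : Vec d → Vec d} (hφ : IsTest Ω φ) :
    (hφ.memLp 2 (volume.restrict Ω)).toLp φ ∈ spaceV Ω := by
  have hp : ∀ j, HasWeakPartial Ω j φ fun y => fderiv ℝ φ y (unitVec j) := fun j =>
    hasWeakPartial_of_contDiff (hφ.1.of_le (by simp)) ((hφ.fderiv_apply (unitVec j)).memLp 2 _)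
  have hcoe := (hφ.memLp 2 (volume.restrict Ω)).coeFn_toLp
  constructor
  · rw [sobolevSq, sobolevAuxSq_congr ho _ hcoe, ← sobolevSq, sobolevSq_one, if_pos fun j => ⟨_, hp j⟩]
    refine ENNReal.add_lt_top.2 ⟨ENNReal.pow_lt_top (hφ.memLp 2 (volume.restrict Ω)).2, ENNReal.sum_lt_top.2 fun j _ => ?_⟩
    exact ENNReal.pow_lt_top (hasWeakPartial_weakPartial ⟨_, hp j⟩).1.2
  · intro δ hδ
    refine ⟨φ, hφ, ?_⟩
    have h0 : (fun x => (hφ.memLp 2 (volume.restrict Ω)).toLp φ x - φ x) =ᵐ[volume.restrict Ω] fun _ => (0 : Vec d) := by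
      filter_upwards [hcoe] with x hx
      rw [hx, sub_self]
    have hz : ∀ j, HasWeakPartial Ω j (fun _ : Vec d => (0 : Vec d)) fun _ => 0 := fun j =>
      ⟨MemLp.zero, fun ψ _ => by simp⟩
    rw [sobolevSq, sobolevAuxSq_congr ho _ h0, ← sobolevSq, sobolevSq_one, if_pos fun j => ⟨_, hz j⟩]
    have hz' : ∀ j, eLpNorm (weakPartial Ω j fun _ : Vec d => (0 : Vec d)) 2 (volume.restrict Ω) = 0 := fun j => by
      rw [eLpNorm_congr_ae ((hz j).weakPartial_ae ho)]; simp
    simp [hz', hδ]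

namespace Mesh
variable {kind : MeshKind} {Ω : Set (Vec d)} {M : Mesh kind Ω}

theorem exists_piecewiseSmooth (hd : 2 ≤ d) {Vk : Set (Vec d) → Submodule ℝ (Vec d → Vec d)}
    (hVk : M.IsLocalVelocity Vk) {v : L2Vec Ω} (hv : v ∈ M.spaceVh Vk) : ∃ q, M.PiecewiseSmooth v q := by
  choose! q hq hvq using hv.2.1
  refine ⟨q, fun K hK => ?_, fun K hK => ?_⟩
  · obtain ⟨N, hN⟩ := hVk K hK
    obtain ⟨P, -, hP⟩ := hN (q K) (hq K hK)
    rw [contDiff_euclidean]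
    intro i
    rw [show (fun x => q K x i) = fun x => MvPolynomial.eval (fun j => x j) (P i) from funext fun x => hP x i]
    exact contDiff_mvPolynomial_eval (P i)
  · rw [← M.restrict_interior hd hK]
    exact hvq K hK

theorem zero_mem_spaceQh (hΩ : interior (closure Ω) = Ω) (ℓ : ℕ) : (0 : L2Scal Ω) ∈ M.spaceQh ℓ := by
  have h0 : ⇑(0 : L2Scal Ω) =ᵐ[volume.restrict Ω] fun _ => (0 : ℝ) := Lp.coeFn_zero _ _ _
  constructor
  · show ∫ x in Ω, (0 : L2Scal Ω) x = 0
    rw [integral_congr_ae h0]; simp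
  · intro K hK
    obtain ⟨A, hA⟩ := M.isElement K hK
    refine ⟨fun _ => 0, ⟨A, hA, 0, ?_, fun x => by simp⟩, ?_⟩
    · cases kind <;> simp [MeshKind.DegreeLE]
    · exact ae_restrict_of_ae_restrict_of_subset (M.interior_subset_domain hΩ hK) h0

/-- By divergence conformity the divergence is itself an admissible `q` in `Q_h`; testing with it
shows that its square integrates to zero. -/
theorem weakDiv_ae_eq_zero (ho : IsOpen Ω) (hb : Bornology.IsBounded Ω)
    {Vk : Set (Vec d) → Submodule ℝ (Vec d → Vec d)} {ℓ : ℕ} (hconf : M.DivergenceConforming Vk ℓ)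
    {v : L2Vec Ω} (hv : v ∈ M.spaceVhDiv Vk ℓ) : weakDiv Ω v =ᵐ[volume.restrict Ω] fun _ => (0 : ℝ) := by
  obtain ⟨q, hq, hqd⟩ := hconf v hv.1
  have h1 := hqd.weakDiv_ae ho hb
  have h2 := hv.2 q hq
  unfold formB at h2
  have h3 : ∫ x in Ω, q x * q x = 0 := by
    rw [← neg_eq_zero, ← h2]
    congr 1
    refine integral_congr_ae ?_
    filter_upwards [h1] with x hx
    rw [hx]
  have h4 := (integral_eq_zero_iff_of_nonneg (fun x => mul_self_nonneg _) ((Lp.memLp q).integrable_mul (Lp.memLp q))).1 h3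
  filter_upwards [h1, h4] with x hx hx2
  rw [hx]
  exact mul_self_eq_zero.1 hx2

/-- Green's formula from the vanishing normal trace, with divergence zero. The test functions are
not required to vanish on the boundary, which encodes `v · n = 0` there. -/
theorem solenoidal (ho : IsOpen Ω) (hb : Bornology.IsBounded Ω)
    {Vk : Set (Vec d) → Submodule ℝ (Vec d → Vec d)} {ℓ : ℕ} (hconf : M.DivergenceConforming Vk ℓ)
    {v : L2Vec Ω} (hv : v ∈ M.spaceVhDiv Vk ℓ) (φ : Vec d → ℝ) (hφ : IsTest univ φ) :
    ∫ y in Ω, fderiv ℝ φ y (v y) = 0 := by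
  have h := hv.1.2.2 φ hφ
  have h0 : ∫ x in Ω, weakDiv Ω v x * φ x = 0 := by
    refine integral_eq_zero_of_ae ?_
    filter_upwards [weakDiv_ae_eq_zero ho hb hconf hv] with x hx
    rw [hx, zero_mul]; rfl
  linarith

theorem formB_eq_zero (ho : IsOpen Ω) (hb : Bornology.IsBounded Ω)
    {Vk : Set (Vec d) → Submodule ℝ (Vec d → Vec d)} {ℓ : ℕ} (hconf : M.DivergenceConforming Vk ℓ)
    {v : L2Vec Ω} (hv : v ∈ M.spaceVhDiv Vk ℓ) (r : Vec d → ℝ) : formB Ω v r = 0 := by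
  unfold formB
  rw [neg_eq_zero]
  refine integral_eq_zero_of_ae ?_
  filter_upwards [weakDiv_ae_eq_zero ho hb hconf hv] with x hx
  rw [hx, mul_zero]; rfl

end Mesh

theorem formB_zero {Ω : Set (Vec d)} (w : Vec d → Vec d) : formB Ω w (0 : L2Scal Ω) = 0 := by
  unfold formB
  rw [neg_eq_zero]
  refine integral_eq_zero_of_ae ?_
  filter_upwards [Lp.coeFn_zero ℝ 2 (volume.restrict Ω)] with x hx
  rw [hx]; simp

end Discrete

/-! ### Linearity of the weak time derivative -/

section TimeDerivative
variable {X : Type*} [NormedAddCommGroup X] [NormedSpace ℝ X] [CompleteSpace X]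

theorem HasWeakTimeDeriv.timeDeriv_ae {T : ℝ} {u u' : ℝ → X} (h : HasWeakTimeDeriv T u u') :
    timeDeriv T u =ᵐ[volume.restrict (Ioo 0 T)] u' := by
  have he : ∃ u', HasWeakTimeDeriv T u u' := ⟨u', h⟩
  have hs : HasWeakTimeDeriv T u (timeDeriv T u) := by
    unfold timeDeriv
    rw [dif_pos he]
    exact he.choose_spec
  have hfin : IsFiniteMeasure (volume.restrict (Ioo 0 T)) := isFiniteMeasure_restrict.2 (by simp)
  refine ae_eq_of_forall_isTest isOpen_Ioo (IntegrableOn.locallyIntegrableOn (hs.1.integrable (by norm_num)))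
    (IntegrableOn.locallyIntegrableOn (h.1.integrable (by norm_num))) fun φ hφ => ?_
  exact neg_injective ((hs.2 φ hφ).symm.trans (h.2 φ hφ))

theorem HasWeakTimeDeriv.sub {T : ℝ} {u u' w w' : ℝ → X} (h : HasWeakTimeDeriv T u u') (h' : HasWeakTimeDeriv T w w')
    (hu : MemLp u 2 (volume.restrict (Ioo 0 T))) (hw : MemLp w 2 (volume.restrict (Ioo 0 T))) :
    HasWeakTimeDeriv T (u - w) (u' - w') := by
  have hfin : IsFiniteMeasure (volume.restrict (Ioo 0 T)) := isFiniteMeasure_restrict.2 (by simp)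
  refine ⟨h.1.sub h'.1, fun φ hφ => ?_⟩
  have hb : ∀ {ψ : ℝ → ℝ}, Continuous ψ → HasCompactSupport ψ → ∀ {z : ℝ → X}, MemLp z 2 (volume.restrict (Ioo 0 T)) →
      Integrable (fun t => ψ t • z t) (volume.restrict (Ioo 0 T)) := by
    intro ψ hψ hψs z hz
    obtain ⟨C, hC⟩ := hψs.exists_bound_of_continuous hψ
    exact (hz.integrable (by norm_num)).bdd_smul C hψ.aestronglyMeasurable (Eventually.of_forall hC)
  have hdc : Continuous (deriv φ) := hφ.1.continuous_deriv (by simp)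
  simp only [Pi.sub_apply, smul_sub]
  rw [integral_sub (hb hdc hφ.2.1.deriv hu) (hb hdc hφ.2.1.deriv hw),
    integral_sub (hb hφ.continuous hφ.2.1 h.1) (hb hφ.continuous hφ.2.1 h'.1), h.2 φ hφ, h'.2 φ hφ]
  abel

theorem timeDeriv_sub_ae {T : ℝ} {u w : ℝ → X} (h : ∃ u', HasWeakTimeDeriv T u u') (h' : ∃ w', HasWeakTimeDeriv T w w')
    (hu : MemLp u 2 (volume.restrict (Ioo 0 T))) (hw : MemLp w 2 (volume.restrict (Ioo 0 T))) :
    ∀ᵐ t ∂volume.restrict (Ioo 0 T), timeDeriv T (u - w) t = timeDeriv T u t - timeDeriv T w t := by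
  obtain ⟨u', hu'⟩ := h
  obtain ⟨w', hw'⟩ := h'
  filter_upwards [hu'.timeDeriv_ae, hw'.timeDeriv_ae, (hu'.sub hw' hu hw).timeDeriv_ae] with t h1 h2 h3
  rw [h1, h2, h3, Pi.sub_apply]

theorem memLp_of_mem_spaceVT {d : ℕ} {Ω : Set (Vec d)} {T : ℝ} {u : ℝ → L2Vec Ω} (h : u ∈ spaceVT Ω T) :
    MemLp u 2 (volume.restrict (Ioo 0 T)) := by
  refine ⟨h.1.1, (eLpNorm_lt_top_iff_lintegral_rpow_enorm_lt_top (by norm_num) (by norm_num)).2 ?_⟩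
  refine lt_of_le_of_lt (lintegral_mono fun t => ?_) h.1.2
  have := eLpNorm_sq_le_sobolevSq_one Ω (u t)
  rw [← Lp.enorm_def] at this
  simpa using this

end TimeDerivative

/-! ### From the Oseen equation to the momentum balance at almost every time -/

section WeakForm
variable {d : ℕ}

/-- Exhibits the weak form as a continuous function of the pair of the test field and its gradient
in `L²`, the form in which separability can be exploited. -/
theorem IsTest.integral_formDensity_eq {Ω : Set (Vec d)} {φ : Vec d → Vec d} (hφ : IsTest Ω φ)
    {σ : Fin d → Vec d → Vec d} {G : Vec d → Vec d} (hσ : ∀ j, MemLp (σ j) 2 (volume.restrict Ω))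
    (hG : MemLp G 2 (volume.restrict Ω)) :
    ∫ y in Ω, formDensity σ G φ y =
      (∑ j, inner ℝ ((hσ j).toLp (σ j)) ((hφ.memLp_fderiv_apply (unitVec j) 2 (volume.restrict Ω)).toLp _)) +
        inner ℝ (hG.toLp G) ((hφ.memLp 2 (volume.restrict Ω)).toLp φ) := by
  simp only [L2.inner_def]
  rw [← integral_finsetSum _ fun j _ => L2.integrable_inner _ _,
    ← integral_add (integrable_finsetSum _ fun j _ => L2.integrable_inner _ _) (L2.integrable_inner _ _)]
  refine integral_congr_ae ?_
  filter_upwards [ae_all_iff.2 fun j => (hσ j).coeFn_toLp, hG.coeFn_toLp,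
    (hφ.memLp 2 (volume.restrict Ω)).coeFn_toLp,
    ae_all_iff.2 fun j => (hφ.memLp_fderiv_apply (unitVec j) 2 (volume.restrict Ω)).coeFn_toLp] with y h1 h2 h3 h4
  simp only [formDensity, h1, h2, h3, h4]

/-- With the topology induced by `J`, the set `X` is second countable, hence separable; a continuous
function that vanishes on a dense subset vanishes. -/
theorem exists_countable_forall_eq_zero {X Y : Type*} [TopologicalSpace Y] [SecondCountableTopology Y] (J : X → Y) :
    ∃ s : Set X, s.Countable ∧ ∀ Λ : Y → ℝ, Continuous Λ → (∀ x ∈ s, Λ (J x) = 0) → ∀ x, Λ (J x) = 0 := by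
  let : TopologicalSpace X := TopologicalSpace.induced J inferInstance
  have hJ : IsInducing J := ⟨rfl⟩
  have : SecondCountableTopology X := hJ.secondCountableTopology
  obtain ⟨s, hs, hsd⟩ := TopologicalSpace.exists_countable_dense X
  refine ⟨s, hs, fun Λ hΛ h x => ?_⟩
  have hc : IsClosed {x : X | Λ (J x) = 0} := isClosed_eq (hΛ.comp hJ.continuous) continuous_const
  exact hc.closure_subset_iff.2 h (hsd x)

theorem continuous_sum_inner {H : Type*} [NormedAddCommGroup H] [InnerProductSpace ℝ H] (a : Fin d → H) (b : H) :
    Continuous fun z : H × (Fin d → H) => (∑ j, (inner ℝ (a j) (z.2 j) : ℝ)) + inner ℝ b z.1 := by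
  fun_prop

/-- Countably many test functions suffice in a weak formulation of second order. -/
theorem exists_countable_tests (Ω : Set (Vec d)) : ∃ C : Set (Vec d → Vec d), C.Countable ∧ (∀ φ ∈ C, IsTest Ω φ) ∧
    ∀ (σ : Fin d → Vec d → Vec d) (G : Vec d → Vec d), (∀ j, MemLp (σ j) 2 (volume.restrict Ω)) →
      MemLp G 2 (volume.restrict Ω) → (∀ φ ∈ C, ∫ y in Ω, formDensity σ G φ y = 0) →
      ∀ φ, IsTest Ω φ → ∫ y in Ω, formDensity σ G φ y = 0 := by
  have : SecondCountableTopology (L2Vec Ω) := UniformSpace.secondCountable_of_separable _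
  obtain ⟨s, hs, h⟩ := exists_countable_forall_eq_zero (X := {φ : Vec d → Vec d // IsTest Ω φ})
    (Y := L2Vec Ω × (Fin d → L2Vec Ω)) fun φ => ((φ.2.memLp 2 (volume.restrict Ω)).toLp _,
      fun j => (φ.2.memLp_fderiv_apply (unitVec j) 2 (volume.restrict Ω)).toLp _)
  refine ⟨Subtype.val '' s, hs.image _, ?_, fun σ G hσ hG h0 φ hφ => ?_⟩
  · rintro _ ⟨φ, -, rfl⟩
    exact φ.2
  · rw [hφ.integral_formDensity_eq hσ hG]
    refine h _ (continuous_sum_inner (fun j => (hσ j).toLp (σ j)) (hG.toLp G)) (fun φ hφs => ?_) ⟨φ, hφ⟩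
    have := h0 φ ⟨φ, hφs, rfl⟩
    rwa [φ.2.integral_formDensity_eq hσ hG] at this

/-- Dividing the equation with `q = 0` by `ν` gives a balance whose stress is the plain gradient
minus the rescaled pressure. Time derivative, force and convection are all in `L²` and go into the
source. -/
theorem integral_formDensity_of_weak_equation {Ω : Set (Vec d)} (ho : IsOpen Ω) (hb : Bornology.IsBounded Ω)
    {ν : ℝ} (hν : 0 < ν) {w : L2Vec Ω} (hw : w ∈ spaceV Ω) {b : Vec d → Vec d} (hbt : MemLp b ⊤ (volume.restrict Ω))
    (p : L2Scal Ω) (A g : L2Vec Ω) {φ : Vec d → Vec d} (hφ : IsTest Ω φ)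
    (h : inner ℝ A ((hφ.memLp 2 (volume.restrict Ω)).toLp φ) + ν * formA Ω w ((hφ.memLp 2 (volume.restrict Ω)).toLp φ)
      + formC Ω b w ((hφ.memLp 2 (volume.restrict Ω)).toLp φ) + formB Ω ((hφ.memLp 2 (volume.restrict Ω)).toLp φ) p
      - formB Ω w (0 : L2Scal Ω) = inner ℝ g ((hφ.memLp 2 (volume.restrict Ω)).toLp φ)) :
    ∫ y in Ω, formDensity (fun j y => weakPartial Ω j w y - (ν⁻¹ * p y) • unitVec j)
      (fun y => ν⁻¹ • (A y - g y + ∑ j, b y j • weakPartial Ω j w y)) φ y = 0 := by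
  have hwp := fun j => OseenHdiv.Mesh.hasWeakPartial_of_mem_spaceV hw j
  set Φ := (hφ.memLp 2 (volume.restrict Ω)).toLp φ with hΦ
  have hcoe : Φ =ᵐ[volume.restrict Ω] φ := (hφ.memLp 2 (volume.restrict Ω)).coeFn_toLp
  have hD := fun j => hφ.memLp_fderiv_apply (unitVec j) 2 (volume.restrict Ω)
  have hconv := memLp_convective hbt fun j => (hwp j).1
  have hdiv : weakDiv Ω Φ =ᵐ[volume.restrict Ω] fun y => ∑ j, inner ℝ (unitVec j) (fderiv ℝ φ y (unitVec j)) := by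
    refine HasWeakDiv.weakDiv_ae ho hb ⟨hφ.hasWeakDiv.1, fun ψ hψ => ?_⟩
    rw [← hφ.hasWeakDiv.2 ψ hψ]
    refine integral_congr_ae ?_
    filter_upwards [hcoe] with x hx
    rw [hx]
  have e1 : formA Ω w Φ = ∫ y in Ω, ∑ j, (inner ℝ (weakPartial Ω j w y) (fderiv ℝ φ y (unitVec j)) : ℝ) := by
    refine integral_congr_ae ?_
    filter_upwards [ae_all_iff.2 fun j => (weakPartial_congr ho hcoe j).trans (hφ.weakPartial_ae ho j)] with y hy
    simp only [hy]
  have e2 : formC Ω b w Φ = ∫ y in Ω, (inner ℝ (∑ j, b y j • weakPartial Ω j w y) (φ y) : ℝ) := by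
    refine integral_congr_ae ?_
    filter_upwards [hcoe] with y hy
    rw [hy]
  have e3 : formB Ω Φ p = - ∫ y in Ω, p y * ∑ j, (inner ℝ (unitVec j) (fderiv ℝ φ y (unitVec j)) : ℝ) := by
    unfold formB
    congr 1
    refine integral_congr_ae ?_
    filter_upwards [hdiv] with y hy
    rw [hy]
  have e4 : ∀ z : L2Vec Ω, (inner ℝ z Φ : ℝ) = ∫ y in Ω, (inner ℝ (z y) (φ y) : ℝ) := fun z => by
    rw [L2.inner_def]
    refine integral_congr_ae ?_
    filter_upwards [hcoe] with y hy
    rw [hy]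
  rw [e1, e2, e3, e4, e4, formB_zero] at h
  have hL : ∀ {z : Vec d → Vec d}, MemLp z 2 (volume.restrict Ω) →
      Integrable (fun y => (inner ℝ (z y) (φ y) : ℝ)) (volume.restrict Ω) := fun hz =>
    (L2.integrable_inner (hz.toLp _) Φ).congr (by
      filter_upwards [hz.coeFn_toLp, hcoe] with y h1 h2
      rw [h1, h2])
  have i1 : Integrable (fun y => ∑ j, (inner ℝ (weakPartial Ω j w y) (fderiv ℝ φ y (unitVec j)) : ℝ))
      (volume.restrict Ω) := integrable_finsetSum _ fun j _ =>
    (L2.integrable_inner ((hwp j).1.toLp _) ((hD j).toLp _)).congr (by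
      filter_upwards [(hwp j).1.coeFn_toLp, (hD j).coeFn_toLp] with y h1 h2
      rw [h1, h2])
  have i2 := hL hconv
  have i3 : Integrable (fun y => p y * ∑ j, (inner ℝ (unitVec j) (fderiv ℝ φ y (unitVec j)) : ℝ))
      (volume.restrict Ω) := (Lp.memLp p).integrable_mul hφ.hasWeakDiv.1
  have i4 := hL (Lp.memLp A)
  have i5 := hL (Lp.memLp g)
  have e5 : ∫ y in Ω, formDensity (fun j y => weakPartial Ω j w y - (ν⁻¹ * p y) • unitVec j)
      (fun y => ν⁻¹ • (A y - g y + ∑ j, b y j • weakPartial Ω j w y)) φ y =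
      ∫ y in Ω, ((∑ j, (inner ℝ (weakPartial Ω j w y) (fderiv ℝ φ y (unitVec j)) : ℝ)) +
        ν⁻¹ * (((inner ℝ (A y) (φ y) - inner ℝ (g y) (φ y)) + inner ℝ (∑ j, b y j • weakPartial Ω j w y) (φ y)) -
          p y * ∑ j, (inner ℝ (unitVec j) (fderiv ℝ φ y (unitVec j)) : ℝ))) := by
    congr 1 with y
    simp only [formDensity, inner_sub_left, inner_add_left, inner_smul_left, RCLike.conj_to_real,
      Finset.sum_sub_distrib, ← Finset.mul_sum]
    ring
  have i45 : Integrable (fun y => (inner ℝ (A y) (φ y) - inner ℝ (g y) (φ y) : ℝ)) (volume.restrict Ω) := i4.sub i5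
  have i452 : Integrable (fun y => ((inner ℝ (A y) (φ y) - inner ℝ (g y) (φ y)) +
      inner ℝ (∑ j, b y j • weakPartial Ω j w y) (φ y) : ℝ)) (volume.restrict Ω) := i45.add i2
  have i6 : Integrable (fun y => ν⁻¹ * (((inner ℝ (A y) (φ y) - inner ℝ (g y) (φ y)) +
      inner ℝ (∑ j, b y j • weakPartial Ω j w y) (φ y)) -
        p y * ∑ j, (inner ℝ (unitVec j) (fderiv ℝ φ y (unitVec j)) : ℝ))) (volume.restrict Ω) :=
    (i452.sub i3).const_mul ν⁻¹
  rw [e5, integral_add i1 i6, integral_const_mul, integral_sub i452 i3,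
    integral_add i45 i2, integral_sub i4 i5]
  field_simp
  linarith

theorem ae_memLp_top {Ω : Set (Vec d)} {T : ℝ} {β : ℝ → Vec d → Vec d} (hβ : IsConvectiveField Ω T β)
    (hb : Bornology.IsBounded Ω) : ∀ᵐ t ∂volume.restrict (Ioo 0 T), MemLp (β t) ⊤ (volume.restrict Ω) := by
  have hfin : IsFiniteMeasure (volume.restrict Ω : Measure (Vec d)) :=
    isFiniteMeasure_restrict.2 hb.measure_lt_top.ne
  obtain ⟨C, -, hC⟩ := hβ.1.exists_ae_norm_le
  filter_upwards [hβ.1.1.prodMk_left, Measure.ae_ae_of_ae_prod hC] with t h1 h2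
  exact memLp_top_of_bound h1 C h2

namespace Mesh
variable {kind : MeshKind} {Ω : Set (Vec d)} {M : Mesh kind Ω}

/-- The discrete forms are consistent for weak solutions tested with solenoidal piecewise smooth fields. -/
theorem forms_consistent (hd : 2 ≤ d) (ho : IsOpen Ω) (hb : Bornology.IsBounded Ω) (hΩ : interior (closure Ω) = Ω)
    {w : L2Vec Ω} (hw : w ∈ spaceV Ω) {ε : ℝ} (hε : 0 < ε) (hreg : M.brokenSobolevSq (3 / 2 + ε) w < ⊤)
    {v : L2Vec Ω} {q : Set (Vec d) → Vec d → Vec d} (hv : M.PiecewiseSmooth v q)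
    (hsol : ∀ φ : Vec d → ℝ, IsTest univ φ → ∫ y in Ω, fderiv ℝ φ y (v y) = 0)
    {ν : ℝ} (hν : 0 < ν) {b : Vec d → Vec d} (hbt : MemLp b ⊤ (volume.restrict Ω))
    (p : L2Scal Ω) (A g : L2Vec Ω)
    (hE : ∀ φ : Vec d → Vec d, IsTest Ω φ →
      ∫ y in Ω, formDensity (fun j y => weakPartial Ω j w y - (ν⁻¹ * p y) • unitVec j)
        (fun y => ν⁻¹ • (A y - g y + ∑ j, b y j • weakPartial Ω j w y)) φ y = 0)
    (σ γ : ℝ) (hF : Set (Vec d) → ℝ) :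
    inner ℝ A v + ν * M.formAh σ hF w v + M.formCh γ b w v = inner ℝ g v := by
  have hwp := fun j => OseenHdiv.Mesh.hasWeakPartial_of_mem_spaceV hw j
  have hconv := memLp_convective hbt fun j => (hwp j).1
  have hG : MemLp (fun y => ν⁻¹ • (A y - g y + ∑ j, b y j • weakPartial Ω j w y)) 2 (volume.restrict Ω) :=
    (((Lp.memLp A).sub (Lp.memLp g)).add hconv).const_smul ν⁻¹
  have hmain := M.consistency hd ho hb hΩ hw hε hreg hv hsol ((Lp.memLp p).const_mul ν⁻¹) hG hE
  have hzero : ∀ F ∈ M.facets, ∀ g : Vec d → ℝ, (∀ᵐ x ∂M.facetMeasure F, g x = 0) → facetInt F g = 0 := by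
    intro F hF g hg
    rw [M.facetInt_eq hd hF]
    exact integral_eq_zero_of_ae hg
  have hj := fun F (hF : F ∈ M.facets) => M.jump_ae_eq_zero hd ho hb hΩ hw hF
  have hmem : ∀ F ∈ M.interiorFacets, F ∈ M.facets := fun F hF => by
    classical
    unfold interiorFacets at hF
    exact (Finset.mem_filter.1 hF).1
  -- As `w` has no jumps, the symmetry, penalty, convective and upwind facet terms all vanish; only
  -- the term with the averaged normal derivative of `w` is left, supplied by `consistency`.
  have t3 : ∑ F ∈ M.facets, facetInt F (fun x => inner ℝ (M.jump F w x) (M.avgNormalDeriv F v x)) = 0 :=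
    Finset.sum_eq_zero fun F hF => hzero F hF _ (by filter_upwards [hj F hF] with x hx; rw [hx, inner_zero_left])
  have t4 : ∑ F ∈ M.facets, facetInt F (fun x => σ / hF F * inner ℝ (M.jump F w x) (M.jump F v x)) = 0 :=
    Finset.sum_eq_zero fun F hF => hzero F hF _ (by
      filter_upwards [hj F hF] with x hx; rw [hx, inner_zero_left, mul_zero])
  have s2 : ∑ F ∈ M.interiorFacets,
      facetInt F (fun x => M.normalTrace b F x * inner ℝ (M.jump F w x) (M.avg F v x)) = 0 :=
    Finset.sum_eq_zero fun F hF => hzero F (hmem F hF) _ (by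
      filter_upwards [hj F (hmem F hF)] with x hx; rw [hx, inner_zero_left, mul_zero])
  have s3 : ∑ F ∈ M.interiorFacets,
      facetInt F (fun x => γ / 2 * |M.normalTrace b F x| * inner ℝ (M.jump F w x) (M.jump F v x)) = 0 :=
    Finset.sum_eq_zero fun F hF => hzero F (hmem F hF) _ (by
      filter_upwards [hj F (hmem F hF)] with x hx; rw [hx, inner_zero_left, mul_zero])
  have s1 : ∫ x in Ω, (inner ℝ (∑ j, b x j • M.brokenPartial j w x) (v x) : ℝ) =
      ∫ x in Ω, (inner ℝ (∑ j, b x j • weakPartial Ω j w x) (v x) : ℝ) := by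
    refine integral_congr_ae ?_
    filter_upwards [ae_all_iff.2 fun j => M.brokenPartial_ae_eq_weakPartial hd hΩ (hwp j)] with x hx
    simp only [hx]
  have hL : ∀ {z : Vec d → Vec d}, MemLp z 2 (volume.restrict Ω) →
      Integrable (fun y => (inner ℝ (z y) (v y) : ℝ)) (volume.restrict Ω) := fun hz =>
    (L2.integrable_inner (hz.toLp _) v).congr (by filter_upwards [hz.coeFn_toLp] with y h1; rw [h1])
  have i4 := hL (Lp.memLp A)
  have i5 := hL (Lp.memLp g)
  have i45 : Integrable (fun y => (inner ℝ (A y) (v y) - inner ℝ (g y) (v y) : ℝ)) (volume.restrict Ω) := i4.sub i5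
  have e : ∫ x in Ω, (inner ℝ (ν⁻¹ • (A x - g x + ∑ j, b x j • weakPartial Ω j w x)) (v x) : ℝ) =
      ν⁻¹ * (inner ℝ A v - inner ℝ g v + ∫ x in Ω, (inner ℝ (∑ j, b x j • weakPartial Ω j w x) (v x) : ℝ)) := by
    simp only [inner_smul_left, RCLike.conj_to_real, inner_add_left, inner_sub_left]
    rw [integral_const_mul, integral_add i45 (hL hconv), integral_sub i4 i5, L2.inner_def, L2.inner_def]
  rw [e] at hmain
  unfold formAh formCh
  rw [t3, t4, s2, s3, s1, ← hmain]
  field_simp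
  ring

end Mesh
end WeakForm
end OseenHdiv

end

/-! ### Galerkin orthogonality -/

open OseenHdiv

theorem corollary2p9 {d : ℕ} (hd : d = 2 ∨ d = 3)
    {Ω : Set (Vec d)} (hΩ : IsOpen Ω) (hΩconn : IsConnected Ω) (hΩbdd : Bornology.IsBounded Ω)
    (hΩreg : interior (closure Ω) = Ω)
    {kind : MeshKind} (M : Mesh kind Ω)
    (Vk : Set (Vec d) → Submodule ℝ (Vec d → Vec d)) (hVk : M.IsLocalVelocity Vk)
    (ℓ : ℕ) (hconf : M.DivergenceConforming Vk ℓ)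
    {σ γ : ℝ} (hσ : 0 < σ) (hγ : 0 ≤ γ)
    (hF : Set (Vec d) → ℝ) (hF_pos : ∀ F ∈ M.facets, 0 < hF F)
    {T ν : ℝ} (hT : 0 < T) (hν : 0 < ν)
    (β : ℝ → Vec d → Vec d) (hβ : IsConvectiveField Ω T β)
    (f : ℝ → L2Vec Ω) (u₀ u₀h : L2Vec Ω)
    (u : ℝ → L2Vec Ω) (p : ℝ → L2Scal Ω) (hu : IsOseenSolution Ω T ν β f u₀ u p)
    {ε : ℝ} (hε : 0 < ε)
    (hreg : MemBochnerL2 T (fun w : L2Vec Ω => M.brokenSobolevSq (3 / 2 + ε) w) u)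
    (uh : ℝ → L2Vec Ω) (ph : ℝ → L2Scal Ω)
    (huh : M.IsDiscreteSolution Vk ℓ σ γ hF T ν β f u₀h uh ph) :
    ∀ vh ∈ M.spaceVhDiv Vk ℓ, ∀ᵐ t ∂volume.restrict (Ioo 0 T),
      inner ℝ (timeDeriv T (u - uh) t) vh + ν * M.formAh σ hF (u t - uh t) vh
        + M.formCh γ (β t) (u t - uh t) vh = 0 := by
  have hd2 : 2 ≤ d := by rcases hd with rfl | rfl <;> norm_num
  obtain ⟨huV, hpQ, -, heq⟩ := hu
  obtain ⟨huhV, -, -, -, hdisc⟩ := huh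
  intro vh hvh
  obtain ⟨q, hq⟩ := M.exists_piecewiseSmooth hd2 hVk hvh.1
  have hsol := M.solenoidal hΩ hΩbdd hconf hvh
  have hβt := ae_memLp_top hβ hΩbdd
  -- The equation holds outside a null set of times depending on the test field; with countably many
  -- fields there is one null set for all.
  obtain ⟨C, hC, hCt, hCd⟩ := exists_countable_tests Ω
  have hweak : ∀ᵐ t ∂volume.restrict (Ioo 0 T), ∀ φ, IsTest Ω φ →
      ∫ y in Ω, formDensity (fun j y => weakPartial Ω j (u t) y - (ν⁻¹ * p t y) • unitVec j)
        (fun y => ν⁻¹ • (timeDeriv T u t y - f t y + ∑ j, β t y j • weakPartial Ω j (u t) y)) φ y = 0 := by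
    have h1 : ∀ᵐ t ∂volume.restrict (Ioo 0 T), ∀ φ (hφ : φ ∈ C),
        inner ℝ (timeDeriv T u t) (((hCt φ hφ).memLp 2 (volume.restrict Ω)).toLp φ)
          + ν * formA Ω (u t) (((hCt φ hφ).memLp 2 (volume.restrict Ω)).toLp φ)
          + formC Ω (β t) (u t) (((hCt φ hφ).memLp 2 (volume.restrict Ω)).toLp φ)
          + formB Ω (((hCt φ hφ).memLp 2 (volume.restrict Ω)).toLp φ) (p t)
          - formB Ω (u t) (0 : L2Scal Ω) = inner ℝ (f t) (((hCt φ hφ).memLp 2 (volume.restrict Ω)).toLp φ) := by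
      refine (ae_ball_iff hC).2 fun φ hφ => heq _ ((hCt φ hφ).toLp_mem_spaceV hΩ) 0 ?_
      show ∫ x in Ω, (0 : L2Scal Ω) x = 0
      rw [integral_congr_ae (Lp.coeFn_zero ℝ 2 (volume.restrict Ω))]
      simp
    filter_upwards [h1, huV.2.1, hβt] with t ht htV htβ
    have hwp := fun j => OseenHdiv.Mesh.hasWeakPartial_of_mem_spaceV htV j
    have hfin : IsFiniteMeasure (volume.restrict Ω : Measure (Vec d)) :=
      isFiniteMeasure_restrict.2 hΩbdd.measure_lt_top.ne
    refine hCd _ _ (fun j => ?_) ?_ fun φ hφ =>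
      integral_formDensity_of_weak_equation hΩ hΩbdd hν htV htβ (p t) _ _ (hCt φ hφ) (ht φ hφ)
    · refine (hwp j).1.sub ?_
      exact ((memLp_top_const (unitVec j : Vec d)).smul ((Lp.memLp (p t)).const_mul ν⁻¹))
    · exact (((Lp.memLp (timeDeriv T u t)).sub (Lp.memLp (f t))).add
        (memLp_convective htβ fun j => (hwp j).1)).const_smul ν⁻¹
  -- The discrete equation is needed only for the single pair `(vh, 0)`, so its null set causes no
  -- difficulty.
  filter_upwards [hweak, huV.2.1, hβt, M.ae_brokenSobolevSq_lt_top hΩreg hreg, huhV.2.1,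
    hdisc vh hvh.1 0 (M.zero_mem_spaceQh hΩreg ℓ),
    timeDeriv_sub_ae huV.2.2 ⟨_, huhV.2.2.choose_spec.1⟩ (memLp_of_mem_spaceVT huV) huhV.1]
    with t hE htV htβ htreg htVh htd hts
  -- The discrete velocity at time `t` is piecewise polynomial; thus it has all traces, and the
  -- forms split along the difference.
  obtain ⟨r, hr⟩ := M.exists_piecewiseSmooth hd2 hVk htVh
  have hc := M.forms_consistent hd2 hΩ hΩbdd hΩreg htV hε htreg hq hsol hν htβ (p t) _ _ hE σ γ hF
  have hw := M.isRegular_of_mem_spaceV hd2 hΩbdd hΩreg htV hε htreg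
  have hwh := hr.isRegular hd2 hΩbdd
  rw [M.formB_eq_zero hΩ hΩbdd hconf hvh, formB_zero] at htd
  rw [hts, inner_sub_left, M.formAh_sub hd2 hΩbdd hΩreg hw hwh hq EventuallyEq.rfl,
    M.formCh_sub hd2 hΩbdd hΩreg hw hwh hq EventuallyEq.rfl γ htβ]
  linarith
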